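/- Let $\mathbb T=\mathbb R/\mathbb Z$, let $d,d',m\ge 0$, $k\ge 2$, $p\ge 1$ be integers with $2p>k-1$, let $U\subset\mathbb R^2$ be an open neighbourhood of $(0,0)$, $\Lambda\subset\mathbb R^m$ open, $\omega\in\mathbb R^d$, $\nu\in\mathbb R^{d'}$. Let $X$ be a vector field on $U\times\mathbb T^d$ depending on $t\in\mathbb R$ and $\lambda\in\Lambda$, quasiperiodically on $t$ with time frequencies $\nu$ and analytic hull function; that is, $X(x,y,\theta,t,\lambda)=\check X(x,y,\theta,\nu t,\lambda)$ with $\check X:U\times\mathbb T^d\times\mathbb T^{d'}\times\Lambda\to\mathbb R^2\times\mathbb R^d$ real analytic. Assume that $X$ has the reduced form $$X(x,y,\theta,t,\lambda)=\begin{pmatrix} c(\theta,t,\lambda)\,y\\ a_k(\theta,t,\lambda)\,x^k+A(x,y,\theta,t,\lambda)\\ \omega+d_p(\theta,t,\lambda)\,x^p+B(x,y,\theta,t,\lambda)\end{pmatrix},$$ where (at the level of the hull functions, for every value of the angles and of $\lambda$) $A=y\,O(\|(x,y)\|^{k-1})+O(\|(x,y)\|^{k+1})$ and $B=y\,O(\|(x,y)\|^{p-1})+O(\|(x,y)\|^{p+1})$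 as $(x,y)\to 0$. Let $\bar c(\lambda),\bar a_k(\lambda),\bar d_p(\lambda)$ denote the averages of the hull functions of $c,a_k,d_p$ over $\mathbb T^d\times\mathbb T^{d'}$. Assume that $\bar c(\lambda)>0$ and $\bar a_k(\lambda)>0$ for all $\lambda\in\Lambda$, and that $(\omega,\nu)\in\mathbb R^{d+d'}$ is Diophantine: there are $\gamma>0$ and $\tau\ge d+d'-1$ with $|(\omega,\nu)\cdot q|\ge\gamma|q|^{-\tau}$ for all $q\in\mathbb Z^{d+d'}\setminus\{0\}$, where $|q|=\sum_i|q_i|$. Then for every compact set $L\subset\Lambda$ there exist $\rho>0$, an open set $\Lambda'$ with $L\subset\Lambda'\subset\Lambda$, and a $C^1$ map $K:[0,\rho)\times\mathbb T^d\times\mathbb R\times\Lambda'\to\mathbb R^2\times\mathbb T^d$ with values in $U\times\mathbb T^d$, analytic in $(0,\rho)\times\mathbb T^d\times\mathbb R\times\Lambda'$, depending quasiperiodically on $t$ with the same frequencies $\nu$ (with a hull function on $[0,\rho)\times\mathbb T^d\times\mathbb T^{d'}\times\Lambda'$ that is $C^1$, and analytic for $u>0$), of the form $$K(u,\theta,t,\lambda)=\bigl(u^2,\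 \overline K^y_{k+1}(\lambda)u^{k+1},\ \theta+\overline K^\theta_{2p-k+1}(\lambda)u^{2p-k+1}\bigr)+\bigl(O(u^3),O(u^{k+2}),O(u^{2p-k+2})\bigr),$$ with the $O$ uniform in $(\theta,t,\lambda)$, and a polynomial vector field $$Y(u,\theta,t,\lambda)=Y(u,\lambda)=\bigl(\overline Y^x_k(\lambda)u^k+\overline Y^x_{2k-1}(\lambda)u^{2k-1},\ \omega\bigr)$$ with coefficients analytic in $\lambda\in\Lambda'$ and $\overline Y^x_k(\lambda)<0$, such that $$X(K(u,\theta,t,\lambda),t,\lambda)-\partial_{(u,\theta)}K(u,\theta,t,\lambda)\cdot Y(u,\theta,t,\lambda)-\partial_tK(u,\theta,t,\lambda)=0$$ for all $(u,\theta,t,\lambda)\in[0,\rho)\times\mathbb T^d\times\mathbb R\times\Lambda'$. Moreover, $$\overline K^y_{k+1}(\lambda)=-\sqrt{\frac{2\,\bar a_k(\lambda)}{\bar c(\lambda)(k+1)}},\quad \overline K^\theta_{2p-k+1}(\lambda)=-\frac{\bar d_p(\lambda)}{2p-k+1}\sqrt{\frac{2(k+1)}{\bar c(\lambda)\,\bar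 a_k(\lambda)}},\quad \overline Y^x_k(\lambda)=-\sqrt{\frac{\bar c(\lambda)\,\bar a_k(\lambda)}{2(k+1)}}.$$ -/

import Mathlib

open Set Filter Topology MeasureTheory Asymptotics

noncomputable section

/-- A vector `w ∈ ℝ^ι` is Diophantine (in the vector field setting): there are `C > 0` and
`τ ≥ |ι| - 1` with `|w · q| ≥ C |q|^(-τ)` for all `q ∈ ℤ^ι \ {0}`, where `|q| = ∑ |q_i|`. -/
def IsDiophantine {ι : Type*} [Fintype ι] (w : ι → ℝ) : Prop :=
  ∃ C : ℝ, 0 < C ∧ ∃ τ : ℝ, (Fintype.card ι : ℝ) - 1 ≤ τ ∧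
    ∀ q : ι → ℤ, q ≠ 0 →
      C * (∑ i, |(q i : ℝ)|) ^ (-τ) ≤ |∑ i, w i * (q i : ℝ)|

/-- The average over the torus `𝕋^d × 𝕋^n` (both with period one) of a function of the lifted
angles `(θ, τ)`, i.e. its integral over the unit cube, which has volume one. The function may
depend on a further parameter `l`. -/
def torusAverage {d n m : ℕ} {F : Type*} [NormedAddCommGroup F] [NormedSpace ℝ F]
    (h : (Fin d → ℝ) × (Fin n → ℝ) × (Fin m → ℝ) → F) (l : Fin m → ℝ) : F :=
  ∫ z in (Icc (0 : Fin d → ℝ) 1) ×ˢ (Icc (0 : Fin n → ℝ) 1), h (z.1, z.2, l)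

/-- `f(x, y) = y O(‖(x, y)‖^(j-1)) + O(‖(x, y)‖^(j+1))` as `(x, y) → 0`. -/
def HasReducedOrder {F : Type*} [NormedAddCommGroup F] [NormedSpace ℝ F]
    (j : ℕ) (f : ℝ × ℝ → F) : Prop :=
  ∃ f₁ f₂ : ℝ × ℝ → F,
    f₁ =O[𝓝 0] (fun z => ‖z‖ ^ (j - 1)) ∧
    f₂ =O[𝓝 0] (fun z => ‖z‖ ^ (j + 1)) ∧
    ∀ᶠ z in 𝓝 (0 : ℝ × ℝ), f z = z.2 • f₁ z + f₂ z

/-- The real vector `q` with integer entries. -/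
def intVec {d : ℕ} (q : Fin d → ℤ) : Fin d → ℝ := fun i => (q i : ℝ)

/-- `Xh (x, y, θ, τ, l)` is the hull function of an analytic vector field in reduced form on
`U × 𝕋^d × ℝ × Λ`. Functions on a torus are written as `ℤ`-periodic functions of the lifted
angles `θ ∈ ℝ^d` and `τ ∈ ℝ^n`. The components of the field are
`c y`, `a x^k + A` and `ω + b x^p + B`. -/
structure IsReducedHull {d n m : ℕ} (U : Set (ℝ × ℝ)) (Λ : Set (Fin m → ℝ)) (k p : ℕ)
    (ω : Fin d → ℝ)
    (c a : (Fin d → ℝ) × (Fin n → ℝ) × (Fin m → ℝ) → ℝ)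
    (b : (Fin d → ℝ) × (Fin n → ℝ) × (Fin m → ℝ) → (Fin d → ℝ))
    (A : ℝ × ℝ × (Fin d → ℝ) × (Fin n → ℝ) × (Fin m → ℝ) → ℝ)
    (B : ℝ × ℝ × (Fin d → ℝ) × (Fin n → ℝ) × (Fin m → ℝ) → (Fin d → ℝ))
    (Xh : ℝ × ℝ × (Fin d → ℝ) × (Fin n → ℝ) × (Fin m → ℝ) → ℝ × ℝ × (Fin d → ℝ)) : Prop where
  analytic : AnalyticOnNhd ℝ Xh {z | (z.1, z.2.1) ∈ U ∧ z.2.2.2.2 ∈ Λ}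
  periodic : ∀ x y θ τ l, (x, y) ∈ U → l ∈ Λ → ∀ (q : Fin d → ℤ) (r : Fin n → ℤ),
    Xh (x, y, θ + intVec q, τ + intVec r, l) = Xh (x, y, θ, τ, l)
  form : ∀ x y θ τ l, (x, y) ∈ U → l ∈ Λ →
    Xh (x, y, θ, τ, l) =
      (c (θ, τ, l) * y,
       a (θ, τ, l) * x ^ k + A (x, y, θ, τ, l),
       ω + x ^ p • b (θ, τ, l) + B (x, y, θ, τ, l))
  order_A : ∀ θ τ l, l ∈ Λ → HasReducedOrder k (fun z => A (z.1, z.2, θ, τ, l))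
  order_B : ∀ θ τ l, l ∈ Λ → HasReducedOrder p (fun z => B (z.1, z.2, θ, τ, l))

/-- The nonautonomous vector field `X(x, y, θ, t, l) = Xh(x, y, θ, ν t, l)` with hull function
`Xh` and time frequencies `ν`. -/
def fieldOfHull {d n m : ℕ} (ν : Fin n → ℝ)
    (Xh : ℝ × ℝ × (Fin d → ℝ) × (Fin n → ℝ) × (Fin m → ℝ) → ℝ × ℝ × (Fin d → ℝ)) :
    ℝ × ℝ × (Fin d → ℝ) × ℝ × (Fin m → ℝ) → ℝ × ℝ × (Fin d → ℝ) :=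
  fun z => Xh (z.1, z.2.1, z.2.2.1, z.2.2.2.1 • ν, z.2.2.2.2)

/-- The time dependent map `K(u, θ, t, l) = Kh(u, θ, ν t, l)` with hull function `Kh` and time
frequencies `ν`. -/
def mapOfHull {d n m : ℕ} (ν : Fin n → ℝ)
    (Kh : ℝ × (Fin d → ℝ) × (Fin n → ℝ) × (Fin m → ℝ) → ℝ × ℝ × (Fin d → ℝ)) :
    ℝ × (Fin d → ℝ) × ℝ × (Fin m → ℝ) → ℝ × ℝ × (Fin d → ℝ) :=
  fun z => Kh (z.1, z.2.1, z.2.2.1 • ν, z.2.2.2)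

/-- The hull function `Kh` induces a map `[0, ρ) × 𝕋^d × 𝕋^n × Λ' → ℝ² × 𝕋^d` whose angular
component is homotopic to `θ`: its lift is equivariant under integer translations. -/
def IsTorusLift {d n m : ℕ} (ρ : ℝ) (Λ' : Set (Fin m → ℝ))
    (Kh : ℝ × (Fin d → ℝ) × (Fin n → ℝ) × (Fin m → ℝ) → ℝ × ℝ × (Fin d → ℝ)) : Prop :=
  ∀ u ∈ Ico (0 : ℝ) ρ, ∀ θ τ, ∀ l ∈ Λ', ∀ (q : Fin d → ℤ) (r : Fin n → ℤ),
    Kh (u, θ + intVec q, τ + intVec r, l) = Kh (u, θ, τ, l) + (0, 0, intVec q)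

/-- The invariance equation
`X(K(u, θ, t, l), t, l) - ∂_{(u,θ)} K(u, θ, t, l) · Y(u, l) - ∂_t K(u, θ, t, l) = 0`
on `[0, ρ) × 𝕋^d × ℝ × Λ'`; at `u = 0` the derivative in `u` is one-sided. -/
def InvarianceEquation {d m : ℕ} (ρ : ℝ) (Λ' : Set (Fin m → ℝ))
    (X : ℝ × ℝ × (Fin d → ℝ) × ℝ × (Fin m → ℝ) → ℝ × ℝ × (Fin d → ℝ))
    (K : ℝ × (Fin d → ℝ) × ℝ × (Fin m → ℝ) → ℝ × ℝ × (Fin d → ℝ))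
    (Y : ℝ → (Fin m → ℝ) → ℝ × (Fin d → ℝ)) : Prop :=
  ∀ u ∈ Ico (0 : ℝ) ρ, ∀ θ t, ∀ l ∈ Λ',
    X ((K (u, θ, t, l)).1, (K (u, θ, t, l)).2.1, (K (u, θ, t, l)).2.2, t, l)
      - fderivWithin ℝ (fun v : ℝ × (Fin d → ℝ) => K (v.1, v.2, t, l))
          (Ico (0 : ℝ) ρ ×ˢ univ) (u, θ) (Y u l)
      - deriv (fun s : ℝ => K (u, θ, s, l)) t = 0

end

/-! Put κ = k - 1 and e = 2p - κ, adjoin the phases τ = ν t to the angles, ϑ = (θ, τ), Ω = (ω, ν),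
and look for K = (u² ξ, u^(κ+2) η, θ + u^e ζ) and Y = (u^(κ+1) y, ω) with y = -α + β u^κ. Write W =
(ξ, η, ζ). Since 2p = e + κ, each component of the field has exactly the power u^κ beyond its own
weight, and invariance becomes u^(κ+1) y ∂_u W + ∂_Ω W = u^κ (F(u, W, ϑ, l) - y S W), S = diag(2, κ
+ 2, e). The reduced form makes F analytic at u = 0, with F(0, W) = (c η, a ξ^(κ+1), ξ^p b); see
`HasReducedOrder.isBigO_blowUp` and `IsReducedField.isBlowUpField`.

Formal solution. At order zero the averaged equation determines α, η₀, ζ₀, which are the stated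
leading coefficients. To gain an order, add u^N X(l) + u^(N+κ) φ(ϑ, l). Here φ solves ∂_Ω φ = (a
function of zero average), which the Diophantine condition permits (`exists_dirDeriv_eq`), and X
makes the average zero. The (ξ, η) block of the system for X has determinant α² (N - κ)(N + 2κ + 4);
the only resonance, N = κ, is absorbed by β. This is why Y has exactly the second monomial u^(2k-1).
The outcome is `IsBlowUpField.exists_isApproximateSolution`.

Remainder. Let W be an approximate solution of order κM and seek the solution W + D. Along the
characteristics, w = u^(-κ) satisfies w' = κ (α - β / w) and so grows linearly, while D' = R(u, D,
ϑ, l) has Lipschitz constant M₀ u^κ = M₀ / w. Solutions of size w^(-M) are found by integrating from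
infinity: the factor 1/M coming from ∫ s^(-M-1) ds beats M₀ for large M and gives a contraction
(`exists_orbitFixedPoint`). By uniqueness the solutions are restrictions of one another along an
orbit (`OrbitSolution.δ_shift`), so their initial values form an invariant graph
(`OrbitSolution.fderiv_initialValue`). Transport along orbits bounds its derivatives
(`OrbitSolution.exists_decay`), whence D extends by zero to u ≤ 0 as a C¹ function.

Analyticity is obtained without complexification. A real analytic function with uniform Taylor
bounds acts analytically on bounded continuous functions (`analyticAt_superpose`), and compactness
together with periodicity supplies the uniformity. The slow flow, the remainder and the solutions of
the small divisor equation are built from such operators, continuous linear maps and fixed points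
(`exists_analytic_fixedPoint`). -/

section

open scoped ContDiff BoundedContinuousFunction NNReal ENNReal

/-! ### Locally uniform Cauchy estimates for real analytic maps -/

section TaylorBounds

open scoped Nat

variable {E F : Type*} [NormedAddCommGroup E] [NormedSpace ℝ E] [NormedAddCommGroup F]
  [NormedSpace ℝ F]

/-- `f` is analytic at `x`, its Taylor series at `x` sums to `f` on the ball of radius `r`, and
the Taylor coefficients satisfy the Cauchy estimates with constants `C` and `r`. -/
structure HasTaylorBound (f : E → F) (C r : ℝ) (x : E) : Prop where
  analyticAt : AnalyticAt ℝ f x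
  norm_le : ∀ n : ℕ, ‖iteratedFDeriv ℝ n f x‖ ≤ C * n ! * (r⁻¹) ^ n
  hasSum : ∀ y, ‖y‖ < r →
    HasSum (fun n : ℕ => (n ! : ℝ)⁻¹ • iteratedFDeriv ℝ n f x (fun _ => y)) (f (x + y))

theorem HasTaylorBound.mono {f : E → F} {C C' r r' : ℝ} {x : E} (h : HasTaylorBound f C r x)
    (hC : C ≤ C') (hr' : 0 < r') (hr : r' ≤ r) : HasTaylorBound f C' r' x := by
  have hr0 : 0 < r := hr'.trans_le hr
  have hC0 : 0 ≤ C := by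
    have := (norm_nonneg _).trans (h.norm_le 0)
    simpa using this
  refine ⟨h.analyticAt, fun n => (h.norm_le n).trans ?_, fun y hy => h.hasSum y (hy.trans_le hr)⟩
  have : r⁻¹ ≤ r'⁻¹ := inv_anti₀ hr' hr
  have hC0' : 0 ≤ C' := hC0.trans hC
  gcongr

/-- The expansion at a nearby centre is the recentred series `p.changeOrigin`. If 2r is below the
radius of `p`, the series of all recentred terms with both radii equal to r converges, and its sum C
bounds every coefficient times r^n for all centres of the ball at once. The factorial counts the
permutations in the iterated derivative. -/
theorem AnalyticAt.exists_hasTaylorBound [CompleteSpace F] {f : E → F} {x₀ : E}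
    (hf : AnalyticAt ℝ f x₀) :
    ∃ C r : ℝ, 0 < r ∧ ∀ x ∈ Metric.ball x₀ r, HasTaylorBound f C r x := by
  obtain ⟨p, R, hp⟩ := hf
  obtain ⟨r, hr0, hrR⟩ : ∃ r : ℝ≥0, 0 < r ∧ ((r : ℝ≥0∞) + r) < R := by
    obtain ⟨s, hs0, hs⟩ := ENNReal.lt_iff_exists_nnreal_btwn.1 hp.r_pos
    have hs0' : 0 < s := by exact_mod_cast hs0
    refine ⟨s / 2, by positivity, ?_⟩
    have : ((s / 2 : ℝ≥0) : ℝ≥0∞) + (s / 2 : ℝ≥0) = s := by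
      rw [← ENNReal.coe_add, add_halves]
    rwa [this]
  have hsum := p.changeOriginSeries_summable_aux₁ (hrR.trans_le hp.r_le)
  set C : ℝ≥0 := ∑' s : Σ k l : ℕ, { s : Finset (Fin (k + l)) // s.card = l },
    ‖p (s.1 + s.2.1)‖₊ * r ^ s.2.1 * r ^ s.1 with hC
  refine ⟨C, r, by exact_mod_cast hr0, fun x hx => ?_⟩
  obtain ⟨h, rfl⟩ : ∃ h, x = x₀ + h := ⟨x - x₀, by abel⟩
  have hh : ‖h‖₊ < r := by
    rw [Metric.mem_ball, dist_eq_norm, add_sub_cancel_left] at hx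
    exact_mod_cast hx
  have hhR : (‖h‖₊ : ℝ≥0∞) < R :=
    (ENNReal.coe_lt_coe.2 hh).trans (lt_of_le_of_lt (by simp) hrR)
  have hq := hp.changeOrigin hhR
  have hq_le : (r : ℝ≥0∞) ≤ R - ‖h‖₊ := by
    refine ENNReal.le_sub_of_add_le_right (by simp) ?_
    exact le_trans (add_le_add_right (by exact_mod_cast hh.le) _) hrR.le
  have hbound : ∀ n, ‖p.changeOrigin h n‖ ≤ C * ((r : ℝ)⁻¹) ^ n := by
    intro n
    have h1 := p.nnnorm_changeOrigin_le (x := h) n (hhR.trans_le hp.r_le)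
    have h2 : (∑' s : Σ l : ℕ, { s : Finset (Fin (n + l)) // s.card = l },
        ‖p (n + s.1)‖₊ * ‖h‖₊ ^ s.1) * r ^ n ≤ C := by
      have h3 := (NNReal.summable_sigma.1 hsum)
      calc (∑' s : Σ l : ℕ, { s : Finset (Fin (n + l)) // s.card = l },
          ‖p (n + s.1)‖₊ * ‖h‖₊ ^ s.1) * r ^ n
          ≤ ∑' s : Σ l : ℕ, { s : Finset (Fin (n + l)) // s.card = l },
            ‖p (n + s.1)‖₊ * r ^ s.1 * r ^ n := by
            rw [← NNReal.tsum_mul_right]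
            have h4 := h3.1 n
            refine Summable.tsum_le_tsum (fun s => ?_) (NNReal.summable_of_le (fun s => ?_) h4) h4
            all_goals gcongr
        _ ≤ C := by
            rw [hC, hsum.tsum_sigma' h3.1]
            exact h3.2.le_tsum n (fun _ _ => zero_le)
    have h5 : ‖p.changeOrigin h n‖₊ * r ^ n ≤ C := le_trans (by gcongr) h2
    have h6 : ‖p.changeOrigin h n‖ * (r : ℝ) ^ n ≤ C := by exact_mod_cast h5
    rw [inv_pow, ← div_eq_mul_inv, le_div_iff₀ (by positivity)]
    exact h6
  refine ⟨hq.analyticAt, fun n => ?_, fun y hy => ?_⟩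
  · refine ContinuousMultilinearMap.opNorm_le_bound (by positivity) fun v => ?_
    rw [hq.iteratedFDeriv_eq_sum_of_completeSpace]
    refine (norm_sum_le _ _).trans ?_
    have : ∀ σ ∈ (Finset.univ : Finset (Equiv.Perm (Fin n))),
        ‖p.changeOrigin h n (fun i => v (σ i))‖ ≤ (C * ((r : ℝ)⁻¹) ^ n) * ∏ i, ‖v i‖ := by
      intro σ _
      refine ((p.changeOrigin h n).le_opNorm _).trans ?_
      rw [Equiv.prod_comp σ (fun i => ‖v i‖)]
      gcongr
      exact hbound n
    refine (Finset.sum_le_card_nsmul _ _ _ this).trans ?_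
    rw [Finset.card_univ, Fintype.card_perm, Fintype.card_fin, nsmul_eq_mul]
    apply le_of_eq; ring
  · refine hq.hasSum_iteratedFDeriv (y := y) ?_
    refine Metric.eball_subset_eball hq_le ?_
    rw [Metric.mem_eball, edist_zero_right]
    have : ‖y‖₊ < r := by exact_mod_cast hy
    exact_mod_cast this

/-- The invariance is assumed only near x, because periodicity will be known only on the open set
where the function is analytic. -/
theorem HasTaylorBound.add_right {f : E → F} {C r : ℝ} {x v : E} (h : HasTaylorBound f C r x)
    (hr : 0 < r) (hv : ∀ y, ‖y‖ < r → f (x + v + y) = f (x + y)) :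
    HasTaylorBound f C r (x + v) := by
  have hev : ∀ᶠ z in 𝓝 x, f (z + v) = f z := by
    filter_upwards [Metric.ball_mem_nhds x hr] with z hz
    have := hv (z - x) (by rwa [Metric.mem_ball, dist_eq_norm] at hz)
    rwa [show x + v + (z - x) = z + v by abel, show x + (z - x) = z by abel] at this
  have hit : ∀ n, iteratedFDeriv ℝ n f (x + v) = iteratedFDeriv ℝ n f x := by
    intro n
    rw [← iteratedFDeriv_comp_add_right]
    exact (Filter.EventuallyEq.iteratedFDeriv ℝ (f₁ := fun z => f (z + v)) (f₂ := f) hev n).eq_of_nhds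
  refine ⟨?_, fun n => by rw [hit]; exact h.norm_le n, fun y hy => ?_⟩
  · have h1 : AnalyticAt ℝ (fun z => f (z + v)) x := h.analyticAt.congr (Filter.EventuallyEq.symm hev)
    have h2 : AnalyticAt ℝ (fun z => f (z - v + v)) (x + v) :=
      AnalyticAt.fun_comp (g := fun z => f (z + v)) (f := fun z => z - v) (by simpa using h1)
        (by fun_prop)
    simpa using h2
  · simp only [hit, hv y hy]
    exact h.hasSum y hy

theorem AnalyticAt.continuousAt_iteratedFDeriv [CompleteSpace F] {f : E → F} {x : E}
    (hf : AnalyticAt ℝ f x) (n : ℕ) : ContinuousAt (iteratedFDeriv ℝ n f) x := by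
  obtain ⟨s, hs, h⟩ := hf.exists_mem_nhds_analyticOnNhd
  exact (h.iteratedFDeriv n x (mem_of_mem_nhds hs)).continuousAt

/-- If `f` is analytic on an open set `D` and periodic there with respect to a set `Γ` of
translations, its Taylor bounds on a compact subset of `D` are uniform and extend to the
translates of this subset. -/
theorem IsCompact.exists_hasTaylorBound [CompleteSpace F] {f : E → F} {s D Γ : Set E}
    (hs : IsCompact s) (hD : IsOpen D) (hsD : s ⊆ D) (hf : AnalyticOnNhd ℝ f D)
    (hΓ : ∀ x ∈ D, ∀ v ∈ Γ, f (x + v) = f x) :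
    ∃ C r : ℝ, 0 < r ∧ ∀ x ∈ s, HasTaylorBound f C r x ∧
      ∀ v ∈ Γ, HasTaylorBound f C r (x + v) := by
  have key : ∃ C r : ℝ, 0 < r ∧ ∀ x ∈ s, HasTaylorBound f C r x ∧ Metric.ball x r ⊆ D := by
    refine hs.induction_on (p := fun s => ∃ C r : ℝ, 0 < r ∧ ∀ x ∈ s, HasTaylorBound f C r x ∧
      Metric.ball x r ⊆ D) ⟨0, 1, one_pos, by simp⟩ ?_ ?_ ?_
    · rintro s t hst ⟨C, r, hr, h⟩
      exact ⟨C, r, hr, fun x hx => h x (hst hx)⟩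
    · rintro s t ⟨C, r, hr, h⟩ ⟨C', r', hr', h'⟩
      refine ⟨max C C', min r r', lt_min hr hr', ?_⟩
      rintro x (hx | hx)
      · exact ⟨(h x hx).1.mono (le_max_left _ _) (lt_min hr hr') (min_le_left _ _),
          (Metric.ball_subset_ball (min_le_left _ _)).trans (h x hx).2⟩
      · exact ⟨(h' x hx).1.mono (le_max_right _ _) (lt_min hr hr') (min_le_right _ _),
          (Metric.ball_subset_ball (min_le_right _ _)).trans (h' x hx).2⟩
    · intro x hx
      obtain ⟨C, r, hr, h⟩ := (hf x (hsD hx)).exists_hasTaylorBound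
      obtain ⟨ε, hε, hεD⟩ := Metric.isOpen_iff.1 hD x (hsD hx)
      refine ⟨Metric.ball x (min r (ε / 2)), mem_nhdsWithin_of_mem_nhds
        (Metric.ball_mem_nhds _ (by positivity)), C, min r (ε / 2), by positivity, ?_⟩
      intro y hy
      refine ⟨(h y (Metric.ball_subset_ball (min_le_left _ _) hy)).mono le_rfl (by positivity)
        (min_le_left _ _), fun z hz => hεD ?_⟩
      rw [Metric.mem_ball] at *
      have h1 := dist_triangle z y x
      have h2 := min_le_right r (ε / 2)
      linarith
  obtain ⟨C, r, hr, h⟩ := key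
  refine ⟨C, r, hr, fun x hx => ⟨(h x hx).1, fun v hv => (h x hx).1.add_right hr fun y hy => ?_⟩⟩
  rw [add_right_comm]
  exact hΓ _ ((h x hx).2 (by simpa using hy)) v hv

end TaylorBounds

/-! ### Superposition operators on bounded continuous functions -/

section Superposition

open scoped Nat

set_option linter.unusedSectionVars false

variable {S E F : Type*} [TopologicalSpace S] [NormedAddCommGroup E] [NormedSpace ℝ E]
  [NormedAddCommGroup F] [NormedSpace ℝ F]

open Classical in
/-- The superposition operator `ζ ↦ (s ↦ f (b s + ζ s))` on bounded continuous functions, with the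
value `0` where this function is not bounded and continuous. -/
noncomputable def superpose (f : E → F) (b : S → E) (ζ : S →ᵇ E) : S →ᵇ F :=
  if h : Continuous (fun s => f (b s + ζ s)) ∧ ∃ C, ∀ s, ‖f (b s + ζ s)‖ ≤ C then
    .ofNormedAddCommGroup _ h.1 h.2.choose h.2.choose_spec
  else 0

theorem superpose_apply {f : E → F} {b : S → E} {ζ : S →ᵇ E}
    (h : Continuous (fun s => f (b s + ζ s))) {C : ℝ} (hC : ∀ s, ‖f (b s + ζ s)‖ ≤ C) (s : S) :
    superpose f b ζ s = f (b s + ζ s) := by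
  rw [superpose, dif_pos ⟨h, C, hC⟩]
  rfl

/-- A bounded continuous family of multilinear maps acts on bounded continuous functions. -/
noncomputable def pointwiseMultilinear {n : ℕ} (A : S → E [×n]→L[ℝ] F) (hA : Continuous A) (C : ℝ)
    (hC : ∀ s, ‖A s‖ ≤ C) : (S →ᵇ E) [×n]→L[ℝ] (S →ᵇ F) :=
  MultilinearMap.mkContinuous
    { toFun := fun w => .ofNormedAddCommGroup (fun s => A s (fun i => w i s))
        (hA.eval (continuous_pi fun i => (w i).continuous)) (C * ∏ i, ‖w i‖) (fun s => by
          refine ((A s).le_opNorm _).trans ?_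
          have := (norm_nonneg _).trans (hC s)
          gcongr with i
          · exact hC s
          · exact (w i).norm_coe_le_norm s)
      map_update_add' := by
        intro _ w i x y
        ext s
        have (z : S →ᵇ E) : (fun j => Function.update w i z j s) =
            Function.update (fun j => w j s) i (z s) := by
          ext j; by_cases h : j = i
          · subst h; simp
          · simp [h]
        simp [this]
      map_update_smul' := by
        intro _ w i c x
        ext s
        have (z : S →ᵇ E) : (fun j => Function.update w i z j s) =
            Function.update (fun j => w j s) i (z s) := by
          ext j; by_cases h : j = i
          · subst h; simp
          · simp [h]
        simp [this] }
    (max C 0) (fun w => by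
      refine (BoundedContinuousFunction.norm_le (by positivity)).2 fun s => ?_
      refine ((A s).le_opNorm _).trans ?_
      gcongr with i
      · exact (hC s).trans (le_max_left _ _)
      · exact (w i).norm_coe_le_norm s)

theorem norm_pointwiseMultilinear_le {n : ℕ} (A : S → E [×n]→L[ℝ] F) (hA : Continuous A) {C : ℝ}
    (hC : ∀ s, ‖A s‖ ≤ C) (hC0 : 0 ≤ C) : ‖pointwiseMultilinear A hA C hC‖ ≤ C :=
  (MultilinearMap.mkContinuous_norm_le _ (le_max_right _ _) _).trans (max_le le_rfl hC0)

/-- The terms of the power series of the operator are the Taylor coefficients of f, applied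
pointwise. Cauchy estimates uniform in s make the series converge in the supremum norm; S is not
compact, so uniformity has to be assumed. By the second conclusion, the formula for the operator
holds near ζ₀ without recourse to the default value. -/
theorem analyticAt_superpose [CompleteSpace F] {f : E → F} {b : S → E} (hb : Continuous b)
    {ζ₀ : S →ᵇ E} {C r : ℝ} (hr : 0 < r) (h : ∀ s, HasTaylorBound f C r (b s + ζ₀ s)) :
    AnalyticAt ℝ (superpose f b) ζ₀ ∧
      ∀ᶠ ζ in 𝓝 ζ₀, ∀ s, superpose f b ζ s = f (b s + ζ s) := by
  -- For empty S there is no point at which to read off 0 ≤ C.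
  rcases isEmpty_or_nonempty S with hS | ⟨⟨s₀⟩⟩
  · have : superpose f b = fun _ => 0 := by
      ext ζ s; exact hS.elim s
    rw [this]
    exact ⟨analyticAt_const, .of_forall fun ζ s => hS.elim s⟩
  have hC0 : 0 ≤ C := by
    have := (norm_nonneg _).trans ((h s₀).norm_le 0)
    simpa using this
  have hcont : Continuous fun s => b s + ζ₀ s := hb.add ζ₀.continuous
  have hA (n : ℕ) : Continuous fun s => (n ! : ℝ)⁻¹ • iteratedFDeriv ℝ n f (b s + ζ₀ s) :=
    continuous_iff_continuousAt.2 fun s =>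
      (ContinuousAt.comp (f := fun s => b s + ζ₀ s)
        ((h s).analyticAt.continuousAt_iteratedFDeriv n) hcont.continuousAt).fun_const_smul _
  have hAC (n : ℕ) (s : S) : ‖(n ! : ℝ)⁻¹ • iteratedFDeriv ℝ n f (b s + ζ₀ s)‖ ≤ C * r⁻¹ ^ n := by
    rw [norm_smul, norm_inv, Real.norm_natCast]
    have h0 : (0 : ℝ) < n ! := by positivity
    rw [inv_mul_le_iff₀ h0]
    refine ((h s).norm_le n).trans (le_of_eq (by ring))
  let P : FormalMultilinearSeries ℝ (S →ᵇ E) (S →ᵇ F) := fun n =>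
    pointwiseMultilinear _ (hA n) (C * r⁻¹ ^ n) (hAC n)
  have hP (n : ℕ) : ‖P n‖ ≤ C * r⁻¹ ^ n := norm_pointwiseMultilinear_le _ _ _ (by positivity)
  have hterm (w : S →ᵇ E) (n : ℕ) : ‖P n fun _ => w‖ ≤ C * (‖w‖ / r) ^ n := by
    refine ((P n).le_opNorm _).trans ?_
    rw [Finset.prod_const, Finset.card_univ, Fintype.card_fin, div_eq_mul_inv, mul_pow, ← mul_assoc,
      mul_right_comm]
    gcongr
    exact hP n
  have hval (w : S →ᵇ E) (hw : ‖w‖ < r) :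
      HasSum (fun n => P n fun _ => w) (superpose f b (ζ₀ + w)) ∧
        ∀ s, superpose f b (ζ₀ + w) s = f (b s + (ζ₀ + w) s) := by
    have hsum : Summable fun n => P n fun _ => w := by
      refine Summable.of_norm_bounded (g := fun n => C * (‖w‖ / r) ^ n) ?_ (hterm w)
      exact (summable_geometric_of_lt_one (by positivity) ((div_lt_one hr).2 hw)).mul_left C
    obtain ⟨g, hg⟩ := hsum
    have hgs (s : S) : g s = f (b s + (ζ₀ + w) s) := by
      have h1 : HasSum (fun n => (P n fun _ => w) s) (g s) :=
        hg.mapL (BoundedContinuousFunction.evalCLM ℝ s)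
      have h2 := (h s).hasSum (w s) ((w.norm_coe_le_norm s).trans_lt hw)
      rw [show b s + (ζ₀ + w) s = b s + ζ₀ s + w s by simp [add_assoc]]
      exact h1.unique h2
    have happ : ∀ s, superpose f b (ζ₀ + w) s = f (b s + (ζ₀ + w) s) := by
      refine superpose_apply (C := ‖g‖) ?_ fun s => ?_
      · simp_rw [← hgs]; exact g.continuous
      · rw [← hgs]; exact g.norm_coe_le_norm s
    have : superpose f b (ζ₀ + w) = g := by
      ext s; rw [happ, hgs]
    exact ⟨this ▸ hg, happ⟩
  refine ⟨⟨P, ENNReal.ofReal r, ?_, by simpa using hr, fun {w} hw => ?_⟩, ?_⟩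
  · refine ENNReal.le_of_forall_nnreal_lt fun t ht => ?_
    refine P.le_radius_of_bound C fun n => ?_
    have ht' : (t : ℝ) < r := by
      rw [← ENNReal.ofReal_coe_nnreal] at ht
      exact (ENNReal.ofReal_lt_ofReal_iff hr).1 ht
    calc ‖P n‖ * (t : ℝ) ^ n ≤ C * r⁻¹ ^ n * r ^ n := by gcongr; exact hP n
      _ = C := by rw [mul_assoc, ← mul_pow, inv_mul_cancel₀ hr.ne', one_pow, mul_one]
  · refine (hval w ?_).1
    rw [Metric.mem_eball, edist_zero_right, ← ofReal_norm] at hw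
    exact (ENNReal.ofReal_lt_ofReal_iff hr).1 hw
  · filter_upwards [Metric.ball_mem_nhds ζ₀ hr] with ζ hζ
    have := (hval (ζ - ζ₀) (by rwa [Metric.mem_ball, dist_eq_norm] at hζ)).2
    simpa using this

/-- Variant for curves `b + ζ₀` whose values are translates, by periods of `f`, of points of a
compact set. -/
theorem analyticAt_superpose_of_isCompact [CompleteSpace F] {f : E → F} {b : S → E}
    (hb : Continuous b) {ζ₀ : S →ᵇ E} {K D Γ : Set E} (hK : IsCompact K) (hD : IsOpen D)
    (hKD : K ⊆ D) (hf : AnalyticOnNhd ℝ f D) (hΓ : ∀ x ∈ D, ∀ v ∈ Γ, f (x + v) = f x)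
    (h : ∀ s, ∃ x ∈ K, ∃ v ∈ insert 0 Γ, b s + ζ₀ s = x + v) :
    AnalyticAt ℝ (superpose f b) ζ₀ ∧
      ∀ᶠ ζ in 𝓝 ζ₀, ∀ s, superpose f b ζ s = f (b s + ζ s) := by
  obtain ⟨C, r, hr, hC⟩ := hK.exists_hasTaylorBound hD hKD hf hΓ
  refine analyticAt_superpose hb hr (C := C) fun s => ?_
  obtain ⟨x, hx, v, hv, hxv⟩ := h s
  rw [hxv]
  rcases hv with rfl | hv
  · simpa using (hC x hx).1
  · exact (hC x hx).2 v hv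

end Superposition

end

section

open scoped ContDiff BoundedContinuousFunction NNReal ENNReal

/-! ### Analytic dependence of fixed points -/

section FixedPoint

variable {X Z : Type*} [NormedAddCommGroup X] [NormedSpace ℝ X] [CompleteSpace X]
  [NormedAddCommGroup Z] [NormedSpace ℝ Z] [CompleteSpace Z]

/-- The fixed point of a contraction depending analytically on parameters is analytic in the
parameters. -/
theorem exists_analytic_fixedPoint {G : X × Z → Z} {Q : Set X} (hQ : IsOpen Q) {ε : ℝ} (hε : 0 < ε)
    (hG : ∀ p ∈ Q, ∀ z, ‖z‖ < ε → AnalyticAt ℝ G (p, z))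
    (h0 : ∀ p ∈ Q, ‖G (p, 0)‖ ≤ ε / 4)
    (hLip : ∀ p ∈ Q, ∀ z z', ‖z‖ ≤ ε → ‖z'‖ ≤ ε → ‖G (p, z) - G (p, z')‖ ≤ 1 / 2 * ‖z - z'‖) :
    ∃ φ : X → Z, AnalyticOnNhd ℝ φ Q ∧ ∀ p ∈ Q, ‖φ p‖ ≤ ε / 2 ∧ G (p, φ p) = φ p ∧
      ∀ z, ‖z‖ ≤ ε → G (p, z) = z → z = φ p := by
  have hex : ∀ p ∈ Q, ∃ z, ‖z‖ ≤ ε / 2 ∧ G (p, z) = z ∧ ∀ z', ‖z'‖ ≤ ε → G (p, z') = z' → z' = z := by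
    intro p hp
    have hmaps : MapsTo (fun z => G (p, z)) (Metric.closedBall 0 ε) (Metric.closedBall 0 ε) := by
      intro z hz
      rw [mem_closedBall_zero_iff] at *
      have h1 := hLip p hp z 0 hz (by simpa using hε.le)
      have h2 := h0 p hp
      have h3 := norm_sub_norm_le (G (p, z)) (G (p, 0))
      rw [sub_zero] at h1
      linarith
    have hcontr : ContractingWith (1 / 2) (hmaps.restrict _ _ _) := by
      refine ⟨by norm_num, LipschitzWith.of_dist_le_mul fun z z' => ?_⟩
      have := hLip p hp z z' (mem_closedBall_zero_iff.1 z.2) (mem_closedBall_zero_iff.1 z'.2)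
      simpa [Subtype.dist_eq, dist_eq_norm] using this
    obtain ⟨z, hz, hfix, -⟩ := hcontr.exists_fixedPoint' Metric.isClosed_closedBall.isComplete hmaps
      (x := 0) (by simpa using hε.le) (edist_ne_top _ _)
    rw [mem_closedBall_zero_iff] at hz
    have hfix' : G (p, z) = z := hfix
    refine ⟨z, ?_, hfix', fun z' hz' hfz' => ?_⟩
    · have h1 := hLip p hp z 0 hz (by simpa using hε.le)
      have h2 := h0 p hp
      have h3 := norm_sub_norm_le (G (p, z)) (G (p, 0))
      rw [sub_zero] at h1
      rw [hfix'] at h1 h3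
      linarith
    · have h1 := hLip p hp z' z hz' hz
      rw [hfz', hfix'] at h1
      have h2 := norm_nonneg (z' - z)
      exact sub_eq_zero.1 (norm_eq_zero.1 (by linarith))
  choose! φ hφ1 hφ2 hφ3 using hex
  refine ⟨φ, fun p hp => ?_, fun p hp => ⟨hφ1 p hp, hφ2 p hp, hφ3 p hp⟩⟩
  -- The fixed point is strictly inside the ball, where G is analytic and the Lipschitz bound
  -- controls a derivative.
  have hlt : ‖φ p‖ < ε := (hφ1 p hp).trans_lt (by linarith)
  have hGa := hG p hp (φ p) hlt
  set f : X × Z → Z := fun q => q.2 - G q with hf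
  have cdf : ContDiffAt ℝ ω f (p, φ p) := by
    have : AnalyticAt ℝ f (p, φ p) := analyticAt_snd.sub hGa
    exact this.contDiffAt
  have hinv : (fderiv ℝ f (p, φ p) ∘L .inr ℝ X Z).IsInvertible := by
    -- The contraction constant bounds the partial derivative T, so 1 - T is invertible by a Neumann
    -- series and the implicit function theorem applies to z - G(p, z).
    set T : Z →L[ℝ] Z := fderiv ℝ (fun z => G (p, z)) (φ p) with hT
    have hTle : ‖T‖ ≤ 1 / 2 := by
      refine norm_fderiv_le_of_lip' ℝ (by norm_num) ?_
      filter_upwards [(isOpen_lt continuous_norm continuous_const).mem_nhds hlt] with z hz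
      exact hLip p hp z (φ p) (le_of_lt hz) hlt.le
    have hTeq : fderiv ℝ f (p, φ p) ∘L .inr ℝ X Z = 1 - T := by
      have hd : HasFDerivAt G (fderiv ℝ G (p, φ p)) (p, φ p) := hGa.differentiableAt.hasFDerivAt
      have h1 : T = fderiv ℝ G (p, φ p) ∘L .inr ℝ X Z :=
        (hd.comp (φ p) (hasFDerivAt_prodMk_right p (φ p))).fderiv
      have h2 : fderiv ℝ f (p, φ p) = .snd ℝ X Z - fderiv ℝ G (p, φ p) :=
        (hasFDerivAt_snd.sub hd).fderiv
      rw [h1, h2]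
      ext z; simp
    rw [hTeq]
    obtain ⟨u, hu⟩ := isUnit_one_sub_of_norm_lt_one (hTle.trans_lt (by norm_num))
    rw [← hu]
    exact ⟨ContinuousLinearEquiv.ofUnit u, rfl⟩
  have hψ := cdf.contDiffAt_implicitFunction (by simp) hinv
  set ψ := cdf.implicitFunction (by simp) hinv with hψdef
  have hψp : ψ p = φ p := cdf.implicitFunction_apply_self (by simp) hinv
  have hev := cdf.eventually_apply_implicitFunction (by simp) hinv
  have hcont : ContinuousAt ψ p := hψ.continuousAt
  have hsmall : ∀ᶠ x in 𝓝 p, ‖ψ x‖ < ε :=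
    hcont.norm.eventually_lt continuousAt_const (by rwa [hψp])
  refine AnalyticAt.congr (f := ψ) hψ.analyticAt ?_
  -- The implicit function is a fixed point in the ball, so uniqueness identifies it with φ near p.
  filter_upwards [hev, hsmall, hQ.mem_nhds hp] with x hx1 hx2 hx3
  have hx1' : ψ x - G (x, ψ x) = φ p - G (p, φ p) := hx1
  rw [hφ2 p hp, sub_self, sub_eq_zero] at hx1'
  exact hφ3 x hx3 _ hx2.le hx1'.symm

end FixedPoint

/-! ### Integration as a continuous linear map -/

section ParametricIntegral

set_option linter.unusedSectionVars false

variable {S E F : Type*} [TopologicalSpace S] [SecondCountableTopology S] [MeasurableSpace S]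
  [BorelSpace S] [NormedAddCommGroup E] [NormedSpace ℝ E] [NormedAddCommGroup F] [NormedSpace ℝ F]

theorem BoundedContinuousFunction.integrable_of_finite [TopologicalSpace.PseudoMetrizableSpace S] (μ : Measure S)
    [IsFiniteMeasure μ] (g : S →ᵇ F) : Integrable g μ :=
  Integrable.of_bound g.continuous.aestronglyMeasurable ‖g‖ (.of_forall g.norm_coe_le_norm)

/-- Integration of bounded continuous functions against a finite measure. -/
noncomputable def integralBCF [TopologicalSpace.PseudoMetrizableSpace S] (F : Type*) [NormedAddCommGroup F]
    [NormedSpace ℝ F] (μ : Measure S) [IsFiniteMeasure μ] : (S →ᵇ F) →L[ℝ] F :=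
  LinearMap.mkContinuous
    { toFun := fun g => ∫ s, g s ∂μ
      map_add' := fun g h => by
        simpa using integral_add (g.integrable_of_finite μ) (h.integrable_of_finite μ)
      map_smul' := fun c g => by simpa using integral_smul c g }
    (μ.real univ) (fun g => by
      refine (norm_integral_le_of_norm_le_const (.of_forall g.norm_coe_le_norm)).trans ?_
      rw [mul_comm])

theorem integralBCF_apply [TopologicalSpace.PseudoMetrizableSpace S] (μ : Measure S) [IsFiniteMeasure μ]
    (g : S →ᵇ F) : integralBCF F μ g = ∫ s, g s ∂μ := rfl

end ParametricIntegral

/-! ### Division of analytic functions by powers of u -/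

section Division

set_option linter.unusedSectionVars false

variable {E F : Type*} [NormedAddCommGroup E] [NormedSpace ℝ E] [NormedAddCommGroup F]
  [NormedSpace ℝ F] [CompleteSpace F]

theorem norm_projIcc_mul_prod_le (q : ℝ × E) (s : ℝ) :
    ‖((projIcc (0 : ℝ) 1 zero_le_one s : ℝ) * q.1, q.2)‖ ≤ ‖q‖ := by
  have h := (projIcc (0 : ℝ) 1 zero_le_one s).2
  rw [Prod.norm_def, Prod.norm_def]
  refine max_le_max ?_ le_rfl
  rw [norm_mul, Real.norm_of_nonneg h.1]
  exact mul_le_of_le_one_left (norm_nonneg _) h.2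

/-- The segments `s ↦ (s u, z)`, `0 ≤ s ≤ 1`, as bounded continuous functions. -/
noncomputable def segmentCurve (E : Type*) [NormedAddCommGroup E] [NormedSpace ℝ E] :
    ℝ × E →L[ℝ] (ℝ →ᵇ ℝ × E) :=
  LinearMap.mkContinuous
    { toFun := fun q => .ofNormedAddCommGroup
        (fun s => ((projIcc (0 : ℝ) 1 zero_le_one s : ℝ) * q.1, q.2))
        (by fun_prop) ‖q‖ (norm_projIcc_mul_prod_le q)
      map_add' := fun q q' => by ext s <;> simp [mul_add]
      map_smul' := fun c q => by ext s <;> simp [mul_left_comm] }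
    1 (fun q => by
      rw [one_mul]
      exact (BoundedContinuousFunction.norm_le (norm_nonneg _)).2 (norm_projIcc_mul_prod_le q))

theorem segmentCurve_apply (q : ℝ × E) (s : ℝ) :
    segmentCurve E q s = ((projIcc (0 : ℝ) 1 zero_le_one s : ℝ) * q.1, q.2) := rfl

/-- Hadamard's lemma: integrate d/ds f(s u, z) over [0, 1]. The quotient is analytic because (u, z)
↦ (s ↦ (s u, z)) is a continuous linear map into the bounded curves, followed by superposition with
∂_u f and by integration. -/
theorem AnalyticAt.exists_div {f : ℝ × E → F} {z : E} (hf : AnalyticAt ℝ f (0, z)) :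
    AnalyticAt ℝ (fun q : ℝ × E => ∫ s in (0 : ℝ)..1, fderiv ℝ f (s * q.1, q.2) (1, 0)) (0, z) ∧
    ∀ᶠ q : ℝ × E in 𝓝 (0, z),
      f q = f (0, q.2) + q.1 • ∫ s in (0 : ℝ)..1, fderiv ℝ f (s * q.1, q.2) (1, 0) := by
  set f' : ℝ × E → F := fun q => fderiv ℝ f q (1, 0) with hf'
  have hf'a : AnalyticAt ℝ f' (0, z) := by
    have := hf.fderiv
    exact AnalyticAt.fun_comp (ContinuousLinearMap.analyticAt
      (ContinuousLinearMap.apply ℝ F ((1 : ℝ), (0 : E))) _) this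
  constructor
  · obtain ⟨C, r, hr, hC⟩ := hf'a.exists_hasTaylorBound
    have h0 : ∀ s, (fun _ : ℝ => (0 : ℝ × E)) s + segmentCurve E (0, z) s = (0, z) := by
      intro s; simp [segmentCurve_apply]
    have hsup := analyticAt_superpose (f := f') (b := fun _ : ℝ => (0 : ℝ × E)) continuous_const
      (ζ₀ := segmentCurve E (0, z)) hr (C := C) (fun s => by
        rw [h0]; exact hC _ (Metric.mem_ball_self hr))
    have h1 : AnalyticAt ℝ (fun q : ℝ × E => integralBCF F (volume.restrict (Ioc (0 : ℝ) 1))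
        (superpose f' (fun _ => 0) (segmentCurve E q))) (0, z) := by
      refine (ContinuousLinearMap.analyticAt _ _).fun_comp ?_
      exact AnalyticAt.fun_comp (f := segmentCurve E) (x := (0, z)) hsup.1
        (ContinuousLinearMap.analyticAt _ _)
    refine h1.congr ?_
    have h2 := ((segmentCurve E).continuous.tendsto (0, z)).eventually hsup.2
    filter_upwards [h2] with q hq
    rw [integralBCF_apply, intervalIntegral.integral_of_le zero_le_one]
    refine setIntegral_congr_fun measurableSet_Ioc fun s hs => ?_
    simp only [hq, zero_add, segmentCurve_apply]
    rw [projIcc_of_mem zero_le_one ⟨hs.1.le, hs.2⟩]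
  · obtain ⟨r, hr, hball⟩ := hf.exists_ball_analyticOnNhd
    filter_upwards [Metric.ball_mem_nhds _ hr] with q hq
    have hmem : ∀ s ∈ uIcc (0 : ℝ) 1, (s * q.1, q.2) ∈ Metric.ball ((0 : ℝ), z) r := by
      intro s hs
      rw [uIcc_of_le zero_le_one] at hs
      rw [Metric.mem_ball, Prod.dist_eq, max_lt_iff] at *
      refine ⟨lt_of_le_of_lt ?_ hq.1, hq.2⟩
      simp only [dist_zero_right, norm_mul, Real.norm_of_nonneg hs.1]
      exact mul_le_of_le_one_left (norm_nonneg _) hs.2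
    have hderiv : ∀ s ∈ uIcc (0 : ℝ) 1, HasDerivAt (fun s : ℝ => f (s * q.1, q.2))
        (q.1 • f' (s * q.1, q.2)) s := by
      intro s hs
      have hd := (hball _ (hmem s hs)).differentiableAt.hasFDerivAt
      have hl : HasDerivAt (fun s : ℝ => (s * q.1, q.2)) (q.1, (0 : E)) s := by
        simpa using ((hasDerivAt_id s).mul_const q.1).prodMk (hasDerivAt_const s q.2)
      have := hd.comp_hasDerivAt s hl
      convert! this using 1
      rw [hf', ← map_smul]
      simp
    have hcont : ContinuousOn (fun s : ℝ => q.1 • f' (s * q.1, q.2)) (uIcc 0 1) := by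
      intro s hs
      have h3 : ContinuousAt f' (s * q.1, q.2) := by
        have := (hball _ (hmem s hs)).fderiv.continuousAt
        exact this.clm_apply continuousAt_const
      have h4 : ContinuousAt (fun s : ℝ => f' (s * q.1, q.2)) s :=
        ContinuousAt.comp (f := fun s : ℝ => (s * q.1, q.2)) h3 (by fun_prop)
      exact (h4.const_smul _).continuousWithinAt
    have := intervalIntegral.integral_eq_sub_of_hasDerivAt hderiv hcont.intervalIntegrable
    rw [intervalIntegral.integral_smul] at this
    rw [this]
    simp

/-- An analytic function of `(u, z)` which is `O(u ^ N)` for every `z` is `u ^ N` times an analytic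
function. -/
theorem exists_eventually_eq_pow_smul (N : ℕ) {f : ℝ × E → F} {D : Set E} (hD : IsOpen D)
    (hf : ∀ z ∈ D, AnalyticAt ℝ f (0, z))
    (hO : ∀ z ∈ D, (fun u : ℝ => f (u, z)) =O[𝓝[≠] 0] fun u => u ^ N) :
    ∃ g : ℝ × E → F, ∀ z ∈ D, AnalyticAt ℝ g (0, z) ∧ ∀ᶠ q in 𝓝 ((0 : ℝ), z), f q = q.1 ^ N • g q := by
  induction N generalizing f with
  | zero => exact ⟨f, fun z hz => ⟨hf z hz, by simp⟩⟩
  | succ N ih =>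
    -- The order condition is only pointwise in z. It forces f to vanish on {0} × D, so that f
    -- equals u times the Hadamard quotient, whose order is one lower.
    have hzero : ∀ z ∈ D, f (0, z) = 0 := by
      intro z hz
      have h1 : Tendsto (fun u : ℝ => f (u, z)) (𝓝[≠] 0) (𝓝 0) := by
        refine (hO z hz).trans_tendsto ?_
        have : Tendsto (fun u : ℝ => u ^ (N + 1)) (𝓝 0) (𝓝 (0 ^ (N + 1))) :=
          (continuous_pow _).tendsto 0
        rw [zero_pow (by omega)] at this
        exact this.mono_left nhdsWithin_le_nhds
      have h2 : Tendsto (fun u : ℝ => f (u, z)) (𝓝[≠] 0) (𝓝 (f (0, z))) := by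
        have : ContinuousAt (fun u : ℝ => f (u, z)) 0 :=
          ContinuousAt.comp (f := fun u : ℝ => (u, z)) (hf z hz).continuousAt (by fun_prop)
        exact this.tendsto.mono_left nhdsWithin_le_nhds
      exact tendsto_nhds_unique h2 h1
    set g₁ : ℝ × E → F := fun q => ∫ s in (0 : ℝ)..1, fderiv ℝ f (s * q.1, q.2) (1, 0) with hg₁
    have hfg : ∀ z ∈ D, ∀ᶠ q in 𝓝 ((0 : ℝ), z), f q = q.1 • g₁ q := by
      intro z hz
      have hmem : ∀ᶠ q : ℝ × E in 𝓝 ((0 : ℝ), z), q.2 ∈ D :=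
        continuousAt_snd.eventually (hD.mem_nhds hz)
      filter_upwards [(hf z hz).exists_div.2, hmem] with q hq hq2
      rw [hq, hzero _ hq2, zero_add]
    obtain ⟨g, hg⟩ := ih (f := g₁) (fun z hz => (hf z hz).exists_div.1) (fun z hz => by
      have hline : Tendsto (fun u : ℝ => (u, z)) (𝓝[≠] 0) (𝓝 (0, z)) :=
        (Continuous.tendsto' (by fun_prop) _ _ rfl).mono_left nhdsWithin_le_nhds
      have h1 : (fun u : ℝ => g₁ (u, z)) =ᶠ[𝓝[≠] 0] fun u => u⁻¹ • f (u, z) := by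
        filter_upwards [hline.eventually (hfg z hz), self_mem_nhdsWithin] with u hu hu0
        rw [hu, smul_smul, inv_mul_cancel₀ hu0, one_smul]
      refine h1.trans_isBigO ?_
      have h2 := (isBigO_refl (fun u : ℝ => u⁻¹) (𝓝[≠] 0)).smul (hO z hz)
      refine h2.congr' .rfl ?_
      filter_upwards [self_mem_nhdsWithin] with u hu0
      rw [smul_eq_mul, pow_succ', inv_mul_cancel_left₀ hu0])
    refine ⟨g, fun z hz => ⟨(hg z hz).1, ?_⟩⟩
    filter_upwards [hfg z hz, (hg z hz).2] with q h1 h2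
    rw [h1, h2, smul_smul, pow_succ']

/-- The quotient of `f` by `u ^ N`, extended by its limit to `u = 0`. -/
noncomputable def divPow (f : ℝ × E → F) (N : ℕ) (q : ℝ × E) : F :=
  if q.1 = 0 then limUnder (𝓝[≠] (0 : ℝ)) (fun u => (u ^ N)⁻¹ • f (u, q.2))
  else (q.1 ^ N)⁻¹ • f q

theorem pow_smul_divPow (f : ℝ × E → F) (N : ℕ) {q : ℝ × E} (hq : q.1 ≠ 0) :
    q.1 ^ N • divPow f N q = f q := by
  rw [divPow, if_neg hq, smul_smul, mul_inv_cancel₀ (pow_ne_zero _ hq), one_smul]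

/-- As D is open, the limits used at u = 0 agree with the analytic quotient for all z nearby. An
explicit quotient, unlike a chosen one, visibly inherits the periodicity of f. -/
theorem analyticAt_divPow (N : ℕ) {f : ℝ × E → F} {D : Set E} (hD : IsOpen D)
    (hf : ∀ z ∈ D, AnalyticAt ℝ f (0, z))
    (hO : ∀ z ∈ D, (fun u : ℝ => f (u, z)) =O[𝓝[≠] 0] fun u => u ^ N) {z : E} (hz : z ∈ D) :
    AnalyticAt ℝ (divPow f N) (0, z) ∧
      Tendsto (fun u : ℝ => (u ^ N)⁻¹ • f (u, z)) (𝓝[≠] 0) (𝓝 (divPow f N (0, z))) := by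
  obtain ⟨g, hg⟩ := exists_eventually_eq_pow_smul N hD hf hO
  have hlim : ∀ z ∈ D, Tendsto (fun u : ℝ => (u ^ N)⁻¹ • f (u, z)) (𝓝[≠] 0) (𝓝 (g (0, z))) := by
    intro z hz
    have hline : Tendsto (fun u : ℝ => (u, z)) (𝓝[≠] 0) (𝓝 (0, z)) :=
      (Continuous.tendsto' (by fun_prop) _ _ rfl).mono_left nhdsWithin_le_nhds
    have h1 := (hg z hz).1.continuousAt.tendsto.comp hline
    refine h1.congr' ?_
    filter_upwards [hline.eventually (hg z hz).2, self_mem_nhdsWithin] with u hu hu0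
    rw [hu, smul_smul, inv_mul_cancel₀ (pow_ne_zero _ hu0), one_smul]
    rfl
  have hval : ∀ z ∈ D, divPow f N (0, z) = g (0, z) := by
    intro z hz
    rw [divPow, if_pos rfl]
    exact (hlim z hz).limUnder_eq
  refine ⟨(hg z hz).1.congr ?_, by rw [hval z hz]; exact hlim z hz⟩
  have hmem : ∀ᶠ q : ℝ × E in 𝓝 ((0 : ℝ), z), q.2 ∈ D :=
    continuousAt_snd.eventually (hD.mem_nhds hz)
  filter_upwards [(hg z hz).2, hmem] with q hq hq2
  by_cases h0 : q.1 = 0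
  · have : q = (0, q.2) := Prod.ext h0 rfl
    rw [this, hval _ hq2]
  · rw [divPow, if_neg h0, hq, smul_smul, inv_mul_cancel₀ (pow_ne_zero _ h0), one_smul]

theorem divPow_apply_zero (N : ℕ) {f : ℝ × E → F} {D : Set E} (hD : IsOpen D)
    (hf : ∀ z ∈ D, AnalyticAt ℝ f (0, z))
    (hO : ∀ z ∈ D, (fun u : ℝ => f (u, z)) =O[𝓝[≠] 0] fun u => u ^ N) {z : E} (hz : z ∈ D) {w : F}
    (hw : (fun u : ℝ => f (u, z) - u ^ N • w) =o[𝓝[≠] 0] fun u => u ^ N) :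
    divPow f N (0, z) = w := by
  refine tendsto_nhds_unique (analyticAt_divPow N hD hf hO hz).2 ?_
  have h2 : Tendsto (fun u : ℝ => (u ^ N)⁻¹ • (f (u, z) - u ^ N • w)) (𝓝[≠] 0) (𝓝 0) := by
    have h3 := (isBigO_refl (fun u : ℝ => (u ^ N)⁻¹) (𝓝[≠] 0)).smul_isLittleO hw
    have h4 : (fun u : ℝ => (u ^ N)⁻¹ • u ^ N) =O[𝓝[≠] 0] fun _ => (1 : ℝ) := by
      refine EventuallyEq.isBigO ?_
      filter_upwards [self_mem_nhdsWithin] with u hu0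
      rw [smul_eq_mul, inv_mul_cancel₀ (pow_ne_zero _ hu0)]
    exact (h3.trans_isBigO h4).tendsto_zero_of_tendsto tendsto_const_nhds
  have h3 := h2.add_const w
  rw [zero_add] at h3
  refine h3.congr' ?_
  filter_upwards [self_mem_nhdsWithin] with u hu0
  rw [smul_sub, smul_smul, inv_mul_cancel₀ (pow_ne_zero _ hu0), one_smul, sub_add_cancel]

end Division

end

section

open scoped ContDiff BoundedContinuousFunction NNReal ENNReal

/-! ### Fourier coefficients of periodic functions -/

section Torus

set_option linter.unusedSectionVars false

variable {ι : Type*} [Fintype ι]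

/-- The half-open unit cube. -/
def unitCube (ι : Type*) : Set (ι → ℝ) := {x | ∀ i, x i ∈ Ioc ((0 : ι → ℝ) i) ((0 : ι → ℝ) i + 1)}

theorem unitCube_eq : unitCube ι = Set.pi univ fun _ => Ioc (0 : ℝ) 1 := by
  ext x; simp [unitCube]

theorem unitCube_ae_eq : (unitCube ι : Set (ι → ℝ)) =ᵐ[volume] (Icc 0 1 : Set (ι → ℝ)) := by
  rw [unitCube_eq]
  exact Measure.univ_pi_Ioc_ae_eq_Icc

instance : IsProbabilityMeasure ((volume : Measure (ι → ℝ)).restrict (unitCube ι)) := by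
  refine ⟨?_⟩
  rw [Measure.restrict_apply_univ, unitCube_eq, volume_pi_pi]
  simp

/-- The exponential monomial `x ↦ exp (2 π i q · x)` on `ℝ^ι`. -/
noncomputable def expMonomial (q : ι → ℤ) (x : ι → ℝ) : ℂ :=
  Complex.exp ((∑ i, q i * x i : ℝ) * (2 * Real.pi * Complex.I))

theorem mFourier_coe (q : ι → ℤ) (x : ι → ℝ) :
    UnitAddTorus.mFourier q (fun i => (x i : UnitAddCircle)) = expMonomial q x := by
  simp only [UnitAddTorus.mFourier, ContinuousMap.coe_mk, fourier_coe_apply, expMonomial]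
  rw [← Complex.exp_sum]
  congr 1
  push_cast
  rw [Finset.sum_mul]
  refine Finset.sum_congr rfl fun i _ => ?_
  ring

theorem expMonomial_add (q : ι → ℤ) (x y : ι → ℝ) :
    expMonomial q (x + y) = expMonomial q x * expMonomial q y := by
  rw [expMonomial, expMonomial, expMonomial, ← Complex.exp_add, ← add_mul]
  congr 2
  simp only [Pi.add_apply, mul_add, Finset.sum_add_distrib]
  push_cast
  rfl

theorem expMonomial_zero_right (q : ι → ℤ) : expMonomial q 0 = 1 := by
  simp [expMonomial]

theorem norm_expMonomial (q : ι → ℤ) (x : ι → ℝ) : ‖expMonomial q x‖ = 1 := by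
  rw [expMonomial, ← Complex.norm_exp_ofReal_mul_I ((∑ i, q i * x i : ℝ) * (2 * Real.pi))]
  congr 2
  push_cast
  ring

theorem expMonomial_intVec (q r : ι → ℤ) : expMonomial q (fun i => (r i : ℝ)) = 1 := by
  rw [expMonomial, Complex.exp_eq_one_iff]
  exact ⟨∑ i, q i * r i, by push_cast; rfl⟩

theorem continuous_expMonomial (q : ι → ℤ) : Continuous (expMonomial q) := by
  unfold expMonomial
  fun_prop

theorem expMonomial_neg_mul (q : ι → ℤ) (x : ι → ℝ) : expMonomial (-q) x * expMonomial q x = 1 := by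
  rw [expMonomial, expMonomial, ← Complex.exp_add, ← add_mul]
  simp

/-- The Fourier coefficients over the unit cube, as functionals on the bounded continuous
functions. -/
noncomputable def cubeCoeff (q : ι → ℤ) : ((ι → ℝ) →ᵇ ℂ) →L[ℝ] ℂ :=
  integralBCF ℂ ((volume : Measure (ι → ℝ)).restrict (unitCube ι)) ∘L
    ContinuousLinearMap.mul ℝ ((ι → ℝ) →ᵇ ℂ) (.ofNormedAddCommGroup (expMonomial (-q))
      (continuous_expMonomial _) 1 (fun x => (norm_expMonomial _ x).le))

theorem cubeCoeff_apply (q : ι → ℤ) (g : (ι → ℝ) →ᵇ ℂ) :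
    cubeCoeff q g = ∫ x in unitCube ι, expMonomial (-q) x * g x := rfl

theorem norm_cubeCoeff_apply_le (q : ι → ℤ) (g : (ι → ℝ) →ᵇ ℂ) : ‖cubeCoeff q g‖ ≤ ‖g‖ := by
  rw [cubeCoeff_apply]
  refine (norm_integral_le_of_norm_le_const (C := ‖g‖) (.of_forall fun x => ?_)).trans ?_
  · rw [norm_mul, norm_expMonomial, one_mul]
    exact g.norm_coe_le_norm x
  · simp

theorem norm_cubeCoeff_le (q : ι → ℤ) : ‖cubeCoeff q‖ ≤ 1 :=
  ContinuousLinearMap.opNorm_le_bound _ zero_le_one fun g => by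
    rw [one_mul]; exact norm_cubeCoeff_apply_le q g

theorem cubeCoeff_zero (g : (ι → ℝ) →ᵇ ℂ) : cubeCoeff 0 g = ∫ x in Icc (0 : ι → ℝ) 1, g x := by
  rw [cubeCoeff_apply, setIntegral_congr_set unitCube_ae_eq]
  simp [expMonomial]

theorem exists_torus_lift {g : (ι → ℝ) → ℂ} (hg : Continuous g)
    (hper : ∀ x (q : ι → ℤ), g (x + fun i => (q i : ℝ)) = g x) :
    ∃ G : C(UnitAddTorus ι, ℂ), ∀ x : ι → ℝ, G (fun i => (x i : UnitAddCircle)) = g x := by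
  have hq : IsOpenQuotientMap (fun (x : ι → ℝ) (i : ι) => (x i : UnitAddCircle)) :=
    IsOpenQuotientMap.piMap (f := fun (_ : ι) (x : ℝ) => (x : UnitAddCircle))
      fun _ => QuotientAddGroup.isOpenQuotientMap_mk
  have hfac : ∀ x y : ι → ℝ, (fun i => (x i : UnitAddCircle)) = (fun i => (y i : UnitAddCircle)) →
      g x = g y := by
    intro x y hxy
    have h1 : ∀ i, ∃ n : ℤ, y i + n = x i := by
      intro i
      have h2 := congrFun hxy i
      rw [← sub_eq_zero, ← QuotientAddGroup.mk_sub] at h2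
      obtain ⟨n, hn⟩ := (AddCircle.coe_eq_zero_iff (1 : ℝ)).1 h2
      exact ⟨n, by simp at hn; linarith⟩
    choose n hn using h1
    rw [← hper y n]
    congr 1
    ext i
    simp [← hn i]
  choose s hs using hq.surjective
  refine ⟨⟨fun t => g (s t), ?_⟩, fun x => hfac _ _ (hs _)⟩
  rw [hq.isQuotientMap.continuous_iff]
  refine hg.congr fun x => ?_
  exact (hfac _ _ (hs _)).symm

theorem hasSum_cubeCoeff (g : (ι → ℝ) →ᵇ ℂ)
    (hper : ∀ x (q : ι → ℤ), g (x + fun i => (q i : ℝ)) = g x)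
    (hs : Summable fun q => cubeCoeff q g) (x : ι → ℝ) :
    HasSum (fun q => cubeCoeff q g * expMonomial q x) (g x) := by
  obtain ⟨G, hG⟩ := exists_torus_lift g.continuous hper
  have hc : ∀ q, UnitAddTorus.mFourierCoeff G q = cubeCoeff q g := by
    intro q
    rw [UnitAddTorus.mFourierCoeff_eq_integral G q 0, cubeCoeff_apply]
    simp only [mFourier_coe, hG, smul_eq_mul]
    rfl
  have := UnitAddTorus.hasSum_mFourier_series_apply_of_summable (f := G) (by
    simpa only [← hc] using hs) (fun i => (x i : UnitAddCircle))
  simpa only [hc, hG, mFourier_coe, smul_eq_mul] using this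

/-- The normalized measure on the circle. -/
noncomputable local instance : MeasureSpace UnitAddCircle := ⟨AddCircle.haarAddCircle⟩

/-- The normalized measure on the circle is a Haar measure. -/
local instance : Measure.IsAddHaarMeasure (volume : Measure UnitAddCircle) :=
  inferInstanceAs (Measure.IsAddHaarMeasure AddCircle.haarAddCircle)

/-- The integrand descends to the torus, whose Haar measure is invariant under translations.
Differentiating in α therefore multiplies the coefficients by 2πi q · v; this is
`cubeCoeff_dirDeriv`. -/
theorem cubeCoeff_translate (q : ι → ℤ) (g g' : (ι → ℝ) →ᵇ ℂ)
    (hper : ∀ x (q : ι → ℤ), g (x + fun i => (q i : ℝ)) = g x) (α : ι → ℝ)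
    (hg' : ∀ x, g' x = g (x + α)) : cubeCoeff q g' = expMonomial q α * cubeCoeff q g := by
  obtain ⟨G, hG⟩ := exists_torus_lift (g := fun x => expMonomial (-q) x * g x)
    ((continuous_expMonomial _).mul g.continuous) (fun x r => by
      simp only [expMonomial_add, expMonomial_intVec, hper, mul_one])
  have h1 : cubeCoeff q g = ∫ t : UnitAddTorus ι, G t := by
    rw [UnitAddTorus.integral_preimage _ 0, cubeCoeff_apply]
    simp only [hG]
    rfl
  have h2 : cubeCoeff q g' = expMonomial q α *
      ∫ t : UnitAddTorus ι, G (t + fun i => (α i : UnitAddCircle)) := by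
    rw [UnitAddTorus.integral_preimage _ 0, cubeCoeff_apply, ← integral_const_mul]
    refine integral_congr_ae (.of_forall fun x => ?_)
    have h3 := hG (x + α)
    simp only [Pi.add_apply, QuotientAddGroup.mk_add] at h3
    have h4 : (fun i => ((x i : ℝ) : UnitAddCircle)) + (fun i => (α i : UnitAddCircle)) =
      fun i => ((x i : ℝ) : UnitAddCircle) + ((α i : ℝ) : UnitAddCircle) := rfl
    simp only [h4]
    erw [h3]
    rw [hg', expMonomial_add, ← mul_assoc, ← mul_assoc, mul_comm (expMonomial q α),
      mul_assoc (expMonomial (-q) x), mul_comm (expMonomial q α), expMonomial_neg_mul, mul_one]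
  rw [h1, h2]
  congr 1
  exact integral_add_right_eq_self _ _

end Torus

/-! ### The small divisor equation for analytic periodic functions -/

section SmallDivisors

/-- Constant functions, as a continuous linear map. -/
noncomputable def constBCF (S E : Type*) [TopologicalSpace S] [NormedAddCommGroup E]
    [NormedSpace ℝ E] : E →L[ℝ] (S →ᵇ E) :=
  LinearMap.mkContinuous
    { toFun := fun x => BoundedContinuousFunction.const S x
      map_add' := fun _ _ => rfl
      map_smul' := fun _ _ => rfl } 1 (fun x => by
        rw [one_mul]
        exact BoundedContinuousFunction.norm_const_le x)

@[simp]
theorem constBCF_apply (S : Type*) {E : Type*} [TopologicalSpace S] [NormedAddCommGroup E]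
    [NormedSpace ℝ E] (x : E) (s : S) : constBCF S E x s = x := rfl

variable {ι : Type*} [Fintype ι] {P F : Type*} [NormedAddCommGroup P] [NormedSpace ℝ P]
  [NormedAddCommGroup F] [NormedSpace ℝ F] [CompleteSpace F]

/-- The translates of an analytic periodic function depend analytically on the translation. -/
theorem exists_analytic_translate {h : (ι → ℝ) × P → F} {Λ : Set P} (hΛ : IsOpen Λ)
    (hh : AnalyticOnNhd ℝ h (univ ×ˢ Λ))
    (hper : ∀ l ∈ Λ, ∀ x (q : ι → ℤ), h ((x + fun i => (q i : ℝ)), l) = h (x, l)) :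
    ∃ H : (ι → ℝ) × P → ((ι → ℝ) →ᵇ F), AnalyticOnNhd ℝ H (univ ×ˢ Λ) ∧
      ∀ α, ∀ l ∈ Λ, ∀ s, H (α, l) s = h (s + α, l) := by
  have key : ∀ p ∈ (univ ×ˢ Λ : Set ((ι → ℝ) × P)), _ := fun p (hp : p ∈ univ ×ˢ Λ) =>
    analyticAt_superpose_of_isCompact (S := ι → ℝ) (f := h) (b := fun s => (s, (0 : P)))
      (by fun_prop) (ζ₀ := constBCF (ι → ℝ) _ p) (K := Icc 0 1 ×ˢ {p.2}) (D := univ ×ˢ Λ)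
      (Γ := range fun q : ι → ℤ => ((fun i => (q i : ℝ)), (0 : P)))
      (isCompact_Icc.prod isCompact_singleton) (isOpen_univ.prod hΛ)
      (by
        rintro ⟨x, l⟩ ⟨-, hl⟩
        obtain rfl : l = p.2 := hl
        exact ⟨mem_univ _, hp.2⟩) hh
      (by
        rintro ⟨x, l⟩ ⟨-, hl⟩ _ ⟨q, rfl⟩
        simpa using hper l hl x q)
      (by
        intro s
        -- Modulo integer vectors every translate lies in the compact cube, so the Taylor bounds are
        -- uniform in s.
        refine ⟨(fun i => Int.fract ((s + p.1) i), p.2), ⟨?_, rfl⟩, _, Or.inr ⟨fun i =>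
          ⌊(s + p.1) i⌋, rfl⟩, ?_⟩
        · exact ⟨fun i => Int.fract_nonneg _, fun i => (Int.fract_lt_one _).le⟩
        · ext i
          · simp
          · simp)
  refine ⟨fun p => superpose h (fun s => (s, (0 : P))) (constBCF (ι → ℝ) _ p), fun p hp => ?_,
    fun α l hl s => ?_⟩
  · exact (key p hp).1.fun_comp (ContinuousLinearMap.analyticAt _ _)
  · have := (key (α, l) ⟨mem_univ _, hl⟩).2.self_of_nhds s
    simpa using this

/-- Iterated directional derivative in the first variable. -/
noncomputable def dirDeriv {X Y Z : Type*} [NormedAddCommGroup X] [NormedSpace ℝ X]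
    [NormedAddCommGroup Y] [NormedSpace ℝ Y] [NormedAddCommGroup Z] [NormedSpace ℝ Z]
    (v : X) (H : X × Y → Z) (p : X × Y) : Z := fderiv ℝ H p (v, 0)

theorem AnalyticOnNhd.dirDeriv {X Y Z : Type*} [NormedAddCommGroup X] [NormedSpace ℝ X]
    [NormedAddCommGroup Y] [NormedSpace ℝ Y] [NormedAddCommGroup Z] [NormedSpace ℝ Z]
    [CompleteSpace Z] {v : X} {H : X × Y → Z} {Q : Set (X × Y)} (hH : AnalyticOnNhd ℝ H Q) :
    AnalyticOnNhd ℝ (dirDeriv v H) Q := fun p hp =>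
  AnalyticAt.fun_comp (f := fderiv ℝ H) (g := fun T : X × Y →L[ℝ] Z => T (v, 0))
    (ContinuousLinearMap.analyticAt (ContinuousLinearMap.apply ℝ Z ((v, 0) : X × Y)) _)
    (hH p hp).fderiv

theorem hasDerivAt_expMonomial (q : ι → ℤ) (x v : ι → ℝ) :
    HasDerivAt (fun t : ℝ => expMonomial q (x + t • v))
      ((2 * Real.pi * Complex.I * (∑ i, q i * v i : ℝ)) * expMonomial q x) 0 := by
  unfold expMonomial
  have h1 : HasDerivAt (fun t : ℝ => (∑ i, q i * (x + t • v) i : ℝ)) (∑ i, q i * v i) 0 := by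
    refine HasDerivAt.fun_sum fun i _ => ?_
    have := (((hasDerivAt_id (0 : ℝ)).mul_const (v i)).const_add (x i)).const_mul (q i : ℝ)
    simpa using this
  have h2 := (h1.ofReal_comp.mul_const (2 * Real.pi * Complex.I)).cexp
  convert! h2 using 1
  simp
  ring

theorem cubeCoeff_dirDeriv {H : (ι → ℝ) × P → ((ι → ℝ) →ᵇ ℂ)} {Λ : Set P}
    (hH : AnalyticOnNhd ℝ H (univ ×ˢ Λ)) {q : ι → ℤ} {c : P → ℂ}
    (hc : ∀ α, ∀ l ∈ Λ, cubeCoeff q (H (α, l)) = expMonomial q α * c l) (v : ι → ℝ) :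
    ∀ α, ∀ l ∈ Λ, cubeCoeff q (dirDeriv v H (α, l)) =
      expMonomial q α * ((2 * Real.pi * Complex.I * (∑ i, q i * v i : ℝ)) * c l) := by
  intro α l hl
  have hd := (hH (α, l) ⟨mem_univ _, hl⟩).differentiableAt.hasFDerivAt
  have hline : HasDerivAt (fun t : ℝ => (α + t • v, l)) (v, (0 : P)) 0 := by
    have h1 := ((hasDerivAt_id (0 : ℝ)).smul_const v).const_add α
    simpa using h1.prodMk (hasDerivAt_const (0 : ℝ) l)
  have h2 : HasDerivAt (fun t : ℝ => H (α + t • v, l)) (dirDeriv v H (α, l)) 0 := by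
    refine HasFDerivAt.comp_hasDerivAt (f := fun t : ℝ => (α + t • v, l)) 0 (l := H) ?_ hline
    simpa using hd
  have h3 := (cubeCoeff q).hasFDerivAt.comp_hasDerivAt 0 h2
  have h4 : HasDerivAt (fun t : ℝ => expMonomial q (α + t • v) * c l) _ 0 :=
    (hasDerivAt_expMonomial q α v).mul_const (c l)
  have h5 : (⇑(cubeCoeff q) ∘ fun t : ℝ => H (α + t • v, l)) =
      fun t : ℝ => expMonomial q (α + t • v) * c l := by
    ext t; exact hc _ l hl
  rw [h5] at h3
  rw [h3.unique h4]
  ring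

theorem cubeCoeff_iterate_dirDeriv {H : (ι → ℝ) × P → ((ι → ℝ) →ᵇ ℂ)} {Λ : Set P}
    (hH : AnalyticOnNhd ℝ H (univ ×ˢ Λ)) {q : ι → ℤ} {c : P → ℂ}
    (hc : ∀ α, ∀ l ∈ Λ, cubeCoeff q (H (α, l)) = expMonomial q α * c l) (v : ι → ℝ) (k : ℕ) :
    AnalyticOnNhd ℝ ((dirDeriv v)^[k] H) (univ ×ˢ Λ) ∧
    ∀ α, ∀ l ∈ Λ, cubeCoeff q ((dirDeriv v)^[k] H (α, l)) =
      expMonomial q α * ((2 * Real.pi * Complex.I * (∑ i, q i * v i : ℝ)) ^ k * c l) := by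
  induction k with
  | zero => exact ⟨hH, by simpa using hc⟩
  | succ k ih =>
    rw [Function.iterate_succ_apply']
    refine ⟨ih.1.dirDeriv, fun α l hl => ?_⟩
    rw [cubeCoeff_dirDeriv ih.1 (c := fun l =>
      (2 * Real.pi * Complex.I * (∑ i, q i * v i : ℝ)) ^ k * c l) ih.2 v α l hl]
    ring

theorem summable_norm_int_rpow {s : ℝ} (hs : s < -Fintype.card ι) :
    Summable fun q : ι → ℤ => ‖(fun i => (q i : ℝ))‖ ^ s := by
  classical
  let L : Submodule ℤ (ι → ℝ) := Submodule.span ℤ (range (Pi.basisFun ℝ ι))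
  have hmem (q : ι → ℤ) : (fun i => (q i : ℝ)) ∈ L := by
    have : (fun i => (q i : ℝ)) = ∑ i, q i • Pi.basisFun ℝ ι i := by
      ext j
      simp [Pi.single_apply]
    rw [this]
    exact Submodule.sum_mem _ fun i _ => Submodule.smul_mem _ _ (Submodule.subset_span ⟨i, rfl⟩)
  have hsum := ZLattice.summable_norm_rpow L s (by
    rw [ZLattice.rank ℝ, Module.finrank_fintype_fun_eq_card]; exact hs)
  have hinj : Function.Injective fun q : ι → ℤ => (⟨_, hmem q⟩ : L) := by
    intro q q' h
    have h1 : (fun i => (q i : ℝ)) = fun i => (q' i : ℝ) := congrArg Subtype.val h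
    ext i
    have h2 := congrFun h1 i
    exact Int.cast_injective h2
  exact Summable.comp_injective (i := fun q : ι → ℤ => (⟨_, hmem q⟩ : L)) hsum hinj

theorem norm_intCast_ge_one {q : ι → ℤ} (hq : q ≠ 0) : 1 ≤ ‖(fun i => (q i : ℝ))‖ := by
  obtain ⟨i, hi⟩ := Function.ne_iff.1 hq
  have h1 := norm_le_pi_norm (fun i => (q i : ℝ)) i
  have h2 : (1 : ℝ) ≤ |(q i : ℝ)| := by exact_mod_cast Int.one_le_abs hi
  exact h2.trans h1

/-- The weights `(2 π i Ω · q)⁻¹ (∑ (2 π i q_j) ^ (2 M))⁻¹`. -/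
noncomputable def divisorWeight (Ω : ι → ℝ) (M : ℕ) (q : ι → ℤ) : ℂ :=
  (2 * Real.pi * Complex.I * (∑ i, q i * Ω i : ℝ))⁻¹ *
    (∑ j, (2 * Real.pi * Complex.I * (q j : ℝ)) ^ (2 * M))⁻¹

/-- All terms have the sign (-1)^M, so nothing cancels and the term with the largest |q_j| bounds
the sum from below. -/
theorem norm_sum_pow_ge (M : ℕ) (q : ι → ℤ) (hq : q ≠ 0) :
    ‖(fun i => (q i : ℝ))‖ ^ (2 * M) ≤ ‖∑ j, (2 * Real.pi * Complex.I * (q j : ℝ)) ^ (2 * M)‖ := by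
  have h1 : ∑ j, (2 * Real.pi * Complex.I * (q j : ℝ)) ^ (2 * M) =
      (-1) ^ M * ((∑ j, (2 * Real.pi * q j) ^ (2 * M) : ℝ) : ℂ) := by
    push_cast
    rw [Finset.mul_sum]
    refine Finset.sum_congr rfl fun j _ => ?_
    rw [show (2 * Real.pi * Complex.I * (q j : ℂ)) = Complex.I * (2 * Real.pi * q j) by ring,
      mul_pow, pow_mul Complex.I, Complex.I_sq]
  have hnn : ∀ j ∈ Finset.univ, 0 ≤ (2 * Real.pi * (q j : ℝ)) ^ (2 * M) := fun j _ =>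
    (even_two_mul M).pow_nonneg _
  rw [h1, norm_mul, norm_pow, norm_neg, norm_one, one_pow, one_mul, Complex.norm_real,
    Real.norm_of_nonneg (Finset.sum_nonneg hnn)]
  obtain ⟨i₀, -⟩ := Function.ne_iff.1 hq
  have : Nonempty ι := ⟨i₀⟩
  obtain ⟨i, hi⟩ := Finite.exists_max fun i => ‖(q i : ℝ)‖
  have h2 : ‖(fun i => (q i : ℝ))‖ ≤ |(q i : ℝ)| :=
    (pi_norm_le_iff_of_nonempty _).2 hi
  refine le_trans ?_ (Finset.single_le_sum hnn (Finset.mem_univ i))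
  rw [← (even_two_mul M).pow_abs (2 * Real.pi * (q i : ℝ))]
  gcongr
  refine h2.trans ?_
  rw [abs_mul]
  refine le_mul_of_one_le_left (abs_nonneg _) ?_
  rw [abs_of_pos (by positivity)]
  have := Real.pi_gt_three
  linarith

theorem IsDiophantine.sum_ne_zero {Ω : ι → ℝ} (hΩ : IsDiophantine Ω) {q : ι → ℤ} (hq : q ≠ 0) :
    ∑ i, q i * Ω i ≠ 0 := by
  obtain ⟨C, hC, τ, -, h⟩ := hΩ
  intro h0
  have h1 := h q hq
  simp_rw [mul_comm (Ω _)] at h1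
  rw [h0, abs_zero] at h1
  obtain ⟨i, hi⟩ := Function.ne_iff.1 hq
  have h2 : 0 < ∑ i, |(q i : ℝ)| :=
    Finset.sum_pos' (fun _ _ => abs_nonneg _) ⟨i, Finset.mem_univ _, by
      have : (q i : ℝ) ≠ 0 := by exact_mod_cast hi
      positivity⟩
  have := mul_pos hC (Real.rpow_pos_of_pos h2 (-τ))
  linarith

/-- High derivatives pay for the small divisors: |Ω · q|⁻¹ grows at most like |q|^σ, while the other
factor is at most |q|^(-2M). With N the dimension, M > σ + N gives σ - 2M < -N, the range of
summability over the lattice. -/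
theorem exists_summable_divisorWeight {Ω : ι → ℝ} (hΩ : IsDiophantine Ω) :
    ∃ M : ℕ, (Summable fun q : ι → ℤ => if q = 0 then 0 else ‖divisorWeight Ω M q‖) ∧
      Summable fun q : ι → ℤ => if q = 0 then 0 else
        ‖∑ j, (2 * Real.pi * Complex.I * (q j : ℝ)) ^ (2 * M)‖⁻¹ := by
  obtain ⟨C, hC, τ, -, h⟩ := hΩ
  set N : ℝ := ((Fintype.card ι : ℕ) : ℝ) with hN
  -- The monotonicity of powers used below needs a nonnegative exponent; τ itself can be negative
  -- only for empty ι.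
  set σ : ℝ := max τ 0 with hσ
  obtain ⟨M, hM⟩ := exists_nat_gt (σ + N)
  have hσ0 : 0 ≤ σ := le_max_right _ _
  have hN0 : 0 ≤ N := Nat.cast_nonneg _
  have hD : ∀ q : ι → ℤ, q ≠ 0 → ‖∑ j, (2 * Real.pi * Complex.I * (q j : ℝ)) ^ (2 * M)‖⁻¹ ≤
      ‖(fun i => (q i : ℝ))‖ ^ (-(2 * M : ℝ)) := by
    intro q hq
    have h1 := norm_intCast_ge_one hq
    rw [Real.rpow_neg (norm_nonneg _)]
    refine inv_anti₀ (by positivity) ?_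
    have := norm_sum_pow_ge M q hq
    rw [← Real.rpow_natCast] at this
    simpa using this
  refine ⟨M, ?_, ?_⟩
  · refine Summable.of_nonneg_of_le (fun q => by split_ifs <;> positivity) (fun q => ?_)
      ((summable_norm_int_rpow (ι := ι) (s := σ - 2 * M) (by rw [← hN]; linarith)).mul_left
        (C⁻¹ * N ^ σ))
    split_ifs with hq
    · positivity
    · have h1 := norm_intCast_ge_one hq
      have hone : (1 : ℝ) ≤ ∑ i, |(q i : ℝ)| := by
        refine h1.trans ((pi_norm_le_iff_of_nonneg (by positivity)).2 fun i => ?_)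
        exact Finset.single_le_sum (f := fun i => |(q i : ℝ)|) (fun _ _ => abs_nonneg _)
          (Finset.mem_univ i)
      have hsum : ∑ i, |(q i : ℝ)| ≤ N * ‖(fun i => (q i : ℝ))‖ := by
        refine (Finset.sum_le_card_nsmul _ _ _ fun i _ =>
          norm_le_pi_norm (fun i => (q i : ℝ)) i).trans (le_of_eq ?_)
        rw [nsmul_eq_mul, Finset.card_univ]
      have h2 : C * (N * ‖(fun i => (q i : ℝ))‖) ^ (-σ) ≤ |∑ i, q i * Ω i| := by
        have h3 := h q hq
        simp_rw [mul_comm (Ω _)] at h3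
        refine le_trans ?_ h3
        gcongr 1
        calc (N * ‖(fun i => (q i : ℝ))‖) ^ (-σ) ≤ (∑ i, |(q i : ℝ)|) ^ (-σ) :=
              Real.rpow_le_rpow_of_nonpos (by linarith) hsum (by linarith)
          _ ≤ (∑ i, |(q i : ℝ)|) ^ (-τ) :=
              Real.rpow_le_rpow_of_exponent_le hone (neg_le_neg (le_max_left _ _))
      have hNpos : 0 < N * ‖(fun i => (q i : ℝ))‖ := by linarith
      have h4 : ‖(2 * Real.pi * Complex.I * (∑ i, q i * Ω i : ℝ) : ℂ)⁻¹‖ ≤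
          C⁻¹ * (N * ‖(fun i => (q i : ℝ))‖) ^ σ := by
        have h5 : C⁻¹ * (N * ‖(fun i => (q i : ℝ))‖) ^ σ =
            (C * (N * ‖(fun i => (q i : ℝ))‖) ^ (-σ))⁻¹ := by
          rw [Real.rpow_neg hNpos.le, mul_inv, inv_inv]
        rw [h5, norm_inv]
        refine inv_anti₀ (mul_pos hC (Real.rpow_pos_of_pos hNpos _)) (h2.trans ?_)
        rw [norm_mul, Complex.norm_real, Real.norm_eq_abs]
        refine le_mul_of_one_le_left (abs_nonneg _) ?_
        simp only [norm_mul, Complex.norm_I, Complex.norm_real, Complex.norm_ofNat, mul_one,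
          Real.norm_of_nonneg Real.pi_pos.le]
        have := Real.pi_gt_three
        linarith
      rw [divisorWeight, norm_mul]
      rw [norm_inv (∑ j, _)]
      calc _ ≤ C⁻¹ * (N * ‖(fun i => (q i : ℝ))‖) ^ σ * ‖(fun i => (q i : ℝ))‖ ^ (-(2 * M : ℝ)) :=
            mul_le_mul h4 (hD q hq) (by positivity) (by positivity)
        _ = C⁻¹ * N ^ σ * ‖(fun i => (q i : ℝ))‖ ^ (σ - 2 * M) := by
            rw [Real.mul_rpow hN0 (norm_nonneg _), sub_eq_add_neg, Real.rpow_add (by linarith)]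
            ring
  · refine Summable.of_nonneg_of_le (fun q => by split_ifs <;> positivity) (fun q => ?_)
      (summable_norm_int_rpow (ι := ι) (s := -(2 * M)) (by rw [← hN]; linarith))
    split_ifs with hq
    · positivity
    · exact hD q hq

/-- The small divisor equation: an analytic periodic function with zero average is the derivative,
in a Diophantine direction, of an analytic periodic function. -/
theorem exists_dirDeriv_eq_sub_average {Ω : ι → ℝ} (hΩ : IsDiophantine Ω)
    {h : (ι → ℝ) × P → ℝ} {Λ : Set P} (hΛ : IsOpen Λ) (hh : AnalyticOnNhd ℝ h (univ ×ˢ Λ))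
    (hper : ∀ l ∈ Λ, ∀ x (q : ι → ℤ), h ((x + fun i => (q i : ℝ)), l) = h (x, l)) :
    ∃ f : (ι → ℝ) × P → ℝ, AnalyticOnNhd ℝ f (univ ×ˢ Λ) ∧
      (∀ l ∈ Λ, ∀ x (q : ι → ℤ), f ((x + fun i => (q i : ℝ)), l) = f (x, l)) ∧
      ∀ x, ∀ l ∈ Λ, fderiv ℝ f (x, l) (Ω, 0) = h (x, l) - ∫ s in Icc (0 : ι → ℝ) 1, h (s, l) := by
  classical
  obtain ⟨M, hw, hD⟩ := exists_summable_divisorWeight hΩ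
  have hhc : AnalyticOnNhd ℝ (fun p => (h p : ℂ)) (univ ×ˢ Λ) := fun p hp =>
    (ContinuousLinearMap.analyticAt Complex.ofRealCLM _).fun_comp (hh p hp)
  obtain ⟨H, hHa, hH⟩ := exists_analytic_translate hΛ hhc (fun l hl x q => by rw [hper l hl])
  have hHper : ∀ α, ∀ l ∈ Λ, ∀ x (q : ι → ℤ),
      H (α, l) (x + fun i => (q i : ℝ)) = H (α, l) x := by
    intro α l hl x q
    rw [hH _ _ hl, hH _ _ hl, add_right_comm, hper l hl]
  set c : (ι → ℤ) → P → ℂ := fun q l => cubeCoeff q (H (0, l)) with hcdef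
  have hc : ∀ q : ι → ℤ, ∀ α, ∀ l ∈ Λ, cubeCoeff q (H (α, l)) = expMonomial q α * c q l := by
    intro q α l hl
    refine cubeCoeff_translate q _ _ (hHper 0 l hl) α fun x => ?_
    rw [hH _ _ hl, hH _ _ hl, add_zero]
  set D : (ι → ℤ) → ℂ := fun q => ∑ j, (2 * Real.pi * Complex.I * (q j : ℝ)) ^ (2 * M) with hDdef
  -- The solution is the sum over q of w_q times the q-th coefficient of L = Σ_j ∂_j^(2M) H. The
  -- derivatives multiply the coefficients of H by D q; the weights divide by D q again and by 2πi Ω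
  -- · q, and they are summable on their own.
  set L : (ι → ℝ) × P → ((ι → ℝ) →ᵇ ℂ) := fun p =>
    ∑ j, (dirDeriv (Pi.single j 1))^[2 * M] H p with hLdef
  have hLa : AnalyticOnNhd ℝ L (univ ×ˢ Λ) := fun p hp =>
    Finset.analyticAt_fun_sum _ fun j _ =>
      (cubeCoeff_iterate_dirDeriv hHa (hc 0) (Pi.single j 1) (2 * M)).1 p hp
  have hLc : ∀ q : ι → ℤ, ∀ α, ∀ l ∈ Λ,
      cubeCoeff q (L (α, l)) = expMonomial q α * (D q * c q l) := by
    intro q α l hl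
    rw [hLdef, map_sum, hDdef]
    simp only
    rw [Finset.sum_mul, Finset.mul_sum]
    refine Finset.sum_congr rfl fun j _ => ?_
    rw [(cubeCoeff_iterate_dirDeriv hHa (hc q) (Pi.single j 1) (2 * M)).2 α l hl]
    congr 4
    simp [Pi.single_apply]
  have hD0 : ∀ q : ι → ℤ, q ≠ 0 → D q ≠ 0 := by
    intro q hq h0
    have h1 := norm_sum_pow_ge M q hq
    have h2 := norm_intCast_ge_one hq
    rw [show ∑ j, (2 * Real.pi * Complex.I * (q j : ℝ)) ^ (2 * M) = D q from rfl, h0,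
      norm_zero] at h1
    have h3 := one_le_pow₀ (n := 2 * M) h2
    linarith
  set w : (ι → ℤ) → ℂ := fun q => if q = 0 then 0 else divisorWeight Ω M q with hwdef
  have hwn : Summable fun q => ‖w q • cubeCoeff q‖ := by
    refine Summable.of_nonneg_of_le (fun q => norm_nonneg _) (fun q => ?_) hw
    rw [norm_smul]
    refine (mul_le_of_le_one_right (norm_nonneg _) (norm_cubeCoeff_le q)).trans (le_of_eq ?_)
    rw [hwdef]
    split_ifs with hq <;> simp [hq]
  -- The series converges in operator norm, so T is a single continuous functional, and T ∘ L is
  -- analytic in the angles and in l.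
  set T : ((ι → ℝ) →ᵇ ℂ) →L[ℝ] ℂ := ∑' q, w q • cubeCoeff q with hT
  have hTs : ∀ g, HasSum (fun q => w q * cubeCoeff q g) (T g) := by
    intro g
    have := hwn.of_norm.hasSum.mapL (ContinuousLinearMap.apply ℝ ℂ g)
    simpa using this
  have hfa : AnalyticOnNhd ℝ (fun p => (T (L p)).re) (univ ×ˢ Λ) := fun p hp =>
    (ContinuousLinearMap.analyticAt (Complex.reCLM ∘L T) _).fun_comp (hLa p hp)
  refine ⟨fun p => (T (L p)).re, hfa, fun l hl x q => ?_, fun x l hl => ?_⟩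
  · have : T (L ((x + fun i => (q i : ℝ)), l)) = T (L (x, l)) := by
      refine (hTs _).unique ?_
      convert! hTs (L (x, l)) using 2 with r
      rw [hLc _ _ _ hl, hLc _ _ _ hl, expMonomial_add, expMonomial_intVec, mul_one]
    simp only [this]
  · have hd : fderiv ℝ (fun p => (T (L p)).re) (x, l) (Ω, 0) = (T (dirDeriv Ω L (x, l))).re := by
      have h1 := (Complex.reCLM ∘L T).hasFDerivAt.comp (x, l)
        (hLa (x, l) ⟨mem_univ _, hl⟩).differentiableAt.hasFDerivAt
      have h2 : fderiv ℝ (fun p => (T (L p)).re) (x, l) = _ := h1.fderiv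
      rw [h2]
      rfl
    -- The coefficients of L are D q times those of H and are bounded by ‖L‖; hence the Fourier
    -- series of H converges absolutely.
    have hsum : Summable fun q => cubeCoeff q (H (0, l)) := by
      refine Summable.of_norm_bounded_eventually
        (g := fun q => (if q = 0 then 0 else ‖D q‖⁻¹) * ‖L (0, l)‖) (hD.mul_right _) ?_
      filter_upwards [(Set.finite_singleton (0 : ι → ℤ)).compl_mem_cofinite] with q hq
      have hq0 : q ≠ 0 := by simpa using hq
      rw [if_neg hq0, inv_mul_eq_div, le_div_iff₀ (norm_pos_iff.2 (hD0 q hq0)), mul_comm]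
      have h1 := norm_cubeCoeff_apply_le q (L (0, l))
      rw [hLc _ _ _ hl, expMonomial_zero_right, one_mul, norm_mul] at h1
      exact h1
    have hinv := hasSum_cubeCoeff (H (0, l)) (hHper 0 l hl) hsum x
    have h2 : HasSum (fun q => w q * cubeCoeff q (dirDeriv Ω L (x, l)))
        (H (0, l) x - cubeCoeff 0 (H (0, l))) := by
      -- The weight at q = 0 is zero, so exactly the average is missing from the series.
      have h3 := hinv.sub (hasSum_ite_eq (0 : ι → ℤ) (cubeCoeff 0 (H (0, l))))
      convert! h3 using 2 with q
      rw [cubeCoeff_dirDeriv hLa (hLc q) Ω x l hl, hwdef]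
      by_cases hq : q = 0
      · subst hq
        simp [expMonomial]
      · simp only [if_neg hq, sub_zero, divisorWeight]
        have h4 := hD0 q hq
        have h5 : ((∑ i, q i * Ω i : ℝ) : ℂ) ≠ 0 := by exact_mod_cast hΩ.sum_ne_zero hq
        have h6 := Complex.two_pi_I_ne_zero
        rw [show ∑ j, (2 * Real.pi * Complex.I * (q j : ℝ)) ^ (2 * M) = D q from rfl]
        field_simp
        rw [mul_comm]
    rw [hd, (hTs _).unique h2, cubeCoeff_zero, hH _ _ hl, add_zero, Complex.sub_re,
      Complex.ofReal_re]
    congr 1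
    have h6 : ∀ s, H (0, l) s = (h (s, l) : ℂ) := fun s => by rw [hH _ _ hl, add_zero]
    simp_rw [h6]
    rw [integral_complex_ofReal, Complex.ofReal_re]

end SmallDivisors

end

section

open scoped ContDiff BoundedContinuousFunction NNReal ENNReal

/-! ### Weighted integral operators on a half-line -/

section HalfLineOperators

set_option linter.unusedSectionVars false

variable {V : Type*} [NormedAddCommGroup V] [NormedSpace ℝ V] [CompleteSpace V] {A : ℝ}

/-- The weight `(A + s)⁻¹`, constant for negative `s`. -/
noncomputable def invWeight (A s : ℝ) : ℝ := (A + max s 0)⁻¹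

theorem continuous_invWeight (hA : 0 < A) : Continuous (invWeight A) := by
  unfold invWeight
  refine Continuous.inv₀ (by fun_prop) fun s => ?_
  have := le_max_right s 0
  positivity

theorem invWeight_pos (hA : 0 < A) (s : ℝ) : 0 < invWeight A s := by
  have := le_max_right s 0
  unfold invWeight; positivity

theorem invWeight_le (hA : 0 < A) (s : ℝ) : invWeight A s ≤ A⁻¹ :=
  inv_anti₀ hA (by have := le_max_right s 0; linarith)

theorem invWeight_of_nonneg {s : ℝ} (hs : 0 ≤ s) : invWeight A s = (A + s)⁻¹ := by
  rw [invWeight, max_eq_left hs]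

theorem max_mul_invWeight_le_one (hA : 0 < A) (s : ℝ) : max s 0 * invWeight A s ≤ 1 := by
  have := le_max_right s 0
  rw [invWeight, ← div_eq_mul_inv, div_le_one (by positivity)]
  linarith

theorem norm_invWeight_mul_integral_le (hA : 0 < A) (g : ℝ →ᵇ ℝ) (r : ℝ) :
    ‖invWeight A r * ∫ s in (0 : ℝ)..max r 0, invWeight A s * g s‖ ≤ A⁻¹ * ‖g‖ := by
  have h1 : ‖∫ s in (0 : ℝ)..max r 0, invWeight A s * g s‖ ≤ A⁻¹ * ‖g‖ * |max r 0 - 0| := by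
    refine intervalIntegral.norm_integral_le_of_norm_le_const fun s _ => ?_
    rw [norm_mul, Real.norm_of_nonneg (invWeight_pos hA s).le]
    exact mul_le_mul (invWeight_le hA s) (g.norm_coe_le_norm s) (norm_nonneg _) (by positivity)
  rw [sub_zero, abs_of_nonneg (le_max_right _ _)] at h1
  rw [norm_mul, Real.norm_of_nonneg (invWeight_pos hA r).le]
  calc _ ≤ invWeight A r * (A⁻¹ * ‖g‖ * max r 0) :=
        mul_le_mul_of_nonneg_left h1 (invWeight_pos hA r).le
    _ = A⁻¹ * ‖g‖ * (max r 0 * invWeight A r) := by ring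
    _ ≤ A⁻¹ * ‖g‖ * 1 := by gcongr; exact max_mul_invWeight_le_one hA r
    _ = A⁻¹ * ‖g‖ := mul_one _

theorem continuous_invWeight_mul (hA : 0 < A) (g : ℝ →ᵇ ℝ) :
    Continuous fun s => invWeight A s * g s :=
  (continuous_invWeight hA).mul g.continuous

theorem continuous_invWeight_mul_integral (hA : 0 < A) (g : ℝ →ᵇ ℝ) :
    Continuous fun r => invWeight A r * ∫ s in (0 : ℝ)..max r 0, invWeight A s * g s :=
  (continuous_invWeight hA).mul ((intervalIntegral.continuous_primitive
    (fun a b => (continuous_invWeight_mul hA g).intervalIntegrable a b) 0).comp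
    (by fun_prop : Continuous fun r : ℝ => max r 0))

/-- The operator `g ↦ (A + r)⁻¹ ∫_0^r (A + s)⁻¹ g(s) ds`. -/
noncomputable def averageOp (hA : 0 < A) : (ℝ →ᵇ ℝ) →L[ℝ] (ℝ →ᵇ ℝ) :=
  LinearMap.mkContinuous
    { toFun := fun g => .ofNormedAddCommGroup
        (fun r => invWeight A r * ∫ s in (0 : ℝ)..max r 0, invWeight A s * g s)
        (continuous_invWeight_mul_integral hA g) (A⁻¹ * ‖g‖) (norm_invWeight_mul_integral_le hA g)
      map_add' := fun g h => by
        ext r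
        simp only [BoundedContinuousFunction.coe_ofNormedAddCommGroup,
          BoundedContinuousFunction.coe_add, Pi.add_apply, mul_add]
        rw [intervalIntegral.integral_add ((continuous_invWeight_mul hA g).intervalIntegrable _ _)
          ((continuous_invWeight_mul hA h).intervalIntegrable _ _), mul_add]
      map_smul' := fun a g => by
        ext r
        simp only [BoundedContinuousFunction.coe_ofNormedAddCommGroup,
          BoundedContinuousFunction.coe_smul, smul_eq_mul, RingHom.id_apply]
        simp_rw [mul_left_comm _ a]
        rw [intervalIntegral.integral_const_mul, mul_left_comm] }
    A⁻¹ (fun g => (BoundedContinuousFunction.norm_le (by positivity)).2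
      fun r => norm_invWeight_mul_integral_le hA g r)

theorem averageOp_apply (hA : 0 < A) (g : ℝ →ᵇ ℝ) (r : ℝ) :
    averageOp hA g r = invWeight A r * ∫ s in (0 : ℝ)..max r 0, invWeight A s * g s := rfl

theorem norm_averageOp_apply_le (hA : 0 < A) (g : ℝ →ᵇ ℝ) : ‖averageOp hA g‖ ≤ A⁻¹ * ‖g‖ :=
  (averageOp hA).le_of_opNorm_le (LinearMap.mkContinuous_norm_le _ (by positivity) _) g

theorem integral_Ioi_inv_pow (hA : 0 < A) {M : ℕ} (hM : 1 ≤ M) {r : ℝ} (hr : 0 ≤ r) :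
    IntegrableOn (fun s => invWeight A s ^ (M + 1)) (Ioi r) ∧
      ∫ s in Ioi r, invWeight A s ^ (M + 1) = (M : ℝ)⁻¹ * (A + r)⁻¹ ^ M := by
  have hM0 : (M : ℝ) ≠ 0 := by positivity
  have hd : ∀ s ∈ Ici r, HasDerivAt (fun s => -((M : ℝ)⁻¹ * (A + s)⁻¹ ^ M))
      ((A + s)⁻¹ ^ (M + 1)) s := by
    intro s hs
    have hs0 : A + s ≠ 0 := by have : 0 ≤ s := hr.trans hs; positivity
    have h1 := ((((hasDerivAt_id s).const_add A).inv hs0).pow M).const_mul (M : ℝ)⁻¹ |>.neg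
    convert! h1 using 1
    simp only [id_eq, Pi.inv_apply]
    obtain ⟨m, rfl⟩ : ∃ m, M = m + 1 := ⟨M - 1, by omega⟩
    field_simp
    simp
    field_simp
    ring
  have ht : Tendsto (fun s => -((M : ℝ)⁻¹ * (A + s)⁻¹ ^ M)) atTop (𝓝 0) := by
    have h1 : Tendsto (fun s : ℝ => (A + s)⁻¹) atTop (𝓝 0) :=
      tendsto_inv_atTop_zero.comp (tendsto_atTop_add_const_left _ _ tendsto_id)
    have h2 := ((h1.pow M).const_mul (M : ℝ)⁻¹).neg
    rwa [zero_pow (by omega), mul_zero, neg_zero] at h2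
  have hcongr : ∀ s ∈ Ioi r, (A + s)⁻¹ ^ (M + 1) = invWeight A s ^ (M + 1) := fun s hs => by
    rw [invWeight_of_nonneg (hr.trans (le_of_lt hs))]
  have hpos : ∀ s ∈ Ioi r, 0 ≤ (A + s)⁻¹ ^ (M + 1) := fun s hs => by
    rw [hcongr s hs]; exact (pow_pos (invWeight_pos hA s) _).le
  have hint := integrableOn_Ioi_deriv_of_nonneg' hd hpos ht
  constructor
  · exact hint.congr_fun hcongr measurableSet_Ioi
  · rw [← setIntegral_congr_fun measurableSet_Ioi hcongr,
      integral_Ioi_of_hasDerivAt_of_tendsto' hd hint ht]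
    ring

theorem integrableOn_invWeight_smul (hA : 0 < A) {M : ℕ} (hM : 1 ≤ M) (g : ℝ →ᵇ V) {r : ℝ}
    (hr : 0 ≤ r) : IntegrableOn (fun s => invWeight A s ^ (M + 1) • g s) (Ioi r) :=
  (integral_Ioi_inv_pow hA hM hr).1.smul_bdd ‖g‖
    g.continuous.aestronglyMeasurable (.of_forall g.norm_coe_le_norm)

theorem norm_integral_invWeight_smul_le (hA : 0 < A) {M : ℕ} (hM : 1 ≤ M) (g : ℝ →ᵇ V) {r : ℝ}
    (hr : 0 ≤ r) : ‖∫ s in Ioi r, invWeight A s ^ (M + 1) • g s‖ ≤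
      (M : ℝ)⁻¹ * (A + r)⁻¹ ^ M * ‖g‖ := by
  rw [← (integral_Ioi_inv_pow hA hM hr).2, ← integral_mul_const]
  refine norm_integral_le_of_norm_le ((integral_Ioi_inv_pow hA hM hr).1.mul_const _)
    (.of_forall fun s => ?_)
  rw [norm_smul, Real.norm_of_nonneg (pow_pos (invWeight_pos hA s) _).le]
  gcongr
  · exact (pow_pos (invWeight_pos hA s) _).le
  · exact g.norm_coe_le_norm s

theorem norm_smul_integral_invWeight_le (hA : 0 < A) {M : ℕ} (hM : 1 ≤ M) (g : ℝ →ᵇ V) (r : ℝ) :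
    ‖(A + max r 0) ^ M • ∫ s in Ioi (max r 0), invWeight A s ^ (M + 1) • g s‖ ≤
      (M : ℝ)⁻¹ * ‖g‖ := by
  have h0 := le_max_right r 0
  rw [norm_smul, Real.norm_of_nonneg (by positivity)]
  calc _ ≤ (A + max r 0) ^ M * ((M : ℝ)⁻¹ * (A + max r 0)⁻¹ ^ M * ‖g‖) := by
        gcongr; exact norm_integral_invWeight_smul_le hA hM g h0
    _ = (M : ℝ)⁻¹ * ‖g‖ := by
        have : A + max r 0 ≠ 0 := by positivity
        rw [inv_pow]
        field_simp

theorem continuous_smul_integral_invWeight (hA : 0 < A) {M : ℕ} (hM : 1 ≤ M) (g : ℝ →ᵇ V) :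
    Continuous fun r : ℝ =>
      (A + max r 0) ^ M • ∫ s in Ioi (max r 0), invWeight A s ^ (M + 1) • g s := by
  have h1 : Continuous fun s => invWeight A s ^ (M + 1) • g s :=
    ((continuous_invWeight hA).pow _).smul g.continuous
  have h2 : (fun r : ℝ => ∫ s in Ioi (max r 0), invWeight A s ^ (M + 1) • g s) =
      fun r => (∫ s in Ioi (0 : ℝ), invWeight A s ^ (M + 1) • g s) -
        ∫ s in (0 : ℝ)..max r 0, invWeight A s ^ (M + 1) • g s := by
    ext r
    rw [← intervalIntegral.integral_Ioi_sub_Ioi (integrableOn_invWeight_smul hA hM g le_rfl)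
      (le_max_right r 0)]
    abel
  refine Continuous.smul (by fun_prop) ?_
  rw [h2]
  exact continuous_const.sub ((intervalIntegral.continuous_primitive
    (fun a b => h1.intervalIntegrable a b) 0).comp (by fun_prop : Continuous fun r : ℝ => max r 0))

/-- The operator `g ↦ (A + r)^M ∫_r^∞ (A + s)^(-(M+1)) g(s) ds`. -/
noncomputable def tailOp (V : Type*) [NormedAddCommGroup V] [NormedSpace ℝ V] [CompleteSpace V]
    (hA : 0 < A) {M : ℕ} (hM : 1 ≤ M) : (ℝ →ᵇ V) →L[ℝ] (ℝ →ᵇ V) :=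
  LinearMap.mkContinuous
    { toFun := fun g => .ofNormedAddCommGroup
        (fun r => (A + max r 0) ^ M • ∫ s in Ioi (max r 0), invWeight A s ^ (M + 1) • g s)
        (continuous_smul_integral_invWeight hA hM g) ((M : ℝ)⁻¹ * ‖g‖)
        (norm_smul_integral_invWeight_le hA hM g)
      map_add' := fun g h => by
        ext1 r
        simp only [BoundedContinuousFunction.coe_ofNormedAddCommGroup,
          BoundedContinuousFunction.coe_add, Pi.add_apply, smul_add]
        rw [integral_add (integrableOn_invWeight_smul hA hM g (le_max_right _ _))
          (integrableOn_invWeight_smul hA hM h (le_max_right _ _)), smul_add]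
      map_smul' := fun a g => by
        ext1 r
        simp only [BoundedContinuousFunction.coe_ofNormedAddCommGroup,
          BoundedContinuousFunction.coe_smul, RingHom.id_apply]
        simp_rw [smul_comm _ a]
        rw [integral_smul, smul_comm] }
    (M : ℝ)⁻¹ (fun g => (BoundedContinuousFunction.norm_le (by positivity)).2
      fun r => norm_smul_integral_invWeight_le hA hM g r)

theorem tailOp_apply (hA : 0 < A) {M : ℕ} (hM : 1 ≤ M) (g : ℝ →ᵇ V) (r : ℝ) :
    tailOp V hA hM g r =
      (A + max r 0) ^ M • ∫ s in Ioi (max r 0), invWeight A s ^ (M + 1) • g s := rfl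

/-- The gain 1/M is what beats the Lipschitz constant of the remainder equation. -/
theorem norm_tailOp_apply_le (hA : 0 < A) {M : ℕ} (hM : 1 ≤ M) (g : ℝ →ᵇ V) :
    ‖tailOp V hA hM g‖ ≤ (M : ℝ)⁻¹ * ‖g‖ :=
  (tailOp V hA hM).le_of_opNorm_le (LinearMap.mkContinuous_norm_le _ (by positivity) _) g

end HalfLineOperators

/-! ### The slow variable w = u^(-κ) -/

section SlowVariable

variable {P : Type*} [NormedAddCommGroup P] [NormedSpace ℝ P] [CompleteSpace P]

/-- The solutions `w` of `w' = κ (α - β / w)`, divided by `A + r`, depend analytically on the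
initial condition and on the parameters, in the supremum norm. -/
theorem exists_slowVariable {Λ : Set P} (hΛ : IsOpen Λ) {α β : P → ℝ} (hα : AnalyticOnNhd ℝ α Λ)
    (hβ : AnalyticOnNhd ℝ β Λ) {κ αm αM βM : ℝ} (hκ : 0 < κ) (hαm : 0 < αm)
    (hα1 : ∀ l ∈ Λ, αm ≤ α l) (hα2 : ∀ l ∈ Λ, α l ≤ αM) (hβ1 : ∀ l ∈ Λ, |β l| ≤ βM) :
    ∃ c C A₀ : ℝ, 0 < c ∧ 0 < C ∧ 0 < A₀ ∧ ∀ A, A₀ ≤ A → ∃ ψ : ℝ × P → (ℝ →ᵇ ℝ),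
      AnalyticOnNhd ℝ ψ (Ioi A ×ˢ Λ) ∧ ∀ p ∈ Ioi A ×ˢ Λ,
        (∀ r, c ≤ ψ p r ∧ ψ p r ≤ p.1 / A + C) ∧ A * ψ p 0 = p.1 ∧
        ∀ r, 0 ≤ r → HasDerivWithinAt (fun r => (A + max r 0) * ψ p r)
          (κ * (α p.2 - β p.2 / ((A + r) * ψ p r))) (Ici r) r ∧
          κ * αm / 2 ≤ κ * (α p.2 - β p.2 / ((A + r) * ψ p r)) := by
  rcases Λ.eq_empty_or_nonempty with rfl | ⟨l₀, hl₀⟩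
  · exact ⟨1, 1, 1, one_pos, one_pos, one_pos, fun A _ => ⟨0, by simp [AnalyticOnNhd], by simp⟩⟩
  have hβM : 0 ≤ βM := (abs_nonneg _).trans (hβ1 l₀ hl₀)
  have hαM : 0 < αM := hαm.trans_le ((hα1 l₀ hl₀).trans (hα2 l₀ hl₀))
  -- The main part a = (p.1 + κ α r) / (A + r), with p.1 > A, is at least min(1, κ αm) = 2c. The
  -- correction z is sought in the ball of radius c, so ψ = a + z stays above c.
  set c : ℝ := min 1 (κ * αm) / 2 with hc
  have hc0 : 0 < c := by positivity
  -- In A₀ the second term makes the fixed-point map a contraction; the third keeps |β / w| below αm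
  -- / 2, which gives the lower bound for w'.
  refine ⟨c, κ * αM + c, 1 + 4 * (κ * βM) / c ^ 2 + 2 * βM / (c * αm), hc0, by positivity,
    by positivity, fun A hA => ?_⟩
  have hA1 : 1 ≤ A := by
    have h1 : 0 ≤ 4 * (κ * βM) / c ^ 2 := by positivity
    have h2 : 0 ≤ 2 * βM / (c * αm) := by positivity
    linarith
  have hA0 : 0 < A := by linarith
  have hA2 : κ * βM * A⁻¹ ≤ c ^ 2 / 4 := by
    have h2 : 0 ≤ 2 * βM / (c * αm) := by positivity
    have h1 : 4 * (κ * βM) / c ^ 2 ≤ A := by linarith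
    rw [div_le_iff₀ (by positivity)] at h1
    rw [← div_eq_mul_inv, div_le_iff₀ hA0]
    linarith
  have hA3 : βM / (c * A) ≤ αm / 2 := by
    have h2 : 0 ≤ 4 * (κ * βM) / c ^ 2 := by positivity
    have h1 : 2 * βM / (c * αm) ≤ A := by linarith
    rw [div_le_iff₀ (by positivity)] at h1 ⊢
    linarith
  let e₁ : ℝ →ᵇ ℝ := .ofNormedAddCommGroup (invWeight A) (continuous_invWeight hA0) A⁻¹ (fun s => by
    rw [Real.norm_of_nonneg (invWeight_pos hA0 s).le]; exact invWeight_le hA0 s)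
  let e₂ : ℝ →ᵇ ℝ := .ofNormedAddCommGroup (fun r => max r 0 * invWeight A r)
    ((by fun_prop : Continuous fun r : ℝ => max r 0).mul (continuous_invWeight hA0)) 1 (fun s => by
      rw [Real.norm_of_nonneg (mul_nonneg (le_max_right _ _) (invWeight_pos hA0 s).le)]
      exact max_mul_invWeight_le_one hA0 s)
  let a : ℝ × P → (ℝ →ᵇ ℝ) := fun p => p.1 • e₁ + (κ * α p.2) • e₂
  have ha_apply : ∀ p r, a p r = (p.1 + κ * α p.2 * max r 0) * invWeight A r := fun p r => by
    simp only [a, BoundedContinuousFunction.coe_add, BoundedContinuousFunction.coe_smul,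
      Pi.add_apply, smul_eq_mul, e₁, e₂, BoundedContinuousFunction.coe_ofNormedAddCommGroup]
    ring
  have haan : AnalyticOnNhd ℝ a (Ioi A ×ˢ Λ) := by
    rintro p ⟨-, hp⟩
    have h1 : AnalyticAt ℝ (fun p : ℝ × P => α p.2) p := (hα _ hp).fun_comp analyticAt_snd
    exact (analyticAt_fst.smul analyticAt_const).add
      ((analyticAt_const.mul h1).smul analyticAt_const)
  have ha_ge : ∀ p ∈ Ioi A ×ˢ Λ, ∀ r, 2 * c ≤ a p r := by
    rintro p ⟨hp1, hp2⟩ r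
    have h0 := le_max_right r 0
    rw [ha_apply, invWeight, ← div_eq_mul_inv, le_div_iff₀ (by positivity), hc]
    have h1 : min 1 (κ * αm) ≤ 1 := min_le_left _ _
    have h2 : min 1 (κ * αm) ≤ κ * αm := min_le_right _ _
    have h3 : κ * αm ≤ κ * α p.2 := mul_le_mul_of_nonneg_left (hα1 _ hp2) hκ.le
    have h4 : min 1 (κ * αm) * A ≤ 1 * A := by gcongr
    have h5 : min 1 (κ * αm) * max r 0 ≤ κ * α p.2 * max r 0 := by
      gcongr; exact h2.trans h3
    have h6 : A < p.1 := hp1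
    linarith
  have ha_le : ∀ p ∈ Ioi A ×ˢ Λ, ∀ r, a p r ≤ p.1 / A + κ * αM := by
    rintro p ⟨hp1, hp2⟩ r
    have h0 := le_max_right r 0
    have h6 : A < p.1 := hp1
    rw [ha_apply, add_mul, div_eq_mul_inv]
    have h1 := max_mul_invWeight_le_one hA0 r
    have h3 : κ * α p.2 ≤ κ * αM := mul_le_mul_of_nonneg_left (hα2 _ hp2) hκ.le
    have h4 : κ * α p.2 * max r 0 * invWeight A r ≤ κ * αM * 1 := by
      rw [mul_assoc]
      exact mul_le_mul h3 h1 (mul_nonneg h0 (invWeight_pos hA0 r).le) (by positivity)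
    have h5 : p.1 * invWeight A r ≤ p.1 * A⁻¹ :=
      mul_le_mul_of_nonneg_left (invWeight_le hA0 r) (by linarith)
    linarith
  have hge : ∀ p ∈ Ioi A ×ˢ Λ, ∀ z : ℝ →ᵇ ℝ, ‖z‖ ≤ c → ∀ r, c ≤ (a p + z) r := by
    intro p hp z hz r
    have h1 := ha_ge p hp r
    have h2 := (z.norm_coe_le_norm r).trans hz
    rw [Real.norm_eq_abs, abs_le] at h2
    simp only [BoundedContinuousFunction.coe_add, Pi.add_apply]
    linarith [h2.1]
  let b : ℝ → ℝ := fun _ => 0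
  have hsup : ∀ z : ℝ →ᵇ ℝ, (∀ r, c ≤ z r) → AnalyticAt ℝ (superpose Inv.inv b) z ∧
      ∀ r, superpose Inv.inv b z r = (z r)⁻¹ := by
    intro z hz
    have := analyticAt_superpose_of_isCompact (f := (Inv.inv : ℝ → ℝ)) (b := b) (ζ₀ := z)
      (K := Icc c ‖z‖) (D := Ioi 0) (Γ := ∅) continuous_const isCompact_Icc isOpen_Ioi
      (fun x hx => hc0.trans_le hx.1) (fun x hx => analyticAt_inv (ne_of_gt hx)) (by simp)
      (fun s => ⟨z s, ⟨hz s, (le_abs_self _).trans (z.norm_coe_le_norm s)⟩, 0, by simp, by simp [b]⟩)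
    refine ⟨this.1, fun r => ?_⟩
    simpa [b] using this.2.self_of_nhds r
  -- The integrated equation for w = (A + r) ψ is w = p.1 + κ α r - κ β ∫ ds / w. After division by
  -- A + r the first two terms form a, and the last one is `averageOp` of 1/ψ.
  let G : (ℝ × P) × (ℝ →ᵇ ℝ) → (ℝ →ᵇ ℝ) := fun q =>
    (-(κ * β q.1.2)) • averageOp hA0 (superpose Inv.inv b (a q.1 + q.2))
  obtain ⟨z, hza, hz⟩ := exists_analytic_fixedPoint (G := G) (Q := Ioi A ×ˢ Λ)
    (isOpen_Ioi.prod hΛ) hc0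
    (by
      intro p hp z hz
      have h1 : AnalyticAt ℝ (fun q : (ℝ × P) × (ℝ →ᵇ ℝ) => β q.1.2) (p, z) :=
        AnalyticAt.fun_comp (f := fun q : (ℝ × P) × (ℝ →ᵇ ℝ) => q.1.2) (hβ _ hp.2)
          (analyticAt_snd.fun_comp analyticAt_fst)
      have h2 : AnalyticAt ℝ (fun q : (ℝ × P) × (ℝ →ᵇ ℝ) => a q.1 + q.2) (p, z) :=
        (AnalyticAt.fun_comp (f := fun q : (ℝ × P) × (ℝ →ᵇ ℝ) => q.1) (haan p hp)
          analyticAt_fst).fun_add analyticAt_snd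
      have h3 := (hsup (a p + z) (hge p hp z hz.le)).1
      exact (analyticAt_const.mul h1).neg.smul ((ContinuousLinearMap.analyticAt _ _).fun_comp
        (AnalyticAt.fun_comp (f := fun q : (ℝ × P) × (ℝ →ᵇ ℝ) => a q.1 + q.2) h3 h2)))
    (by
      intro p hp
      have h1 := hsup (a p + 0) (hge p hp 0 (by simpa using hc0.le))
      have h2 : ‖superpose Inv.inv b (a p + 0)‖ ≤ c⁻¹ := by
        refine (BoundedContinuousFunction.norm_le (by positivity)).2 fun r => ?_
        have h3 := hge p hp 0 (by simpa using hc0.le) r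
        rw [h1.2, norm_inv, Real.norm_of_nonneg (hc0.le.trans h3)]
        exact inv_anti₀ hc0 h3
      simp only [G, norm_smul, norm_neg, norm_mul, Real.norm_eq_abs, abs_of_pos hκ]
      calc κ * |β p.2| * ‖averageOp hA0 (superpose Inv.inv b (a p + 0))‖
          ≤ κ * βM * (A⁻¹ * c⁻¹) := by
            gcongr
            · exact hβ1 _ hp.2
            · exact (norm_averageOp_apply_le _ _).trans (by gcongr)
        _ = κ * βM * A⁻¹ * c⁻¹ := by ring
        _ ≤ c ^ 2 / 4 * c⁻¹ := by gcongr
        _ = c / 4 := by field_simp)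
    (by
      intro p hp z z' hz hz'
      have h1 := hsup (a p + z) (hge p hp z hz)
      have h1' := hsup (a p + z') (hge p hp z' hz')
      have h2 : ‖superpose Inv.inv b (a p + z) - superpose Inv.inv b (a p + z')‖ ≤
          (c ^ 2)⁻¹ * ‖z - z'‖ := by
        refine (BoundedContinuousFunction.norm_le (by positivity)).2 fun r => ?_
        have h3 := hge p hp z hz r
        have h3' := hge p hp z' hz' r
        have h4 : 0 < (a p + z) r := hc0.trans_le h3
        have h4' : 0 < (a p + z') r := hc0.trans_le h3'
        rw [BoundedContinuousFunction.coe_sub, Pi.sub_apply, h1.2, h1'.2,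
          inv_sub_inv h4.ne' h4'.ne', norm_div, norm_mul, Real.norm_of_nonneg h4.le,
          Real.norm_of_nonneg h4'.le, inv_mul_eq_div]
        have h5 : ‖(a p + z') r - (a p + z) r‖ ≤ ‖z - z'‖ := by
          have : (a p + z') r - (a p + z) r = -((z - z') r) := by simp
          rw [this, norm_neg]
          exact (z - z').norm_coe_le_norm r
        gcongr
        nlinarith
      have h6 : G (p, z) - G (p, z') = (-(κ * β p.2)) • averageOp hA0
          (superpose Inv.inv b (a p + z) - superpose Inv.inv b (a p + z')) := by
        rw [map_sub, smul_sub]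
      rw [h6, norm_smul, norm_neg, norm_mul, Real.norm_eq_abs, Real.norm_eq_abs,
        abs_of_pos hκ]
      calc _ ≤ κ * βM * (A⁻¹ * ((c ^ 2)⁻¹ * ‖z - z'‖)) := by
            gcongr
            · exact hβ1 _ hp.2
            · exact (norm_averageOp_apply_le _ _).trans (by gcongr)
        _ = κ * βM * A⁻¹ * (c ^ 2)⁻¹ * ‖z - z'‖ := by ring
        _ ≤ c ^ 2 / 4 * (c ^ 2)⁻¹ * ‖z - z'‖ := by gcongr
        _ ≤ 1 / 2 * ‖z - z'‖ := by
            gcongr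
            rw [div_mul_eq_mul_div, mul_inv_cancel₀ (by positivity)]
            norm_num)
  refine ⟨fun p => a p + z p, fun p hp => (haan p hp).add (hza p hp), fun p hp => ?_⟩
  obtain ⟨hz1, hz2, -⟩ := hz p hp
  have hzc : ‖z p‖ ≤ c := by linarith
  have hψ := hge p hp (z p) hzc
  have hinv := (hsup (a p + z p) hψ).2
  have heq : ∀ r, 0 ≤ r → (A + r) * (a p + z p) r = p.1 + κ * α p.2 * r -
      κ * β p.2 * ∫ s in (0 : ℝ)..r, invWeight A s * ((a p + z p) s)⁻¹ := by
    intro r hr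
    have h1 : z p r = -(κ * β p.2) * ((A + r)⁻¹ *
        ∫ s in (0 : ℝ)..r, invWeight A s * ((a p + z p) s)⁻¹) := by
      conv_lhs => rw [← hz2]
      simp only [G, BoundedContinuousFunction.coe_smul, smul_eq_mul, averageOp_apply, hinv,
        invWeight_of_nonneg hr, max_eq_left hr]
    have h2 : A + r ≠ 0 := by positivity
    rw [BoundedContinuousFunction.coe_add, Pi.add_apply, h1, ha_apply, invWeight_of_nonneg hr,
      max_eq_left hr]
    field_simp
    simp only [BoundedContinuousFunction.coe_add, Pi.add_apply]
    ring
  refine ⟨fun r => ⟨hψ r, ?_⟩, ?_, fun r hr => ⟨?_, ?_⟩⟩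
  · have h1 := ha_le p hp r
    have h2 := ((z p).norm_coe_le_norm r).trans hzc
    rw [Real.norm_eq_abs, abs_le] at h2
    simp only [BoundedContinuousFunction.coe_add, Pi.add_apply]
    linarith [h2.2]
  · have := heq 0 le_rfl
    simpa using this
  · have hcont : Continuous fun s => invWeight A s * ((a p + z p) s)⁻¹ :=
      (continuous_invWeight hA0).mul ((a p + z p).continuous.inv₀ fun s =>
        (hc0.trans_le (hψ s)).ne')
    have h1 := (intervalIntegral.integral_hasDerivAt_right (hcont.intervalIntegrable 0 r)
      (hcont.stronglyMeasurableAtFilter _ _) hcont.continuousAt)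
    have h2 := (((hasDerivAt_id r).const_mul (κ * α p.2)).const_add p.1).sub
      (h1.const_mul (κ * β p.2))
    have h3 : HasDerivWithinAt (fun r => (A + max r 0) * (a p + z p) r)
        (κ * α p.2 * 1 - κ * β p.2 * (invWeight A r * ((a p + z p) r)⁻¹)) (Ici r) r := by
      refine h2.hasDerivWithinAt.congr (fun s hs => ?_) ?_
      · have hs0 : 0 ≤ s := hr.trans hs
        rw [max_eq_left hs0, heq s hs0]
        rfl
      · rw [max_eq_left hr, heq r hr]
        rfl
    convert h3 using 1
    rw [invWeight_of_nonneg hr, ← mul_inv]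
    ring
  · have h1 : |β p.2 / ((A + r) * (a p + z p) r)| ≤ αm / 2 := by
      refine le_trans ?_ hA3
      rw [abs_div, abs_of_pos (mul_pos (by positivity) (hc0.trans_le (hψ r)))]
      have h4 : c * A ≤ (A + r) * (a p + z p) r := by
        rw [mul_comm]
        exact mul_le_mul (by linarith) (hψ r) hc0.le (by positivity)
      exact div_le_div₀ hβM (hβ1 _ hp.2) (by positivity) h4
    have h2 := (abs_le.1 h1).2
    have h3 := hα1 _ hp.2
    have h4 : κ * (αm / 2) ≤ κ * (α p.2 - β p.2 / ((A + r) * (a p + z p) r)) :=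
      mul_le_mul_of_nonneg_left (by linarith) hκ.le
    linarith

end SlowVariable

end

section

open scoped BoundedContinuousFunction NNReal ENNReal

/-! ### The fixed-point problem for the remainder along orbits -/

section OrbitFixedPoint

set_option linter.unusedSectionVars false

variable {V Θ P : Type*} [NormedAddCommGroup V] [NormedSpace ℝ V] [ProperSpace V]
  [NormedAddCommGroup Θ] [NormedSpace ℝ Θ] [CompleteSpace Θ]
  [NormedAddCommGroup P] [NormedSpace ℝ P] [CompleteSpace P]

/-- Values at negative s are an artefact of working with functions on the whole line. -/
theorem tailOp_congr {A : ℝ} (hA : 0 < A) {M : ℕ} (hM : 1 ≤ M) {g h : ℝ →ᵇ V}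
    (hgh : ∀ s, 0 ≤ s → g s = h s) : tailOp V hA hM g = tailOp V hA hM h := by
  ext r
  rw [tailOp_apply, tailOp_apply]
  congr 1
  refine setIntegral_congr_fun measurableSet_Ioi fun s hs => ?_
  simp only [hgh s ((le_max_right r 0).trans (le_of_lt hs))]

/-- The bounded curve `s ↦ (0, u s, z s, ϑ, l)`. -/
noncomputable def orbitCurve (u : ℝ →ᵇ ℝ) (z : ℝ →ᵇ V) (ϑ : Θ) (l : P) :
    ℝ →ᵇ ℝ × ℝ × V × Θ × P :=
  (ContinuousLinearMap.inr ℝ ℝ (ℝ × V × Θ × P) ∘L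
    ContinuousLinearMap.inl ℝ ℝ (V × Θ × P)).compLeftContinuousBounded ℝ u +
  (ContinuousLinearMap.inr ℝ ℝ (ℝ × V × Θ × P) ∘L ContinuousLinearMap.inr ℝ ℝ (V × Θ × P) ∘L
    ContinuousLinearMap.inl ℝ V (Θ × P)).compLeftContinuousBounded ℝ z +
  constBCF ℝ (ℝ × ℝ × V × Θ × P) (0, 0, 0, ϑ, l)

theorem orbitCurve_apply (u : ℝ →ᵇ ℝ) (z : ℝ →ᵇ V) (ϑ : Θ) (l : P) (s : ℝ) :
    orbitCurve u z ϑ l s = (0, u s, z s, ϑ, l) := by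
  simp [orbitCurve, constBCF_apply]

theorem AnalyticAt.orbitCurve {X : Type*} [NormedAddCommGroup X] [NormedSpace ℝ X]
    {u : X → (ℝ →ᵇ ℝ)} {z : X → (ℝ →ᵇ V)} {ϑ : X → Θ} {l : X → P} {x : X}
    (hu : AnalyticAt ℝ u x) (hz : AnalyticAt ℝ z x) (hϑ : AnalyticAt ℝ ϑ x)
    (hl : AnalyticAt ℝ l x) :
    AnalyticAt ℝ (fun x => orbitCurve (u x) (z x) (ϑ x) (l x)) x := by
  refine AnalyticAt.fun_add (AnalyticAt.fun_add ?_ ?_) ?_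
  · exact (ContinuousLinearMap.analyticAt _ _).fun_comp hu
  · exact (ContinuousLinearMap.analyticAt _ _).fun_comp hz
  · exact (ContinuousLinearMap.analyticAt _ _).fun_comp
      (analyticAt_const.prod (analyticAt_const.prod (analyticAt_const.prod (hϑ.prod hl))))

/-- The fixed point of `δ ↦ -tailOp (f (χ, υ, δ, ϑ + s Ω, l))` depends analytically on the
parameters. -/
theorem exists_orbitFixedPoint {f : ℝ × ℝ × V × Θ × P → V} {A Υ χ₀ ε : ℝ} (hA : 0 < A)
    (hε : 0 < ε) {M : ℕ} (hM : 1 ≤ M) {χ : ℝ → ℝ} (hχ : Continuous χ)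
    (hχ0 : ∀ s, 0 < χ s ∧ χ s ≤ χ₀) {Λ Λ₀ : Set P} (hΛ : IsOpen Λ) (hΛ₀ : IsOpen Λ₀)
    (hc : IsCompact (closure Λ)) (hcl : closure Λ ⊆ Λ₀) {D₀ Γ : Set Θ} (hD₀ : IsCompact D₀)
    (hΓ : ∀ ϑ, ∃ x ∈ D₀, ∃ v ∈ Γ, ϑ = x + v) (Ω : Θ)
    (hper : ∀ x υ z ϑ, ∀ l ∈ Λ₀, ∀ v ∈ Γ, f (x, υ, z, ϑ + v, l) = f (x, υ, z, ϑ, l))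
    (hf : ∀ x ∈ Icc 0 χ₀, ∀ υ ∈ Icc 0 Υ, ∀ z, ‖z‖ ≤ ε → ∀ ϑ ∈ D₀, ∀ l ∈ closure Λ,
      AnalyticAt ℝ f (x, υ, z, ϑ, l))
    (h0 : ∀ x ∈ Ioc 0 χ₀, ∀ υ ∈ Icc 0 Υ, ∀ ϑ, ∀ l ∈ Λ, ‖f (x, υ, 0, ϑ, l)‖ ≤ ε / 4)
    (hLip : ∀ x ∈ Ioc 0 χ₀, ∀ υ ∈ Icc 0 Υ, ∀ z z', ‖z‖ ≤ ε → ‖z'‖ ≤ ε → ∀ ϑ, ∀ l ∈ Λ,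
      ‖f (x, υ, z, ϑ, l) - f (x, υ, z', ϑ, l)‖ ≤ M / 2 * ‖z - z'‖)
    {W : Set ℝ} (hW : IsOpen W) {υ : ℝ × P → (ℝ →ᵇ ℝ)} (hυ : AnalyticOnNhd ℝ υ (W ×ˢ Λ))
    (hυ0 : ∀ p ∈ W ×ˢ Λ, ∀ s, υ p s ∈ Icc 0 Υ) :
    ∃ δ : ℝ × Θ × P → (ℝ →ᵇ V), AnalyticOnNhd ℝ δ (W ×ˢ univ ×ˢ Λ) ∧
      ∀ w ∈ W, ∀ ϑ, ∀ l ∈ Λ, ‖δ (w, ϑ, l)‖ ≤ ε / 2 ∧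
        (∃ g : ℝ →ᵇ V, (∀ s, g s = f (χ s, υ (w, l) s, δ (w, ϑ, l) s, ϑ + max s 0 • Ω, l)) ∧
          δ (w, ϑ, l) = -tailOp V hA hM g) ∧
        ∀ z g : ℝ →ᵇ V, ‖z‖ ≤ ε →
          (∀ s, 0 ≤ s → g s = f (χ s, υ (w, l) s, z s, ϑ + max s 0 • Ω, l)) →
          z = -tailOp V hA hM g → z = δ (w, ϑ, l) := by
  -- The drift s Ω of the angle is unbounded and therefore belongs to the base curve, not to the
  -- bounded variable; periodicity of f keeps the Taylor bounds uniform along it.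
  let b : ℝ → ℝ × ℝ × V × Θ × P := fun s => (χ s, 0, 0, max s 0 • Ω, 0)
  have hb : Continuous b := by fun_prop
  have hbζ : ∀ u z ϑ l s, b s + orbitCurve u z ϑ l s = (χ s, u s, z s, ϑ + max s 0 • Ω, l) := by
    intro u z ϑ l s
    simp [b, orbitCurve_apply, add_comm]
  let K : Set (ℝ × ℝ × V × Θ × P) :=
    Icc 0 χ₀ ×ˢ Icc 0 Υ ×ˢ Metric.closedBall 0 ε ×ˢ D₀ ×ˢ closure Λ
  let D : Set (ℝ × ℝ × V × Θ × P) := {x | AnalyticAt ℝ f x} ∩ {x | x.2.2.2.2 ∈ Λ₀}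
  have hK : IsCompact K := isCompact_Icc.prod (isCompact_Icc.prod
    ((isCompact_closedBall _ _).prod (hD₀.prod hc)))
  have hD : IsOpen D := (isOpen_analyticAt ℝ f).inter (hΛ₀.preimage (by fun_prop))
  have hKD : K ⊆ D := by
    rintro ⟨x, y, z, ϑ, l⟩ ⟨hx, hy, hz, hϑ, hl⟩
    exact ⟨hf x hx y hy z (by simpa using hz) ϑ hϑ l hl, hcl hl⟩
  have hsup : ∀ p ∈ W ×ˢ Λ, ∀ z : ℝ →ᵇ V, ‖z‖ ≤ ε → ∀ ϑ,
      AnalyticAt ℝ (superpose f b) (orbitCurve (υ p) z ϑ p.2) ∧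
      ∀ s, superpose f b (orbitCurve (υ p) z ϑ p.2) s =
        f (χ s, υ p s, z s, ϑ + max s 0 • Ω, p.2) := by
    intro p hp z hz ϑ
    have := analyticAt_superpose_of_isCompact (f := f) (b := b) (ζ₀ := orbitCurve (υ p) z ϑ p.2)
      (Γ := (fun v => (0, 0, 0, v, 0)) '' Γ) hb hK hD hKD (fun x hx => hx.1)
      (by
        rintro ⟨x, y, z, ϑ, l⟩ hx _ ⟨v, hv, rfl⟩
        simpa using hper x y z ϑ l hx.2 v hv)
      (by
        intro s
        obtain ⟨x, hx, v, hv, h⟩ := hΓ (ϑ + max s 0 • Ω)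
        refine ⟨(χ s, υ p s, z s, x, p.2), ⟨⟨(hχ0 s).1.le, (hχ0 s).2⟩, hυ0 p hp s, ?_, hx,
          subset_closure hp.2⟩, (0, 0, 0, v, 0), .inr ⟨v, hv, rfl⟩, ?_⟩
        · simpa using (z.norm_coe_le_norm s).trans hz
        · rw [hbζ, h]; simp)
    exact ⟨this.1, fun s => by rw [this.2.self_of_nhds s, hbζ]⟩
  obtain ⟨G, hG⟩ : ∃ G : (ℝ × Θ × P) × (ℝ →ᵇ V) → (ℝ →ᵇ V), ∀ q, G q =
      -tailOp V hA hM (superpose f b (orbitCurve (υ (q.1.1, q.1.2.2)) q.2 q.1.2.1 q.1.2.2)) :=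
    ⟨_, fun q => rfl⟩
  have hM0 : (0 : ℝ) < M := by positivity
  obtain ⟨δ, hδa, hδ⟩ := exists_analytic_fixedPoint (G := G) (Q := W ×ˢ univ ×ˢ Λ)
    (hW.prod (isOpen_univ.prod hΛ)) hε
    (by
      rintro ⟨w, ϑ, l⟩ ⟨hw, -, hl⟩ z hz
      have h4 : AnalyticAt ℝ (fun q : (ℝ × Θ × P) × (ℝ →ᵇ V) => q.1.2) ((w, ϑ, l), z) :=
        analyticAt_snd.fun_comp analyticAt_fst
      have h5 : AnalyticAt ℝ (fun q : (ℝ × Θ × P) × (ℝ →ᵇ V) => q.1.2.2) ((w, ϑ, l), z) :=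
        analyticAt_snd.fun_comp h4
      have h1 : AnalyticAt ℝ (fun q : (ℝ × Θ × P) × (ℝ →ᵇ V) => υ (q.1.1, q.1.2.2))
          ((w, ϑ, l), z) :=
        AnalyticAt.fun_comp (f := fun q : (ℝ × Θ × P) × (ℝ →ᵇ V) => (q.1.1, q.1.2.2))
          (hυ (w, l) ⟨hw, hl⟩) ((analyticAt_fst.fun_comp analyticAt_fst).prod h5)
      have h2 := AnalyticAt.orbitCurve h1 analyticAt_snd (analyticAt_fst.fun_comp h4) h5
      have h6 : AnalyticAt ℝ (fun q : (ℝ × Θ × P) × (ℝ →ᵇ V) =>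
          superpose f b (orbitCurve (υ (q.1.1, q.1.2.2)) q.2 q.1.2.1 q.1.2.2)) ((w, ϑ, l), z) :=
        AnalyticAt.fun_comp (g := superpose f b) (f := fun q : (ℝ × Θ × P) × (ℝ →ᵇ V) =>
          orbitCurve (υ (q.1.1, q.1.2.2)) q.2 q.1.2.1 q.1.2.2)
          (hsup (w, l) ⟨hw, hl⟩ z hz.le ϑ).1 h2
      have h7 := ((tailOp V hA hM).analyticAt _).fun_comp h6
      rw [funext hG]
      exact h7.fun_neg)
    (by
      rintro ⟨w, ϑ, l⟩ ⟨hw, -, hl⟩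
      have h1 := (hsup (w, l) ⟨hw, hl⟩ 0 (by simpa using hε.le) ϑ).2
      have h2 : ‖superpose f b (orbitCurve (υ (w, l)) 0 ϑ l)‖ ≤ ε / 4 := by
        refine (BoundedContinuousFunction.norm_le (by positivity)).2 fun s => ?_
        rw [h1]
        exact h0 _ (hχ0 s) _ (hυ0 _ ⟨hw, hl⟩ s) _ l hl
      rw [hG, norm_neg]
      refine (norm_tailOp_apply_le hA hM _).trans ?_
      have h3 : (M : ℝ)⁻¹ ≤ 1 := inv_le_one_of_one_le₀ (by exact_mod_cast hM)
      calc _ ≤ 1 * (ε / 4) := by gcongr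
        _ = ε / 4 := one_mul _)
    (by
      rintro ⟨w, ϑ, l⟩ ⟨hw, -, hl⟩ z z' hz hz'
      have h1 := (hsup (w, l) ⟨hw, hl⟩ z hz ϑ).2
      have h1' := (hsup (w, l) ⟨hw, hl⟩ z' hz' ϑ).2
      have h2 : ‖superpose f b (orbitCurve (υ (w, l)) z' ϑ l) -
          superpose f b (orbitCurve (υ (w, l)) z ϑ l)‖ ≤ M / 2 * ‖z - z'‖ := by
        refine (BoundedContinuousFunction.norm_le (by positivity)).2 fun s => ?_
        rw [BoundedContinuousFunction.coe_sub, Pi.sub_apply, h1, h1', norm_sub_rev]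
        refine (hLip _ (hχ0 s) _ (hυ0 _ ⟨hw, hl⟩ s) _ _ ((z.norm_coe_le_norm s).trans hz)
          ((z'.norm_coe_le_norm s).trans hz') _ l hl).trans ?_
        gcongr
        exact (z - z').norm_coe_le_norm s
      have h3 : G ((w, ϑ, l), z) - G ((w, ϑ, l), z') = tailOp V hA hM
          (superpose f b (orbitCurve (υ (w, l)) z' ϑ l) -
            superpose f b (orbitCurve (υ (w, l)) z ϑ l)) := by
        rw [map_sub, hG, hG]
        abel
      rw [h3]
      refine (norm_tailOp_apply_le hA hM _).trans ?_
      calc _ ≤ (M : ℝ)⁻¹ * (M / 2 * ‖z - z'‖) := by gcongr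
        _ = 1 / 2 * ‖z - z'‖ := by field_simp)
  refine ⟨δ, hδa, fun w hw ϑ l hl => ?_⟩
  obtain ⟨h1, h2, h3⟩ := hδ (w, ϑ, l) ⟨hw, trivial, hl⟩
  refine ⟨h1, ⟨_, (hsup (w, l) ⟨hw, hl⟩ _ (by linarith) ϑ).2, h2.symm.trans (hG _)⟩, fun z g hz hg hzg => ?_⟩
  refine h3 z hz ?_
  have h4 : tailOp V hA hM (superpose f b (orbitCurve (υ (w, l)) z ϑ l)) = tailOp V hA hM g :=
    tailOp_congr hA hM fun s hs => by rw [(hsup (w, l) ⟨hw, hl⟩ z hz ϑ).2, hg s hs]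
  rw [hG]
  simp only [h4]
  exact hzg.symm

/-- With u = x υ and the unknown scaled by x^(κM), R acquires a factor x^(κM+κ): at z = 0 by the
order hypothesis, for differences by the Lipschitz bound M₀ |u|^κ. The quotient f has Lipschitz
constant M₀ υ^κ ≤ M / 2. Along orbits x^κ will be (A + r)⁻¹, so the scaling turns D = (A + r)^(-M) δ
into an equation for the bounded δ. -/
theorem exists_scaledField {R : ℝ × V × Θ × P → V} {κ M : ℕ} (hκ : 1 ≤ κ) (hM : 1 ≤ M) {M₀ Υ : ℝ}
    (hM₀ : 0 ≤ M₀) (hΥM : M₀ * Υ ^ κ ≤ M / 2) {Λ Λ₀ : Set P} (hΛ₀ : IsOpen Λ₀)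
    (hc : IsCompact (closure Λ)) (hcl : closure Λ ⊆ Λ₀) {D₀ Γ : Set Θ} (hD₀ : IsCompact D₀)
    (hΓ : ∀ ϑ, ∃ x ∈ D₀, ∃ v ∈ Γ, ϑ = x + v)
    (hR : ∀ ϑ, ∀ l ∈ Λ₀, AnalyticAt ℝ R (0, 0, ϑ, l))
    (hper : ∀ u z ϑ, ∀ l ∈ Λ₀, ∀ v ∈ Γ, R (u, z, ϑ + v, l) = R (u, z, ϑ, l))
    (hO : ∀ ϑ, ∀ l ∈ Λ₀, (fun u => R (u, 0, ϑ, l)) =O[𝓝 0] fun u : ℝ => u ^ (κ * M + κ))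
    (hLip : ∀ ϑ, ∀ l ∈ Λ₀, ∀ᶠ q : ℝ × V × V × Θ × P in 𝓝 (0, 0, 0, ϑ, l),
      ‖R (q.1, q.2.1, q.2.2.2) - R (q.1, q.2.2.1, q.2.2.2)‖ ≤
        M₀ * |q.1| ^ κ * ‖q.2.1 - q.2.2.1‖) :
    ∃ (f : ℝ × ℝ × V × Θ × P → V) (ε χ₀ : ℝ), 0 < ε ∧ 0 < χ₀ ∧
      (∀ x υ z ϑ, ∀ l ∈ Λ₀, ∀ v ∈ Γ, f (x, υ, z, ϑ + v, l) = f (x, υ, z, ϑ, l)) ∧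
      (∀ x ∈ Icc 0 χ₀, ∀ υ ∈ Icc 0 Υ, ∀ z, ‖z‖ ≤ ε → ∀ ϑ ∈ D₀, ∀ l ∈ closure Λ,
        AnalyticAt ℝ f (x, υ, z, ϑ, l)) ∧
      (∀ x ∈ Ioc 0 χ₀, ∀ υ ∈ Icc 0 Υ, ∀ ϑ, ∀ l ∈ Λ, ‖f (x, υ, 0, ϑ, l)‖ ≤ ε / 4) ∧
      (∀ x ∈ Ioc 0 χ₀, ∀ υ ∈ Icc 0 Υ, ∀ z z', ‖z‖ ≤ ε → ‖z'‖ ≤ ε → ∀ ϑ, ∀ l ∈ Λ,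
        ‖f (x, υ, z, ϑ, l) - f (x, υ, z', ϑ, l)‖ ≤ M / 2 * ‖z - z'‖) ∧
      ∀ x, x ≠ 0 → ∀ υ z ϑ l,
        x ^ (κ * M + κ) • f (x, υ, z, ϑ, l) = R (x * υ, x ^ (κ * M) • z, ϑ, l) := by
  have hN : κ * M ≠ 0 := (Nat.mul_pos hκ hM).ne'
  obtain ⟨Q, hQ⟩ : ∃ Q : ℝ × (ℝ × V × Θ × P) → V,
      ∀ q, Q q = R (q.1 * q.2.1, q.1 ^ (κ * M) • q.2.2.1, q.2.2.2) := ⟨_, fun q => rfl⟩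
  have hD : IsOpen {z : ℝ × V × Θ × P | z.2.2.2 ∈ Λ₀} := hΛ₀.preimage (by fun_prop)
  have hQa : ∀ z ∈ {z : ℝ × V × Θ × P | z.2.2.2 ∈ Λ₀}, AnalyticAt ℝ Q (0, z) := by
    rintro ⟨υ, z, ϑ, l⟩ hl
    rw [funext hQ]
    have h2 : AnalyticAt ℝ (fun q : ℝ × (ℝ × V × Θ × P) => q.2.1) (0, υ, z, ϑ, l) :=
      analyticAt_fst.fun_comp analyticAt_snd
    have h3 : AnalyticAt ℝ (fun q : ℝ × (ℝ × V × Θ × P) => q.2.2) (0, υ, z, ϑ, l) :=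
      analyticAt_snd.fun_comp analyticAt_snd
    refine AnalyticAt.fun_comp (g := R) (f := fun q : ℝ × (ℝ × V × Θ × P) =>
      (q.1 * q.2.1, q.1 ^ (κ * M) • q.2.2.1, q.2.2.2)) ?_ ?_
    · simpa [hN] using hR ϑ l hl
    · exact (analyticAt_fst.fun_mul h2).prod (((analyticAt_fst.fun_pow _).fun_smul
        (analyticAt_fst.fun_comp h3)).prod (analyticAt_snd.fun_comp h3))
  have hQL : ∀ (υ : ℝ) (z z' : V) (ϑ : Θ), ∀ l ∈ Λ₀,
      ∀ᶠ q : ℝ × (ℝ × V × V × Θ × P) in 𝓝 (0, (υ, z, z', ϑ, l)),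
        ‖Q (q.1, q.2.1, q.2.2.1, q.2.2.2.2) - Q (q.1, q.2.1, q.2.2.2.1, q.2.2.2.2)‖ ≤
          |q.1| ^ (κ * M + κ) * (M₀ * |q.2.1| ^ κ * ‖q.2.2.1 - q.2.2.2.1‖) := by
    intro υ z z' ϑ l hl
    have ht : Tendsto (fun q : ℝ × (ℝ × V × V × Θ × P) => (q.1 * q.2.1, q.1 ^ (κ * M) • q.2.2.1,
        q.1 ^ (κ * M) • q.2.2.2.1, q.2.2.2.2)) (𝓝 (0, (υ, z, z', ϑ, l))) (𝓝 (0, 0, 0, ϑ, l)) :=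
      Continuous.tendsto' (by fun_prop) _ _ (by simp [hN])
    filter_upwards [ht.eventually (hLip ϑ l hl)] with q hq
    rw [hQ, hQ]
    refine hq.trans (le_of_eq ?_)
    rw [← smul_sub, norm_smul, norm_pow, Real.norm_eq_abs, abs_mul]
    ring
  have hQO : ∀ z ∈ {z : ℝ × V × Θ × P | z.2.2.2 ∈ Λ₀},
      (fun u : ℝ => Q (u, z)) =O[𝓝[≠] 0] fun u => u ^ (κ * M + κ) := by
    rintro ⟨υ, z, ϑ, l⟩ hl
    refine IsBigO.mono ?_ (nhdsWithin_le_nhds (s := {0}ᶜ))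
    have h1 : (fun u : ℝ => Q (u, υ, z, ϑ, l) - Q (u, υ, 0, ϑ, l)) =O[𝓝 0]
        fun u => u ^ (κ * M + κ) := by
      have ht : Tendsto (fun u : ℝ => (u, (υ, z, (0 : V), ϑ, l))) (𝓝 0)
          (𝓝 (0, (υ, z, 0, ϑ, l))) := Continuous.tendsto' (by fun_prop) _ _ rfl
      refine IsBigO.of_bound (M₀ * |υ| ^ κ * ‖z - 0‖) ?_
      filter_upwards [ht.eventually (hQL υ z 0 ϑ l hl)] with u hu
      rw [norm_pow, Real.norm_eq_abs, mul_comm]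
      exact hu
    have h2 : (fun u : ℝ => Q (u, υ, 0, ϑ, l)) =O[𝓝 0] fun u => u ^ (κ * M + κ) := by
      have ht : Tendsto (fun u : ℝ => u * υ) (𝓝 0) (𝓝 0) :=
        Continuous.tendsto' (by fun_prop) _ _ (by simp)
      have h3 := (hO ϑ l hl).comp_tendsto ht
      simp only [hQ, smul_zero]
      refine h3.trans (IsBigO.of_bound (|υ| ^ (κ * M + κ)) (.of_forall fun u => ?_))
      simp only [Function.comp_apply]
      rw [mul_pow, norm_mul, norm_pow, norm_pow, Real.norm_eq_abs, Real.norm_eq_abs, mul_comm]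
    simpa using h1.add h2
  set f := divPow Q (κ * M + κ) with hf
  have hfa : ∀ z ∈ {z : ℝ × V × Θ × P | z.2.2.2 ∈ Λ₀}, AnalyticAt ℝ f (0, z) := fun z hz =>
    (analyticAt_divPow _ hD hQa hQO hz).1
  have hfper : ∀ x υ z ϑ, ∀ l ∈ Λ₀, ∀ v ∈ Γ, f (x, υ, z, ϑ + v, l) = f (x, υ, z, ϑ, l) := by
    intro x υ z ϑ l hl v hv
    have : ∀ u, Q (u, υ, z, ϑ + v, l) = Q (u, υ, z, ϑ, l) := fun u => by
      rw [hQ, hQ]; exact hper _ _ _ l hl v hv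
    simp only [hf, divPow, this]
  have hfQ : ∀ x, x ≠ 0 → ∀ υ z ϑ l, x ^ (κ * M + κ) • f (x, υ, z, ϑ, l) = Q (x, υ, z, ϑ, l) :=
    fun x hx υ z ϑ l => pow_smul_divPow Q _ (q := (x, υ, z, ϑ, l)) hx
  have hK₁ : IsCompact (Icc 0 Υ ×ˢ ({0} : Set V) ×ˢ D₀ ×ˢ closure Λ) :=
    isCompact_Icc.prod (isCompact_singleton.prod (hD₀.prod hc))
  obtain ⟨B, hB⟩ : ∃ B, ∀ z ∈ Icc 0 Υ ×ˢ ({0} : Set V) ×ˢ D₀ ×ˢ closure Λ, ‖f (0, z)‖ ≤ B :=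
    hK₁.exists_bound_of_continuousOn fun z hz =>
      ((hfa z (hcl hz.2.2.2)).continuousAt.comp
        (by fun_prop : Continuous fun z : ℝ × V × Θ × P => ((0 : ℝ), z)).continuousAt).continuousWithinAt
  have hB' := hK₁.eventually_forall_of_forall_eventually (x₀ := (0 : ℝ))
    (P := fun x z => ‖f (x, z)‖ ≤ B + 1) fun z hz => by
      have h1 : ‖f (0, z)‖ < B + 1 := (hB z hz).trans_lt (lt_add_one B)
      exact ((hfa z (hcl hz.2.2.2)).continuousAt.norm.eventually (gt_mem_nhds h1)).mono
        fun q hq => hq.le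
  -- The radius need not be small: z enters R only through x^(κM) z, so the estimates hold on any
  -- given ball once x is small. It can thus be fitted to the bound B for f at x = 0, z = 0.
  set ε : ℝ := max 1 (4 * (B + 1)) with hε
  have hε0 : 0 < ε := lt_of_lt_of_le one_pos (le_max_left _ _)
  have hεB : B + 1 ≤ ε / 4 := by
    have := le_max_right 1 (4 * (B + 1))
    rw [← hε] at this
    linarith
  have hA' := ((isCompact_Icc (a := (0 : ℝ)) (b := Υ)).prod
    ((isCompact_closedBall (0 : V) ε).prod (hD₀.prod hc))).eventually_forall_of_forall_eventually
    (x₀ := (0 : ℝ)) (P := fun x z => AnalyticAt ℝ f (x, z)) fun z hz =>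
      (hfa z (hcl hz.2.2.2)).eventually_analyticAt
  have hL' := ((isCompact_Icc (a := (0 : ℝ)) (b := Υ)).prod ((isCompact_closedBall (0 : V) ε).prod
    ((isCompact_closedBall (0 : V) ε).prod (hD₀.prod hc)))).eventually_forall_of_forall_eventually
    (x₀ := (0 : ℝ)) (P := fun x z =>
      ‖Q (x, z.1, z.2.1, z.2.2.2) - Q (x, z.1, z.2.2.1, z.2.2.2)‖ ≤
          |x| ^ (κ * M + κ) * (M₀ * |z.1| ^ κ * ‖z.2.1 - z.2.2.1‖)) fun z hz =>
      hQL _ _ _ _ _ (hcl hz.2.2.2.2)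
  obtain ⟨r, hr, hball⟩ := Metric.eventually_nhds_iff.1 (hB'.and (hA'.and hL'))
  have hmem : ∀ x ∈ Icc 0 (r / 2), dist x 0 < r := fun x hx => by
    rw [Real.dist_eq, sub_zero, abs_of_nonneg hx.1]
    linarith [hx.2]
  refine ⟨f, ε, r / 2, hε0, by positivity, hfper, ?_, ?_, ?_, fun x hx υ z ϑ l => ?_⟩
  · intro x hx υ hυ z hz ϑ hϑ l hl
    exact (hball (hmem x hx)).2.1 (υ, z, ϑ, l) ⟨hυ, by simpa using hz, hϑ, hl⟩
  · intro x hx υ hυ ϑ l hl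
    obtain ⟨ϑ', hϑ', v, hv, rfl⟩ := hΓ ϑ
    rw [hfper _ _ _ _ l (hcl (subset_closure hl)) v hv]
    exact ((hball (hmem x ⟨hx.1.le, hx.2⟩)).1 (υ, 0, ϑ', l)
      ⟨hυ, rfl, hϑ', subset_closure hl⟩).trans hεB
  · intro x hx υ hυ z z' hz hz' ϑ l hl
    obtain ⟨ϑ', hϑ', v, hv, rfl⟩ := hΓ ϑ
    rw [hfper _ _ _ _ l (hcl (subset_closure hl)) v hv,
      hfper _ _ _ _ l (hcl (subset_closure hl)) v hv]
    have h1 := (hball (hmem x ⟨hx.1.le, hx.2⟩)).2.2 (υ, z, z', ϑ', l)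
      ⟨hυ, by simpa using hz, by simpa using hz', hϑ', subset_closure hl⟩
    simp only at h1
    rw [← hfQ x hx.1.ne', ← hfQ x hx.1.ne', ← smul_sub, norm_smul, norm_pow, Real.norm_eq_abs] at h1
    have h2 := le_of_mul_le_mul_left h1 (pow_pos (abs_pos.2 hx.1.ne') _)
    refine h2.trans ?_
    gcongr
    refine le_trans ?_ hΥM
    rw [abs_of_nonneg hυ.1]
    gcongr
    exacts [hυ.1, hυ.2]
  · rw [hfQ x hx, hQ]

end OrbitFixedPoint

end

section

open scoped BoundedContinuousFunction NNReal ENNReal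

/-! ### Bounded solutions over the orbits of the slow variable -/

section OrbitSolution

set_option linter.unusedSectionVars false

variable {V Θ P : Type*} [NormedAddCommGroup V] [NormedSpace ℝ V] [ProperSpace V]
  [NormedAddCommGroup Θ] [NormedSpace ℝ Θ] [CompleteSpace Θ]
  [NormedAddCommGroup P] [NormedSpace ℝ P] [CompleteSpace P]

/-- The positive root `u` of `u ^ κ = w⁻¹`. -/
noncomputable def invRoot (κ : ℕ) (w : ℝ) : ℝ := (w⁻¹) ^ ((κ : ℝ)⁻¹)

theorem invRoot_pow {κ : ℕ} (hκ : 1 ≤ κ) {w : ℝ} (hw : 0 ≤ w) : invRoot κ w ^ κ = w⁻¹ :=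
  Real.rpow_inv_natCast_pow (inv_nonneg.2 hw) (by omega)

theorem invRoot_pos (κ : ℕ) {w : ℝ} (hw : 0 < w) : 0 < invRoot κ w :=
  Real.rpow_pos_of_pos (inv_pos.2 hw) _

theorem invRoot_mul (κ : ℕ) {v w : ℝ} (hv : 0 ≤ v) (hw : 0 ≤ w) :
    invRoot κ (v * w) = invRoot κ v * invRoot κ w := by
  rw [invRoot, mul_inv, Real.mul_rpow (inv_nonneg.2 hv) (inv_nonneg.2 hw)]
  rfl

theorem invRoot_le (κ : ℕ) {v w : ℝ} (hv : 0 < v) (hvw : v ≤ w) : invRoot κ w ≤ invRoot κ v :=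
  Real.rpow_le_rpow (inv_nonneg.2 (hv.le.trans hvw)) (inv_anti₀ hv hvw) (by positivity)

theorem invRoot_inv_pow {κ : ℕ} (hκ : 1 ≤ κ) {u : ℝ} (hu : 0 ≤ u) : invRoot κ ((u ^ κ)⁻¹) = u := by
  rw [invRoot, inv_inv, Real.pow_rpow_inv_natCast hu (by omega)]

theorem analyticAt_invRoot (κ : ℕ) {w : ℝ} (hw : 0 < w) : AnalyticAt ℝ (invRoot κ) w :=
  AnalyticAt.fun_comp (g := fun x : ℝ => x ^ ((κ : ℝ)⁻¹))
    (Real.contDiffAt_rpow_const_of_ne (inv_pos.2 hw).ne').analyticAt (analyticAt_inv hw.ne')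

/-- `δ` gives the bounded solutions of the remainder equation `Δ' = R(u, Δ, ϑ + r Ω, l)`,
`Δ = (A + r)⁻ᴹ δ`, along the orbits `w = (A + r) ψ` of the slow variable. -/
structure OrbitSolution (κ M : ℕ) (α β : P → ℝ) (Λ : Set P) (Γ : Set Θ) (Ω : Θ)
    (R : ℝ × V × Θ × P → V) (A c C ε B m : ℝ) (hA : 0 < A) (hM : 1 ≤ M)
    (ψ : ℝ × P → (ℝ →ᵇ ℝ)) (δ : ℝ × Θ × P → (ℝ →ᵇ V)) : Prop where
  c_pos : 0 < c
  C_pos : 0 < C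
  ε_pos : 0 < ε
  m_pos : 0 < m
  analytic_ψ : AnalyticOnNhd ℝ ψ (Ioi A ×ˢ Λ)
  le_ψ : ∀ w, A < w → ∀ l ∈ Λ, ∀ r, c ≤ ψ (w, l) r
  ψ_le : ∀ w, A < w → ∀ l ∈ Λ, ∀ r, ψ (w, l) r ≤ w / A + C
  ψ_zero : ∀ w, A < w → ∀ l ∈ Λ, A * ψ (w, l) 0 = w
  ψ_deriv : ∀ w, A < w → ∀ l ∈ Λ, ∀ r, 0 ≤ r →
    HasDerivWithinAt (fun r => (A + max r 0) * ψ (w, l) r)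
      (κ * (α l - β l / ((A + r) * ψ (w, l) r))) (Ici r) r
  le_deriv : ∀ w, A < w → ∀ l ∈ Λ, ∀ r, 0 ≤ r →
    m ≤ κ * (α l - β l / ((A + r) * ψ (w, l) r))
  analytic_δ : AnalyticOnNhd ℝ δ (Ioi A ×ˢ univ ×ˢ Λ)
  periodic_R : ∀ u z ϑ, ∀ l ∈ Λ, ∀ v ∈ Γ, R (u, z, ϑ + v, l) = R (u, z, ϑ, l)
  δ_le : ∀ w, A < w → ∀ ϑ, ∀ l ∈ Λ, ‖δ (w, ϑ, l)‖ ≤ ε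
  δ_eq : ∀ w, A < w → ∀ ϑ, ∀ l ∈ Λ, ∃ g : ℝ →ᵇ V, (∀ r, ‖g r‖ ≤ B) ∧
    (∀ r, 0 ≤ r → (A + r)⁻¹ ^ (M + 1) • g r = R (invRoot κ ((A + r) * ψ (w, l) r),
      (A + r)⁻¹ ^ M • δ (w, ϑ, l) r, ϑ + r • Ω, l)) ∧ δ (w, ϑ, l) = -tailOp V hA hM g
  δ_unique : ∀ w, A < w → ∀ ϑ, ∀ l ∈ Λ, ∀ z g : ℝ →ᵇ V, ‖z‖ ≤ ε →
    (∀ r, 0 ≤ r → (A + r)⁻¹ ^ (M + 1) • g r = R (invRoot κ ((A + r) * ψ (w, l) r),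
      (A + r)⁻¹ ^ M • z r, ϑ + r • Ω, l)) → z = -tailOp V hA hM g → z = δ (w, ϑ, l)

/-- The constant c, a lower bound for ψ, depends only on the slow equation and precedes M. Along
orbits u^κ = 1 / ((A + r) ψ) ≤ 1 / (c (A + r)), so Υ^κ = 1 / c and the contraction condition M₀ Υ^κ
≤ M / 2 reads 2 M₀ ≤ c M. -/
theorem exists_orbitSolution {Λ Λ₀ : Set P} (hΛ : IsOpen Λ) (hΛ₀ : IsOpen Λ₀)
    (hc : IsCompact (closure Λ)) (hcl : closure Λ ⊆ Λ₀) {α β : P → ℝ}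
    (hα : AnalyticOnNhd ℝ α Λ₀) (hβ : AnalyticOnNhd ℝ β Λ₀) (hα0 : ∀ l ∈ Λ₀, 0 < α l)
    {κ : ℕ} (hκ : 1 ≤ κ) {D₀ Γ : Set Θ} (hD₀ : IsCompact D₀)
    (hΓ : ∀ ϑ, ∃ x ∈ D₀, ∃ v ∈ Γ, ϑ = x + v) (Ω : Θ) :
    ∃ c : ℝ, 0 < c ∧ ∀ (M : ℕ) (hM : 1 ≤ M) (M₀ : ℝ), 0 ≤ M₀ → 2 * M₀ ≤ c * M →
      ∀ R : ℝ × V × Θ × P → V,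
      (∀ ϑ, ∀ l ∈ Λ₀, AnalyticAt ℝ R (0, 0, ϑ, l)) →
      (∀ u z ϑ, ∀ l ∈ Λ₀, ∀ v ∈ Γ, R (u, z, ϑ + v, l) = R (u, z, ϑ, l)) →
      (∀ ϑ, ∀ l ∈ Λ₀, (fun u => R (u, 0, ϑ, l)) =O[𝓝 0] fun u : ℝ => u ^ (κ * M + κ)) →
      (∀ ϑ, ∀ l ∈ Λ₀, ∀ᶠ q : ℝ × V × V × Θ × P in 𝓝 (0, 0, 0, ϑ, l),
        ‖R (q.1, q.2.1, q.2.2.2) - R (q.1, q.2.2.1, q.2.2.2)‖ ≤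
          M₀ * |q.1| ^ κ * ‖q.2.1 - q.2.2.1‖) →
      ∃ (A C ε B m : ℝ) (hA : 0 < A) (ψ : ℝ × P → (ℝ →ᵇ ℝ)) (δ : ℝ × Θ × P → (ℝ →ᵇ V)),
        OrbitSolution κ M α β Λ Γ Ω R A c C ε B m hA hM ψ δ := by
  rcases Λ.eq_empty_or_nonempty with rfl | hne
  · refine ⟨1, one_pos, fun M hM M₀ _ _ R _ _ _ _ => ⟨1, 1, 1, 1, 1, one_pos, 0, 0, ?_⟩⟩
    constructor <;> simp [AnalyticOnNhd]
  have hne' : (closure Λ).Nonempty := hne.closure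
  obtain ⟨l₁, hl₁, hmin⟩ := hc.exists_isMinOn hne' (hα.continuousOn.mono hcl)
  obtain ⟨l₂, hl₂, hmax⟩ := hc.exists_isMaxOn hne' (hα.continuousOn.mono hcl)
  obtain ⟨βM, hβM⟩ := hc.exists_bound_of_continuousOn (hβ.continuousOn.mono hcl)
  have hαm : 0 < α l₁ := hα0 _ (hcl hl₁)
  have hκ0 : (0 : ℝ) < κ := by exact_mod_cast hκ
  have hsub : Λ ⊆ Λ₀ := subset_closure.trans hcl
  obtain ⟨c, C, A₀, hc0, hC0, hA₀, hψ⟩ := exists_slowVariable hΛ (hα.mono hsub) (hβ.mono hsub)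
    hκ0 hαm (fun l hl => hmin (subset_closure hl)) (fun l hl => hmax (subset_closure hl))
    (fun l hl => hβM l (subset_closure hl))
  refine ⟨c, hc0, fun M hM M₀ hM₀ hMc R hR hper hO hLip => ?_⟩
  obtain ⟨f, ε, χ₀, hε, hχ₀, hfper, hfa, hf0, hfL, hfR⟩ :=
    exists_scaledField (Υ := invRoot κ c) hκ hM hM₀ (by
      rw [invRoot_pow hκ hc0.le, ← div_eq_mul_inv, div_le_iff₀ hc0]
      linarith) hΛ₀ hc hcl hD₀ hΓ hR hper hO hLip
  -- The second entry gives χ = (A + s)^(-1/κ) ≤ χ₀, the range in which the scaled field is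
  -- controlled.
  set A : ℝ := max A₀ ((χ₀ ^ κ)⁻¹) with hAdef
  have hA : 0 < A := hA₀.trans_le (le_max_left _ _)
  obtain ⟨ψ, hψa, hψ⟩ := hψ A (le_max_left _ _)
  have hAχ : invRoot κ A ≤ χ₀ := by
    have h1 := invRoot_le κ (by positivity) (le_max_right A₀ ((χ₀ ^ κ)⁻¹))
    rwa [invRoot_inv_pow hκ hχ₀.le] at h1
  let χ : ℝ → ℝ := fun s => invRoot κ (A + max s 0)
  have hApos : ∀ s : ℝ, A ≤ A + max s 0 := fun s => by linarith [le_max_right s 0]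
  have hχc : Continuous χ := continuous_iff_continuousAt.2 fun s =>
    ContinuousAt.comp (f := fun s : ℝ => A + max s 0)
      (analyticAt_invRoot κ (hA.trans_le (hApos s))).continuousAt (by fun_prop)
  have hχ : ∀ s, 0 < χ s ∧ χ s ≤ χ₀ := fun s =>
    ⟨invRoot_pos κ (hA.trans_le (hApos s)), (invRoot_le κ hA (hApos s)).trans hAχ⟩
  let b : ℝ → ℝ := fun _ => 0
  have hsup : ∀ p ∈ Ioi A ×ˢ Λ, AnalyticAt ℝ (superpose (invRoot κ) b) (ψ p) ∧
      ∀ r, superpose (invRoot κ) b (ψ p) r = invRoot κ (ψ p r) := by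
    intro p hp
    have := analyticAt_superpose_of_isCompact (f := invRoot κ) (b := b) (ζ₀ := ψ p)
      (K := Icc c ‖ψ p‖) (D := Ioi 0) (Γ := ∅) continuous_const isCompact_Icc isOpen_Ioi
      (fun x hx => hc0.trans_le hx.1) (fun x hx => analyticAt_invRoot κ hx) (by simp)
      (fun s => ⟨ψ p s, ⟨((hψ p hp).1 s).1, (le_abs_self _).trans ((ψ p).norm_coe_le_norm s)⟩, 0,
        by simp, by simp [b]⟩)
    refine ⟨this.1, fun r => ?_⟩
    simpa [b] using this.2.self_of_nhds r
  obtain ⟨δ, hδa, hδ⟩ := exists_orbitFixedPoint (Υ := invRoot κ c) hA hε hM hχc hχ hΛ hΛ₀ hc hcl hD₀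
    hΓ Ω hfper hfa hf0 hfL isOpen_Ioi (υ := fun p => superpose (invRoot κ) b (ψ p))
    (fun p hp => (hsup p hp).1.fun_comp (hψa p hp))
    (fun p hp s => by
      rw [(hsup p hp).2]
      have h1 := ((hψ p hp).1 s).1
      exact ⟨(invRoot_pos κ (hc0.trans_le h1)).le, invRoot_le κ hc0 h1⟩)
  have hscale : ∀ w, A < w → ∀ ϑ, ∀ l ∈ Λ, ∀ (z : V) (r : ℝ), 0 ≤ r →
      (A + r)⁻¹ ^ (M + 1) • f (χ r, superpose (invRoot κ) b (ψ (w, l)) r, z,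
        ϑ + max r 0 • Ω, l) = R (invRoot κ ((A + r) * ψ (w, l) r), (A + r)⁻¹ ^ M • z,
          ϑ + r • Ω, l) := by
    intro w hw ϑ l hl z r hr
    have h1 := hfR (χ r) (hχ r).1.ne' (superpose (invRoot κ) b (ψ (w, l)) r) z (ϑ + r • Ω) l
    have h2 : χ r ^ κ = (A + r)⁻¹ := by
      simp only [χ, max_eq_left hr]
      exact invRoot_pow hκ (by positivity)
    rw [show κ * M + κ = κ * (M + 1) by ring, pow_mul, pow_mul, h2,
      (hsup (w, l) ⟨hw, hl⟩).2] at h1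
    rw [max_eq_left hr, (hsup (w, l) ⟨hw, hl⟩).2, h1,
      invRoot_mul κ (by positivity) (hc0.le.trans ((hψ (w, l) ⟨hw, hl⟩).1 r).1)]
    simp only [χ, max_eq_left hr]
  refine ⟨A, C, ε, ε / 4 + M / 2 * ε, κ * α l₁ / 2, hA, ψ, δ, hc0, hC0, hε, by positivity, hψa,
    fun w hw l hl r => ((hψ (w, l) ⟨hw, hl⟩).1 r).1, fun w hw l hl r => ((hψ (w, l) ⟨hw, hl⟩).1 r).2,
    fun w hw l hl => (hψ (w, l) ⟨hw, hl⟩).2.1, fun w hw l hl r hr => ((hψ (w, l) ⟨hw, hl⟩).2.2 r hr).1,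
    fun w hw l hl r hr => ((hψ (w, l) ⟨hw, hl⟩).2.2 r hr).2, hδa,
    fun u z ϑ l hl v hv => hper u z ϑ l (hsub hl) v hv,
    fun w hw ϑ l hl => (hδ w hw ϑ l hl).1.trans (by linarith), ?_, ?_⟩
  · intro w hw ϑ l hl
    obtain ⟨h1, ⟨g, hg, hδg⟩, -⟩ := hδ w hw ϑ l hl
    have hυ : ∀ r, superpose (invRoot κ) b (ψ (w, l)) r ∈ Icc 0 (invRoot κ c) := fun r => by
      rw [(hsup (w, l) ⟨hw, hl⟩).2]
      have h1 := ((hψ (w, l) ⟨hw, hl⟩).1 r).1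
      exact ⟨(invRoot_pos κ (hc0.trans_le h1)).le, invRoot_le κ hc0 h1⟩
    refine ⟨g, fun r => ?_, fun r hr => ?_, hδg⟩
    · have h2 := hf0 (χ r) (hχ r) _ (hυ r) (ϑ + max r 0 • Ω) l hl
      have h3 : ‖δ (w, ϑ, l) r‖ ≤ ε := ((δ (w, ϑ, l)).norm_coe_le_norm r).trans (by linarith)
      have h4 := hfL (χ r) (hχ r) _ (hυ r) (δ (w, ϑ, l) r) 0 h3 (by simpa using hε.le)
        (ϑ + max r 0 • Ω) l hl
      rw [sub_zero] at h4
      rw [hg]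
      have h5 := norm_le_norm_add_norm_sub' (f (χ r, superpose (invRoot κ) b (ψ (w, l)) r,
        δ (w, ϑ, l) r, ϑ + max r 0 • Ω, l)) (f (χ r, superpose (invRoot κ) b (ψ (w, l)) r,
        0, ϑ + max r 0 • Ω, l))
      have h6 : (M : ℝ) / 2 * ‖δ (w, ϑ, l) r‖ ≤ M / 2 * ε := by gcongr
      linarith
    · rw [hg, hscale w hw ϑ l hl _ r hr]
  · intro w hw ϑ l hl z g hz hg hzg
    refine (hδ w hw ϑ l hl).2.2 z g hz (fun r hr => ?_) hzg
    have h1 := hg r hr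
    rw [← hscale w hw ϑ l hl _ r hr] at h1
    have h2 : (A + r)⁻¹ ^ (M + 1) ≠ 0 := by positivity
    exact smul_right_injective V h2 h1

end OrbitSolution

end

section

open scoped BoundedContinuousFunction NNReal ENNReal

/-! ### Restriction of solutions along orbits -/

section ShiftProperty

set_option linter.unusedSectionVars false

variable {V Θ P : Type*} [NormedAddCommGroup V] [NormedSpace ℝ V] [ProperSpace V]
  [NormedAddCommGroup Θ] [NormedSpace ℝ Θ] [CompleteSpace Θ]
  [NormedAddCommGroup P] [NormedSpace ℝ P] [CompleteSpace P]

/-- Two solutions of `w' = κ (a - b / w)` that stay above a positive level agree if they have the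
same initial value. -/
theorem slowVariable_unique {κ a b A T : ℝ} (hA : 0 < A) {w w' : ℝ → ℝ}
    (hw : ContinuousOn w (Icc 0 T)) (hw' : ContinuousOn w' (Icc 0 T))
    (hd : ∀ r ∈ Ico 0 T, HasDerivWithinAt w (κ * (a - b / w r)) (Ici r) r)
    (hd' : ∀ r ∈ Ico 0 T, HasDerivWithinAt w' (κ * (a - b / w' r)) (Ici r) r)
    (hge : ∀ r ∈ Ico 0 T, A ≤ w r) (hge' : ∀ r ∈ Ico 0 T, A ≤ w' r) (h0 : w 0 = w' 0) :
    EqOn w w' (Icc 0 T) := by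
  have hL : LipschitzOnWith (Real.toNNReal (|κ * b| * (A ^ 2)⁻¹)) (fun y => κ * (a - b / y))
      (Ici A) := by
    refine LipschitzOnWith.of_dist_le_mul fun x hx y hy => ?_
    have hx0 : 0 < x := hA.trans_le hx
    have hy0 : 0 < y := hA.trans_le hy
    rw [Real.coe_toNNReal _ (by positivity), Real.dist_eq, Real.dist_eq]
    have h1 : κ * (a - b / x) - κ * (a - b / y) = κ * b * ((x * y)⁻¹ * (x - y)) := by
      field_simp
      ring
    rw [h1, abs_mul (κ * b), abs_mul (x * y)⁻¹, abs_of_pos (by positivity : 0 < (x * y)⁻¹), ← mul_assoc]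
    gcongr
    rw [sq]
    exact mul_le_mul hx hy hA.le hx0.le
  exact ODE_solution_unique_of_mem_Icc_right (v := fun _ y => κ * (a - b / y)) (s := fun _ => Ici A)
    (fun _ _ => hL) hw hd hge hw' hd' hge' h0

variable {κ M : ℕ} {α β : P → ℝ} {Λ : Set P} {Γ : Set Θ} {Ω : Θ} {R : ℝ × V × Θ × P → V}
  {A c C ε B m : ℝ} {hA : 0 < A} {hM : 1 ≤ M} {ψ : ℝ × P → (ℝ →ᵇ ℝ)} {δ : ℝ × Θ × P → (ℝ →ᵇ V)}

namespace OrbitSolution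

variable (h : OrbitSolution κ M α β Λ Γ Ω R A c C ε B m hA hM ψ δ) {w : ℝ} (hw : A < w) {l : P}
  (hl : l ∈ Λ)
include h hw hl

theorem continuous_slow : Continuous fun r => (A + max r 0) * ψ (w, l) r :=
  (by fun_prop : Continuous fun r : ℝ => A + max r 0).mul (ψ (w, l)).continuous

theorem le_slow {r : ℝ} (hr : 0 ≤ r) : w + m * r ≤ (A + r) * ψ (w, l) r := by
  have h1 := image_le_of_deriv_right_le_deriv_boundary (a := 0) (b := r) (f := fun r => w + m * r)
    (f' := fun _ => m) (B := fun r => (A + max r 0) * ψ (w, l) r)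
    (B' := fun r => κ * (α l - β l / ((A + r) * ψ (w, l) r))) (by fun_prop)
    (fun x _ => by
      simpa using (((hasDerivAt_id x).const_mul m).const_add w).hasDerivWithinAt)
    (by simpa using (h.ψ_zero w hw l hl).ge) (h.continuous_slow hw hl).continuousOn
    (fun x hx => h.ψ_deriv w hw l hl x hx.1) (fun x hx => h.le_deriv w hw l hl x hx.1)
    (right_mem_Icc.2 hr)
  simpa [max_eq_left hr] using h1

theorem lt_slow {r : ℝ} (hr : 0 ≤ r) : A < (A + r) * ψ (w, l) r := by
  have h1 := h.le_slow hw hl hr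
  have h2 := mul_nonneg h.m_pos.le hr
  linarith

/-- The semigroup property of an autonomous flow: both sides solve the slow equation in r and agree
at r = 0. -/
theorem slow_shift {s r : ℝ} (hs : 0 ≤ s) (hr : 0 ≤ r) :
    (A + r) * ψ ((A + s) * ψ (w, l) s, l) r = (A + (r + s)) * ψ (w, l) (r + s) := by
  have hw' := h.lt_slow hw hl hs
  have h1 := slowVariable_unique (κ := κ) (a := α l) (b := β l) (A := A) (T := r) hA
    (w := fun r => (A + max r 0) * ψ ((A + s) * ψ (w, l) s, l) r)
    (w' := fun r => (A + max (r + s) 0) * ψ (w, l) (r + s))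
    (h.continuous_slow hw' hl).continuousOn
    ((h.continuous_slow hw hl).comp (by fun_prop : Continuous fun r : ℝ => r + s)).continuousOn
    (fun x hx => by
      rw [max_eq_left hx.1]
      exact h.ψ_deriv _ hw' l hl x hx.1)
    (fun x hx => by
      have hx0 : 0 ≤ x + s := add_nonneg hx.1 hs
      have h2 := h.ψ_deriv w hw l hl (x + s) hx0
      have h3 : HasDerivWithinAt (fun r : ℝ => r + s) 1 (Ici x) x :=
        ((hasDerivAt_id x).add_const s).hasDerivWithinAt
      have h4 := HasDerivWithinAt.scomp x h2 h3 (t' := Ici (x + s)) (fun y hy => by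
        simpa using hy)
      simp only [max_eq_left hx0]
      simpa [Function.comp_def] using h4)
    (fun x hx => by rw [max_eq_left hx.1]; exact (h.lt_slow hw' hl hx.1).le)
    (fun x hx => by
      have hx0 : 0 ≤ x + s := add_nonneg hx.1 hs
      rw [max_eq_left hx0]; exact (h.lt_slow hw hl hx0).le)
    (by simpa [max_eq_left hs] using h.ψ_zero _ hw' l hl) (right_mem_Icc.2 hr)
  simpa [max_eq_left hr, max_eq_left (add_nonneg hr hs)] using h1

/-- The solution at a later point of the orbit is the restriction of the solution. -/
theorem δ_shift (ϑ : Θ) {s r : ℝ} (hs : 0 ≤ s) (hr : 0 ≤ r) :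
    (A + r)⁻¹ ^ M • δ ((A + s) * ψ (w, l) s, ϑ + s • Ω, l) r =
      (A + (r + s))⁻¹ ^ M • δ (w, ϑ, l) (r + s) := by
  have hw' := h.lt_slow hw hl hs
  obtain ⟨g, hgB, hg, hδ⟩ := h.δ_eq w hw ϑ l hl
  have hpos : ∀ r : ℝ, 0 < A + max r 0 := fun r => by
    have := le_max_right r 0
    linarith
  have hpos' : ∀ r : ℝ, 0 < A + (max r 0 + s) := fun r => by
    have := hpos r
    linarith
  -- The factor q^j converts between the weights: (A + r)^(-j) q^j = (A + r + s)^(-j). Since q ≤ 1,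
  -- the shifted function stays in the ball where solutions are unique.
  let q : ℝ → ℝ := fun r => (A + (max r 0 + s))⁻¹ * (A + max r 0)
  have hq0 : ∀ r, 0 ≤ q r := fun r => (mul_pos (inv_pos.2 (hpos' r)) (hpos r)).le
  have hq1 : ∀ r, q r ≤ 1 := fun r => by
    rw [inv_mul_le_iff₀ (hpos' r)]
    linarith
  have hqc : Continuous q := (Continuous.inv₀ (by fun_prop) fun r => (hpos' r).ne').mul (by fun_prop)
  have hsc : Continuous fun r : ℝ => max r 0 + s := by fun_prop
  let sh : ℕ → (ℝ →ᵇ V) → (ℝ →ᵇ V) := fun j z => .ofNormedAddCommGroup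
    (fun r => q r ^ j • z (max r 0 + s)) ((hqc.pow j).smul (z.continuous.comp hsc)) ‖z‖ fun r => by
      rw [norm_smul, norm_pow, Real.norm_of_nonneg (hq0 r)]
      calc _ ≤ 1 * ‖z‖ := mul_le_mul (pow_le_one₀ (hq0 r) (hq1 r)) (z.norm_coe_le_norm _)
            (norm_nonneg _) zero_le_one
        _ = ‖z‖ := one_mul _
  have hsh : ∀ j z r, sh j z r = q r ^ j • z (max r 0 + s) := fun j z r => rfl
  have hsh' : ∀ j z r, 0 ≤ r → (A + r)⁻¹ ^ j • sh j z r = (A + (r + s))⁻¹ ^ j • z (r + s) := by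
    intro j z r hr
    have h1 := hpos r
    rw [hsh, smul_smul, ← mul_pow]
    simp only [q]
    rw [max_eq_left hr] at h1 ⊢
    congr 2
    field_simp
  have huniq := h.δ_unique _ hw' (ϑ + s • Ω) l hl (sh M (δ (w, ϑ, l))) (sh (M + 1) g)
    ((BoundedContinuousFunction.norm_ofNormedAddCommGroup_le _ (norm_nonneg _) _).trans
      (h.δ_le w hw ϑ l hl))
    (fun r hr => by
      rw [hsh' _ _ r hr, hsh' _ _ r hr, h.slow_shift hw hl hs hr, hg _ (add_nonneg hr hs), add_smul,
        add_comm (r • Ω), add_assoc])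
    (by
      ext1 r
      rw [BoundedContinuousFunction.coe_neg, Pi.neg_apply, tailOp_apply, hsh, hδ,
        BoundedContinuousFunction.coe_neg, Pi.neg_apply, tailOp_apply, smul_neg, smul_smul]
      have h0 : 0 ≤ max r 0 := le_max_right _ _
      have h1 : max (max r 0 + s) 0 = max r 0 + s := max_eq_left (add_nonneg h0 hs)
      have h2 : q r ^ M * (A + max (max r 0 + s) 0) ^ M = (A + max r 0) ^ M := by
        have h3 := hpos' r
        rw [h1, ← mul_pow]
        congr 1
        simp only [q]
        field_simp
      rw [h2]
      congr 2
      -- The tail beyond r + s is the tail beyond r after a translation by s, so the shifted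
      -- function solves the fixed-point equation of the later point.
      rw [h1, ← (measurePreserving_add_right volume s).setIntegral_preimage_emb
        (measurableEmbedding_addRight s), preimage_add_const_Ioi, add_sub_cancel_right]
      refine setIntegral_congr_fun measurableSet_Ioi fun σ hσ => ?_
      have hσ0 : 0 ≤ σ := h0.trans (le_of_lt hσ)
      rw [invWeight_of_nonneg hσ0, invWeight_of_nonneg (add_nonneg hσ0 hs), hsh' _ _ σ hσ0])
  rw [← huniq, hsh' M _ r hr]

/-- Periodicity of R makes the solution at ϑ + v a solution at ϑ, and uniqueness in the ball
concludes. -/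
theorem periodic_δ (ϑ : Θ) {v : Θ} (hv : v ∈ Γ) : δ (w, ϑ + v, l) = δ (w, ϑ, l) := by
  obtain ⟨g, -, hg, hδ⟩ := h.δ_eq w hw (ϑ + v) l hl
  refine h.δ_unique w hw ϑ l hl _ g (h.δ_le w hw _ l hl) (fun r hr => ?_) hδ
  rw [hg r hr, add_right_comm, h.periodic_R _ _ _ l hl v hv]

end OrbitSolution

end ShiftProperty

end

section

open scoped BoundedContinuousFunction NNReal ENNReal

/-! ### The invariant graph of initial values and its decay -/

section Remainder

set_option linter.unusedSectionVars false

variable {V Θ P : Type*} [NormedAddCommGroup V] [NormedSpace ℝ V] [ProperSpace V]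
  [NormedAddCommGroup Θ] [NormedSpace ℝ Θ] [CompleteSpace Θ]
  [NormedAddCommGroup P] [NormedSpace ℝ P] [CompleteSpace P]

variable {κ M : ℕ} {α β : P → ℝ} {Λ : Set P} {Γ : Set Θ} {Ω : Θ} {R : ℝ × V × Θ × P → V}
  {A c C ε B m : ℝ} {hA : 0 < A} {hM : 1 ≤ M} {ψ : ℝ × P → (ℝ →ᵇ ℝ)} {δ : ℝ × Θ × P → (ℝ →ᵇ V)}

/-- The value of the solution `(A + r)⁻ᴹ δ` at `r = 0`. -/
noncomputable def initialValue (A : ℝ) (M : ℕ) (δ : ℝ × Θ × P → (ℝ →ᵇ V)) (q : ℝ × Θ × P) : V :=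
  A⁻¹ ^ M • δ q 0

namespace OrbitSolution

theorem analyticOnNhd_initialValue (h : OrbitSolution κ M α β Λ Γ Ω R A c C ε B m hA hM ψ δ) :
    AnalyticOnNhd ℝ (initialValue A M δ) (Ioi A ×ˢ univ ×ˢ Λ) := fun q hq =>
  ((A⁻¹ ^ M • BoundedContinuousFunction.evalCLM ℝ (0 : ℝ) : (ℝ →ᵇ V) →L[ℝ] V).analyticAt _).fun_comp
    (h.analytic_δ q hq)

/-- This is `δ_shift` read at r = 0: over each orbit the graph of initial values contains the entire
solution. -/
theorem initialValue_orbit (h : OrbitSolution κ M α β Λ Γ Ω R A c C ε B m hA hM ψ δ) {w : ℝ}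
    (hw : A < w) (ϑ : Θ) {l : P} (hl : l ∈ Λ) {r : ℝ} (hr : 0 ≤ r) :
    initialValue A M δ ((A + r) * ψ (w, l) r, ϑ + r • Ω, l) = (A + r)⁻¹ ^ M • δ (w, ϑ, l) r := by
  have h1 := h.δ_shift hw hl ϑ hr le_rfl
  rw [add_zero, zero_add] at h1
  exact h1

theorem hasDerivWithinAt_orbit (h : OrbitSolution κ M α β Λ Γ Ω R A c C ε B m hA hM ψ δ) {w : ℝ}
    (hw : A < w) (ϑ : Θ) {l : P} (hl : l ∈ Λ) :
    HasDerivWithinAt (fun r => (A + r)⁻¹ ^ M • δ (w, ϑ, l) r)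
      (R (invRoot κ w, initialValue A M δ (w, ϑ, l), ϑ, l)) (Ici 0) 0 := by
  obtain ⟨g, -, hg, hδ⟩ := h.δ_eq w hw ϑ l hl
  have hcont : Continuous fun s => invWeight A s ^ (M + 1) • g s :=
    ((continuous_invWeight hA).pow _).smul g.continuous
  have h1 : ∀ r, 0 ≤ r → (A + r)⁻¹ ^ M • δ (w, ϑ, l) r =
      (∫ s in (0 : ℝ)..r, invWeight A s ^ (M + 1) • g s) -
        ∫ s in Ioi (0 : ℝ), invWeight A s ^ (M + 1) • g s := by
    intro r hr
    have h2 : A + r ≠ 0 := by positivity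
    rw [hδ, BoundedContinuousFunction.coe_neg, Pi.neg_apply, tailOp_apply, max_eq_left hr, smul_neg,
      smul_smul, ← mul_pow, inv_mul_cancel₀ h2, one_pow, one_smul,
      ← intervalIntegral.integral_Ioi_sub_Ioi (integrableOn_invWeight_smul hA hM g le_rfl) hr]
    abel
  have h2 := (intervalIntegral.integral_hasDerivAt_right (hcont.intervalIntegrable 0 0)
    (hcont.stronglyMeasurableAtFilter _ _) hcont.continuousAt).sub_const
    (∫ s in Ioi (0 : ℝ), invWeight A s ^ (M + 1) • g s)
  have h3 := hg 0 le_rfl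
  rw [add_zero, h.ψ_zero w hw l hl, zero_smul, add_zero] at h3
  rw [invWeight_of_nonneg le_rfl, add_zero, h3] at h2
  exact h2.hasDerivWithinAt.congr (fun s hs => h1 s hs) (h1 0 le_rfl)

/-- The right derivative at r = 0 of the solution is computed twice: by the chain rule along the
graph, and from the integral equation. -/
theorem fderiv_initialValue (h : OrbitSolution κ M α β Λ Γ Ω R A c C ε B m hA hM ψ δ) {w : ℝ}
    (hw : A < w) (ϑ : Θ) {l : P} (hl : l ∈ Λ) :
    fderiv ℝ (initialValue A M δ) (w, ϑ, l) (κ * (α l - β l / w), Ω, 0) =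
      R (invRoot κ w, initialValue A M δ (w, ϑ, l), ϑ, l) := by
  have h1 := h.ψ_deriv w hw l hl 0 le_rfl
  rw [add_zero, h.ψ_zero w hw l hl] at h1
  have h2 : HasDerivWithinAt (fun r : ℝ => ϑ + r • Ω) Ω (Ici 0) 0 := by
    simpa using (((hasDerivAt_id (0 : ℝ)).smul_const Ω).const_add ϑ).hasDerivWithinAt (s := Ici 0)
  have h3 := h1.prodMk (h2.prodMk (hasDerivWithinAt_const (0 : ℝ) (Ici 0) l))
  have h4 := (h.analyticOnNhd_initialValue (w, ϑ, l) ⟨hw, trivial, hl⟩).differentiableAt.hasFDerivAt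
  have h5 := HasFDerivAt.comp_hasDerivWithinAt_of_eq (0 : ℝ) h4 h3
    (by simp [h.ψ_zero w hw l hl])
  have h6 : HasDerivWithinAt (fun r => (A + r)⁻¹ ^ M • δ (w, ϑ, l) r)
      (fderiv ℝ (initialValue A M δ) (w, ϑ, l) (κ * (α l - β l / w), Ω, 0)) (Ici 0) 0 := by
    refine h5.congr (fun r hr => ?_) ?_
    · simp only [Function.comp_apply, max_eq_left (mem_Ici.1 hr)]
      exact (h.initialValue_orbit hw ϑ hl hr).symm
    · simp only [Function.comp_apply, max_eq_left le_rfl]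
      exact (h.initialValue_orbit hw ϑ hl le_rfl).symm
  exact (uniqueDiffWithinAt_Ici 0).eq_deriv _ h6 (h.hasDerivWithinAt_orbit hw ϑ hl)

theorem exists_slow_eq (h : OrbitSolution κ M α β Λ Γ Ω R A c C ε B m hA hM ψ δ) {w w' : ℝ}
    (hw : A < w) {l : P} (hl : l ∈ Λ) (hw' : w ≤ w') :
    ∃ r, 0 ≤ r ∧ (A + r) * ψ (w, l) r = w' := by
  have hT : 0 ≤ (w' - w) / m := div_nonneg (sub_nonneg.2 hw') h.m_pos.le
  have h1 := h.le_slow hw hl hT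
  rw [mul_div_cancel₀ _ h.m_pos.ne', add_sub_cancel] at h1
  obtain ⟨r, hr, hr'⟩ := intermediate_value_Icc hT (h.continuous_slow hw hl).continuousOn
    (show w' ∈ Icc _ _ from ⟨by simpa [h.ψ_zero w hw l hl] using hw', by
      simpa only [max_eq_left hT] using h1⟩)
  exact ⟨r, hr.1, by simpa only [max_eq_left hr.1] using hr'⟩

/-- The derivative of the solution along the orbit in the parameters. -/
theorem fderiv_orbit (h : OrbitSolution κ M α β Λ Γ Ω R A c C ε B m hA hM ψ δ) (hΛ : IsOpen Λ)
    {w : ℝ} (hw : A < w) (ϑ : Θ) {l : P} (hl : l ∈ Λ) {r : ℝ} (hr : 0 ≤ r) (vϑ : Θ) (vl : P) :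
    fderiv ℝ (initialValue A M δ) ((A + r) * ψ (w, l) r, ϑ + r • Ω, l)
      ((A + r) * (fderiv ℝ ψ (w, l) (0, vl)) r, vϑ, vl) =
    (A + r)⁻¹ ^ M • (fderiv ℝ δ (w, ϑ, l) (0, vϑ, vl)) r := by
  have hq : (w, ϑ, l) ∈ Ioi A ×ˢ (univ : Set Θ) ×ˢ Λ := ⟨hw, trivial, hl⟩
  have hψ := (h.analytic_ψ (w, l) ⟨hw, hl⟩).differentiableAt.hasFDerivAt
  have h1 : HasFDerivAt (fun q : ℝ × Θ × P => (A + r)⁻¹ ^ M • δ q r)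
      (((A + r)⁻¹ ^ M • BoundedContinuousFunction.evalCLM ℝ r : (ℝ →ᵇ V) →L[ℝ] V) ∘L
        fderiv ℝ δ (w, ϑ, l)) (w, ϑ, l) :=
    ((ContinuousLinearMap.hasFDerivAt
      ((A + r)⁻¹ ^ M • BoundedContinuousFunction.evalCLM ℝ r : (ℝ →ᵇ V) →L[ℝ] V)).comp _
      (h.analytic_δ _ hq).differentiableAt.hasFDerivAt).congr_of_eventuallyEq
      (.of_forall fun q => by simp)
  have h2 : HasFDerivAt (fun q : ℝ × Θ × P => (A + r) * ψ (q.1, q.2.2) r)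
      (((A + r) • BoundedContinuousFunction.evalCLM ℝ r : (ℝ →ᵇ ℝ) →L[ℝ] ℝ) ∘L
        fderiv ℝ ψ (w, l) ∘L (ContinuousLinearMap.fst ℝ ℝ (Θ × P)).prod
          (ContinuousLinearMap.snd ℝ Θ P ∘L ContinuousLinearMap.snd ℝ ℝ (Θ × P))) (w, ϑ, l) :=
    ((ContinuousLinearMap.hasFDerivAt
      ((A + r) • BoundedContinuousFunction.evalCLM ℝ r : (ℝ →ᵇ ℝ) →L[ℝ] ℝ)).comp (w, ϑ, l)
      (HasFDerivAt.comp (g := ψ) (w, ϑ, l) hψ (ContinuousLinearMap.hasFDerivAt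
      ((ContinuousLinearMap.fst ℝ ℝ (Θ × P)).prod
          (ContinuousLinearMap.snd ℝ Θ P ∘L ContinuousLinearMap.snd ℝ ℝ (Θ × P)))))).congr_of_eventuallyEq
      (.of_forall fun q => by simp)
  have h3 : HasFDerivAt (fun q : ℝ × Θ × P => (q.2.1 + r • Ω, q.2.2))
      (ContinuousLinearMap.snd ℝ ℝ (Θ × P)) (w, ϑ, l) := by
    have := (ContinuousLinearMap.snd ℝ ℝ (Θ × P)).hasFDerivAt (x := (w, ϑ, l)) |>.add_const
      (r • Ω, (0 : P))
    refine this.congr_of_eventuallyEq (.of_forall fun q => ?_)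
    ext <;> simp
  have h4 := (h.analyticOnNhd_initialValue ((A + r) * ψ (w, l) r, ϑ + r • Ω, l)
    ⟨h.lt_slow hw hl hr, trivial, hl⟩).differentiableAt.hasFDerivAt
  have h5 := HasFDerivAt.comp (w, ϑ, l) h4 (h2.prodMk h3)
  have hopen : ∀ᶠ q in 𝓝 (w, ϑ, l), q ∈ Ioi A ×ˢ (univ : Set Θ) ×ˢ Λ :=
    (isOpen_Ioi.prod (isOpen_univ.prod hΛ)).mem_nhds hq
  have h6 := h5.congr_of_eventuallyEq (f₁ := fun q : ℝ × Θ × P => (A + r)⁻¹ ^ M • δ q r) (by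
    filter_upwards [hopen] with q hq
    exact (h.initialValue_orbit hq.1 q.2.1 hq.2.2 hr).symm)
  have h7 := DFunLike.congr_fun (h6.unique h1) (0, vϑ, vl)
  simpa using h7

theorem periodic_initialValue (h : OrbitSolution κ M α β Λ Γ Ω R A c C ε B m hA hM ψ δ) {w : ℝ}
    (hw : A < w) (ϑ : Θ) {l : P} (hl : l ∈ Λ) {v : Θ} (hv : v ∈ Γ) :
    initialValue A M δ (w, ϑ + v, l) = initialValue A M δ (w, ϑ, l) := by
  rw [initialValue, initialValue, h.periodic_δ hw hl ϑ hv]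

theorem exists_bound_fderiv_δ (h : OrbitSolution κ M α β Λ Γ Ω R A c C ε B m hA hM ψ δ)
    (hΛ : IsOpen Λ) {D₀ : Set Θ} (hD₀ : IsCompact D₀) (hΓ : ∀ ϑ, ∃ x ∈ D₀, ∃ v ∈ Γ, ϑ = x + v)
    {C₀ : Set P} (hC₀ : IsCompact C₀) (hC₀Λ : C₀ ⊆ Λ) {w : ℝ} (hw : A < w) :
    ∃ B₁ : ℝ, ∀ ϑ, ∀ l ∈ C₀, ‖fderiv ℝ δ (w, ϑ, l)‖ ≤ B₁ := by
  obtain ⟨B₁, hB₁⟩ := ((isCompact_singleton (x := w)).prod (hD₀.prod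
    hC₀)).exists_bound_of_continuousOn (f := fderiv ℝ δ)
    (h.analytic_δ.fderiv.continuousOn.mono fun q hq => by
      obtain ⟨h1, -, h3⟩ := hq
      exact ⟨by rw [h1]; exact hw, trivial, hC₀Λ h3⟩)
  refine ⟨B₁, fun ϑ l hl => ?_⟩
  obtain ⟨x, hx, v, hv, rfl⟩ := hΓ ϑ
  have h1 : fderiv ℝ δ (w, x + v, l) = fderiv ℝ δ (w, x, l) := by
    have h2 : (w, x + v, l) = (w, x, l) + ((0 : ℝ), v, (0 : P)) := by simp
    rw [h2, ← fderiv_comp_add_right]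
    refine Filter.EventuallyEq.fderiv_eq ?_
    filter_upwards [(isOpen_Ioi.prod (isOpen_univ.prod hΛ)).mem_nhds
      (show (w, x, l) ∈ Ioi A ×ˢ (univ : Set Θ) ×ˢ Λ from ⟨hw, trivial, hC₀Λ hl⟩)] with q hq
    have h3 : q + ((0 : ℝ), v, (0 : P)) = (q.1, q.2.1 + v, q.2.2) := by ext <;> simp
    rw [h3, h.periodic_δ hq.1 hq.2.2 _ hv]
  rw [h1]
  exact hB₁ _ ⟨rfl, hx, hl⟩

/-- Every point with w ≥ 2A lies on an orbit issuing from w = 2A, where compactness and periodicity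
bound the first derivatives of δ and ψ. Along the orbit everything scales by (A + r)^(-M),
comparable to w^(-M). The derivative loses one factor A + r, at most w / c, because orbits with
nearby parameters separate at that rate. -/
theorem exists_decay (h : OrbitSolution κ M α β Λ Γ Ω R A c C ε B m hA hM ψ δ)
    (hΛ : IsOpen Λ) {D₀ : Set Θ} (hD₀ : IsCompact D₀) (hΓ : ∀ ϑ, ∃ x ∈ D₀, ∃ v ∈ Γ, ϑ = x + v)
    {C₀ : Set P} (hC₀ : IsCompact C₀) (hC₀Λ : C₀ ⊆ Λ) :
    ∃ C' : ℝ, ∀ w, 2 * A ≤ w → ∀ ϑ, ∀ l ∈ C₀, ‖initialValue A M δ (w, ϑ, l)‖ ≤ C' * w⁻¹ ^ M ∧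
      ‖fderiv ℝ (initialValue A M δ) (w, ϑ, l)‖ ≤ C' * w⁻¹ ^ M * w := by
  have h2A : A < 2 * A := by linarith
  obtain ⟨B₁, hB₁⟩ := h.exists_bound_fderiv_δ hΛ hD₀ hΓ hC₀ hC₀Λ h2A
  obtain ⟨B₂, hB₂⟩ := ((isCompact_singleton (x := 2 * A)).prod hC₀).exists_bound_of_continuousOn
    (f := fderiv ℝ ψ) (h.analytic_ψ.fderiv.continuousOn.mono fun q hq =>
      ⟨by rw [hq.1]; exact h2A, hC₀Λ hq.2⟩)
  have hc := h.c_pos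
  have hC := h.C_pos
  have hε := h.ε_pos
  have hm := h.m_pos
  set E : ℝ := |B| / A + |B₁| * ‖Ω‖ with hE
  have hE0 : 0 ≤ E := by positivity
  set F : ℝ := |B₁| / A + (1 / A + |B₂|) * (E / m) with hF
  have hF0 : 0 ≤ F := by positivity
  refine ⟨(2 + C) ^ M * (ε + F / c), fun w hw ϑ₀ l hl => ?_⟩
  have hlΛ := hC₀Λ hl
  have hw0 : 0 < w := by linarith
  obtain ⟨r, hr, hrw⟩ := h.exists_slow_eq h2A hlΛ hw
  obtain ⟨ϑ, rfl⟩ : ∃ ϑ, ϑ₀ = ϑ + r • Ω := ⟨ϑ₀ - r • Ω, by abel⟩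
  have hAr : 0 < A + r := by linarith
  set a : ℝ := (A + r)⁻¹ ^ M with ha
  have ha0 : 0 < a := by positivity
  have hinit : initialValue A M δ (w, ϑ + r • Ω, l) = a • δ (2 * A, ϑ, l) r := by
    rw [← h.initialValue_orbit h2A ϑ hlΛ hr, hrw]
  have haw : a ≤ (2 + C) ^ M * w⁻¹ ^ M := by
    rw [← mul_pow]
    refine pow_le_pow_left₀ (by positivity) ?_ _
    rw [← div_eq_mul_inv, inv_le_iff_one_le_mul₀ hAr, div_mul_eq_mul_div, one_le_div hw0, ← hrw]
    have h1 := h.ψ_le (2 * A) h2A l hlΛ r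
    rw [mul_div_assoc, div_self hA.ne', mul_one] at h1
    nlinarith
  have hrw' : A + r ≤ w / c := by
    rw [le_div_iff₀ hc, ← hrw]
    have h1 := h.le_ψ (2 * A) h2A l hlΛ r
    nlinarith
  have hwM : 0 ≤ (2 + C) ^ M * w⁻¹ ^ M := by positivity
  constructor
  · rw [hinit, norm_smul, Real.norm_of_nonneg ha0.le]
    have h1 : ‖δ (2 * A, ϑ, l) r‖ ≤ ε :=
      ((δ (2 * A, ϑ, l)).norm_coe_le_norm r).trans (h.δ_le _ h2A ϑ l hlΛ)
    calc a * ‖δ (2 * A, ϑ, l) r‖ ≤ ((2 + C) ^ M * w⁻¹ ^ M) * (ε + F / c) := by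
          gcongr
          have : 0 ≤ F / c := by positivity
          linarith
      _ = _ := by ring
  set T := fderiv ℝ (initialValue A M δ) (w, ϑ + r • Ω, l) with hT
  -- These are the variations of the orbit in ϑ and l with the starting value w = 2A held fixed.
  have hT1 : ∀ vϑ vl, ‖T ((A + r) * (fderiv ℝ ψ (2 * A, l) (0, vl)) r, vϑ, vl)‖ ≤
      a * (|B₁| * max ‖vϑ‖ ‖vl‖) := by
    intro vϑ vl
    have h1 := h.fderiv_orbit hΛ h2A ϑ hlΛ hr vϑ vl
    rw [hrw] at h1
    rw [hT, h1, norm_smul, Real.norm_of_nonneg ha0.le]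
    gcongr
    refine (BoundedContinuousFunction.norm_coe_le_norm _ r).trans
      ((ContinuousLinearMap.le_opNorm _ _).trans ?_)
    have h2 : ‖((0 : ℝ), vϑ, vl)‖ = max ‖vϑ‖ ‖vl‖ := by
      rw [Prod.norm_def, Prod.norm_def, norm_zero, max_eq_right (by positivity)]
    rw [h2]
    gcongr
    exact (hB₁ ϑ l hl).trans (le_abs_self _)
  have hTΩ : ‖T (κ * (α l - β l / w), Ω, 0)‖ ≤ a * (|B| / A) := by
    rw [hT, h.fderiv_initialValue (by linarith) _ hlΛ, hinit]
    obtain ⟨g, hgB, hg, -⟩ := h.δ_eq (2 * A) h2A ϑ l hlΛ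
    have h1 := hg r hr
    rw [hrw] at h1
    rw [← h1, norm_smul, norm_pow, Real.norm_of_nonneg (by positivity), pow_succ, mul_assoc,
      div_eq_inv_mul]
    gcongr
    · linarith
    · exact (hgB r).trans (le_abs_self _)
  have hμ : m ≤ κ * (α l - β l / w) := by
    have := h.le_deriv _ h2A l hlΛ r hr
    rwa [hrw] at this
  -- The w-direction is a difference of controlled ones: the flow direction (μ, Ω, 0), bounded
  -- through the equation, minus the variation (0, Ω, 0), equals μ (1, 0, 0), and μ ≥ m > 0.
  have hT0 : ‖T (1, 0, 0)‖ ≤ a * (E / m) := by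
    have h1 := hT1 Ω 0
    have h2 : ((0 : ℝ), (0 : P)) = 0 := rfl
    rw [h2, map_zero, BoundedContinuousFunction.coe_zero, Pi.zero_apply, mul_zero, norm_zero,
      max_eq_left (norm_nonneg _)] at h1
    have h3 : (κ * (α l - β l / w)) • T (1, 0, 0) = T (κ * (α l - β l / w), Ω, 0) - T (0, Ω, 0) := by
      rw [← map_smul, ← map_sub]
      simp
      rfl
    have h4 : κ * (α l - β l / w) * ‖T (1, 0, 0)‖ ≤ a * E := by
      rw [← Real.norm_of_nonneg (hm.le.trans hμ), ← norm_smul, h3]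
      refine (norm_sub_le _ _).trans ?_
      rw [hE, mul_add]
      exact add_le_add hTΩ h1
    rw [← mul_div_assoc, le_div_iff₀ hm, mul_comm]
    exact (mul_le_mul_of_nonneg_right hμ (norm_nonneg _)).trans h4
  have hTv : ‖T‖ ≤ a * (A + r) * F := by
    refine ContinuousLinearMap.opNorm_le_bound _ (by positivity) fun v => ?_
    obtain ⟨x, vϑ, vl⟩ := v
    set v : ℝ × Θ × P := (x, vϑ, vl) with hv
    have hx : |x| ≤ ‖v‖ := norm_fst_le v
    have hvv : max ‖vϑ‖ ‖vl‖ ≤ ‖v‖ := norm_snd_le v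
    set y := (fderiv ℝ ψ (2 * A, l) (0, vl)) r with hy
    have hyv : |y| ≤ |B₂| * ‖v‖ := by
      rw [← Real.norm_eq_abs, hy]
      refine (BoundedContinuousFunction.norm_coe_le_norm _ r).trans
        ((ContinuousLinearMap.le_opNorm _ _).trans ?_)
      have h2 : ‖((0 : ℝ), vl)‖ = ‖vl‖ := by
        rw [Prod.norm_def, norm_zero, max_eq_right (norm_nonneg _)]
      rw [h2]
      gcongr
      · exact (hB₂ (2 * A, l) ⟨rfl, hl⟩).trans (le_abs_self _)
      · exact (le_max_right _ _).trans hvv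
    have h1 : T v = T ((A + r) * y, vϑ, vl) + (x - (A + r) * y) • T (1, 0, 0) := by
      rw [← map_smul, ← map_add]
      simp [hv]
    have h2 : |x - (A + r) * y| ≤ (A + r) * ((1 / A + |B₂|) * ‖v‖) := by
      refine (abs_sub _ _).trans ?_
      rw [abs_mul, abs_of_pos hAr]
      have h3 : ‖v‖ ≤ (A + r) * (1 / A * ‖v‖) := by
        rw [← mul_assoc, mul_one_div]
        exact le_mul_of_one_le_left (norm_nonneg _) ((one_le_div hA).2 (by linarith))
      have h4 : (A + r) * |y| ≤ (A + r) * (|B₂| * ‖v‖) := by gcongr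
      linarith
    rw [h1]
    refine (norm_add_le _ _).trans ?_
    rw [norm_smul, Real.norm_eq_abs]
    have h5 : a * (|B₁| * max ‖vϑ‖ ‖vl‖) ≤ a * ((A + r) * (|B₁| / A) * ‖v‖) := by
      have h6 : |B₁| ≤ (A + r) * (|B₁| / A) := by
        rw [mul_div_assoc', mul_comm, mul_div_assoc]
        exact le_mul_of_one_le_right (abs_nonneg _) ((one_le_div hA).2 (by linarith))
      gcongr
    calc _ ≤ a * ((A + r) * (|B₁| / A) * ‖v‖) +
          (A + r) * ((1 / A + |B₂|) * ‖v‖) * (a * (E / m)) :=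
          add_le_add ((hT1 vϑ vl).trans h5) (mul_le_mul h2 hT0 (norm_nonneg _) (by positivity))
      _ = a * (A + r) * F * ‖v‖ := by rw [hF]; ring
  refine hTv.trans ?_
  calc a * (A + r) * F ≤ ((2 + C) ^ M * w⁻¹ ^ M) * (w / c) * F := by gcongr
    _ = ((2 + C) ^ M * w⁻¹ ^ M) * (F / c) * w := by ring
    _ ≤ ((2 + C) ^ M * w⁻¹ ^ M) * (ε + F / c) * w := by gcongr; linarith
    _ = _ := by ring

end OrbitSolution

end Remainder

end

section

open scoped BoundedContinuousFunction NNReal ENNReal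

/-! ### Extension of the remainder to u = 0 -/

section ExtensionToZero

set_option linter.unusedSectionVars false

variable {V Θ P : Type*} [NormedAddCommGroup V] [NormedSpace ℝ V]
  [NormedAddCommGroup Θ] [NormedSpace ℝ Θ] [NormedAddCommGroup P] [NormedSpace ℝ P]

/-- A function on `{u < ρ}` that vanishes for `u ≤ 0`, is of class `C¹` for `u > 0` and has
a derivative of size `O(u)` is of class `C¹`. -/
theorem contDiffOn_one_of_fderiv_le {E : Type*} [NormedAddCommGroup E] [NormedSpace ℝ E]
    {D : ℝ × E → V} {ρ C : ℝ} {S : Set E} (hS : IsOpen S) (hC : 0 ≤ C)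
    (h0 : ∀ u ≤ 0, ∀ z ∈ S, D (u, z) = 0)
    (hD : ContDiffOn ℝ 1 D (Ioo 0 ρ ×ˢ S))
    (hD0 : ∀ u ∈ Ioo 0 ρ, ∀ z ∈ S, ‖D (u, z)‖ ≤ C * u ^ 2)
    (hD1 : ∀ u ∈ Ioo 0 ρ, ∀ z ∈ S, ‖fderiv ℝ D (u, z)‖ ≤ C * u) :
    ContDiffOn ℝ 1 D (Iio ρ ×ˢ S) := by
  have hopen : IsOpen (Iio ρ ×ˢ S) := isOpen_Iio.prod hS
  have hopen' : IsOpen (Ioo 0 ρ ×ˢ S) := isOpen_Ioo.prod hS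
  rcases le_or_gt ρ 0 with hρ | hρ
  · exact (contDiffOn_const (c := (0 : V))).congr fun q hq =>
      h0 q.1 ((le_of_lt hq.1).trans hρ) q.2 hq.2
  have hle : ∀ q ∈ Iio ρ ×ˢ S, ‖D q‖ ≤ C * q.1 ^ 2 := by
    rintro ⟨u, z⟩ ⟨hu, hz⟩
    rcases le_or_gt u 0 with hu0 | hu0
    · rw [h0 u hu0 z hz, norm_zero]; positivity
    · exact hD0 u ⟨hu0, hu⟩ z hz
  have hfd : ∀ q ∈ Iio ρ ×ˢ S, q.1 ≤ 0 → HasFDerivAt (𝕜 := ℝ) D 0 q := by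
    rintro ⟨u, z⟩ ⟨hu, hz⟩ hu0
    have h1 : D (u, z) = 0 := h0 u hu0 z hz
    refine hasFDerivAt_iff_isLittleO_nhds_zero.2 ?_
    have h2 : ∀ᶠ v : ℝ × E in 𝓝 0, (u, z) + v ∈ Iio ρ ×ˢ S :=
      (Continuous.tendsto' (by fun_prop : Continuous fun v : ℝ × E => (u, z) + v) 0 (u, z)
        (by simp)).eventually (hopen.mem_nhds ⟨hu, hz⟩)
    have h3 : (fun v : ℝ × E => ‖v‖ ^ 2) =o[𝓝 0] fun v => v := by
      simpa using (isLittleO_norm_pow_id (E' := ℝ × E) (n := 2) one_lt_two)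
    refine IsBigO.trans_isLittleO (IsBigO.of_bound C ?_) h3
    filter_upwards [h2] with v hv
    rw [h1, sub_zero, _root_.zero_apply, sub_zero, norm_pow, norm_norm]
    rcases le_or_gt (u + v.1) 0 with h4 | h4
    · have h5 : D ((u, z) + v) = 0 := h0 _ h4 _ hv.2
      rw [h5, norm_zero]; positivity
    · refine (hle _ hv).trans ?_
      have h5 : u + v.1 ≤ ‖v‖ := by
        have : v.1 ≤ ‖v‖ := (le_abs_self _).trans (norm_fst_le v)
        linarith
      have h6 : ((u, z) + v).1 = u + v.1 := rfl
      rw [h6]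
      gcongr
  have hdiff : DifferentiableOn ℝ D (Iio ρ ×ˢ S) := by
    rintro ⟨u, z⟩ ⟨hu, hz⟩
    rcases le_or_gt u 0 with hu0 | hu0
    · exact (hfd (u, z) ⟨hu, hz⟩ hu0).differentiableAt.differentiableWithinAt
    · exact ((hD.contDiffAt (hopen'.mem_nhds ⟨⟨hu0, hu⟩, hz⟩)).differentiableAt
        one_ne_zero).differentiableWithinAt
  refine (contDiffOn_succ_iff_fderiv_of_isOpen (n := 0) hopen).2 ⟨hdiff, by simp, ?_⟩
  rw [contDiffOn_zero]
  rintro ⟨u, z⟩ ⟨hu, hz⟩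
  refine ContinuousAt.continuousWithinAt ?_
  rcases le_or_gt u 0 with hu0 | hu0
  · rw [ContinuousAt, (hfd (u, z) ⟨hu, hz⟩ hu0).fderiv]
    have h1 : Tendsto (fun q : ℝ × E => C * max q.1 0) (𝓝 (u, z)) (𝓝 0) :=
      Continuous.tendsto' (by fun_prop) _ _ (by simp [max_eq_right hu0])
    refine squeeze_zero_norm' ?_ h1
    filter_upwards [hopen.mem_nhds ⟨hu, hz⟩] with q hq
    rcases le_or_gt q.1 0 with hq0 | hq0
    · rw [(hfd q hq hq0).fderiv, norm_zero]
      exact mul_nonneg hC (le_max_right _ _)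
    · rw [max_eq_left hq0.le]
      exact hD1 q.1 ⟨hq0, hq.1⟩ q.2 hq.2
  · exact ((hD.contDiffAt (hopen'.mem_nhds ⟨⟨hu0, hu⟩, hz⟩)).fderiv_right
      (m := 0) (by simp)).continuousAt

variable [ProperSpace V] [CompleteSpace Θ] [CompleteSpace P]

/-- The graph of initial values, read in u = w^(-1/κ) and extended by zero. The slow equation w' = κ
(α - β / w) becomes u' = u^(κ+1) (-α + β u^κ), so the graph equation turns into the equation for D.
The compact set C₀ makes the decay constants uniform. -/
theorem exists_invariantRemainder {Λ Λ₀ : Set P} (hΛ : IsOpen Λ) (hΛ₀ : IsOpen Λ₀)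
    (hc : IsCompact (closure Λ)) (hcl : closure Λ ⊆ Λ₀) {C₀ : Set P} (hC₀ : IsCompact C₀)
    (hC₀Λ : C₀ ⊆ Λ) {α β : P → ℝ}
    (hα : AnalyticOnNhd ℝ α Λ₀) (hβ : AnalyticOnNhd ℝ β Λ₀) (hα0 : ∀ l ∈ Λ₀, 0 < α l)
    {κ : ℕ} (hκ : 1 ≤ κ) {D₀ Γ : Set Θ} (hD₀ : IsCompact D₀)
    (hΓ : ∀ ϑ, ∃ x ∈ D₀, ∃ v ∈ Γ, ϑ = x + v) (Ω : Θ) :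
    ∃ c : ℝ, 0 < c ∧ ∀ M : ℕ, 4 ≤ M → ∀ M₀ : ℝ, 0 ≤ M₀ → 2 * M₀ ≤ c * M →
      ∀ R : ℝ × V × Θ × P → V,
      (∀ ϑ, ∀ l ∈ Λ₀, AnalyticAt ℝ R (0, 0, ϑ, l)) →
      (∀ u z ϑ, ∀ l ∈ Λ₀, ∀ v ∈ Γ, R (u, z, ϑ + v, l) = R (u, z, ϑ, l)) →
      (∀ ϑ, ∀ l ∈ Λ₀, (fun u => R (u, 0, ϑ, l)) =O[𝓝 0] fun u : ℝ => u ^ (κ * M + κ)) →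
      (∀ ϑ, ∀ l ∈ Λ₀, ∀ᶠ q : ℝ × V × V × Θ × P in 𝓝 (0, 0, 0, ϑ, l),
        ‖R (q.1, q.2.1, q.2.2.2) - R (q.1, q.2.2.1, q.2.2.2)‖ ≤
          M₀ * |q.1| ^ κ * ‖q.2.1 - q.2.2.1‖) →
      ∃ (ρ C : ℝ) (D : ℝ × Θ × P → V), 0 < ρ ∧ 0 ≤ C ∧
        AnalyticOnNhd ℝ D (Ioo 0 ρ ×ˢ univ ×ˢ interior C₀) ∧
        ContDiffOn ℝ 1 D (Iio ρ ×ˢ univ ×ˢ interior C₀) ∧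
        (∀ u ∈ Iio ρ, ∀ ϑ, ∀ l ∈ interior C₀, ‖D (u, ϑ, l)‖ ≤ C * u ^ 2) ∧
        (∀ u ∈ Iio ρ, ∀ ϑ, ∀ l ∈ interior C₀, ∀ v ∈ Γ, D (u, ϑ + v, l) = D (u, ϑ, l)) ∧
        ∀ u ∈ Ioo 0 ρ, ∀ ϑ, ∀ l ∈ interior C₀,
          fderiv ℝ D (u, ϑ, l) (u ^ (κ + 1) * (-α l + β l * u ^ κ), Ω, 0) =
            R (u, D (u, ϑ, l), ϑ, l) := by
  obtain ⟨c, hc0, hsol⟩ := exists_orbitSolution (V := V) hΛ hΛ₀ hc hcl hα hβ hα0 hκ hD₀ hΓ Ω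
  refine ⟨c, hc0, fun M hM M₀ hM₀ hMc R hR hper hO hLip => ?_⟩
  obtain ⟨A, C, ε, B, m, hA, ψ, δ, h⟩ := hsol M (by omega) M₀ hM₀ hMc R hR hper hO hLip
  obtain ⟨C', hC'⟩ := h.exists_decay hΛ hD₀ hΓ hC₀ hC₀Λ
  set Δ := initialValue A M δ with hΔ
  have hΔa := h.analyticOnNhd_initialValue
  rw [← hΔ] at hΔa
  obtain ⟨D, hD⟩ : ∃ D : ℝ × Θ × P → V, ∀ q, D q = if q.1 ≤ 0 then 0 else
    Δ ((q.1 ^ κ)⁻¹, q.2) := ⟨_, fun q => rfl⟩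
  set ρ : ℝ := min 1 (invRoot κ (2 * A)) with hρdef
  have hρ : 0 < ρ := lt_min one_pos (invRoot_pos κ (by positivity))
  have hw : ∀ u ∈ Ioo 0 ρ, 2 * A ≤ (u ^ κ)⁻¹ := by
    intro u hu
    have h1 : u ≤ invRoot κ (2 * A) := hu.2.le.trans (min_le_right _ _)
    have h2 := pow_le_pow_left₀ hu.1.le h1 κ
    rw [invRoot_pow hκ (by positivity)] at h2
    exact (le_inv_comm₀ (pow_pos hu.1 _) (by positivity)).1 h2
  have hwA : ∀ u ∈ Ioo 0 ρ, A < (u ^ κ)⁻¹ := fun u hu => by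
    have := hw u hu
    linarith
  have hint : interior C₀ ⊆ Λ := interior_subset.trans hC₀Λ
  have hmem : ∀ u ∈ Ioo 0 ρ, ∀ ϑ, ∀ l ∈ interior C₀,
      ((u ^ κ)⁻¹, ϑ, l) ∈ Ioi A ×ˢ (univ : Set Θ) ×ˢ Λ := fun u hu ϑ l hl =>
    ⟨hwA u hu, trivial, hint hl⟩
  have hDeq : ∀ u, 0 < u → ∀ z, D =ᶠ[𝓝 (u, z)] fun q => Δ ((q.1 ^ κ)⁻¹, q.2) := by
    intro u hu z
    have : ∀ᶠ q : ℝ × Θ × P in 𝓝 (u, z), 0 < q.1 := continuousAt_fst.eventually (lt_mem_nhds hu)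
    filter_upwards [this] with q hq
    rw [hD, if_neg (not_le.2 hq)]
  have hDa : AnalyticOnNhd ℝ D (Ioo 0 ρ ×ˢ univ ×ˢ interior C₀) := by
    rintro ⟨u, ϑ, l⟩ ⟨hu, -, hl⟩
    refine AnalyticAt.congr ?_ (hDeq u hu.1 (ϑ, l)).symm
    exact AnalyticAt.fun_comp (f := fun q : ℝ × Θ × P => ((q.1 ^ κ)⁻¹, q.2))
      (hΔa _ (hmem u hu ϑ l hl)) (((analyticAt_fst.fun_pow κ).inv
        (pow_ne_zero _ hu.1.ne')).prod analyticAt_snd)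
  have hd : ∀ u ∈ Ioo 0 ρ, HasDerivAt (fun u : ℝ => (u ^ κ)⁻¹) (-(κ * (u ^ (κ + 1))⁻¹)) u := by
    intro u hu
    have h1 := (hasDerivAt_pow κ u).inv (pow_ne_zero κ hu.1.ne')
    convert! h1 using 1
    have := hu.1.ne'
    obtain ⟨j, rfl⟩ : ∃ j, κ = j + 1 := ⟨κ - 1, by omega⟩
    field_simp
    simp
    ring
  have hfd : ∀ u ∈ Ioo 0 ρ, ∀ ϑ, ∀ l ∈ interior C₀, ∀ v : ℝ × Θ × P,
      fderiv ℝ D (u, ϑ, l) v =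
        fderiv ℝ Δ ((u ^ κ)⁻¹, ϑ, l) (v.1 * -(κ * (u ^ (κ + 1))⁻¹), v.2) := by
    intro u hu ϑ l hl v
    rw [(hDeq u hu.1 (ϑ, l)).fderiv_eq]
    have h1 := ((hd u hu).comp_hasFDerivAt (u, ϑ, l)
      (ContinuousLinearMap.fst ℝ ℝ (Θ × P)).hasFDerivAt).prodMk
      (ContinuousLinearMap.snd ℝ ℝ (Θ × P)).hasFDerivAt
    have h2 := HasFDerivAt.comp (u, ϑ, l)
      (hΔa _ (hmem u hu ϑ l hl)).differentiableAt.hasFDerivAt h1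
    have h3 := h2.fderiv
    simp only [Function.comp_def, ContinuousLinearMap.coe_fst', ContinuousLinearMap.coe_snd'] at h3
    rw [h3]
    simp [mul_comm]
  have hu1 : ∀ u ∈ Ioo 0 ρ, u ≤ 1 := fun u hu => hu.2.le.trans (min_le_left _ _)
  have hbound : ∀ u ∈ Ioo 0 ρ, ∀ z ∈ univ ×ˢ interior C₀, ‖D (u, z)‖ ≤ |C'| * (κ + 1) * u ^ 2 := by
    rintro u hu ⟨ϑ, l⟩ ⟨-, hl⟩
    rw [hD, if_neg (not_le.2 hu.1)]
    refine (hC' _ (hw u hu) ϑ l (interior_subset hl)).1.trans ?_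
    rw [inv_inv, ← pow_mul]
    have h1 : u ^ (κ * M) ≤ u ^ 2 := pow_le_pow_of_le_one hu.1.le (hu1 u hu) (by nlinarith)
    have h2 : |C'| ≤ |C'| * (κ + 1) := le_mul_of_one_le_right (abs_nonneg _) (by simp)
    exact mul_le_mul ((le_abs_self _).trans h2) h1 (pow_nonneg hu.1.le _) (by positivity)
  have hbound1 : ∀ u ∈ Ioo 0 ρ, ∀ z ∈ univ ×ˢ interior C₀,
      ‖fderiv ℝ D (u, z)‖ ≤ |C'| * (κ + 1) * u := by
    rintro u hu ⟨ϑ, l⟩ ⟨-, hl⟩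
    have hu0 := hu.1
    refine ContinuousLinearMap.opNorm_le_bound _ (by positivity) fun v => ?_
    rw [hfd u hu ϑ l hl]
    refine (ContinuousLinearMap.le_opNorm _ _).trans ?_
    have h1 := (hC' _ (hw u hu) ϑ l (interior_subset hl)).2
    rw [inv_inv, ← pow_mul] at h1
    have h2 : ‖(v.1 * -(κ * (u ^ (κ + 1))⁻¹), v.2)‖ ≤ (κ + 1) * (u ^ (κ + 1))⁻¹ * ‖v‖ := by
      have h3 : 1 ≤ (u ^ (κ + 1))⁻¹ := one_le_inv_iff₀.2 ⟨by positivity, pow_le_one₀ hu0.le (hu1 u hu)⟩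
      refine max_le ?_ ?_
      · rw [norm_mul, norm_neg, Real.norm_of_nonneg (by positivity : 0 ≤ κ * (u ^ (κ + 1))⁻¹),
          mul_comm]
        have := norm_fst_le v
        gcongr
        linarith
      · have h4 : 1 ≤ (κ + 1 : ℝ) * (u ^ (κ + 1))⁻¹ := by
          have : (1 : ℝ) ≤ κ + 1 := by simp
          nlinarith
        exact (norm_snd_le v).trans (le_mul_of_one_le_left (norm_nonneg _) h4)
    calc _ ≤ (|C'| * u ^ (κ * M) * (u ^ κ)⁻¹) * ((κ + 1) * (u ^ (κ + 1))⁻¹ * ‖v‖) := by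
          refine mul_le_mul (h1.trans ?_) h2 (norm_nonneg _) (by positivity)
          gcongr
          exact le_abs_self _
      _ = |C'| * (κ + 1) * (u ^ (κ * M) * ((u ^ κ)⁻¹ * (u ^ (κ + 1))⁻¹)) * ‖v‖ := by ring
      _ ≤ |C'| * (κ + 1) * u * ‖v‖ := by
          gcongr
          -- The derivative is bounded by a multiple of u^(κM - 2κ - 1); M ≥ 4 and κ ≥ 1 make this
          -- exponent at least 1.
          rw [← mul_inv, ← pow_add, ← div_eq_mul_inv, div_le_iff₀ (by positivity), ← pow_succ']
          exact pow_le_pow_of_le_one hu0.le (hu1 u hu) (by nlinarith)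
  refine ⟨ρ, |C'| * (κ + 1), D, hρ, by positivity, hDa, ?_, ?_, ?_, ?_⟩
  · exact contDiffOn_one_of_fderiv_le (isOpen_univ.prod isOpen_interior) (by positivity)
      (fun u hu z _ => by rw [hD, if_pos hu]) hDa.contDiffOn_of_completeSpace hbound hbound1
  · intro u hu ϑ l hl
    rcases le_or_gt u 0 with hu0 | hu0
    · rw [hD, if_pos hu0, norm_zero]; positivity
    · exact hbound u ⟨hu0, hu⟩ _ ⟨trivial, hl⟩
  · intro u hu ϑ l hl v hv
    rcases le_or_gt u 0 with hu0 | hu0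
    · rw [hD, hD, if_pos hu0, if_pos hu0]
    · rw [hD, hD, if_neg (not_le.2 hu0), if_neg (not_le.2 hu0)]
      exact h.periodic_initialValue (hwA u ⟨hu0, hu⟩) ϑ (hint hl) hv
  · intro u hu ϑ l hl
    have hu0 := hu.1
    have h1 := h.fderiv_initialValue (hwA u hu) ϑ (hint hl)
    rw [invRoot_inv_pow hκ hu0.le] at h1
    rw [hfd u hu ϑ l hl, hD, if_neg (not_le.2 hu0), ← h1]
    congr 2
    field_simp
    ring

end ExtensionToZero

end

section

open scoped BoundedContinuousFunction NNReal ENNReal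

/-! ### Approximate solutions and the correction of one order -/

section ApproximateSolutions

set_option linter.unusedSectionVars false

/-- Orders of an analytic function are integers: o(u^n) kills the coefficient of u^n. The gain of an
order thus reduces to a single limit. -/
theorem AnalyticAt.isBigO_pow_succ {F : Type*} [NormedAddCommGroup F] [NormedSpace ℝ F]
    [CompleteSpace F] {f : ℝ → F} {n : ℕ} (hf : AnalyticAt ℝ f 0)
    (ho : f =o[𝓝[≠] 0] fun u => u ^ n) : f =O[𝓝 0] fun u => u ^ (n + 1) := by
  obtain ⟨g, hg⟩ := exists_eventually_eq_pow_smul n (f := fun q : ℝ × ℝ => f q.1) (D := univ)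
    isOpen_univ (fun z _ => AnalyticAt.fun_comp (f := Prod.fst) hf analyticAt_fst)
    (fun z _ => ho.isBigO)
  obtain ⟨hga, hfg⟩ := hg 0 trivial
  have hline : Tendsto (fun u : ℝ => (u, (0 : ℝ))) (𝓝 0) (𝓝 (0, 0)) :=
    Continuous.tendsto' (by fun_prop) _ _ rfl
  have h1 : ∀ᶠ u in 𝓝 (0 : ℝ), f u = u ^ n • g (u, 0) := hline.eventually hfg
  have hgd : DifferentiableAt ℝ (fun u : ℝ => g (u, 0)) 0 :=
    DifferentiableAt.comp (g := g) (f := fun u : ℝ => (u, (0 : ℝ))) (0 : ℝ) hga.differentiableAt (by fun_prop)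
  have h2 : g (0, 0) = 0 := by
    have h3 : Tendsto (fun u : ℝ => g (u, 0)) (𝓝[≠] 0) (𝓝 (g (0, 0))) :=
      hgd.continuousAt.tendsto.mono_left nhdsWithin_le_nhds
    refine tendsto_nhds_unique h3 ?_
    have h4 : (fun u : ℝ => (u ^ n)⁻¹ • f u) =o[𝓝[≠] 0] fun u => (u ^ n)⁻¹ • u ^ n :=
      (isBigO_refl (fun u : ℝ => (u ^ n)⁻¹) (𝓝[≠] 0)).smul_isLittleO ho
    have h5 : (fun u : ℝ => (u ^ n)⁻¹ • u ^ n) =O[𝓝[≠] 0] fun _ => (1 : ℝ) := by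
      refine EventuallyEq.isBigO ?_
      filter_upwards [self_mem_nhdsWithin] with u hu0
      rw [smul_eq_mul, inv_mul_cancel₀ (pow_ne_zero _ hu0)]
    refine ((h4.trans_isBigO h5).tendsto_zero_of_tendsto tendsto_const_nhds).congr' ?_
    filter_upwards [self_mem_nhdsWithin, nhdsWithin_le_nhds h1] with u hu0 hu
    rw [hu, smul_smul, inv_mul_cancel₀ (pow_ne_zero _ hu0), one_smul]
  have h3 : (fun u : ℝ => g (u, 0)) =O[𝓝 0] fun u => u := by
    have := hgd.isBigO_sub
    simpa [h2] using this
  refine (((isBigO_refl (fun u : ℝ => u ^ n) (𝓝 0)).smul h3).congr' ?_ ?_)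
  · filter_upwards [h1] with u hu using hu.symm
  · exact .of_forall fun u => (pow_succ u n).symm

variable {V Θ P : Type*} [NormedAddCommGroup V] [NormedSpace ℝ V] [CompleteSpace V]
  [NormedAddCommGroup Θ] [NormedSpace ℝ Θ] [CompleteSpace Θ]
  [NormedAddCommGroup P] [NormedSpace ℝ P] [CompleteSpace P]

/-- The residual of the equation
`u^(κ+1) y ∂_u W + ∂_Ω W = u^κ (F(u, W, ϑ, l) - y S W)`, `y = -α + β u^κ`. -/
noncomputable def blowUpResidual (κ : ℕ) (α β : P → ℝ) (S : V →L[ℝ] V) (Ω : Θ)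
    (F : ℝ × V × Θ × P → V) (W : ℝ × Θ × P → V) (q : ℝ × Θ × P) : V :=
  fderiv ℝ W q (q.1 ^ (κ + 1) * (-α q.2.2 + β q.2.2 * q.1 ^ κ), Ω, 0) -
    q.1 ^ κ • (F (q.1, W q, q.2) - (-α q.2.2 + β q.2.2 * q.1 ^ κ) • S (W q))

/-- `W` solves the equation up to an error of order `u^(N+κ)`. -/
structure IsApproximateSolution (κ N : ℕ) (α β : P → ℝ) (S : V →L[ℝ] V) (Ω : Θ) (Γ : Set Θ)
    (Λ : Set P) (F : ℝ × V × Θ × P → V) (W₀ : P → V) (W : ℝ × Θ × P → V) : Prop where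
  analytic : AnalyticOnNhd ℝ W (univ ×ˢ univ ×ˢ Λ)
  periodic : ∀ u ϑ, ∀ l ∈ Λ, ∀ v ∈ Γ, W (u, ϑ + v, l) = W (u, ϑ, l)
  zero : ∀ ϑ, ∀ l ∈ Λ, W (0, ϑ, l) = W₀ l
  residual : ∀ ϑ, ∀ l ∈ Λ,
    (fun u => blowUpResidual κ α β S Ω F W (u, ϑ, l)) =O[𝓝 0] fun u : ℝ => u ^ (N + κ)

variable {κ N : ℕ} {α β : P → ℝ} {S : V →L[ℝ] V} {Ω : Θ} {Γ : Set Θ} {Λ : Set P}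
  {F : ℝ × V × Θ × P → V} {W₀ : P → V} {W : ℝ × Θ × P → V}

theorem analyticAt_blowUpResidual (hα : AnalyticOnNhd ℝ α Λ) (hβ : AnalyticOnNhd ℝ β Λ)
    (hF : ∀ w ϑ, ∀ l ∈ Λ, AnalyticAt ℝ F (0, w, ϑ, l))
    (hW : AnalyticOnNhd ℝ W (univ ×ˢ univ ×ˢ Λ)) (ϑ : Θ) {l : P} (hl : l ∈ Λ) :
    AnalyticAt ℝ (blowUpResidual κ α β S Ω F W) (0, ϑ, l) := by
  have h1 := hW (0, ϑ, l) ⟨trivial, trivial, hl⟩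
  have h2 : AnalyticAt ℝ (fun q : ℝ × Θ × P => q.2.2) (0, ϑ, l) :=
    analyticAt_snd.fun_comp analyticAt_snd
  have hα' : AnalyticAt ℝ (fun q : ℝ × Θ × P => α q.2.2) (0, ϑ, l) :=
    AnalyticAt.fun_comp (f := fun q : ℝ × Θ × P => q.2.2) (hα l hl) h2
  have hβ' : AnalyticAt ℝ (fun q : ℝ × Θ × P => β q.2.2) (0, ϑ, l) :=
    AnalyticAt.fun_comp (f := fun q : ℝ × Θ × P => q.2.2) (hβ l hl) h2
  have hy : AnalyticAt ℝ (fun q : ℝ × Θ × P => -α q.2.2 + β q.2.2 * q.1 ^ κ) (0, ϑ, l) :=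
    hα'.fun_neg.fun_add (hβ'.fun_mul (analyticAt_fst.fun_pow κ))
  have h3 : AnalyticAt ℝ (fun q : ℝ × Θ × P => F (q.1, W q, q.2)) (0, ϑ, l) :=
    AnalyticAt.fun_comp (f := fun q : ℝ × Θ × P => (q.1, W q, q.2)) (hF _ ϑ l hl)
      (analyticAt_fst.prod (h1.prod analyticAt_snd))
  have h4 : AnalyticAt ℝ (fun q : ℝ × Θ × P => S (W q)) (0, ϑ, l) :=
    (S.analyticAt _).fun_comp h1
  have h5 : AnalyticAt ℝ (fun q : ℝ × Θ × P =>
      (q.1 ^ (κ + 1) * (-α q.2.2 + β q.2.2 * q.1 ^ κ), Ω, (0 : P))) (0, ϑ, l) :=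
    ((analyticAt_fst.fun_pow (κ + 1)).fun_mul hy).prod analyticAt_const
  have h6 : AnalyticAt ℝ (fun q : ℝ × Θ × P => fderiv ℝ W q
      (q.1 ^ (κ + 1) * (-α q.2.2 + β q.2.2 * q.1 ^ κ), Ω, 0)) (0, ϑ, l) :=
    ((ContinuousLinearMap.id ℝ (ℝ × Θ × P →L[ℝ] V)).analyticAt_bilinear _).fun_comp
      (h1.fderiv.prod h5)
  exact h6.fun_sub ((analyticAt_fst.fun_pow κ).fun_smul (h3.fun_sub
    (hy.fun_smul h4)))

theorem periodic_blowUpResidual (hΛ : IsOpen Λ)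
    (hper : ∀ u w ϑ, ∀ l ∈ Λ, ∀ v ∈ Γ, F (u, w, ϑ + v, l) = F (u, w, ϑ, l))
    (hW : ∀ u ϑ, ∀ l ∈ Λ, ∀ v ∈ Γ, W (u, ϑ + v, l) = W (u, ϑ, l)) (u : ℝ) (ϑ : Θ) {l : P}
    (hl : l ∈ Λ) {v : Θ} (hv : v ∈ Γ) :
    blowUpResidual κ α β S Ω F W (u, ϑ + v, l) = blowUpResidual κ α β S Ω F W (u, ϑ, l) := by
  have h1 : fderiv ℝ W (u, ϑ + v, l) = fderiv ℝ W (u, ϑ, l) := by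
    have h2 : (u, ϑ + v, l) = (u, ϑ, l) + ((0 : ℝ), v, (0 : P)) := by simp
    rw [h2, ← fderiv_comp_add_right]
    refine Filter.EventuallyEq.fderiv_eq ?_
    filter_upwards [(isOpen_univ.prod (isOpen_univ.prod hΛ)).mem_nhds
      (show (u, ϑ, l) ∈ (univ : Set ℝ) ×ˢ (univ : Set Θ) ×ˢ Λ from ⟨trivial, trivial, hl⟩)] with q hq
    have h3 : q + ((0 : ℝ), v, (0 : P)) = (q.1, q.2.1 + v, q.2.2) := by ext <;> simp
    rw [h3, hW _ _ _ hq.2.2 v hv]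
  simp only [blowUpResidual, h1, hW u ϑ l hl v hv, hper _ _ _ l hl v hv]

/-- The coefficient of `u^(N+κ)` in the residual. -/
noncomputable def leadingResidual (κ N : ℕ) (α β : P → ℝ) (S : V →L[ℝ] V) (Ω : Θ)
    (F : ℝ × V × Θ × P → V) (W : ℝ × Θ × P → V) (z : Θ × P) : V :=
  divPow (blowUpResidual κ α β S Ω F W) (N + κ) (0, z)

/-- `heq` is the vanishing of the new coefficient of u^(N+κ). X depends on l alone, so ∂_Ω
annihilates it and it acts only through terms carrying u^κ; φ has the additional factor u^κ so that
∂_Ω φ meets those terms at the same order. The change γ of β contributes at order u^(2κ), hence is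
admitted only for N = κ. For N = 0 the condition X = 0 preserves the value at u = 0. -/
theorem IsApproximateSolution.step (hκ : 1 ≤ κ) (hΛ : IsOpen Λ) (hα : AnalyticOnNhd ℝ α Λ)
    (hβ : AnalyticOnNhd ℝ β Λ) (hF : ∀ w ϑ, ∀ l ∈ Λ, AnalyticAt ℝ F (0, w, ϑ, l))
    (hW : IsApproximateSolution κ N α β S Ω Γ Λ F W₀ W) {X : P → V} {γ : P → ℝ} {φ : Θ × P → V}
    (hX : AnalyticOnNhd ℝ X Λ) (hγ : AnalyticOnNhd ℝ γ Λ) (hφ : AnalyticOnNhd ℝ φ (univ ×ˢ Λ))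
    (hφper : ∀ ϑ, ∀ l ∈ Λ, ∀ v ∈ Γ, φ (ϑ + v, l) = φ (ϑ, l))
    (hX0 : N = 0 → ∀ l ∈ Λ, X l = 0) (hγ0 : N ≠ κ → ∀ l ∈ Λ, γ l = 0)
    (heq : ∀ ϑ, ∀ l ∈ Λ, fderiv ℝ φ (ϑ, l) (Ω, 0) =
      -(leadingResidual κ N α β S Ω F W (ϑ, l) - (α l * N) • X l - α l • S (X l) -
        fderiv ℝ (fun w => F (0, w, ϑ, l)) (W₀ l) (X l) + γ l • S (W₀ l))) :
    IsApproximateSolution κ (N + 1) α (fun l => β l + γ l) S Ω Γ Λ F W₀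
      (fun q => W q + (q.1 ^ N • X q.2.2 + q.1 ^ (N + κ) • φ q.2)) := by
  have hκ0 : κ ≠ 0 := by omega
  set W' : ℝ × Θ × P → V := fun q => W q + (q.1 ^ N • X q.2.2 + q.1 ^ (N + κ) • φ q.2) with hW'
  have hβ' : AnalyticOnNhd ℝ (fun l => β l + γ l) Λ := fun l hl => (hβ l hl).fun_add (hγ l hl)
  have han : AnalyticOnNhd ℝ W' (univ ×ˢ univ ×ˢ Λ) := by
    rintro ⟨u, ϑ, l⟩ ⟨-, -, hl⟩
    have h2 : AnalyticAt ℝ (fun q : ℝ × Θ × P => q.2.2) (u, ϑ, l) :=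
      analyticAt_snd.fun_comp analyticAt_snd
    exact (hW.analytic _ ⟨trivial, trivial, hl⟩).fun_add
      (((analyticAt_fst.fun_pow N).fun_smul (AnalyticAt.fun_comp
        (f := fun q : ℝ × Θ × P => q.2.2) (hX l hl) h2)).fun_add
      ((analyticAt_fst.fun_pow (N + κ)).fun_smul
        (AnalyticAt.fun_comp (f := Prod.snd) (hφ (ϑ, l) ⟨trivial, hl⟩) analyticAt_snd)))
  have hzero : ∀ ϑ, ∀ l ∈ Λ, W' (0, ϑ, l) = W₀ l := by
    intro ϑ l hl
    have h1 : (0 : ℝ) ^ N • X l = 0 := by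
      rcases Nat.eq_zero_or_pos N with rfl | hN
      · rw [hX0 rfl l hl, smul_zero]
      · rw [zero_pow hN.ne', zero_smul]
    simp only [hW', hW.zero ϑ l hl, h1]
    rw [zero_pow (by omega), zero_smul, add_zero, add_zero]
  refine ⟨han, fun u ϑ l hl v hv => ?_, hzero, fun ϑ l hl => ?_⟩
  · simp only [hW', hW.periodic u ϑ l hl v hv, hφper ϑ l hl v hv]
  have hlineA : AnalyticAt ℝ (fun u : ℝ => (u, ϑ, l)) 0 :=
    analyticAt_id.prod analyticAt_const
  have hline : Tendsto (fun u : ℝ => (u, ϑ, l)) (𝓝[≠] 0) (𝓝 (0, ϑ, l)) :=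
    hlineA.continuousAt.tendsto.mono_left nhdsWithin_le_nhds
  have hres := analyticAt_blowUpResidual (κ := κ) (S := S) (Ω := Ω) hα hβ' hF han ϑ hl
  rw [show N + 1 + κ = N + κ + 1 by ring]
  refine AnalyticAt.isBigO_pow_succ (AnalyticAt.fun_comp (f := fun u : ℝ => (u, ϑ, l)) hres hlineA) ?_
  -- the derivative of the correction
  have hd : ∀ u x : ℝ, fderiv ℝ W' (u, ϑ, l) (x, Ω, 0) = fderiv ℝ W (u, ϑ, l) (x, Ω, 0) +
      ((N * u ^ (N - 1) * x) • X l + (((N + κ : ℕ) * u ^ (N + κ - 1) * x) • φ (ϑ, l) +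
        u ^ (N + κ) • fderiv ℝ φ (ϑ, l) (Ω, 0))) := by
    intro u x
    have h1 := (hW.analytic (u, ϑ, l) ⟨trivial, trivial, hl⟩).differentiableAt.hasFDerivAt
    have h2 : HasFDerivAt (fun q : ℝ × Θ × P => q.1) (ContinuousLinearMap.fst ℝ ℝ (Θ × P))
        (u, ϑ, l) := (ContinuousLinearMap.fst ℝ ℝ (Θ × P)).hasFDerivAt
    have h3 : HasFDerivAt (fun q : ℝ × Θ × P => q.2) (ContinuousLinearMap.snd ℝ ℝ (Θ × P))
        (u, ϑ, l) := (ContinuousLinearMap.snd ℝ ℝ (Θ × P)).hasFDerivAt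
    have h4 : HasFDerivAt (fun q : ℝ × Θ × P => q.2.2)
        (ContinuousLinearMap.snd ℝ Θ P ∘L ContinuousLinearMap.snd ℝ ℝ (Θ × P)) (u, ϑ, l) :=
      (ContinuousLinearMap.snd ℝ Θ P ∘L ContinuousLinearMap.snd ℝ ℝ (Θ × P)).hasFDerivAt
    have h5 := HasFDerivAt.comp (g := X) (f := fun q : ℝ × Θ × P => q.2.2) (u, ϑ, l)
      (hX l hl).differentiableAt.hasFDerivAt h4
    have h6 := HasFDerivAt.comp (g := φ) (f := fun q : ℝ × Θ × P => q.2) (u, ϑ, l)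
      (hφ (ϑ, l) ⟨trivial, hl⟩).differentiableAt.hasFDerivAt h3
    have h7 := (h1.add (((h2.pow N).smul h5).add ((h2.pow (N + κ)).smul h6))).fderiv
    have h8 : fderiv ℝ W' (u, ϑ, l) = _ := h7
    rw [h8]
    simp
    abel
  set y : ℝ → ℝ := fun u => -α l + β l * u ^ κ with hy
  set y' : ℝ → ℝ := fun u => -α l + (β l + γ l) * u ^ κ with hy'
  set g : ℝ → V := fun u => divPow (blowUpResidual κ α β S Ω F W) (N + κ) (u, ϑ, l) with hg
  set G : ℝ → V := fun u => F (u, W' (u, ϑ, l), ϑ, l) - F (u, W (u, ϑ, l), ϑ, l) with hG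
  set W1 : ℝ → V := fun u => fderiv ℝ W (u, ϑ, l) (1, 0, 0) with hW1
  set dφ : V := fderiv ℝ φ (ϑ, l) (Ω, 0) with hdφ
  -- T is the new residual divided by u^(N+κ), arranged so that its limit at u = 0 can be read off
  -- termwise.
  set T : ℝ → V := fun u => g u + (γ l * u) • W1 u + (N * y' u) • X l +
    ((N + κ : ℕ) * y' u * u ^ κ) • φ (ϑ, l) + dφ - (u ^ N)⁻¹ • G u +
    y' u • S (X l + u ^ κ • φ (ϑ, l)) + γ l • S (W (u, ϑ, l)) with hT
  have hdiff : ∀ u, W' (u, ϑ, l) - W (u, ϑ, l) = u ^ N • (X l + u ^ κ • φ (ϑ, l)) := fun u => by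
    simp only [hW', add_sub_cancel_left, smul_add, smul_smul, pow_add]
  have hresT : ∀ u : ℝ, u ≠ 0 →
      blowUpResidual κ α (fun l => β l + γ l) S Ω F W' (u, ϑ, l) = u ^ (N + κ) • T u := by
    intro u hu
    have h1 : blowUpResidual κ α β S Ω F W (u, ϑ, l) = u ^ (N + κ) • g u :=
      (pow_smul_divPow _ _ (q := (u, ϑ, l)) hu).symm
    have h2 : fderiv ℝ W (u, ϑ, l) (u ^ (κ + 1) * y' u, Ω, 0) =
        fderiv ℝ W (u, ϑ, l) (u ^ (κ + 1) * y u, Ω, 0) + (γ l * u ^ κ * u ^ (κ + 1)) • W1 u := by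
      rw [hW1, ← map_smul, ← map_add]
      congr 1
      simp [hy, hy']
      ring
    have h3 : F (u, W' (u, ϑ, l), ϑ, l) = F (u, W (u, ϑ, l), ϑ, l) + G u := by simp [hG]
    have h4 : S (W' (u, ϑ, l)) = S (W (u, ϑ, l)) + u ^ N • S (X l + u ^ κ • φ (ϑ, l)) := by
      rw [← map_smul, ← hdiff, map_sub]
      abel
    -- Either N = κ, or γ vanishes.
    have h5 : γ l * u ^ κ * u ^ κ = γ l * u ^ (N + κ) := by
      by_cases hN : N = κ
      · rw [hN]; ring
      · rw [hγ0 hN l hl]; ring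
    have h6 : (N : ℝ) * u ^ (N - 1) * (u ^ (κ + 1) * y' u) = u ^ (N + κ) * (N * y' u) := by
      rcases Nat.eq_zero_or_pos N with rfl | hN
      · simp
      · obtain ⟨j, rfl⟩ : ∃ j, N = j + 1 := ⟨N - 1, by omega⟩
        rw [Nat.add_sub_cancel]
        ring
    have h7 : ((N + κ : ℕ) : ℝ) * u ^ (N + κ - 1) * (u ^ (κ + 1) * y' u) =
        u ^ (N + κ) * ((N + κ : ℕ) * y' u * u ^ κ) := by
      obtain ⟨j, rfl⟩ : ∃ j, κ = j + 1 := ⟨κ - 1, by omega⟩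
      rw [show N + (j + 1) - 1 = N + j by omega]
      ring
    have h8 : u ^ κ • G u = u ^ (N + κ) • (u ^ N)⁻¹ • G u := by
      rw [smul_smul, pow_add]
      congr 1
      field_simp
    have h9 : fderiv ℝ W (u, ϑ, l) (u ^ (κ + 1) * y u, Ω, 0) = u ^ (N + κ) • g u +
        u ^ κ • (F (u, W (u, ϑ, l), ϑ, l) - y u • S (W (u, ϑ, l))) := by
      rw [← h1, blowUpResidual]
      abel
    have h10 : γ l * u ^ κ * u ^ (κ + 1) = u ^ (N + κ) * (γ l * u) := by
      rw [pow_succ u κ, ← mul_assoc, h5]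
      ring
    have h11 : y' u = y u + γ l * u ^ κ := by simp only [hy, hy']; ring
    have h12 : (u ^ κ * (γ l * u ^ κ)) • S (W (u, ϑ, l)) =
        (u ^ (N + κ) * γ l) • S (W (u, ϑ, l)) := by
      congr 1
      linear_combination h5
    calc blowUpResidual κ α (fun l => β l + γ l) S Ω F W' (u, ϑ, l)
        = fderiv ℝ W' (u, ϑ, l) (u ^ (κ + 1) * y' u, Ω, 0) -
          u ^ κ • (F (u, W' (u, ϑ, l), ϑ, l) - y' u • S (W' (u, ϑ, l))) := rfl
      _ = u ^ (N + κ) • T u := by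
        rw [hd, h2, h3, h4, h6, h7, h9, h10, hT]
        simp only
        rw [h11]
        linear_combination (norm := module) h12 - h8
  have hWt : Tendsto (fun u : ℝ => W (u, ϑ, l)) (𝓝[≠] 0) (𝓝 (W₀ l)) := by
    rw [← hW.zero ϑ l hl]
    exact (hW.analytic (0, ϑ, l) ⟨trivial, trivial, hl⟩).continuousAt.tendsto.comp hline
  have hWt' : Tendsto (fun u : ℝ => W' (u, ϑ, l)) (𝓝[≠] 0) (𝓝 (W₀ l)) := by
    rw [← hzero ϑ l hl]
    exact (han (0, ϑ, l) ⟨trivial, trivial, hl⟩).continuousAt.tendsto.comp hline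
  have hut : Tendsto (fun u : ℝ => u) (𝓝[≠] 0) (𝓝 0) := nhdsWithin_le_nhds
  have hκt : Tendsto (fun u : ℝ => u ^ κ) (𝓝[≠] 0) (𝓝 0) := by
    simpa [hκ0] using hut.pow κ
  have hy't : Tendsto y' (𝓝[≠] 0) (𝓝 (-α l)) := by
    simpa using (hκt.const_mul (β l + γ l)).const_add (-α l)
  have hht : Tendsto (fun u : ℝ => X l + u ^ κ • φ (ϑ, l)) (𝓝[≠] 0) (𝓝 (X l)) := by
    simpa using (hκt.smul_const (φ (ϑ, l))).const_add (X l)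
  have hgt : Tendsto g (𝓝[≠] 0) (𝓝 (leadingResidual κ N α β S Ω F W (ϑ, l))) :=
    (analyticAt_divPow (N + κ) (f := blowUpResidual κ α β S Ω F W) (D := univ ×ˢ Λ)
      (isOpen_univ.prod hΛ) (fun z hz => analyticAt_blowUpResidual hα hβ hF hW.analytic z.1 hz.2)
      (fun z hz => (hW.residual z.1 z.2 hz.2).mono nhdsWithin_le_nhds)
      (z := (ϑ, l)) ⟨trivial, hl⟩).1.continuousAt.tendsto.comp hline
  have hGt : Tendsto (fun u => (u ^ N)⁻¹ • G u) (𝓝[≠] 0)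
      (𝓝 (fderiv ℝ (fun w => F (0, w, ϑ, l)) (W₀ l) (X l))) := by
    have h1 : AnalyticAt ℝ (fun q : ℝ × V => F (q.1, q.2, ϑ, l)) (0, W₀ l) :=
      AnalyticAt.fun_comp (f := fun q : ℝ × V => (q.1, q.2, ϑ, l)) (hF (W₀ l) ϑ l hl)
        (analyticAt_fst.prod (analyticAt_snd.prod analyticAt_const))
    -- Strict differentiability is needed because both arguments of the difference of F move with u.
    have h2 := h1.hasStrictFDerivAt
    set L := fderiv ℝ (fun q : ℝ × V => F (q.1, q.2, ϑ, l)) (0, W₀ l) with hL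
    have h3 : HasFDerivAt (fun w => F (0, w, ϑ, l)) (L ∘L ContinuousLinearMap.inr ℝ ℝ V) (W₀ l) :=
      HasFDerivAt.comp (g := fun q : ℝ × V => F (q.1, q.2, ϑ, l)) (f := fun w : V => ((0 : ℝ), w))
        (W₀ l) h2.hasFDerivAt (ContinuousLinearMap.inr ℝ ℝ V).hasFDerivAt
    rw [h3.fderiv]
    have h4 : Tendsto (fun u : ℝ => ((u, W' (u, ϑ, l)), (u, W (u, ϑ, l)))) (𝓝[≠] 0)
        (𝓝 ((0, W₀ l), (0, W₀ l))) := (hut.prodMk_nhds hWt').prodMk_nhds (hut.prodMk_nhds hWt)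
    have h5 := h2.isLittleO.comp_tendsto h4
    have h6 : ∀ u, ((u, W' (u, ϑ, l)) : ℝ × V) - (u, W (u, ϑ, l)) =
        (0, u ^ N • (X l + u ^ κ • φ (ϑ, l))) := fun u => by
      rw [← hdiff, Prod.mk_sub_mk, sub_self]
    simp only [Function.comp_def, h6] at h5
    have h7 : (fun u : ℝ => (u ^ N)⁻¹ • (G u - L (0, u ^ N • (X l + u ^ κ • φ (ϑ, l)))))
        =o[𝓝[≠] 0] fun _ => (1 : ℝ) := by
      refine ((isBigO_refl (fun u : ℝ => (u ^ N)⁻¹) (𝓝[≠] 0)).smul_isLittleO h5).trans_isBigO ?_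
      have h8 : Tendsto (fun u : ℝ => ((0 : ℝ), X l + u ^ κ • φ (ϑ, l))) (𝓝[≠] 0)
          (𝓝 (0, X l)) := tendsto_const_nhds.prodMk_nhds hht
      refine IsBigO.congr' (h8.isBigO_one ℝ) ?_ .rfl
      filter_upwards [self_mem_nhdsWithin] with u hu
      rw [Prod.smul_mk, smul_zero, smul_smul, inv_mul_cancel₀ (pow_ne_zero N hu), one_smul]
    have h9 := (isLittleO_one_iff ℝ).1 h7
    have h10 : Tendsto (fun u : ℝ => L (0, X l + u ^ κ • φ (ϑ, l))) (𝓝[≠] 0) (𝓝 (L (0, X l))) :=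
      (L.continuous.tendsto _).comp (tendsto_const_nhds.prodMk_nhds hht)
    have h11 := h9.add h10
    rw [zero_add] at h11
    refine h11.congr' ?_
    filter_upwards [self_mem_nhdsWithin] with u hu
    have h12 : ((0 : ℝ), u ^ N • (X l + u ^ κ • φ (ϑ, l))) = u ^ N • (0, X l + u ^ κ • φ (ϑ, l)) := by
      simp
    rw [h12, map_smul, smul_sub, smul_smul, inv_mul_cancel₀ (pow_ne_zero N hu), one_smul,
      sub_add_cancel]
  have hW1t : Tendsto W1 (𝓝[≠] 0) (𝓝 (W1 0)) :=
    (((hW.analytic (0, ϑ, l) ⟨trivial, trivial, hl⟩).fderiv.continuousAt.clm_apply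
      continuousAt_const).tendsto).comp hline
  have hT0 : Tendsto T (𝓝[≠] 0) (𝓝 0) := by
    have h1 := (((((((hgt.add ((hut.const_mul (γ l)).smul hW1t)).add
      ((hy't.const_mul (N : ℝ)).smul_const (X l))).add
      (((hy't.const_mul ((N + κ : ℕ) : ℝ)).mul hκt).smul_const (φ (ϑ, l)))).add_const dφ).sub hGt).add
      (hy't.smul ((S.continuous.tendsto _).comp hht))).add
      (((S.continuous.tendsto _).comp hWt).const_smul (γ l)))
    convert! h1 using 2
    rw [hdφ, heq ϑ l hl]
    module
  refine IsLittleO.congr' (f₁ := fun u : ℝ => u ^ (N + κ) • T u) ?_ ?_ .rfl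
  · simpa using (isBigO_refl (fun u : ℝ => u ^ (N + κ)) (𝓝[≠] 0)).smul_isLittleO
      ((isLittleO_one_iff ℝ).2 hT0)
  · filter_upwards [self_mem_nhdsWithin] with u hu
    exact (hresT u hu).symm

end ApproximateSolutions

end

section

open scoped BoundedContinuousFunction NNReal ENNReal

/-! ### Averages over the angles -/

section CubeAverage

set_option linter.unusedSectionVars false

variable {ι : Type*} [Fintype ι] {P V V' : Type*} [NormedAddCommGroup P] [NormedSpace ℝ P]
  [NormedAddCommGroup V] [NormedSpace ℝ V] [NormedAddCommGroup V'] [NormedSpace ℝ V']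

/-- The vectors with integer coordinates. -/
def integerVectors (ι : Type*) : Set (ι → ℝ) := range fun (q : ι → ℤ) (i : ι) => (q i : ℝ)

theorem exists_add_integerVectors (ϑ : ι → ℝ) :
    ∃ x ∈ Icc (0 : ι → ℝ) 1, ∃ v ∈ integerVectors ι, ϑ = x + v :=
  ⟨fun i => Int.fract (ϑ i), ⟨fun _ => Int.fract_nonneg _, fun _ => (Int.fract_lt_one _).le⟩,
    fun i => (⌊ϑ i⌋ : ℝ), ⟨fun i => ⌊ϑ i⌋, rfl⟩, funext fun _ => (Int.fract_add_floor _).symm⟩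

/-- The average of a periodic function over the unit cube. -/
noncomputable def cubeAverage (h : (ι → ℝ) × P → V) (l : P) : V := ∫ s in Icc (0 : ι → ℝ) 1, h (s, l)

variable {Λ : Set P}

theorem integrableOn_cube {h : (ι → ℝ) × P → V} (hh : AnalyticOnNhd ℝ h (univ ×ˢ Λ)) {l : P}
    (hl : l ∈ Λ) : IntegrableOn (fun s => h (s, l)) (Icc 0 1) :=
  ContinuousOn.integrableOn_compact isCompact_Icc fun s _ =>
    ((hh (s, l) ⟨trivial, hl⟩).continuousAt.comp
      (f := fun s : ι → ℝ => (s, l)) (by fun_prop)).continuousWithinAt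

theorem volume_real_cube : (volume : Measure (ι → ℝ)).real (Icc 0 1) = 1 := by
  simp [Measure.real, Real.volume_Icc_pi]

variable [CompleteSpace V] [CompleteSpace V']

theorem cubeAverage_const (v : P → V) (l : P) :
    cubeAverage (fun z : (ι → ℝ) × P => v z.2) l = v l := by
  change ∫ _ in Icc (0 : ι → ℝ) 1, v l = v l
  rw [setIntegral_const, volume_real_cube, one_smul]

theorem cubeAverage_add {h g : (ι → ℝ) × P → V} (hh : AnalyticOnNhd ℝ h (univ ×ˢ Λ))
    (hg : AnalyticOnNhd ℝ g (univ ×ˢ Λ)) {l : P} (hl : l ∈ Λ) :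
    cubeAverage (fun z => h z + g z) l = cubeAverage h l + cubeAverage g l :=
  integral_add (integrableOn_cube hh hl) (integrableOn_cube hg hl)

theorem cubeAverage_neg (h : (ι → ℝ) × P → V) (l : P) :
    cubeAverage (fun z => -h z) l = -cubeAverage h l :=
  integral_neg _

theorem cubeAverage_clm {h : (ι → ℝ) × P → V} (hh : AnalyticOnNhd ℝ h (univ ×ˢ Λ))
    (J : P → V →L[ℝ] V') {l : P} (hl : l ∈ Λ) :
    cubeAverage (fun z => J z.2 (h z)) l = J l (cubeAverage h l) :=
  (J l).integral_comp_comm (integrableOn_cube hh hl)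

/-- Averaging is a continuous functional of the bounded function h(·, l), which by periodicity
depends analytically on l in the supremum norm. -/
theorem analyticOnNhd_cubeAverage (hΛ : IsOpen Λ) {h : (ι → ℝ) × P → V}
    (hh : AnalyticOnNhd ℝ h (univ ×ˢ Λ))
    (hper : ∀ x, ∀ l ∈ Λ, ∀ v ∈ integerVectors ι, h (x + v, l) = h (x, l)) :
    AnalyticOnNhd ℝ (cubeAverage h) Λ := by
  obtain ⟨H, hHa, hH⟩ := exists_analytic_translate hΛ hh (fun l hl x q => hper x l hl _ ⟨q, rfl⟩)
  have : IsFiniteMeasure (volume.restrict (Icc (0 : ι → ℝ) 1)) :=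
    isFiniteMeasure_restrict.2 isCompact_Icc.measure_ne_top
  intro l hl
  have h1 : AnalyticAt ℝ (fun l : P => integralBCF V (volume.restrict (Icc (0 : ι → ℝ) 1)) (H (0, l)))
      l := ((integralBCF V _).analyticAt _).fun_comp (AnalyticAt.fun_comp (f := fun l : P => (0, l))
        (hHa (0, l) ⟨trivial, hl⟩) (analyticAt_const.prod analyticAt_id))
  refine h1.congr ?_
  filter_upwards [hΛ.mem_nhds hl] with l' hl'
  rw [integralBCF_apply, cubeAverage]
  refine integral_congr_ae (.of_forall fun s => ?_)
  simp [hH 0 l' hl']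

theorem exists_dirDeriv_eq [FiniteDimensional ℝ V] [FiniteDimensional ℝ P] {Ω : ι → ℝ}
    (hΩ : IsDiophantine Ω)
    (hΛ : IsOpen Λ) {h : (ι → ℝ) × P → V} (hh : AnalyticOnNhd ℝ h (univ ×ˢ Λ))
    (hper : ∀ x, ∀ l ∈ Λ, ∀ v ∈ integerVectors ι, h (x + v, l) = h (x, l))
    (h0 : ∀ l ∈ Λ, cubeAverage h l = 0) :
    ∃ φ : (ι → ℝ) × P → V, AnalyticOnNhd ℝ φ (univ ×ˢ Λ) ∧
      (∀ x, ∀ l ∈ Λ, ∀ v ∈ integerVectors ι, φ (x + v, l) = φ (x, l)) ∧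
      ∀ x, ∀ l ∈ Λ, fderiv ℝ φ (x, l) (Ω, 0) = h (x, l) := by
  let B := Module.finBasis ℝ V
  let co : ∀ i, V →L[ℝ] ℝ := fun i => LinearMap.toContinuousLinearMap (B.coord i)
  have hco : ∀ i v, co i v = B.repr v i := fun i v => rfl
  have hex : ∀ i, ∃ f : (ι → ℝ) × P → ℝ, AnalyticOnNhd ℝ f (univ ×ˢ Λ) ∧
      (∀ l ∈ Λ, ∀ x (q : ι → ℤ), f ((x + fun i => (q i : ℝ)), l) = f (x, l)) ∧
      ∀ x, ∀ l ∈ Λ, fderiv ℝ f (x, l) (Ω, 0) = co i (h (x, l)) := by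
    intro i
    obtain ⟨f, hfa, hfp, hf⟩ := exists_dirDeriv_eq_sub_average hΩ hΛ (h := fun z => co i (h z))
      (fun z hz => ((co i).analyticAt _).fun_comp (hh z hz))
      (fun l hl x q => by rw [hper x l hl _ ⟨q, rfl⟩])
    refine ⟨f, hfa, hfp, fun x l hl => ?_⟩
    have h1 := cubeAverage_clm hh (fun _ => co i) hl
    rw [h0 l hl, map_zero] at h1
    rw [hf x l hl]
    exact (congrArg _ h1).trans (sub_zero _)
  choose f hfa hfp hf using hex
  refine ⟨fun z => ∑ i, f i z • B i, ?_, fun x l hl v hv => ?_, fun x l hl => ?_⟩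
  · intro z hz
    exact Finset.analyticAt_fun_sum _ fun i _ => (hfa i z hz).fun_smul analyticAt_const
  · obtain ⟨q, rfl⟩ := hv
    simp only [hfp _ l hl x q]
  · have h1 : HasFDerivAt (fun z => ∑ i, f i z • B i)
        (∑ i, (fderiv ℝ (f i) (x, l)).smulRight (B i)) (x, l) :=
      HasFDerivAt.fun_sum fun i _ => (hfa i _ ⟨trivial, hl⟩).differentiableAt.hasFDerivAt.smul_const _
    rw [h1.fderiv]
    simp only [_root_.sum_apply, ContinuousLinearMap.smulRight_apply, hf _ x l hl, hco]
    exact B.sum_repr _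

end CubeAverage

end

section

open scoped BoundedContinuousFunction NNReal ENNReal

/-! ### The formal solution, its resonance and the choice of β -/

section FormalSolution

set_option linter.unusedSectionVars false

variable {ι : Type*} [Fintype ι] {P Z : Type*} [NormedAddCommGroup P] [NormedSpace ℝ P]
  [FiniteDimensional ℝ P] [NormedAddCommGroup Z] [NormedSpace ℝ Z] [FiniteDimensional ℝ Z]

/-- The linear map `(ξ, η, ζ) ↦ (2 ξ, (κ + 2) η, e ζ)`. -/
noncomputable def weightMap (κ e : ℕ) (Z : Type*) [NormedAddCommGroup Z] [NormedSpace ℝ Z] :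
    ℝ × ℝ × Z →L[ℝ] ℝ × ℝ × Z :=
  ((2 : ℝ) • ContinuousLinearMap.id ℝ ℝ).prodMap
    (((κ + 2 : ℝ) • ContinuousLinearMap.id ℝ ℝ).prodMap ((e : ℝ) • ContinuousLinearMap.id ℝ Z))

theorem weightMap_apply (κ e : ℕ) (w : ℝ × ℝ × Z) :
    weightMap κ e Z w = (2 * w.1, (κ + 2) * w.2.1, (e : ℝ) • w.2.2) := rfl

/-- A field whose value at `u = 0` is `(c η, a ξ^(κ+1), ξ^p b)`, with leading coefficients
`(1, η₀, ζ₀)` of an invariant manifold of rate `α`. -/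
structure IsBlowUpField (κ p e : ℕ) (Λ : Set P) (c a : (ι → ℝ) × P → ℝ) (b : (ι → ℝ) × P → Z)
    (F : ℝ × (ℝ × ℝ × Z) × (ι → ℝ) × P → ℝ × ℝ × Z) (α η₀ : P → ℝ) (ζ₀ : P → Z) : Prop where
  one_le : 1 ≤ κ
  pos_e : 0 < e
  isOpen : IsOpen Λ
  analytic_c : AnalyticOnNhd ℝ c (univ ×ˢ Λ)
  analytic_a : AnalyticOnNhd ℝ a (univ ×ˢ Λ)
  analytic_b : AnalyticOnNhd ℝ b (univ ×ˢ Λ)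
  periodic_c : ∀ x, ∀ l ∈ Λ, ∀ v ∈ integerVectors ι, c (x + v, l) = c (x, l)
  periodic_a : ∀ x, ∀ l ∈ Λ, ∀ v ∈ integerVectors ι, a (x + v, l) = a (x, l)
  periodic_b : ∀ x, ∀ l ∈ Λ, ∀ v ∈ integerVectors ι, b (x + v, l) = b (x, l)
  analytic_F : ∀ w ϑ, ∀ l ∈ Λ, AnalyticAt ℝ F (0, w, ϑ, l)
  periodic_F : ∀ u w ϑ, ∀ l ∈ Λ, ∀ v ∈ integerVectors ι, F (u, w, ϑ + v, l) = F (u, w, ϑ, l)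
  F_zero : ∀ w ϑ, ∀ l ∈ Λ, F (0, w, ϑ, l) =
    (c (ϑ, l) * w.2.1, a (ϑ, l) * w.1 ^ (κ + 1), w.1 ^ p • b (ϑ, l))
  analytic_α : AnalyticOnNhd ℝ α Λ
  analytic_η₀ : AnalyticOnNhd ℝ η₀ Λ
  analytic_ζ₀ : AnalyticOnNhd ℝ ζ₀ Λ
  pos_c : ∀ l ∈ Λ, 0 < cubeAverage c l
  pos_α : ∀ l ∈ Λ, 0 < α l
  sq_α : ∀ l ∈ Λ, 2 * (κ + 2) * α l ^ 2 = cubeAverage c l * cubeAverage a l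
  eq_η₀ : ∀ l ∈ Λ, cubeAverage c l * η₀ l = -2 * α l
  eq_ζ₀ : ∀ l ∈ Λ, (e * α l) • ζ₀ l = -cubeAverage b l

variable {κ p e : ℕ} {Λ : Set P} {c a : (ι → ℝ) × P → ℝ} {b : (ι → ℝ) × P → Z}
  {F : ℝ × (ℝ × ℝ × Z) × (ι → ℝ) × P → ℝ × ℝ × Z} {α β η₀ : P → ℝ} {ζ₀ : P → Z} {Ω : ι → ℝ}
  {N : ℕ} {W : ℝ × (ι → ℝ) × P → ℝ × ℝ × Z}

namespace IsBlowUpField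

variable (h : IsBlowUpField κ p e Λ c a b F α η₀ ζ₀)
include h

theorem fderiv_F (ϑ : ι → ℝ) {l : P} (hl : l ∈ Λ) (x : ℝ × ℝ × Z) :
    fderiv ℝ (fun w => F (0, w, ϑ, l)) (1, η₀ l, ζ₀ l) x =
      (c (ϑ, l) * x.2.1, (κ + 1) * a (ϑ, l) * x.1, (p * x.1) • b (ϑ, l)) := by
  rw [funext fun w => h.F_zero w ϑ l hl]
  have h1 : HasFDerivAt (fun w : ℝ × ℝ × Z => w.1) (ContinuousLinearMap.fst ℝ ℝ (ℝ × Z))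
    (1, η₀ l, ζ₀ l) := (ContinuousLinearMap.fst ℝ ℝ (ℝ × Z)).hasFDerivAt
  have h2 : HasFDerivAt (fun w : ℝ × ℝ × Z => w.2.1)
    (ContinuousLinearMap.fst ℝ ℝ Z ∘L ContinuousLinearMap.snd ℝ ℝ (ℝ × Z)) (1, η₀ l, ζ₀ l) :=
    (ContinuousLinearMap.fst ℝ ℝ Z ∘L ContinuousLinearMap.snd ℝ ℝ (ℝ × Z)).hasFDerivAt
  have h3 := ((h2.const_mul (c (ϑ, l))).prodMk (((h1.pow (κ + 1)).const_mul (a (ϑ, l))).prodMk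
    ((h1.pow p).smul_const (b (ϑ, l)))))
  have h4 : fderiv ℝ (fun w : ℝ × ℝ × Z => (c (ϑ, l) * w.2.1, a (ϑ, l) * w.1 ^ (κ + 1),
    w.1 ^ p • b (ϑ, l))) (1, η₀ l, ζ₀ l) = _ := h3.fderiv
  rw [h4]
  ext <;> simp
  ring

theorem cubeAverage_affine {l : P} (hl : l ∈ Λ) (r s t : ℝ) (v : ℝ × ℝ × Z) :
    cubeAverage (fun z => (r * c z, s * a z, t • b z) + v) l =
      (r * cubeAverage c l, s * cubeAverage a l, t • cubeAverage b l) + v := by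
  let Jc : ℝ →L[ℝ] ℝ × ℝ × Z := r • ContinuousLinearMap.inl ℝ ℝ (ℝ × Z)
  let Ja : ℝ →L[ℝ] ℝ × ℝ × Z :=
    s • (ContinuousLinearMap.inr ℝ ℝ (ℝ × Z) ∘L ContinuousLinearMap.inl ℝ ℝ Z)
  let Jb : Z →L[ℝ] ℝ × ℝ × Z :=
    t • (ContinuousLinearMap.inr ℝ ℝ (ℝ × Z) ∘L ContinuousLinearMap.inr ℝ ℝ Z)
  have h1 : ∀ (x y : ℝ) (z : Z), ((r * x, s * y, t • z) : ℝ × ℝ × Z) + v =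
      Jc x + (Ja y + (Jb z + v)) := by
    intro x y z
    simp [Jc, Ja, Jb, ← add_assoc]
  have hca : AnalyticOnNhd ℝ (fun z => Jc (c z)) (univ ×ˢ Λ) := fun z hz =>
    (Jc.analyticAt _).fun_comp (h.analytic_c z hz)
  have haa : AnalyticOnNhd ℝ (fun z => Ja (a z)) (univ ×ˢ Λ) := fun z hz =>
    (Ja.analyticAt _).fun_comp (h.analytic_a z hz)
  have hba : AnalyticOnNhd ℝ (fun z => Jb (b z)) (univ ×ˢ Λ) := fun z hz =>
    (Jb.analyticAt _).fun_comp (h.analytic_b z hz)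
  have hva : AnalyticOnNhd ℝ (fun _ : (ι → ℝ) × P => v) (univ ×ˢ Λ) := fun _ _ => analyticAt_const
  have hbv : AnalyticOnNhd ℝ (fun z => Jb (b z) + v) (univ ×ˢ Λ) := fun z hz =>
    (hba z hz).fun_add (hva z hz)
  have hav : AnalyticOnNhd ℝ (fun z => Ja (a z) + (Jb (b z) + v)) (univ ×ˢ Λ) := fun z hz =>
    (haa z hz).fun_add (hbv z hz)
  simp only [h1]
  rw [cubeAverage_add hca hav hl, cubeAverage_add haa hbv hl, cubeAverage_add hba hva hl,
    cubeAverage_clm h.analytic_c (fun _ => Jc) hl, cubeAverage_clm h.analytic_a (fun _ => Ja) hl,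
    cubeAverage_clm h.analytic_b (fun _ => Jb) hl, cubeAverage_const (fun _ => v)]

/-- For W independent of u and ϑ only the right-hand side, of order u^κ, remains. Its leading
coefficient -(F(0, W₀) + α S W₀) has average zero exactly by `sq_α`, `eq_η₀` and `eq_ζ₀`. -/
theorem approximate_zero (hβ : AnalyticOnNhd ℝ β Λ) :
    IsApproximateSolution κ 0 α β (weightMap κ e Z) Ω (integerVectors ι) Λ F
      (fun l => (1, η₀ l, ζ₀ l)) (fun q => (1, η₀ q.2.2, ζ₀ q.2.2)) ∧
    ∀ l ∈ Λ, cubeAverage (leadingResidual κ 0 α β (weightMap κ e Z) Ω F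
      (fun q => (1, η₀ q.2.2, ζ₀ q.2.2))) l = 0 := by
  have hκ := h.one_le
  set S := weightMap κ e Z with hS
  set W₀ : P → ℝ × ℝ × Z := fun l => (1, η₀ l, ζ₀ l) with hW₀
  have hW₀a : AnalyticOnNhd ℝ W₀ Λ := fun l hl =>
    analyticAt_const.prod ((h.analytic_η₀ l hl).prod (h.analytic_ζ₀ l hl))
  have hWa : AnalyticOnNhd ℝ (fun q : ℝ × (ι → ℝ) × P => W₀ q.2.2) (univ ×ˢ univ ×ˢ Λ) :=
    fun q hq => AnalyticAt.fun_comp (f := fun q : ℝ × (ι → ℝ) × P => q.2.2) (hW₀a _ hq.2.2)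
      (analyticAt_snd.fun_comp analyticAt_snd)
  set R := blowUpResidual κ α β S Ω F (fun q : ℝ × (ι → ℝ) × P => W₀ q.2.2) with hR
  have hres : ∀ u ϑ, ∀ l ∈ Λ, R (u, ϑ, l) =
      -(u ^ κ • (F (u, W₀ l, ϑ, l) - (-α l + β l * u ^ κ) • S (W₀ l))) := by
    intro u ϑ l hl
    have h1 : HasFDerivAt (fun q : ℝ × (ι → ℝ) × P => W₀ q.2.2) (fderiv ℝ W₀ l ∘L
        (ContinuousLinearMap.snd ℝ (ι → ℝ) P ∘L ContinuousLinearMap.snd ℝ ℝ ((ι → ℝ) × P)))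
        (u, ϑ, l) :=
      HasFDerivAt.comp (g := W₀) (f := fun q : ℝ × (ι → ℝ) × P => q.2.2) (u, ϑ, l)
        (hW₀a l hl).differentiableAt.hasFDerivAt
        (ContinuousLinearMap.snd ℝ (ι → ℝ) P ∘L
          ContinuousLinearMap.snd ℝ ℝ ((ι → ℝ) × P)).hasFDerivAt
    rw [hR, blowUpResidual, h1.fderiv]
    simp
  have hG : ∀ ϑ, ∀ l ∈ Λ, ContinuousAt
      (fun u : ℝ => F (u, W₀ l, ϑ, l) - (-α l + β l * u ^ κ) • S (W₀ l)) 0 := by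
    intro ϑ l hl
    have h1 : ContinuousAt (fun u : ℝ => F (u, W₀ l, ϑ, l)) 0 :=
      ContinuousAt.comp (f := fun u : ℝ => (u, W₀ l, ϑ, l)) (h.analytic_F _ ϑ l hl).continuousAt
        (by fun_prop)
    exact h1.sub (by fun_prop)
  have hO : ∀ ϑ, ∀ l ∈ Λ, (fun u => R (u, ϑ, l)) =O[𝓝 0] fun u : ℝ => u ^ κ := by
    intro ϑ l hl
    simp only [hres _ ϑ l hl]
    refine IsBigO.neg_left ?_
    simpa using (isBigO_refl (fun u : ℝ => u ^ κ) (𝓝 0)).smul ((hG ϑ l hl).isBigO_one ℝ)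
  refine ⟨⟨hWa, fun _ _ _ _ _ _ => rfl, fun _ _ _ => rfl, fun ϑ l hl => ?_⟩, ?_⟩
  · rw [zero_add]
    exact hO ϑ l hl
  have hlead : ∀ ϑ, ∀ l ∈ Λ, leadingResidual κ 0 α β S Ω F (fun q => W₀ q.2.2) (ϑ, l) =
      -(F (0, W₀ l, ϑ, l) + α l • S (W₀ l)) := by
    intro ϑ l hl
    refine divPow_apply_zero (0 + κ) (D := univ ×ˢ Λ) (isOpen_univ.prod h.isOpen)
      (fun z hz => analyticAt_blowUpResidual h.analytic_α hβ h.analytic_F hWa z.1 hz.2)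
      (fun z hz => ?_) (z := (ϑ, l)) ⟨trivial, hl⟩ ?_
    · rw [zero_add]
      exact (hO z.1 z.2 hz.2).mono nhdsWithin_le_nhds
    · rw [zero_add]
      have h1 := (((hG ϑ l hl).tendsto.mono_left (nhdsWithin_le_nhds (s := {0}ᶜ))).sub_const
        (F (0, W₀ l, ϑ, l) + α l • S (W₀ l))).neg
      simp only [zero_pow (show κ ≠ 0 by omega), mul_zero, add_zero, neg_smul, sub_neg_eq_add,
        sub_self, neg_zero] at h1
      have h2 := (isBigO_refl (fun u : ℝ => u ^ κ) (𝓝[≠] 0)).smul_isLittleO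
        ((isLittleO_one_iff ℝ).2 h1)
      refine IsLittleO.congr h2 (fun u => ?_) (fun u => by simp)
      change _ = R (u, ϑ, l) - _
      rw [hres _ ϑ l hl]
      module
  intro l hl
  have h1 : cubeAverage (leadingResidual κ 0 α β S Ω F (fun q => W₀ q.2.2)) l =
      cubeAverage (fun z => (-η₀ l * c z, (-1 : ℝ) * a z, (-1 : ℝ) • b z) + -(α l • S (W₀ l))) l := by
    refine setIntegral_congr_fun measurableSet_Icc fun s _ => ?_
    rw [hlead s l hl, h.F_zero _ _ l hl]
    simp only [hW₀, Prod.ext_iff]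
    refine ⟨?_, ?_, ?_⟩ <;> simp [add_comm, mul_comm]
  rw [h1, h.cubeAverage_affine hl]
  have h2 := h.eq_η₀ l hl
  have h3 := h.eq_ζ₀ l hl
  have h4 := h.sq_α l hl
  have h5 := (h.pos_c l hl).ne'
  simp only [hW₀, hS, weightMap_apply, Prod.ext_iff]
  refine ⟨?_, ?_, ?_⟩
  · simp
    linear_combination -h2
  · refine mul_left_cancel₀ h5 ?_
    simp only [Prod.snd_add, Prod.fst_add, Prod.snd_neg, Prod.fst_neg, Prod.smul_snd,
      Prod.smul_fst, Prod.snd_zero, Prod.fst_zero, smul_eq_mul]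
    linear_combination h4 - (κ + 2) * α l * h2
  · simp only [Prod.snd_add, Prod.snd_neg, Prod.smul_snd, Prod.snd_zero, smul_smul, neg_smul,
      one_smul, mul_comm (α l), h3]
    abel

theorem analytic_leadingResidual (hβ : AnalyticOnNhd ℝ β Λ)
    (hW : IsApproximateSolution κ N α β (weightMap κ e Z) Ω (integerVectors ι) Λ F
      (fun l => (1, η₀ l, ζ₀ l)) W) :
    AnalyticOnNhd ℝ (leadingResidual κ N α β (weightMap κ e Z) Ω F W) (univ ×ˢ Λ) := fun z hz => by
  have h4 := (analyticAt_divPow (N + κ) (f := blowUpResidual κ α β (weightMap κ e Z) Ω F W)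
    (isOpen_univ.prod h.isOpen)
    (fun z hz => analyticAt_blowUpResidual h.analytic_α hβ h.analytic_F hW.analytic z.1 hz.2)
    (fun z hz => (hW.residual z.1 z.2 hz.2).mono nhdsWithin_le_nhds) hz).1
  exact AnalyticAt.fun_comp (f := fun z : (ι → ℝ) × P => ((0 : ℝ), z)) h4
    (analyticAt_const.prod analyticAt_id)

theorem periodic_leadingResidual
    (hW : IsApproximateSolution κ N α β (weightMap κ e Z) Ω (integerVectors ι) Λ F
      (fun l => (1, η₀ l, ζ₀ l)) W) (x : ι → ℝ) (l : P) (hl : l ∈ Λ) (v : ι → ℝ)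
    (hv : v ∈ integerVectors ι) :
    leadingResidual κ N α β (weightMap κ e Z) Ω F W (x + v, l) =
      leadingResidual κ N α β (weightMap κ e Z) Ω F W (x, l) := by
  have h4 : ∀ u, blowUpResidual κ α β (weightMap κ e Z) Ω F W (u, x + v, l) =
      blowUpResidual κ α β (weightMap κ e Z) Ω F W (u, x, l) := fun u =>
    periodic_blowUpResidual h.isOpen h.periodic_F hW.periodic u x hl hv
  simp only [leadingResidual, divPow, h4]

/-- `h1`, `h2` and `h3` are the components of the averaged condition in
`IsApproximateSolution.step`. Under them the equation for φ has a right-hand side of average zero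
and the small divisor equation can be solved. -/
theorem exists_step (hΩ : IsDiophantine Ω) (hβ : AnalyticOnNhd ℝ β Λ)
    (hW : IsApproximateSolution κ N α β (weightMap κ e Z) Ω (integerVectors ι) Λ F
      (fun l => (1, η₀ l, ζ₀ l)) W) {X₁ X₂ γ : P → ℝ} {X₃ : P → Z}
    (hX₁ : AnalyticOnNhd ℝ X₁ Λ) (hX₂ : AnalyticOnNhd ℝ X₂ Λ) (hX₃ : AnalyticOnNhd ℝ X₃ Λ)
    (hγ : AnalyticOnNhd ℝ γ Λ) (hX0 : N = 0 → ∀ l ∈ Λ, X₁ l = 0 ∧ X₂ l = 0 ∧ X₃ l = 0)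
    (hγ0 : N ≠ κ → ∀ l ∈ Λ, γ l = 0) {E : P → ℝ × ℝ × Z}
    (hE : ∀ l ∈ Λ, cubeAverage (leadingResidual κ N α β (weightMap κ e Z) Ω F W) l = E l)
    (h1 : ∀ l ∈ Λ, α l * (N + 2) * X₁ l + cubeAverage c l * X₂ l = (E l).1 + 2 * γ l)
    (h2 : ∀ l ∈ Λ, α l * (N + κ + 2) * X₂ l + (κ + 1) * cubeAverage a l * X₁ l =
      (E l).2.1 + (κ + 2) * η₀ l * γ l)
    (h3 : ∀ l ∈ Λ, (α l * (N + e)) • X₃ l + (p * X₁ l) • cubeAverage b l =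
      (E l).2.2 + (e * γ l) • ζ₀ l) :
    ∃ W', IsApproximateSolution κ (N + 1) α (fun l => β l + γ l) (weightMap κ e Z) Ω
      (integerVectors ι) Λ F (fun l => (1, η₀ l, ζ₀ l)) W' := by
  have hκ := h.one_le
  set S := weightMap κ e Z with hS
  set E' := leadingResidual κ N α β S Ω F W with hE'
  have hE'a : AnalyticOnNhd ℝ E' (univ ×ˢ Λ) := h.analytic_leadingResidual hβ hW
  have hE'p : ∀ x, ∀ l ∈ Λ, ∀ v ∈ integerVectors ι, E' (x + v, l) = E' (x, l) :=
    h.periodic_leadingResidual hW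
  set X : P → ℝ × ℝ × Z := fun l => (X₁ l, X₂ l, X₃ l) with hXdef
  set W₀ : P → ℝ × ℝ × Z := fun l => (1, η₀ l, ζ₀ l) with hW₀
  have hXa : AnalyticOnNhd ℝ X Λ := fun l hl => (hX₁ l hl).prod ((hX₂ l hl).prod (hX₃ l hl))
  have hW₀a : AnalyticOnNhd ℝ W₀ Λ := fun l hl =>
    analyticAt_const.prod ((h.analytic_η₀ l hl).prod (h.analytic_ζ₀ l hl))
  set v₀ : P → ℝ × ℝ × Z := fun l =>
    (α l * N) • X l + α l • S (X l) - γ l • S (W₀ l) with hv₀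
  have hv₀a : AnalyticOnNhd ℝ v₀ Λ := fun l hl =>
    ((((h.analytic_α l hl).fun_mul analyticAt_const).fun_smul (hXa l hl)).fun_add
      ((h.analytic_α l hl).fun_smul ((S.analyticAt _).fun_comp (hXa l hl)))).fun_sub
      ((hγ l hl).fun_smul ((S.analyticAt _).fun_comp (hW₀a l hl)))
  have hsnd : ∀ {f : P → ℝ}, AnalyticOnNhd ℝ f Λ →
      AnalyticOnNhd ℝ (fun z : (ι → ℝ) × P => f z.2) (univ ×ˢ Λ) := fun hf z hz =>
    AnalyticAt.fun_comp (f := Prod.snd) (hf _ hz.2) analyticAt_snd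
  set H' : (ι → ℝ) × P → ℝ × ℝ × Z := fun z =>
    (X₂ z.2 * c z, ((κ + 1) * X₁ z.2) * a z, (p * X₁ z.2) • b z) + v₀ z.2 with hH'
  have hH'a : AnalyticOnNhd ℝ H' (univ ×ˢ Λ) := fun z hz =>
    ((((hsnd hX₂) z hz).fun_mul (h.analytic_c z hz)).prod
      (((analyticAt_const.fun_mul ((hsnd hX₁) z hz)).fun_mul (h.analytic_a z hz)).prod
      ((analyticAt_const.fun_mul ((hsnd hX₁) z hz)).fun_smul (h.analytic_b z hz)))).fun_add
      (AnalyticAt.fun_comp (f := Prod.snd) (hv₀a _ hz.2) analyticAt_snd)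
  have hav : ∀ l ∈ Λ, cubeAverage (fun z => -E' z + H' z) l = 0 := by
    intro l hl
    have h4 : cubeAverage H' l = (X₂ l * cubeAverage c l, ((κ + 1) * X₁ l) * cubeAverage a l,
        (p * X₁ l) • cubeAverage b l) + v₀ l :=
      h.cubeAverage_affine hl (X₂ l) ((κ + 1) * X₁ l) (p * X₁ l) (v₀ l)
    rw [cubeAverage_add (fun z hz => (hE'a z hz).fun_neg) hH'a hl, cubeAverage_neg, hE l hl, h4]
    have h5 := h1 l hl
    have h6 := h2 l hl
    have h7 := h3 l hl
    simp only [hv₀, hXdef, hW₀, hS, weightMap_apply, Prod.ext_iff]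
    refine ⟨?_, ?_, ?_⟩
    · simp
      linear_combination h5
    · simp
      linear_combination h6
    · simp
      linear_combination (norm := module) h7
  obtain ⟨φ, hφa, hφp, hφ⟩ := exists_dirDeriv_eq hΩ h.isOpen (h := fun z => -E' z + H' z)
    (fun z hz => (hE'a z hz).fun_neg.fun_add (hH'a z hz))
    (fun x l hl v hv => by
      simp only [hH', hE'p x l hl v hv, h.periodic_c x l hl v hv, h.periodic_a x l hl v hv,
        h.periodic_b x l hl v hv]) hav
  refine ⟨_, hW.step hκ h.isOpen h.analytic_α hβ h.analytic_F hXa hγ hφa hφp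
    (fun hN l hl => ?_) hγ0 fun ϑ l hl => ?_⟩
  · simp only [hXdef, hX0 hN l hl]
    rfl
  · rw [hφ ϑ l hl, h.fderiv_F ϑ hl]
    have h4 : H' (ϑ, l) = (c (ϑ, l) * (X l).2.1, (κ + 1) * a (ϑ, l) * (X l).1,
        (p * (X l).1) • b (ϑ, l)) + v₀ l := by
      simp only [hH', hXdef]
      congr 2
      · ring
      · congr 1
        ring
    simp only [h4, hv₀]
    abel

/-- The averages of the leading residual depend analytically on the parameter. -/
theorem analytic_average (hβ : AnalyticOnNhd ℝ β Λ)
    (hW : IsApproximateSolution κ N α β (weightMap κ e Z) Ω (integerVectors ι) Λ F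
      (fun l => (1, η₀ l, ζ₀ l)) W) :
    AnalyticOnNhd ℝ (cubeAverage (leadingResidual κ N α β (weightMap κ e Z) Ω F W)) Λ :=
  analyticOnNhd_cubeAverage h.isOpen (h.analytic_leadingResidual hβ hW)
    (h.periodic_leadingResidual hW)

/-- Away from the resonance the averaged system is invertible: first X₁ and X₂ by Cramer's rule,
then X₃. At N = 0 the vanishing average gives X = 0, as the correction step requires. -/
theorem exists_step_of_ne (hΩ : IsDiophantine Ω) (hβ : AnalyticOnNhd ℝ β Λ) (hN : N ≠ κ)
    (hW : IsApproximateSolution κ N α β (weightMap κ e Z) Ω (integerVectors ι) Λ F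
      (fun l => (1, η₀ l, ζ₀ l)) W)
    (h0 : N = 0 → ∀ l ∈ Λ, cubeAverage (leadingResidual κ N α β (weightMap κ e Z) Ω F W) l = 0) :
    ∃ W', IsApproximateSolution κ (N + 1) α β (weightMap κ e Z) Ω
      (integerVectors ι) Λ F (fun l => (1, η₀ l, ζ₀ l)) W' := by
  set E := cubeAverage (leadingResidual κ N α β (weightMap κ e Z) Ω F W) with hE
  have hEa : AnalyticOnNhd ℝ E Λ := h.analytic_average hβ hW
  have hαa := h.analytic_α
  have hca := analyticOnNhd_cubeAverage h.isOpen h.analytic_c h.periodic_c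
  have haa := analyticOnNhd_cubeAverage h.isOpen h.analytic_a h.periodic_a
  have hba := analyticOnNhd_cubeAverage h.isOpen h.analytic_b h.periodic_b
  have hN' : (N : ℝ) - κ ≠ 0 := sub_ne_zero.2 (by exact_mod_cast hN)
  have hE1 : AnalyticOnNhd ℝ (fun l => (E l).1) Λ := fun l hl => analyticAt_fst.fun_comp (hEa l hl)
  have hE2 : AnalyticOnNhd ℝ (fun l => (E l).2.1) Λ := fun l hl =>
    analyticAt_fst.fun_comp (analyticAt_snd.fun_comp (hEa l hl))
  have hE3 : AnalyticOnNhd ℝ (fun l => (E l).2.2) Λ := fun l hl =>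
    analyticAt_snd.fun_comp (analyticAt_snd.fun_comp (hEa l hl))
  -- The (X₁, X₂) block has determinant α² (N + 2)(N + κ + 2) minus (κ + 1) times the product of the
  -- averages of c and a. By `sq_α` that product is 2 (κ + 2) α², and the expression factors.
  obtain ⟨det, hdet⟩ : ∃ det : P → ℝ, ∀ l, det l = α l ^ 2 * ((N - κ) * (N + 2 * κ + 4)) :=
    ⟨_, fun l => rfl⟩
  have hdet0 : ∀ l ∈ Λ, det l ≠ 0 := fun l hl => by
    rw [hdet]
    exact mul_ne_zero (pow_ne_zero 2 (h.pos_α l hl).ne') (mul_ne_zero hN' (by positivity))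
  have hdeta : AnalyticOnNhd ℝ det Λ := fun l hl => by
    rw [funext hdet]
    exact ((hαa l hl).fun_pow 2).fun_mul analyticAt_const
  obtain ⟨X₁, hX₁⟩ : ∃ X₁ : P → ℝ, ∀ l, X₁ l =
      (α l * (N + κ + 2) * (E l).1 - cubeAverage c l * (E l).2.1) / det l := ⟨_, fun l => rfl⟩
  have hX₁a : AnalyticOnNhd ℝ X₁ Λ := fun l hl => by
    rw [funext hX₁]
    exact ((((hαa l hl).fun_mul analyticAt_const).fun_mul (hE1 l hl)).fun_sub
      ((hca l hl).fun_mul (hE2 l hl))).fun_div (hdeta l hl) (hdet0 l hl)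
  obtain ⟨X₂, hX₂⟩ : ∃ X₂ : P → ℝ, ∀ l, X₂ l =
      (α l * (N + 2) * (E l).2.1 - (κ + 1) * cubeAverage a l * (E l).1) / det l := ⟨_, fun l => rfl⟩
  have hX₂a : AnalyticOnNhd ℝ X₂ Λ := fun l hl => by
    rw [funext hX₂]
    exact ((((hαa l hl).fun_mul analyticAt_const).fun_mul (hE2 l hl)).fun_sub
      ((analyticAt_const.fun_mul (haa l hl)).fun_mul (hE1 l hl))).fun_div (hdeta l hl) (hdet0 l hl)
  obtain ⟨X₃, hX₃⟩ : ∃ X₃ : P → Z, ∀ l, X₃ l =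
      (α l * (N + e))⁻¹ • ((E l).2.2 - (p * X₁ l) • cubeAverage b l) := ⟨_, fun l => rfl⟩
  have he : (N : ℝ) + e ≠ 0 := by
    have := h.pos_e
    positivity
  have hX₃a : AnalyticOnNhd ℝ X₃ Λ := fun l hl => by
    rw [funext hX₃]
    exact (((hαa l hl).fun_mul analyticAt_const).fun_inv
      (mul_ne_zero (h.pos_α l hl).ne' he)).fun_smul ((hE3 l hl).fun_sub
        ((analyticAt_const.fun_mul (hX₁a l hl)).fun_smul (hba l hl)))
  have hstep := h.exists_step hΩ hβ hW hX₁a hX₂a hX₃a (γ := fun _ => 0)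
    (fun _ _ => analyticAt_const) (fun hN0 l hl => ?_) (fun _ _ _ => rfl) (E := E)
    (fun _ _ => rfl) (fun l hl => ?_) (fun l hl => ?_) (fun l hl => ?_)
  · simpa using hstep
  · have h1 : X₁ l = 0 := by simp [hX₁, h0 hN0 l hl]
    refine ⟨h1, ?_, ?_⟩
    · simp [hX₂, h0 hN0 l hl]
    · simp [hX₃, h0 hN0 l hl, h1]
  · have h1 := hdet0 l hl
    have h2 := h.sq_α l hl
    rw [hX₁, hX₂, ← mul_div_assoc, ← mul_div_assoc, ← add_div, div_eq_iff h1, hdet]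
    linear_combination (κ + 1) * (E l).1 * h2
  · have h1 := hdet0 l hl
    have h2 := h.sq_α l hl
    rw [hX₁, hX₂, ← mul_div_assoc, ← mul_div_assoc, ← add_div, div_eq_iff h1, hdet]
    linear_combination (κ + 1) * (E l).2.1 * h2
  · rw [hX₃, smul_inv_smul₀ (mul_ne_zero (h.pos_α l hl).ne' he)]
    simp

/-- For N = κ the (X₁, X₂) block is singular. Setting X₁ = 0 and taking γ as an unknown instead
restores solvability. -/
theorem exists_step_resonant (hΩ : IsDiophantine Ω) (hβ : AnalyticOnNhd ℝ β Λ)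
    (hW : IsApproximateSolution κ κ α β (weightMap κ e Z) Ω (integerVectors ι) Λ F
      (fun l => (1, η₀ l, ζ₀ l)) W) :
    ∃ β', AnalyticOnNhd ℝ β' Λ ∧ ∃ W', IsApproximateSolution κ (κ + 1) α β' (weightMap κ e Z) Ω
      (integerVectors ι) Λ F (fun l => (1, η₀ l, ζ₀ l)) W' := by
  set E := cubeAverage (leadingResidual κ κ α β (weightMap κ e Z) Ω F W) with hE
  have hEa : AnalyticOnNhd ℝ E Λ := h.analytic_average hβ hW
  have hκ := h.one_le
  have hαa := h.analytic_α
  have hca := analyticOnNhd_cubeAverage h.isOpen h.analytic_c h.periodic_c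
  have hE1 : AnalyticOnNhd ℝ (fun l => (E l).1) Λ := fun l hl => analyticAt_fst.fun_comp (hEa l hl)
  have hE2 : AnalyticOnNhd ℝ (fun l => (E l).2.1) Λ := fun l hl =>
    analyticAt_fst.fun_comp (analyticAt_snd.fun_comp (hEa l hl))
  have hE3 : AnalyticOnNhd ℝ (fun l => (E l).2.2) Λ := fun l hl =>
    analyticAt_snd.fun_comp (analyticAt_snd.fun_comp (hEa l hl))
  have hκ' : (6 * κ + 8 : ℝ) ≠ 0 := by positivity
  have he : (κ : ℝ) + e ≠ 0 := by
    have := h.pos_e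
    positivity
  -- Eliminating X₂ from the two equations, with `eq_η₀`, leaves γ with the factor α (6κ + 8), which
  -- is not zero.
  obtain ⟨γ, hγ⟩ : ∃ γ : P → ℝ, ∀ l, γ l =
      (cubeAverage c l * (E l).2.1 - 2 * (κ + 1) * α l * (E l).1) / (α l * (6 * κ + 8)) :=
    ⟨_, fun l => rfl⟩
  have hγa : AnalyticOnNhd ℝ γ Λ := fun l hl => by
    rw [funext hγ]
    exact (((hca l hl).fun_mul (hE2 l hl)).fun_sub
      ((analyticAt_const.fun_mul (hαa l hl)).fun_mul (hE1 l hl))).fun_div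
      ((hαa l hl).fun_mul analyticAt_const) (mul_ne_zero (h.pos_α l hl).ne' hκ')
  obtain ⟨X₂, hX₂⟩ : ∃ X₂ : P → ℝ, ∀ l, X₂ l = ((E l).1 + 2 * γ l) / cubeAverage c l :=
    ⟨_, fun l => rfl⟩
  have hX₂a : AnalyticOnNhd ℝ X₂ Λ := fun l hl => by
    rw [funext hX₂]
    exact ((hE1 l hl).fun_add (analyticAt_const.fun_mul (hγa l hl))).fun_div (hca l hl)
      (h.pos_c l hl).ne'
  obtain ⟨X₃, hX₃⟩ : ∃ X₃ : P → Z, ∀ l, X₃ l =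
      (α l * (κ + e))⁻¹ • ((E l).2.2 + (e * γ l) • ζ₀ l) := ⟨_, fun l => rfl⟩
  have hX₃a : AnalyticOnNhd ℝ X₃ Λ := fun l hl => by
    rw [funext hX₃]
    exact (((hαa l hl).fun_mul analyticAt_const).fun_inv
      (mul_ne_zero (h.pos_α l hl).ne' he)).fun_smul ((hE3 l hl).fun_add
        ((analyticAt_const.fun_mul (hγa l hl)).fun_smul (h.analytic_ζ₀ l hl)))
  refine ⟨fun l => β l + γ l, fun l hl => (hβ l hl).fun_add (hγa l hl),
    h.exists_step hΩ hβ hW (X₁ := fun _ => 0) (fun _ _ => analyticAt_const) hX₂a hX₃a hγa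
    (fun hN0 => by omega) (fun hN => absurd rfl hN) (E := E)
    (fun _ _ => rfl) (fun l hl => ?_) (fun l hl => ?_) (fun l hl => ?_)⟩
  · have h1 := (h.pos_c l hl).ne'
    rw [hX₂, mul_zero, zero_add, mul_div_cancel₀ _ h1]
  · have h1 := (h.pos_c l hl).ne'
    have h2 : γ l * (α l * (6 * κ + 8)) =
        cubeAverage c l * (E l).2.1 - 2 * (κ + 1) * α l * (E l).1 := by
      rw [hγ, div_mul_cancel₀]
      exact mul_ne_zero (h.pos_α l hl).ne' hκ'
    have h3 := h.eq_η₀ l hl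
    rw [hX₂, mul_zero, add_zero, ← mul_div_assoc, div_eq_iff h1]
    linear_combination h2 - (κ + 2) * γ l * h3
  · rw [hX₃, smul_inv_smul₀ (mul_ne_zero (h.pos_α l hl).ne' he)]
    simp

/-- Approximate solutions of all orders, with the same coefficient `β`. -/
theorem exists_isApproximateSolution (hΩ : IsDiophantine Ω) :
    ∃ β, AnalyticOnNhd ℝ β Λ ∧ ∀ N, κ + 1 ≤ N →
      ∃ W, IsApproximateSolution κ N α β (weightMap κ e Z) Ω
        (integerVectors ι) Λ F (fun l => (1, η₀ l, ζ₀ l)) W := by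
  have hκ := h.one_le
  have hz : AnalyticOnNhd ℝ (fun _ : P => (0 : ℝ)) Λ := fun _ _ => analyticAt_const
  have h1 : ∀ N, N + 1 ≤ κ → ∃ W, IsApproximateSolution κ (N + 1) α (fun _ => 0)
      (weightMap κ e Z) Ω (integerVectors ι) Λ F (fun l => (1, η₀ l, ζ₀ l)) W := by
    intro N
    induction N with
    | zero =>
      intro _
      have h2 := h.approximate_zero (Ω := Ω) hz
      exact h.exists_step_of_ne hΩ hz (by omega) h2.1 (fun _ => h2.2)
    | succ N ih =>
      intro hN
      obtain ⟨W, hW⟩ := ih (by omega)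
      exact h.exists_step_of_ne hΩ hz (by omega) hW (fun h0 => by omega)
  obtain ⟨j, rfl⟩ : ∃ j, κ = j + 1 := ⟨κ - 1, by omega⟩
  obtain ⟨W, hW⟩ := h1 j le_rfl
  -- β is fixed here and no later step changes it, so the approximations of all higher orders share
  -- one field Y.
  obtain ⟨β, hβ, W', hW'⟩ := h.exists_step_resonant hΩ hz hW
  refine ⟨β, hβ, fun N hN => ?_⟩
  induction N, hN using Nat.le_induction with
  | base => exact ⟨W', hW'⟩
  | succ N hN ih =>
    obtain ⟨W, hW⟩ := ih
    exact h.exists_step_of_ne hΩ hβ (by omega) hW (fun h0 => by omega)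

end IsBlowUpField

end FormalSolution

end

section

open scoped BoundedContinuousFunction NNReal ENNReal

/-! ### From approximate to exact solutions -/

section ExactSolution

set_option linter.unusedSectionVars false

theorem fderiv_add_of_eventuallyEq {E V : Type*} [NormedAddCommGroup E] [NormedSpace ℝ E]
    [NormedAddCommGroup V] [NormedSpace ℝ V] {f : E → V} {q w : E}
    (hf : ∀ᶠ q' in 𝓝 q, f (q' + w) = f q') : fderiv ℝ f (q + w) = fderiv ℝ f q := by
  rw [← fderiv_comp_add_right]
  exact Filter.EventuallyEq.fderiv_eq hf

variable {V Θ P : Type*} [NormedAddCommGroup V] [NormedSpace ℝ V] [CompleteSpace V]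
  [NormedAddCommGroup Θ] [NormedSpace ℝ Θ] [CompleteSpace Θ]
  [NormedAddCommGroup P] [NormedSpace ℝ P] [CompleteSpace P]
  {κ : ℕ} {α β : P → ℝ} {S : V →L[ℝ] V} {Ω : Θ} {Γ D₀ : Set Θ} {Λ K : Set P}
  {F : ℝ × V × Θ × P → V} {W₀ : P → V}

/-- A Lipschitz constant near `(0, W₀ l, ϑ, l)`, uniform in `ϑ` and in `l` in a compact set. -/
theorem exists_uniform_lipschitz (hΛ : IsOpen Λ) (hK : IsCompact K) (hKΛ : K ⊆ Λ)
    (hD₀ : IsCompact D₀) (hΓ : ∀ ϑ, ∃ x ∈ D₀, ∃ v ∈ Γ, ϑ = x + v) {G : ℝ × V × Θ × P → V}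
    (hG : ∀ w ϑ, ∀ l ∈ Λ, AnalyticAt ℝ G (0, w, ϑ, l))
    (hper : ∀ u w ϑ, ∀ l ∈ Λ, ∀ v ∈ Γ, G (u, w, ϑ + v, l) = G (u, w, ϑ, l))
    (hW₀ : ContinuousOn W₀ Λ) :
    ∃ M₀ : ℝ, 0 ≤ M₀ ∧ ∀ ϑ, ∀ l ∈ K, ∀ᶠ q : (ℝ × V × Θ × P) × (ℝ × V × Θ × P) in
      𝓝 ((0, W₀ l, ϑ, l), (0, W₀ l, ϑ, l)), ‖G q.1 - G q.2‖ ≤ M₀ * ‖q.1 - q.2‖ := by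
  have hcont : ContinuousOn (fun z : Θ × P => fderiv ℝ G (0, W₀ z.2, z)) (D₀ ×ˢ K) := by
    rintro ⟨ϑ, l⟩ ⟨-, hl⟩
    have h1 : ContinuousWithinAt (fun z : Θ × P => ((0 : ℝ), W₀ z.2, z)) (D₀ ×ˢ K) (ϑ, l) := by
      refine continuousWithinAt_const.prodMk (ContinuousWithinAt.prodMk ?_ continuousWithinAt_id)
      exact ContinuousWithinAt.comp (f := Prod.snd) ((hW₀ l (hKΛ hl)).mono hKΛ)
        continuousWithinAt_snd (fun z hz => hz.2)
    exact ContinuousAt.comp_continuousWithinAt (f := fun z : Θ × P => ((0 : ℝ), W₀ z.2, z))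
      (hG (W₀ l) ϑ l (hKΛ hl)).fderiv.continuousAt h1
  obtain ⟨M, hM⟩ := (hD₀.prod hK).exists_bound_of_continuousOn hcont
  -- The bound comes from the derivative at (0, W₀ l, ϑ, l) alone, plus 1 for the error of strict
  -- differentiability. It does not depend on the order of any approximate solution.
  refine ⟨max M 0 + 1, by positivity, fun ϑ l hl => ?_⟩
  have h1 : ‖fderiv ℝ G (0, W₀ l, ϑ, l)‖ ≤ M := by
    obtain ⟨x, hx, v, hv, rfl⟩ := hΓ ϑ
    have h2 := hM (x, l) ⟨hx, hl⟩
    have h3 : (0, W₀ l, x + v, l) = (0, W₀ l, x, l) + ((0 : ℝ), (0 : V), v, (0 : P)) := by simp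
    have h4 : fderiv ℝ G (0, W₀ l, x + v, l) = fderiv ℝ G (0, W₀ l, x, l) := by
      rw [h3]
      refine fderiv_add_of_eventuallyEq ?_
      filter_upwards [(isOpen_univ.prod (isOpen_univ.prod (isOpen_univ.prod hΛ))).mem_nhds
        (show (0, W₀ l, x, l) ∈ (univ : Set ℝ) ×ˢ (univ : Set V) ×ˢ (univ : Set Θ) ×ˢ Λ from
          ⟨trivial, trivial, trivial, hKΛ hl⟩)] with q hq
      have h5 : q + ((0 : ℝ), (0 : V), v, (0 : P)) = (q.1, q.2.1, q.2.2.1 + v, q.2.2.2) := by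
        ext <;> simp
      rw [h5, hper _ _ _ _ hq.2.2.2 v hv]
    rw [h4]
    exact h2
  have h2 := (hG (W₀ l) ϑ l (hKΛ hl)).hasStrictFDerivAt.isLittleO.def one_pos
  filter_upwards [h2] with q hq
  have h3 := norm_sub_norm_le (G q.1 - G q.2) (fderiv ℝ G (0, W₀ l, ϑ, l) (q.1 - q.2))
  have h4 : ‖fderiv ℝ G (0, W₀ l, ϑ, l) (q.1 - q.2)‖ ≤ max M 0 * ‖q.1 - q.2‖ :=
    (ContinuousLinearMap.le_opNorm _ _).trans
      (mul_le_mul_of_nonneg_right (h1.trans (le_max_left _ _)) (norm_nonneg _))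
  linarith

/-- An approximate solution is close to its value at `u = 0`. -/
theorem IsApproximateSolution.exists_bound {N : ℕ} {W : ℝ × Θ × P → V}
    (hW : IsApproximateSolution κ N α β S Ω Γ Λ F W₀ W) (hK : IsCompact K) (hKΛ : K ⊆ Λ)
    (hD₀ : IsCompact D₀) (hΓ : ∀ ϑ, ∃ x ∈ D₀, ∃ v ∈ Γ, ϑ = x + v) :
    ∃ C : ℝ, 0 ≤ C ∧ ∀ u ∈ Icc (0 : ℝ) 1, ∀ ϑ, ∀ l ∈ K, ‖W (u, ϑ, l) - W₀ l‖ ≤ C * u := by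
  have hcont : ContinuousOn (fun q => fderiv ℝ W q (1, 0, 0)) (Icc (0 : ℝ) 1 ×ˢ D₀ ×ˢ K) :=
    fun q hq => ((hW.analytic q ⟨trivial, trivial, hKΛ hq.2.2⟩).fderiv.continuousAt.clm_apply
      continuousAt_const).continuousWithinAt
  obtain ⟨C, hC⟩ := (isCompact_Icc.prod (hD₀.prod hK)).exists_bound_of_continuousOn hcont
  refine ⟨max C 0, le_max_right _ _, fun u hu ϑ l hl => ?_⟩
  obtain ⟨x, hx, v, hv, rfl⟩ := hΓ ϑ
  rw [hW.periodic u x l (hKΛ hl) v hv, ← hW.zero x l (hKΛ hl)]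
  have hd : ∀ s ∈ Icc (0 : ℝ) 1, HasDerivWithinAt (fun s : ℝ => W (s, x, l))
      (fderiv ℝ W (s, x, l) (1, 0, 0)) (Icc 0 1) s := by
    intro s _
    have h1 : HasFDerivAt W (fderiv ℝ W (s, x, l)) (s, x, l) :=
      (hW.analytic (s, x, l) ⟨trivial, trivial, hKΛ hl⟩).differentiableAt.hasFDerivAt
    have h2 : HasDerivAt (fun s : ℝ => (s, x, l)) ((1 : ℝ), (0 : Θ), (0 : P)) s :=
      (hasDerivAt_id s).prodMk (hasDerivAt_const s (x, l))
    exact (HasFDerivAt.comp_hasDerivAt (f := fun s : ℝ => (s, x, l)) s h1 h2).hasDerivWithinAt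
  have h3 := (convex_Icc (0 : ℝ) 1).norm_image_sub_le_of_norm_hasDerivWithin_le hd
    (fun s hs => (hC (s, x, l) ⟨hs, hx, hl⟩).trans (le_max_left C 0))
    (left_mem_Icc.2 zero_le_one) hu
  simpa [abs_of_nonneg hu.1] using h3

variable [ProperSpace V] [FiniteDimensional ℝ P]

/-- The order of the choices is essential: c comes from the slow equation and M₀ from the field at u
= 0, so M with 2 M₀ ≤ c M can be chosen before the approximate solution W of order κM. The
correction D then solves the remainder equation for R(u, D) = u^κ G(u, W + D) minus the derivative
of W along the field. Here R(u, 0) is minus the residual of W, so it has the required order. -/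
theorem exists_exactSolution (hκ : 1 ≤ κ) (hΛ : IsOpen Λ) (hα : AnalyticOnNhd ℝ α Λ)
    (hβ : AnalyticOnNhd ℝ β Λ) (hα0 : ∀ l ∈ Λ, 0 < α l)
    (hF : ∀ w ϑ, ∀ l ∈ Λ, AnalyticAt ℝ F (0, w, ϑ, l))
    (hper : ∀ u w ϑ, ∀ l ∈ Λ, ∀ v ∈ Γ, F (u, w, ϑ + v, l) = F (u, w, ϑ, l))
    (hD₀ : IsCompact D₀) (hΓ : ∀ ϑ, ∃ x ∈ D₀, ∃ v ∈ Γ, ϑ = x + v)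
    (happrox : ∀ N, κ + 1 ≤ N → ∃ W, IsApproximateSolution κ N α β S Ω Γ Λ F W₀ W)
    {L : Set P} (hL : IsCompact L) (hLΛ : L ⊆ Λ) :
    ∃ (Λ' : Set P) (ρ C : ℝ) (W : ℝ × Θ × P → V), IsOpen Λ' ∧ L ⊆ Λ' ∧
      (∃ K, IsCompact K ∧ Λ' ⊆ K ∧ K ⊆ Λ) ∧ 0 < ρ ∧ 0 ≤ C ∧
      AnalyticOnNhd ℝ W (Ioo 0 ρ ×ˢ univ ×ˢ Λ') ∧
      ContDiffOn ℝ 1 W (Iio ρ ×ˢ univ ×ˢ Λ') ∧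
      (∀ u ∈ Ico 0 ρ, ∀ ϑ, ∀ l ∈ Λ', ‖W (u, ϑ, l) - W₀ l‖ ≤ C * u) ∧
      (∀ u ∈ Iio ρ, ∀ ϑ, ∀ l ∈ Λ', ∀ v ∈ Γ, W (u, ϑ + v, l) = W (u, ϑ, l)) ∧
      ∀ u ∈ Ioo 0 ρ, ∀ ϑ, ∀ l ∈ Λ', blowUpResidual κ α β S Ω F W (u, ϑ, l) = 0 := by
  -- Nested neighbourhoods of L: the remainder equation is posed over the interior of K₁, solved
  -- over the interior of K₂ and estimated uniformly on K₃.
  obtain ⟨K₁, hK₁, hLK₁, hK₁Λ⟩ := exists_compact_between hL hΛ hLΛ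
  obtain ⟨K₂, hK₂, hLK₂, hK₂₁⟩ := exists_compact_between hL isOpen_interior hLK₁
  obtain ⟨K₃, hK₃, hLK₃, hK₃₂⟩ := exists_compact_between hL isOpen_interior hLK₂
  have hcl : closure (interior K₂) ⊆ K₂ := hK₂.isClosed.closure_subset_iff.2 interior_subset
  have hi₁ : interior K₁ ⊆ Λ := interior_subset.trans hK₁Λ
  have hK₃Λ : K₃ ⊆ Λ := hK₃₂.trans (interior_subset.trans (hK₂₁.trans hi₁))
  obtain ⟨c, hc0, hsol⟩ := exists_invariantRemainder (V := V) (Λ := interior K₂)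
    (Λ₀ := interior K₁) isOpen_interior isOpen_interior
    (hK₂.of_isClosed_subset isClosed_closure hcl) (hcl.trans hK₂₁) hK₃ hK₃₂ (hα.mono hi₁)
    (hβ.mono hi₁) (fun l hl => hα0 l (hi₁ hl)) hκ hD₀ hΓ Ω
  obtain ⟨G, hG⟩ : ∃ G : ℝ × V × Θ × P → V, ∀ q, G q =
      F q - (-α q.2.2.2 + β q.2.2.2 * q.1 ^ κ) • S q.2.1 := ⟨_, fun q => rfl⟩
  have hl4 : ∀ q₀ : ℝ × V × Θ × P, AnalyticAt ℝ (fun q : ℝ × V × Θ × P => q.2.2.2) q₀ := fun q₀ =>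
    analyticAt_snd.fun_comp (analyticAt_snd.fun_comp analyticAt_snd)
  have hy : ∀ q₀ : ℝ × V × Θ × P, q₀.2.2.2 ∈ Λ → AnalyticAt ℝ
      (fun q : ℝ × V × Θ × P => -α q.2.2.2 + β q.2.2.2 * q.1 ^ κ) q₀ := fun q₀ hq₀ =>
    (AnalyticAt.fun_comp (f := fun q : ℝ × V × Θ × P => q.2.2.2) (hα _ hq₀) (hl4 q₀)).fun_neg.fun_add
      ((AnalyticAt.fun_comp (f := fun q : ℝ × V × Θ × P => q.2.2.2) (hβ _ hq₀) (hl4 q₀)).fun_mul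
        (analyticAt_fst.fun_pow κ))
  have hGa : ∀ w ϑ, ∀ l ∈ Λ, AnalyticAt ℝ G (0, w, ϑ, l) := fun w ϑ l hl => by
    rw [funext hG]
    exact (hF w ϑ l hl).fun_sub ((hy (0, w, ϑ, l) hl).fun_smul
      ((S.analyticAt _).fun_comp (analyticAt_fst.fun_comp analyticAt_snd)))
  have hGp : ∀ u w ϑ, ∀ l ∈ Λ, ∀ v ∈ Γ, G (u, w, ϑ + v, l) = G (u, w, ϑ, l) :=
    fun u w ϑ l hl v hv => by simp only [hG, hper u w ϑ l hl v hv]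
  have hW₀ : ContinuousOn W₀ Λ := by
    obtain ⟨W, hW⟩ := happrox _ le_rfl
    refine ContinuousOn.congr (f := fun l => W (0, 0, l)) (fun l hl => ?_)
      (fun l hl => (hW.zero 0 l hl).symm)
    exact (ContinuousAt.comp (f := fun l : P => ((0 : ℝ), (0 : Θ), l))
      (hW.analytic (0, 0, l) ⟨trivial, trivial, hl⟩).continuousAt (by fun_prop)).continuousWithinAt
  obtain ⟨M₀, hM₀, hLip⟩ := exists_uniform_lipschitz hΛ hK₁ hK₁Λ hD₀ hΓ hGa hGp hW₀
  obtain ⟨M, hM⟩ := exists_nat_ge (max 4 (2 * M₀ / c) )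
  have hM4 : 4 ≤ M := by exact_mod_cast (le_max_left _ _).trans hM
  have hMc : 2 * M₀ ≤ c * M := by
    have := (div_le_iff₀ hc0).1 ((le_max_right _ _).trans hM)
    linarith
  obtain ⟨W, hW⟩ := happrox (κ * M) (by nlinarith)
  obtain ⟨R, hR⟩ : ∃ R : ℝ × V × Θ × P → V, ∀ q, R q =
      q.1 ^ κ • G (q.1, W (q.1, q.2.2) + q.2.1, q.2.2) - fderiv ℝ W (q.1, q.2.2)
        (q.1 ^ (κ + 1) * (-α q.2.2.2 + β q.2.2.2 * q.1 ^ κ), Ω, 0) := ⟨_, fun q => rfl⟩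
  have hproj : ∀ q₀ : ℝ × V × Θ × P, AnalyticAt ℝ (fun q : ℝ × V × Θ × P => (q.1, q.2.2)) q₀ :=
    fun q₀ => analyticAt_fst.prod (analyticAt_snd.fun_comp analyticAt_snd)
  have hWa : ∀ q₀ : ℝ × V × Θ × P, q₀.2.2.2 ∈ Λ →
      AnalyticAt ℝ (fun q : ℝ × V × Θ × P => W (q.1, q.2.2)) q₀ := fun q₀ hq₀ =>
    AnalyticAt.fun_comp (f := fun q : ℝ × V × Θ × P => (q.1, q.2.2))
      (hW.analytic (q₀.1, q₀.2.2) ⟨trivial, trivial, hq₀⟩) (hproj q₀)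
  have hWa' : ∀ q₀ : ℝ × V × Θ × P, q₀.2.2.2 ∈ Λ →
      AnalyticAt ℝ (fun q : ℝ × V × Θ × P => fderiv ℝ W (q.1, q.2.2)) q₀ := fun q₀ hq₀ =>
    AnalyticAt.fun_comp (f := fun q : ℝ × V × Θ × P => (q.1, q.2.2))
      (hW.analytic (q₀.1, q₀.2.2) ⟨trivial, trivial, hq₀⟩).fderiv (hproj q₀)
  have hRa : ∀ ϑ, ∀ l ∈ interior K₁, AnalyticAt ℝ R (0, 0, ϑ, l) := by
    intro ϑ l hl
    have h1 : AnalyticAt ℝ (fun q : ℝ × V × Θ × P => G (q.1, W (q.1, q.2.2) + q.2.1, q.2.2))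
        (0, 0, ϑ, l) :=
      AnalyticAt.fun_comp (f := fun q : ℝ × V × Θ × P => (q.1, W (q.1, q.2.2) + q.2.1, q.2.2))
        (hGa _ ϑ l (hi₁ hl)) (analyticAt_fst.prod (((hWa (0, 0, ϑ, l) (hi₁ hl)).fun_add
          (analyticAt_fst.fun_comp analyticAt_snd)).prod (analyticAt_snd.fun_comp analyticAt_snd)))
    have h2 : AnalyticAt ℝ (fun q : ℝ × V × Θ × P =>
        (q.1 ^ (κ + 1) * (-α q.2.2.2 + β q.2.2.2 * q.1 ^ κ), Ω, (0 : P))) (0, 0, ϑ, l) :=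
      ((analyticAt_fst.fun_pow (κ + 1)).fun_mul (hy (0, 0, ϑ, l) (hi₁ hl))).prod analyticAt_const
    have h3 : AnalyticAt ℝ (fun q : ℝ × V × Θ × P => fderiv ℝ W (q.1, q.2.2)
        (q.1 ^ (κ + 1) * (-α q.2.2.2 + β q.2.2.2 * q.1 ^ κ), Ω, (0 : P))) (0, 0, ϑ, l) :=
      ((ContinuousLinearMap.id ℝ (ℝ × Θ × P →L[ℝ] V)).analyticAt_bilinear _).fun_comp
        ((hWa' (0, 0, ϑ, l) (hi₁ hl)).prod h2)
    rw [funext hR]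
    exact ((analyticAt_fst.fun_pow κ).fun_smul h1).fun_sub h3
  have hdW : ∀ (u : ℝ) (ϑ : Θ) {l : P}, l ∈ Λ → ∀ {v : Θ}, v ∈ Γ →
      fderiv ℝ W (u, ϑ + v, l) = fderiv ℝ W (u, ϑ, l) := by
    intro u ϑ l hl v hv
    have h2 : (u, ϑ + v, l) = (u, ϑ, l) + ((0 : ℝ), v, (0 : P)) := by simp
    rw [h2]
    refine fderiv_add_of_eventuallyEq ?_
    filter_upwards [(isOpen_univ.prod (isOpen_univ.prod hΛ)).mem_nhds
      (show (u, ϑ, l) ∈ (univ : Set ℝ) ×ˢ (univ : Set Θ) ×ˢ Λ from ⟨trivial, trivial, hl⟩)] with q hq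
    have h3 : q + ((0 : ℝ), v, (0 : P)) = (q.1, q.2.1 + v, q.2.2) := by ext <;> simp
    rw [h3, hW.periodic _ _ _ hq.2.2 v hv]
  have hRp : ∀ u z ϑ, ∀ l ∈ interior K₁, ∀ v ∈ Γ, R (u, z, ϑ + v, l) = R (u, z, ϑ, l) := by
    intro u z ϑ l hl v hv
    simp only [hR, hW.periodic u ϑ l (hi₁ hl) v hv, hGp _ _ ϑ l (hi₁ hl) v hv,
      hdW u ϑ (hi₁ hl) hv]
  have hRO : ∀ ϑ, ∀ l ∈ interior K₁,
      (fun u => R (u, 0, ϑ, l)) =O[𝓝 0] fun u : ℝ => u ^ (κ * M + κ) := by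
    intro ϑ l hl
    refine (hW.residual ϑ l (hi₁ hl)).neg_left.congr_left fun u => ?_
    simp only [hR, hG, blowUpResidual, add_zero, neg_sub]
  have hRL : ∀ ϑ, ∀ l ∈ interior K₁, ∀ᶠ q : ℝ × V × V × Θ × P in 𝓝 (0, 0, 0, ϑ, l),
      ‖R (q.1, q.2.1, q.2.2.2) - R (q.1, q.2.2.1, q.2.2.2)‖ ≤
        M₀ * |q.1| ^ κ * ‖q.2.1 - q.2.2.1‖ := by
    intro ϑ l hl
    have h1 : ContinuousAt (fun q : ℝ × V × V × Θ × P => W (q.1, q.2.2.2)) (0, 0, 0, ϑ, l) :=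
      ContinuousAt.comp (f := fun q : ℝ × V × V × Θ × P => (q.1, q.2.2.2))
        (hW.analytic (0, ϑ, l) ⟨trivial, trivial, hi₁ hl⟩).continuousAt (by fun_prop)
    have h2 : Tendsto (fun q : ℝ × V × V × Θ × P =>
        ((q.1, W (q.1, q.2.2.2) + q.2.1, q.2.2.2), (q.1, W (q.1, q.2.2.2) + q.2.2.1, q.2.2.2)))
        (𝓝 (0, 0, 0, ϑ, l)) (𝓝 ((0, W₀ l, ϑ, l), (0, W₀ l, ϑ, l))) := by
      have h3 : ContinuousAt (fun q : ℝ × V × V × Θ × P =>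
        ((q.1, W (q.1, q.2.2.2) + q.2.1, q.2.2.2), (q.1, W (q.1, q.2.2.2) + q.2.2.1, q.2.2.2)))
        (0, 0, 0, ϑ, l) := by
        refine (continuousAt_fst.prodMk ((h1.add ?_).prodMk ?_)).prodMk
          (continuousAt_fst.prodMk ((h1.add ?_).prodMk ?_)) <;> fun_prop
      have h4 := h3.tendsto
      simpa only [hW.zero ϑ l (hi₁ hl), add_zero] using h4
    filter_upwards [h2.eventually (hLip ϑ l (interior_subset hl))] with q hq
    have h5 : R (q.1, q.2.1, q.2.2.2) - R (q.1, q.2.2.1, q.2.2.2) = q.1 ^ κ •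
        (G (q.1, W (q.1, q.2.2.2) + q.2.1, q.2.2.2) -
          G (q.1, W (q.1, q.2.2.2) + q.2.2.1, q.2.2.2)) := by
      simp only [hR, smul_sub, sub_sub_sub_cancel_right]
    rw [h5, norm_smul, norm_pow, Real.norm_eq_abs, mul_comm M₀, mul_assoc]
    refine mul_le_mul_of_nonneg_left (hq.trans (le_of_eq ?_)) (by positivity)
    simp [Prod.norm_def]
  obtain ⟨ρ, C, D, hρ, hC, hDa, hD1, hDb, hDp, hD⟩ := hsol M hM4 M₀ hM₀ hMc R hRa hRp hRO hRL
  obtain ⟨C', hC', hWb⟩ := hW.exists_bound hK₃ hK₃Λ hD₀ hΓ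
  have hi₃ : interior K₃ ⊆ Λ := interior_subset.trans hK₃Λ
  refine ⟨interior K₃, min ρ 1, C + C', fun q => W q + D q, isOpen_interior, hLK₃,
    ⟨K₃, hK₃, interior_subset, hK₃Λ⟩, lt_min hρ one_pos, add_nonneg hC hC', ?_, ?_, ?_, ?_, ?_⟩
  · exact fun q hq => (hW.analytic q ⟨trivial, trivial, hi₃ hq.2.2⟩).fun_add
      (hDa q ⟨⟨hq.1.1, hq.1.2.trans_le (min_le_left _ _)⟩, trivial, hq.2.2⟩)
  · refine ContDiffOn.add (fun q hq => ?_) (hD1.mono ?_)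
    · exact (hW.analytic q ⟨trivial, trivial, hi₃ hq.2.2⟩).contDiffAt.contDiffWithinAt
    · exact fun q hq => ⟨lt_of_lt_of_le (mem_Iio.1 hq.1) (min_le_left _ _), hq.2⟩
  · intro u hu ϑ l hl
    have hu1 : u < 1 := hu.2.trans_le (min_le_right _ _)
    have h1 := hWb u ⟨hu.1, hu1.le⟩ ϑ l (interior_subset hl)
    have h2 := hDb u (hu.2.trans_le (min_le_left _ _)) ϑ l hl
    have h3 : C * u ^ 2 ≤ C * u := mul_le_mul_of_nonneg_left (by nlinarith [hu.1]) hC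
    calc ‖W (u, ϑ, l) + D (u, ϑ, l) - W₀ l‖ = ‖(W (u, ϑ, l) - W₀ l) + D (u, ϑ, l)‖ := by
          congr 1
          abel
      _ ≤ C' * u + C * u := (norm_add_le _ _).trans (add_le_add h1 (h2.trans h3))
      _ = (C + C') * u := by ring
  · intro u hu ϑ l hl v hv
    simp only
    rw [hW.periodic u ϑ l (hi₃ hl) v hv, hDp u (lt_of_lt_of_le (mem_Iio.1 hu) (min_le_left _ _)) ϑ l hl v hv]
  · intro u hu ϑ l hl
    have hu' : u ∈ Ioo 0 ρ := ⟨hu.1, hu.2.trans_le (min_le_left _ _)⟩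
    have h1 := hD u hu' ϑ l hl
    have h2 := (hW.analytic (u, ϑ, l) ⟨trivial, trivial, hi₃ hl⟩).differentiableAt
    have h3 := (hDa (u, ϑ, l) ⟨hu', trivial, hl⟩).differentiableAt
    rw [blowUpResidual, fderiv_fun_add h2 h3, _root_.add_apply, h1, hR, hG]
    simp

end ExactSolution

end

section

open scoped BoundedContinuousFunction NNReal ENNReal

/-! ### Weighted blow-up of the reduced field -/

section BlowUp

set_option linter.unusedSectionVars false

theorem HasReducedOrder.congr {F : Type*} [NormedAddCommGroup F] [NormedSpace ℝ F] {j : ℕ}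
    {f g : ℝ × ℝ → F} (hf : HasReducedOrder j f) (h : ∀ᶠ z in 𝓝 0, g z = f z) :
    HasReducedOrder j g := by
  obtain ⟨f₁, f₂, h₁, h₂, hz⟩ := hf
  refine ⟨f₁, f₂, h₁, h₂, ?_⟩
  filter_upwards [hz, h] with z h3 h4
  rw [h4, h3]

theorem HasReducedOrder.apply_zero {F : Type*} [NormedAddCommGroup F] [NormedSpace ℝ F] {j : ℕ}
    {f : ℝ × ℝ → F} (hf : HasReducedOrder j f) : f 0 = 0 := by
  obtain ⟨f₁, f₂, -, h₂, hz⟩ := hf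
  obtain ⟨C, hC⟩ := h₂.bound
  have h3 := hC.self_of_nhds
  rw [hz.self_of_nhds]
  simpa using h3

theorem HasReducedOrder.isBigO_axis {F : Type*} [NormedAddCommGroup F] [NormedSpace ℝ F] {j : ℕ}
    {f : ℝ × ℝ → F} (hf : HasReducedOrder j f) :
    (fun x : ℝ => f (x, 0)) =O[𝓝 0] fun x : ℝ => x ^ (j + 1) := by
  obtain ⟨f₁, f₂, -, h₂, hz⟩ := hf
  have ht : Tendsto (fun x : ℝ => (x, (0 : ℝ))) (𝓝 0) (𝓝 0) :=
    Continuous.tendsto' (by fun_prop) _ _ rfl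
  refine IsBigO.congr' (f₁ := fun x : ℝ => f₂ (x, 0)) ?_ ?_ .rfl
  · refine (h₂.comp_tendsto ht).trans (IsBigO.of_bound 1 (.of_forall fun x => ?_))
    simp
  · filter_upwards [ht.eventually hz] with x hx
    rw [hx, zero_smul, zero_add]

/-- Under the weights ‖(x, y)‖ = O(u²) and y = O(u^(κ+2)), so the two parts of f are O(u^(2j+κ)) and
O(u^(2j+2)). As κ ≥ 1, both are smaller than u^(2j) by a full power of u and do not contribute to F
at u = 0. -/
theorem HasReducedOrder.isBigO_blowUp {F : Type*} [NormedAddCommGroup F] [NormedSpace ℝ F]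
    {j κ : ℕ} (hj : 1 ≤ j) (hκ : 1 ≤ κ) {f : ℝ × ℝ → F} (hf : HasReducedOrder j f) (ξ η : ℝ) :
    (fun u : ℝ => f (u ^ 2 * ξ, u ^ (κ + 2) * η)) =O[𝓝 0] fun u : ℝ => u ^ (2 * j + 1) := by
  obtain ⟨f₁, f₂, h₁, h₂, hz⟩ := hf
  have ht : Tendsto (fun u : ℝ => (u ^ 2 * ξ, u ^ (κ + 2) * η)) (𝓝 0) (𝓝 0) :=
    Continuous.tendsto' (by fun_prop) _ _ (by simp)
  have hp : ∀ {i l : ℕ}, l ≤ i → (fun u : ℝ => u ^ i) =O[𝓝 0] fun u : ℝ => u ^ l := by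
    intro i l hil
    rcases hil.eq_or_lt with rfl | hlt
    · exact isBigO_refl _ _
    · exact (isLittleO_pow_pow hlt).isBigO
  have h3 : (fun u : ℝ => u ^ (κ + 2) * η) =O[𝓝 0] fun u : ℝ => u ^ (κ + 2) :=
    (isBigO_refl _ _).mul (isBigO_const_one ℝ η _) |>.congr_right fun u => by simp
  have h4 : (fun u : ℝ => ‖(u ^ 2 * ξ, u ^ (κ + 2) * η)‖) =O[𝓝 0] fun u : ℝ => u ^ 2 := by
    refine IsBigO.norm_left (IsBigO.prod_left ?_ (h3.trans (hp (by omega))))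
    exact (isBigO_refl _ _).mul (isBigO_const_one ℝ ξ _) |>.congr_right fun u => by simp
  have h5 : ∀ i, (fun u : ℝ => ‖(u ^ 2 * ξ, u ^ (κ + 2) * η)‖ ^ i) =O[𝓝 0]
      fun u : ℝ => u ^ (2 * i) := fun i => by
    simpa only [pow_mul] using h4.pow i
  refine IsBigO.congr' (f₁ := fun u : ℝ => (u ^ (κ + 2) * η) • f₁ (u ^ 2 * ξ, u ^ (κ + 2) * η) +
    f₂ (u ^ 2 * ξ, u ^ (κ + 2) * η)) (IsBigO.add ?_ ?_) ?_ .rfl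
  · refine (h3.smul ((h₁.comp_tendsto ht).trans (h5 (j - 1)))).trans ?_
    simp only [smul_eq_mul, ← pow_add]
    exact hp (by omega)
  · exact ((h₂.comp_tendsto ht).trans (h5 (j + 1))).trans (hp (by omega))
  · filter_upwards [ht.eventually hz] with u hu using hu.symm

theorem isLittleO_of_isBigO_pow_succ {F : Type*} [NormedAddCommGroup F] {f : ℝ → F} {N : ℕ}
    (hf : f =O[𝓝 0] fun u : ℝ => u ^ (N + 1)) : f =o[𝓝[≠] 0] fun u : ℝ => u ^ N :=
  (hf.trans_isLittleO (isLittleO_pow_pow (Nat.lt_succ_self N))).mono nhdsWithin_le_nhds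

theorem isBigO_of_sub_pow_smul {F : Type*} [NormedAddCommGroup F] [NormedSpace ℝ F] {f : ℝ → F}
    {N : ℕ} {w : F} (hf : (fun u => f u - u ^ N • w) =O[𝓝 0] fun u : ℝ => u ^ (N + 1)) :
    f =O[𝓝[≠] 0] fun u : ℝ => u ^ N := by
  have h1 : (fun u : ℝ => u ^ N • w) =O[𝓝[≠] 0] fun u : ℝ => u ^ N := by
    simpa using (isBigO_refl (fun u : ℝ => u ^ N) (𝓝[≠] 0)).smul (isBigO_const_one ℝ w _)
  simpa using (isLittleO_of_isBigO_pow_succ hf).isBigO.add h1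

/-- The leading coefficient of an analytic family depends analytically on the parameter. -/
theorem analyticAt_divPow_of_sub {E F : Type*} [NormedAddCommGroup E] [NormedSpace ℝ E]
    [CompleteSpace E] [NormedAddCommGroup F] [NormedSpace ℝ F] [CompleteSpace F] (N : ℕ)
    {f : ℝ × E → F} {D : Set E} (hD : IsOpen D) (hf : ∀ z ∈ D, AnalyticAt ℝ f (0, z)) {g : E → F}
    (hg : ∀ z ∈ D, (fun u => f (u, z) - u ^ N • g z) =O[𝓝 0] fun u : ℝ => u ^ (N + 1)) {z : E}
    (hz : z ∈ D) :
    AnalyticAt ℝ (divPow f N) (0, z) ∧ divPow f N (0, z) = g z :=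
  ⟨(analyticAt_divPow N hD hf (fun z hz => isBigO_of_sub_pow_smul (hg z hz)) hz).1,
    divPow_apply_zero N hD hf (fun z hz => isBigO_of_sub_pow_smul (hg z hz)) hz
      (isLittleO_of_isBigO_pow_succ (hg z hz))⟩

/-- Supplies the analyticity of c, a and b, which is not assumed: they are leading coefficients of X
along the axes. -/
theorem analyticOnNhd_of_sub {E F : Type*} [NormedAddCommGroup E] [NormedSpace ℝ E]
    [CompleteSpace E] [NormedAddCommGroup F] [NormedSpace ℝ F] [CompleteSpace F] (N : ℕ)
    {f : ℝ × E → F} {D : Set E} (hD : IsOpen D) (hf : ∀ z ∈ D, AnalyticAt ℝ f (0, z)) {g : E → F}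
    (hg : ∀ z ∈ D, (fun u => f (u, z) - u ^ N • g z) =O[𝓝 0] fun u : ℝ => u ^ (N + 1)) :
    AnalyticOnNhd ℝ g D := by
  intro z hz
  have h1 : AnalyticAt ℝ (fun z => divPow f N (0, z)) z :=
    AnalyticAt.fun_comp (f := fun z : E => ((0 : ℝ), z)) (analyticAt_divPow_of_sub N hD hf hg hz).1
      (analyticAt_const.prod analyticAt_id)
  refine h1.congr ?_
  filter_upwards [hD.mem_nhds hz] with z' hz' using (analyticAt_divPow_of_sub N hD hf hg hz').2

variable {ι : Type*} [Fintype ι] {P Z : Type*} [NormedAddCommGroup P] [NormedSpace ℝ P]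
  [FiniteDimensional ℝ P] [NormedAddCommGroup Z] [NormedSpace ℝ Z] [FiniteDimensional ℝ Z]

/-- A field near `{(0, 0)} × (ι → ℝ) × Λ`, periodic in the angles, in reduced form. -/
structure IsReducedField (U : Set (ℝ × ℝ)) (Λ : Set P) (κ p : ℕ) (ω : Z)
    (c a : (ι → ℝ) × P → ℝ) (b : (ι → ℝ) × P → Z)
    (X : ℝ × ℝ × (ι → ℝ) × P → ℝ × ℝ × Z) : Prop where
  one_le_κ : 1 ≤ κ
  one_le_p : 1 ≤ p
  isOpen : IsOpen Λ
  mem_nhds : U ∈ 𝓝 (0 : ℝ × ℝ)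
  analytic : ∀ ϑ, ∀ l ∈ Λ, AnalyticAt ℝ X (0, 0, ϑ, l)
  periodic : ∀ x y ϑ, ∀ l ∈ Λ, ∀ v ∈ integerVectors ι, X (x, y, ϑ + v, l) = X (x, y, ϑ, l)
  form : ∀ x y ϑ, ∀ l ∈ Λ, (x, y) ∈ U → (X (x, y, ϑ, l)).1 = c (ϑ, l) * y
  order_a : ∀ ϑ, ∀ l ∈ Λ, HasReducedOrder (κ + 1)
    (fun z => (X (z.1, z.2, ϑ, l)).2.1 - z.1 ^ (κ + 1) * a (ϑ, l))
  order_b : ∀ ϑ, ∀ l ∈ Λ, HasReducedOrder p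
    (fun z => (X (z.1, z.2, ϑ, l)).2.2 - ω - z.1 ^ p • b (ϑ, l))

/-- The field in the variables `x = u² ξ`, `y = u^(κ+2) η`, `θ + u^e ζ`. -/
noncomputable def blowUpField (κ p e : ℕ) (I : Z →L[ℝ] (ι → ℝ)) (ω : Z) (c : (ι → ℝ) × P → ℝ)
    (X : ℝ × ℝ × (ι → ℝ) × P → ℝ × ℝ × Z) (q : ℝ × (ℝ × ℝ × Z) × (ι → ℝ) × P) : ℝ × ℝ × Z :=
  (c (q.2.2.1 + q.1 ^ e • I q.2.1.2.2, q.2.2.2) * q.2.1.2.1,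
    divPow (fun r : ℝ × ℝ × ℝ × (ι → ℝ) × P =>
      (X (r.1 ^ 2 * r.2.1, r.1 ^ (κ + 2) * r.2.2.1, r.2.2.2)).2.1) (2 * (κ + 1))
      (q.1, q.2.1.1, q.2.1.2.1, q.2.2.1 + q.1 ^ e • I q.2.1.2.2, q.2.2.2),
    divPow (fun r : ℝ × ℝ × ℝ × (ι → ℝ) × P =>
      (X (r.1 ^ 2 * r.2.1, r.1 ^ (κ + 2) * r.2.2.1, r.2.2.2)).2.2 - ω) (2 * p)
      (q.1, q.2.1.1, q.2.1.2.1, q.2.2.1 + q.1 ^ e • I q.2.1.2.2, q.2.2.2))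

namespace IsReducedField

variable {U : Set (ℝ × ℝ)} {Λ : Set P} {κ p e : ℕ} {ω : Z} {c a : (ι → ℝ) × P → ℝ}
  {b : (ι → ℝ) × P → Z} {X : ℝ × ℝ × (ι → ℝ) × P → ℝ × ℝ × Z}
  (h : IsReducedField U Λ κ p ω c a b X)
include h

theorem analytic_c : AnalyticOnNhd ℝ c (univ ×ˢ Λ) := by
  refine analyticOnNhd_of_sub 1 (f := fun q : ℝ × (ι → ℝ) × P => (X (0, q.1, q.2)).1)
    (isOpen_univ.prod h.isOpen) (fun z hz => ?_) (fun z hz => ?_)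
  · exact analyticAt_fst.fun_comp (AnalyticAt.fun_comp
      (f := fun q : ℝ × (ι → ℝ) × P => ((0 : ℝ), q.1, q.2)) (h.analytic z.1 z.2 hz.2)
      (analyticAt_const.prod (analyticAt_fst.prod analyticAt_snd)))
  · refine IsBigO.congr' (isBigO_zero _ _) ?_ .rfl
    have ht : Tendsto (fun y : ℝ => ((0 : ℝ), y)) (𝓝 0) (𝓝 0) :=
      Continuous.tendsto' (by fun_prop) _ _ rfl
    filter_upwards [ht.eventually h.mem_nhds] with y hy
    rw [h.form 0 y z.1 z.2 hz.2 hy]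
    simp [mul_comm]

theorem analytic_a : AnalyticOnNhd ℝ a (univ ×ˢ Λ) := by
  refine analyticOnNhd_of_sub (κ + 1) (f := fun q : ℝ × (ι → ℝ) × P => (X (q.1, 0, q.2)).2.1)
    (isOpen_univ.prod h.isOpen) (fun z hz => ?_) (fun z hz => ?_)
  · exact (analyticAt_fst.fun_comp analyticAt_snd).fun_comp (AnalyticAt.fun_comp
      (f := fun q : ℝ × (ι → ℝ) × P => (q.1, (0 : ℝ), q.2)) (h.analytic z.1 z.2 hz.2)
      (analyticAt_fst.prod (analyticAt_const.prod analyticAt_snd)))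
  · exact (h.order_a z.1 z.2 hz.2).isBigO_axis

theorem analytic_b : AnalyticOnNhd ℝ b (univ ×ˢ Λ) := by
  refine analyticOnNhd_of_sub p (f := fun q : ℝ × (ι → ℝ) × P => (X (q.1, 0, q.2)).2.2 - ω)
    (isOpen_univ.prod h.isOpen) (fun z hz => ?_) (fun z hz => ?_)
  · exact ((analyticAt_snd.fun_comp analyticAt_snd).fun_comp (AnalyticAt.fun_comp
      (f := fun q : ℝ × (ι → ℝ) × P => (q.1, (0 : ℝ), q.2)) (h.analytic z.1 z.2 hz.2)
      (analyticAt_fst.prod (analyticAt_const.prod analyticAt_snd)))).fun_sub analyticAt_const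
  · exact (h.order_b z.1 z.2 hz.2).isBigO_axis

theorem analyticAt_comp (ξ η : ℝ) (ϑ : ι → ℝ) {l : P} (hl : l ∈ Λ) :
    AnalyticAt ℝ (fun r : ℝ × ℝ × ℝ × (ι → ℝ) × P =>
      X (r.1 ^ 2 * r.2.1, r.1 ^ (κ + 2) * r.2.2.1, r.2.2.2)) (0, ξ, η, ϑ, l) := by
  refine AnalyticAt.fun_comp (f := fun r : ℝ × ℝ × ℝ × (ι → ℝ) × P =>
    (r.1 ^ 2 * r.2.1, r.1 ^ (κ + 2) * r.2.2.1, r.2.2.2)) ?_ ?_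
  · simpa using h.analytic ϑ l hl
  · have h2 : ∀ q, AnalyticAt ℝ (fun r : ℝ × ℝ × ℝ × (ι → ℝ) × P => r.2.2) q := fun q =>
      analyticAt_snd.fun_comp analyticAt_snd
    exact ((analyticAt_fst.fun_pow 2).fun_mul (analyticAt_fst.fun_comp analyticAt_snd)).prod
      (((analyticAt_fst.fun_pow _).fun_mul (analyticAt_fst.fun_comp (h2 _))).prod
        (analyticAt_snd.fun_comp (h2 _)))

theorem analyticAt_divPow_a (ξ η : ℝ) (ϑ : ι → ℝ) {l : P} (hl : l ∈ Λ) :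
    AnalyticAt ℝ (divPow (fun r : ℝ × ℝ × ℝ × (ι → ℝ) × P =>
      (X (r.1 ^ 2 * r.2.1, r.1 ^ (κ + 2) * r.2.2.1, r.2.2.2)).2.1) (2 * (κ + 1))) (0, ξ, η, ϑ, l) ∧
    divPow (fun r : ℝ × ℝ × ℝ × (ι → ℝ) × P =>
      (X (r.1 ^ 2 * r.2.1, r.1 ^ (κ + 2) * r.2.2.1, r.2.2.2)).2.1) (2 * (κ + 1)) (0, ξ, η, ϑ, l) =
      a (ϑ, l) * ξ ^ (κ + 1) := by
  refine analyticAt_divPow_of_sub (2 * (κ + 1)) (D := univ ×ˢ univ ×ˢ univ ×ˢ Λ)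
    (g := fun z : ℝ × ℝ × (ι → ℝ) × P => a z.2.2 * z.1 ^ (κ + 1))
    (isOpen_univ.prod (isOpen_univ.prod (isOpen_univ.prod h.isOpen)))
    (fun z hz => (analyticAt_fst.fun_comp analyticAt_snd).fun_comp
      (h.analyticAt_comp z.1 z.2.1 z.2.2.1 hz.2.2.2)) (fun z hz => ?_)
    (z := (ξ, η, ϑ, l)) ⟨trivial, trivial, trivial, hl⟩
  refine ((h.order_a z.2.2.1 z.2.2.2 hz.2.2.2).isBigO_blowUp (by omega) h.one_le_κ
    z.1 z.2.1).congr_left fun u => ?_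
  simp only [smul_eq_mul]
  ring

theorem analyticAt_divPow_b (ξ η : ℝ) (ϑ : ι → ℝ) {l : P} (hl : l ∈ Λ) :
    AnalyticAt ℝ (divPow (fun r : ℝ × ℝ × ℝ × (ι → ℝ) × P =>
      (X (r.1 ^ 2 * r.2.1, r.1 ^ (κ + 2) * r.2.2.1, r.2.2.2)).2.2 - ω) (2 * p)) (0, ξ, η, ϑ, l) ∧
    divPow (fun r : ℝ × ℝ × ℝ × (ι → ℝ) × P =>
      (X (r.1 ^ 2 * r.2.1, r.1 ^ (κ + 2) * r.2.2.1, r.2.2.2)).2.2 - ω) (2 * p) (0, ξ, η, ϑ, l) =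
      ξ ^ p • b (ϑ, l) := by
  refine analyticAt_divPow_of_sub (2 * p) (D := univ ×ˢ univ ×ˢ univ ×ˢ Λ)
    (g := fun z : ℝ × ℝ × (ι → ℝ) × P => z.1 ^ p • b z.2.2)
    (isOpen_univ.prod (isOpen_univ.prod (isOpen_univ.prod h.isOpen)))
    (fun z hz => ((analyticAt_snd.fun_comp analyticAt_snd).fun_comp
      (h.analyticAt_comp z.1 z.2.1 z.2.2.1 hz.2.2.2)).fun_sub analyticAt_const) (fun z hz => ?_)
    (z := (ξ, η, ϑ, l)) ⟨trivial, trivial, trivial, hl⟩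
  refine ((h.order_b z.2.2.1 z.2.2.2 hz.2.2.2).isBigO_blowUp h.one_le_p h.one_le_κ
    z.1 z.2.1).congr_left fun u => ?_
  simp only [smul_smul, mul_pow, pow_mul]

variable {I : Z →L[ℝ] (ι → ℝ)}

theorem analyticAt_blowUpField (he : 0 < e) (w : ℝ × ℝ × Z) (ϑ : ι → ℝ) {l : P} (hl : l ∈ Λ) :
    AnalyticAt ℝ (blowUpField κ p e I ω c X) (0, w, ϑ, l) := by
  have h1 : ∀ q, AnalyticAt ℝ (fun q : ℝ × (ℝ × ℝ × Z) × (ι → ℝ) × P => q.2.1) q := fun q =>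
    analyticAt_fst.fun_comp analyticAt_snd
  have h2 : ∀ q, AnalyticAt ℝ (fun q : ℝ × (ℝ × ℝ × Z) × (ι → ℝ) × P => q.2.2) q := fun q =>
    analyticAt_snd.fun_comp analyticAt_snd
  have h3 : ∀ q, AnalyticAt ℝ (fun q : ℝ × (ℝ × ℝ × Z) × (ι → ℝ) × P => q.2.1.2) q := fun q =>
    analyticAt_snd.fun_comp (h1 q)
  have h4 : ∀ q, AnalyticAt ℝ (fun q : ℝ × (ℝ × ℝ × Z) × (ι → ℝ) × P =>
      (q.2.2.1 + q.1 ^ e • I q.2.1.2.2, q.2.2.2)) q := fun q =>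
    ((analyticAt_fst.fun_comp (h2 q)).fun_add ((analyticAt_fst.fun_pow e).fun_smul
      ((I.analyticAt _).fun_comp (analyticAt_snd.fun_comp (h3 q))))).prod
      (analyticAt_snd.fun_comp (h2 q))
  have h5 : ∀ q, AnalyticAt ℝ (fun q : ℝ × (ℝ × ℝ × Z) × (ι → ℝ) × P =>
      (q.1, q.2.1.1, q.2.1.2.1, q.2.2.1 + q.1 ^ e • I q.2.1.2.2, q.2.2.2)) q := fun q =>
    analyticAt_fst.prod ((analyticAt_fst.fun_comp (h1 q)).prod
      ((analyticAt_fst.fun_comp (h3 q)).prod (h4 q)))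
  have h6 : ((0 : ℝ), w.1, w.2.1, ϑ + (0 : ℝ) ^ e • I w.2.2, l) = (0, w.1, w.2.1, ϑ, l) := by
    simp [he.ne']
  refine AnalyticAt.prod ?_ (AnalyticAt.prod ?_ ?_)
  · refine (AnalyticAt.fun_comp (f := fun q : ℝ × (ℝ × ℝ × Z) × (ι → ℝ) × P =>
      (q.2.2.1 + q.1 ^ e • I q.2.1.2.2, q.2.2.2)) (h.analytic_c _ ⟨trivial, hl⟩) (h4 _)).fun_mul
      (analyticAt_fst.fun_comp (h3 _))
  · refine AnalyticAt.fun_comp (f := fun q : ℝ × (ℝ × ℝ × Z) × (ι → ℝ) × P =>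
      (q.1, q.2.1.1, q.2.1.2.1, q.2.2.1 + q.1 ^ e • I q.2.1.2.2, q.2.2.2)) ?_ (h5 _)
    rw [h6]
    exact (h.analyticAt_divPow_a w.1 w.2.1 ϑ hl).1
  · refine AnalyticAt.fun_comp (f := fun q : ℝ × (ℝ × ℝ × Z) × (ι → ℝ) × P =>
      (q.1, q.2.1.1, q.2.1.2.1, q.2.2.1 + q.1 ^ e • I q.2.1.2.2, q.2.2.2)) ?_ (h5 _)
    rw [h6]
    exact (h.analyticAt_divPow_b w.1 w.2.1 ϑ hl).1

theorem blowUpField_zero (he : 0 < e) (w : ℝ × ℝ × Z) (ϑ : ι → ℝ) {l : P} (hl : l ∈ Λ) :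
    blowUpField κ p e I ω c X (0, w, ϑ, l) =
      (c (ϑ, l) * w.2.1, a (ϑ, l) * w.1 ^ (κ + 1), w.1 ^ p • b (ϑ, l)) := by
  simp only [blowUpField, zero_pow he.ne', zero_smul, add_zero,
    (h.analyticAt_divPow_a w.1 w.2.1 ϑ hl).2, (h.analyticAt_divPow_b w.1 w.2.1 ϑ hl).2]

/-- When e + κ = 2p, the powers of u exceed the weights u², u^(κ+2), u^e by the same factor u^κ, the
one on the right of the equation for W. The map I carries the displacement u^e ζ into the space of
all angles. -/
theorem eq_blowUpField {u : ℝ} (hu : u ≠ 0) (w : ℝ × ℝ × Z) (ϑ : ι → ℝ) {l : P} (hl : l ∈ Λ)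
    (hU : (u ^ 2 * w.1, u ^ (κ + 2) * w.2.1) ∈ U) :
    X (u ^ 2 * w.1, u ^ (κ + 2) * w.2.1, ϑ + u ^ e • I w.2.2, l) =
      (u ^ (κ + 2) * (blowUpField κ p e I ω c X (u, w, ϑ, l)).1,
        u ^ (2 * (κ + 1)) * (blowUpField κ p e I ω c X (u, w, ϑ, l)).2.1,
        ω + u ^ (2 * p) • (blowUpField κ p e I ω c X (u, w, ϑ, l)).2.2) := by
  simp only [blowUpField, ← smul_eq_mul (u ^ (2 * (κ + 1)))]
  rw [pow_smul_divPow _ _ (q := (u, _)) hu, pow_smul_divPow _ _ (q := (u, _)) hu]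
  simp only [Prod.ext_iff]
  refine ⟨?_, trivial, ?_⟩
  · rw [h.form _ _ _ l hl hU]
    ring
  · simp

theorem periodic_c (x : ι → ℝ) (l : P) (hl : l ∈ Λ) (v : ι → ℝ) (hv : v ∈ integerVectors ι) :
    c (x + v, l) = c (x, l) := by
  have ht : Tendsto (fun y : ℝ => ((0 : ℝ), y)) (𝓝[≠] 0) (𝓝 0) :=
    (Continuous.tendsto' (by fun_prop) _ _ rfl).mono_left nhdsWithin_le_nhds
  obtain ⟨y, hy, hy0⟩ := ((ht.eventually h.mem_nhds).and self_mem_nhdsWithin).exists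
  refine mul_right_cancel₀ hy0 ?_
  rw [← h.form 0 y _ l hl hy, ← h.form 0 y _ l hl hy, h.periodic 0 y x l hl v hv]

theorem periodic_a (x : ι → ℝ) (l : P) (hl : l ∈ Λ) (v : ι → ℝ) (hv : v ∈ integerVectors ι) :
    a (x + v, l) = a (x, l) := by
  have h1 := (h.analyticAt_divPow_a 1 0 (x + v) hl).2
  have h2 := (h.analyticAt_divPow_a 1 0 x hl).2
  simp only [divPow, h.periodic _ _ x l hl v hv] at h1 h2
  simpa using h1.symm.trans h2

theorem periodic_b (x : ι → ℝ) (l : P) (hl : l ∈ Λ) (v : ι → ℝ) (hv : v ∈ integerVectors ι) :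
    b (x + v, l) = b (x, l) := by
  have h1 := (h.analyticAt_divPow_b 1 0 (x + v) hl).2
  have h2 := (h.analyticAt_divPow_b 1 0 x hl).2
  simp only [divPow, h.periodic _ _ x l hl v hv] at h1 h2
  simpa using h1.symm.trans h2

theorem periodic_blowUpField (u : ℝ) (w : ℝ × ℝ × Z) (ϑ : ι → ℝ) (l : P) (hl : l ∈ Λ) (v : ι → ℝ)
    (hv : v ∈ integerVectors ι) :
    blowUpField κ p e I ω c X (u, w, ϑ + v, l) = blowUpField κ p e I ω c X (u, w, ϑ, l) := by
  simp only [blowUpField, divPow, add_right_comm ϑ v, h.periodic _ _ _ l hl v hv,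
    h.periodic_c _ l hl v hv]

/-- `sq_α` is quadratic in α; the positive root makes u decrease to leading order along Y, and η₀
and ζ₀ then follow linearly. Positivity of the averages keeps the square root analytic. -/
theorem isBlowUpField (he : 0 < e) (hc : ∀ l ∈ Λ, 0 < cubeAverage c l)
    (ha : ∀ l ∈ Λ, 0 < cubeAverage a l) {α : P → ℝ}
    (hα : ∀ l, α l = √(cubeAverage c l * cubeAverage a l / (2 * (κ + 2)))) :
    IsBlowUpField κ p e Λ c a b (blowUpField κ p e I ω c X) α
      (fun l => -2 * α l / cubeAverage c l) (fun l => -((e * α l)⁻¹ • cubeAverage b l)) := by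
  have hca := analyticOnNhd_cubeAverage h.isOpen h.analytic_c h.periodic_c
  have haa := analyticOnNhd_cubeAverage h.isOpen h.analytic_a h.periodic_a
  have hba := analyticOnNhd_cubeAverage h.isOpen h.analytic_b h.periodic_b
  have hpos : ∀ l ∈ Λ, 0 < cubeAverage c l * cubeAverage a l / (2 * (κ + 2)) := fun l hl =>
    div_pos (mul_pos (hc l hl) (ha l hl)) (by positivity)
  have hαpos : ∀ l ∈ Λ, 0 < α l := fun l hl => by
    rw [hα]
    exact Real.sqrt_pos.2 (hpos l hl)
  have hαa : AnalyticOnNhd ℝ α Λ := by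
    rw [funext hα]
    intro l hl
    have hκ : (2 * (κ + 2) : ℝ) ≠ 0 := by positivity
    exact AnalyticAt.fun_comp
      (f := fun l => cubeAverage c l * cubeAverage a l / (2 * (κ + 2)))
      (Real.contDiffAt_sqrt (hpos l hl).ne').analyticAt
      (((hca l hl).fun_mul (haa l hl)).fun_div analyticAt_const hκ)
  have he' : ∀ l ∈ Λ, (e * α l) ≠ 0 := fun l hl =>
    mul_ne_zero (by exact_mod_cast he.ne') (hαpos l hl).ne'
  exact {
    one_le := h.one_le_κ
    pos_e := he
    isOpen := h.isOpen
    analytic_c := h.analytic_c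
    analytic_a := h.analytic_a
    analytic_b := h.analytic_b
    periodic_c := h.periodic_c
    periodic_a := h.periodic_a
    periodic_b := h.periodic_b
    analytic_F := fun w ϑ l hl => h.analyticAt_blowUpField he w ϑ hl
    periodic_F := h.periodic_blowUpField
    F_zero := fun w ϑ l hl => h.blowUpField_zero he w ϑ hl
    analytic_α := hαa
    analytic_η₀ := fun l hl =>
      (analyticAt_const.fun_mul (hαa l hl)).fun_div (hca l hl) (hc l hl).ne'
    analytic_ζ₀ := fun l hl =>
      (((analyticAt_const.fun_mul (hαa l hl)).fun_inv (he' l hl)).fun_smul (hba l hl)).fun_neg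
    pos_c := hc
    pos_α := hαpos
    sq_α := fun l hl => by
      rw [hα, Real.sq_sqrt (hpos l hl).le]
      field_simp
    eq_η₀ := fun l hl => mul_div_cancel₀ _ (hc l hl).ne'
    eq_ζ₀ := fun l hl => by rw [smul_neg, smul_inv_smul₀ (he' l hl)] }

end IsReducedField

end BlowUp

end

section

open scoped BoundedContinuousFunction NNReal ENNReal

/-! ### Return to the original variables -/

section InvariantManifold

set_option linter.unusedSectionVars false

variable {ι : Type*} [Fintype ι] {P Z : Type*} [NormedAddCommGroup P] [NormedSpace ℝ P]
  [NormedAddCommGroup Z] [NormedSpace ℝ Z]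

/-- The map `(ξ, η, ζ) ↦ (u² ξ, u^(κ+2) η, θ + u^e ζ)` along `W = (ξ, η, ζ)`. -/
noncomputable def blowDown (κ e : ℕ) (π : (ι → ℝ) →L[ℝ] Z) (W : ℝ × (ι → ℝ) × P → ℝ × ℝ × Z)
    (q : ℝ × (ι → ℝ) × P) : ℝ × ℝ × Z :=
  (q.1 ^ 2 * (W q).1, q.1 ^ (κ + 2) * (W q).2.1, π q.2.1 + q.1 ^ e • (W q).2.2)

variable {κ e : ℕ} {π : (ι → ℝ) →L[ℝ] Z} {W : ℝ × (ι → ℝ) × P → ℝ × ℝ × Z}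

theorem AnalyticAt.blowDown {q : ℝ × (ι → ℝ) × P} (hW : AnalyticAt ℝ W q) :
    AnalyticAt ℝ (blowDown κ e π W) q :=
  ((analyticAt_fst.fun_pow 2).fun_mul (analyticAt_fst.fun_comp hW)).prod
    (((analyticAt_fst.fun_pow (κ + 2)).fun_mul
      (analyticAt_fst.fun_comp (analyticAt_snd.fun_comp hW))).prod
    (((π.analyticAt _).fun_comp (analyticAt_fst.fun_comp analyticAt_snd)).fun_add
      ((analyticAt_fst.fun_pow e).fun_smul
        (analyticAt_snd.fun_comp (analyticAt_snd.fun_comp hW)))))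

theorem ContDiffOn.blowDown {s : Set (ℝ × (ι → ℝ) × P)} (hW : ContDiffOn ℝ 1 W s) :
    ContDiffOn ℝ 1 (blowDown κ e π W) s := by
  have h1 : ContDiffOn ℝ 1 (fun q : ℝ × (ι → ℝ) × P => q.1) s := contDiff_fst.contDiffOn
  have h2 : ContDiffOn ℝ 1 (fun q : ℝ × (ι → ℝ) × P => π q.2.1) s :=
    (π.contDiff.comp (contDiff_fst.comp contDiff_snd)).contDiffOn
  exact ((h1.pow 2).mul hW.fst).prodMk (((h1.pow (κ + 2)).mul hW.snd.fst).prodMk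
    (h2.add ((h1.pow e).smul hW.snd.snd)))

theorem fderiv_blowDown {q : ℝ × (ι → ℝ) × P} (hW : DifferentiableAt ℝ W q) (x : ℝ) (Ω : ι → ℝ) :
    fderiv ℝ (blowDown κ e π W) q (x, Ω, 0) =
      (2 * q.1 * x * (W q).1 + q.1 ^ 2 * (fderiv ℝ W q (x, Ω, 0)).1,
        (κ + 2) * q.1 ^ (κ + 1) * x * (W q).2.1 + q.1 ^ (κ + 2) * (fderiv ℝ W q (x, Ω, 0)).2.1,
        π Ω + ((e * q.1 ^ (e - 1) * x) • (W q).2.2 + q.1 ^ e • (fderiv ℝ W q (x, Ω, 0)).2.2)) := by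
  have h0 := hW.hasFDerivAt
  have h1 : HasFDerivAt (fun q : ℝ × (ι → ℝ) × P => q.1)
    (ContinuousLinearMap.fst ℝ ℝ ((ι → ℝ) × P)) q :=
    (ContinuousLinearMap.fst ℝ ℝ ((ι → ℝ) × P)).hasFDerivAt
  have h2 : HasFDerivAt (fun q : ℝ × (ι → ℝ) × P => π q.2.1)
    (π ∘L (ContinuousLinearMap.fst ℝ (ι → ℝ) P ∘L ContinuousLinearMap.snd ℝ ℝ ((ι → ℝ) × P))) q :=
    (π ∘L (ContinuousLinearMap.fst ℝ (ι → ℝ) P ∘L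
      ContinuousLinearMap.snd ℝ ℝ ((ι → ℝ) × P))).hasFDerivAt
  have h3 := ((h1.pow 2).mul h0.fst).prodMk (((h1.pow (κ + 2)).mul h0.snd.fst).prodMk
    (h2.add ((h1.pow e).smul h0.snd.snd)))
  have h4 : fderiv ℝ (blowDown κ e π W) q = _ := h3.fderiv
  rw [h4]
  ext
  · simp
    ring
  · simp
    ring
  · simp [add_comm]

variable [FiniteDimensional ℝ P] [FiniteDimensional ℝ Z]

/-- Multiplying the equation for W by the weights gives invariance for u > 0; `hep` matches the
powers in the angular component. -/
theorem IsReducedField.exists_invariantManifold {U : Set (ℝ × ℝ)} {Λ L : Set P} {p : ℕ} {ω : Z}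
    {c a : (ι → ℝ) × P → ℝ} {b : (ι → ℝ) × P → Z} {X : ℝ × ℝ × (ι → ℝ) × P → ℝ × ℝ × Z}
    (h : IsReducedField U Λ κ p ω c a b X) (he : 0 < e) (hep : e + κ = 2 * p)
    (hc : ∀ l ∈ Λ, 0 < cubeAverage c l) (ha : ∀ l ∈ Λ, 0 < cubeAverage a l) {α : P → ℝ}
    (hα : ∀ l, α l = √(cubeAverage c l * cubeAverage a l / (2 * (κ + 2)))) {Ω : ι → ℝ}
    (hΩ : IsDiophantine Ω) (hπ : π Ω = ω) (I : Z →L[ℝ] (ι → ℝ)) (hL : IsCompact L) (hLΛ : L ⊆ Λ) :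
    ∃ (Λ' : Set P) (ρ C : ℝ) (β : P → ℝ) (K : ℝ × (ι → ℝ) × P → ℝ × ℝ × Z), IsOpen Λ' ∧ L ⊆ Λ' ∧
      Λ' ⊆ Λ ∧ 0 < ρ ∧ AnalyticOnNhd ℝ α Λ' ∧ AnalyticOnNhd ℝ β Λ' ∧ (∀ l ∈ Λ', 0 < α l) ∧
      AnalyticOnNhd ℝ K (Ioo 0 ρ ×ˢ univ ×ˢ Λ') ∧
      ContDiffOn ℝ 1 K (Iio ρ ×ˢ univ ×ˢ Λ') ∧
      (∀ u ∈ Ico 0 ρ, ∀ ϑ, ∀ l ∈ Λ',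
        |(K (u, ϑ, l)).1 - u ^ 2| ≤ C * u ^ 3 ∧
        |(K (u, ϑ, l)).2.1 - -2 * α l / cubeAverage c l * u ^ (κ + 2)| ≤ C * u ^ (κ + 3) ∧
        ‖(K (u, ϑ, l)).2.2 - (π ϑ + u ^ e • -((e * α l)⁻¹ • cubeAverage b l))‖ ≤ C * u ^ (e + 1)) ∧
      (∀ u ∈ Ico 0 ρ, ∀ ϑ, ∀ l ∈ Λ', ∀ v ∈ integerVectors ι,
        K (u, ϑ + v, l) = K (u, ϑ, l) + (0, 0, π v)) ∧
      (∀ u ∈ Ico 0 ρ, ∀ ϑ, ∀ l ∈ Λ', ((K (u, ϑ, l)).1, (K (u, ϑ, l)).2.1) ∈ U) ∧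
      ∀ u ∈ Ico 0 ρ, ∀ ϑ, ∀ l ∈ Λ',
        fderiv ℝ K (u, ϑ, l) (u ^ (κ + 1) * (-α l + β l * u ^ κ), Ω, 0) =
          X ((K (u, ϑ, l)).1, (K (u, ϑ, l)).2.1, ϑ + I ((K (u, ϑ, l)).2.2 - π ϑ), l) := by
  have hB := h.isBlowUpField (I := I) he hc ha hα
  obtain ⟨β, hβ, happrox⟩ := hB.exists_isApproximateSolution hΩ
  obtain ⟨Λ', ρ, C, W, hΛ', hLΛ', ⟨K₀, hK₀, hΛK₀, hK₀Λ⟩, hρ, hC, hWa, hW1, hWb, hWp, hW⟩ :=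
    exists_exactSolution h.one_le_κ h.isOpen hB.analytic_α hβ hB.pos_α hB.analytic_F hB.periodic_F
      isCompact_Icc exists_add_integerVectors happrox hL hLΛ
  have hΛ : Λ' ⊆ Λ := hΛK₀.trans hK₀Λ
  obtain ⟨C', hC'⟩ := hK₀.exists_bound_of_continuousOn (hB.analytic_η₀.continuousOn.mono hK₀Λ)
  obtain ⟨δ, hδ, hδU⟩ := Metric.mem_nhds_iff.1 h.mem_nhds
  set B : ℝ := 1 + |C'| + C with hBdef
  have hBpos : 0 < B := by positivity
  -- B bounds |ξ| and |η| for u ≤ 1, and each of their weights contains a factor u; thus u B < δ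
  -- keeps (x, y) inside U.
  set ρ' : ℝ := min (min ρ 1) (δ / B) with hρ'
  have hρ'pos : 0 < ρ' := lt_min (lt_min hρ one_pos) (by positivity)
  have hlt : ∀ {u}, u < ρ' → u < ρ := fun hu =>
    hu.trans_le ((min_le_left _ _).trans (min_le_left _ _))
  have hIco : ∀ {u}, u ∈ Ico 0 ρ' → u ∈ Ico 0 ρ := fun hu => ⟨hu.1, hlt hu.2⟩
  have hbd : ∀ u ∈ Ico 0 ρ', ∀ ϑ, ∀ l ∈ Λ', |(W (u, ϑ, l)).1 - 1| ≤ C * u ∧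
      |(W (u, ϑ, l)).2.1 - -2 * α l / cubeAverage c l| ≤ C * u ∧
      ‖(W (u, ϑ, l)).2.2 - -((e * α l)⁻¹ • cubeAverage b l)‖ ≤ C * u := by
    intro u hu ϑ l hl
    have h1 := hWb u (hIco hu) ϑ l hl
    rw [Prod.norm_def, Prod.norm_def] at h1
    exact ⟨(le_max_left _ _).trans h1, ((le_max_left _ _).trans (le_max_right _ _)).trans h1,
      ((le_max_right _ _).trans (le_max_right _ _)).trans h1⟩
  have hmem : ∀ u ∈ Ico 0 ρ', ∀ ϑ, ∀ l ∈ Λ',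
      (u ^ 2 * (W (u, ϑ, l)).1, u ^ (κ + 2) * (W (u, ϑ, l)).2.1) ∈ U := by
    intro u hu ϑ l hl
    have hu1 : u ≤ 1 := hu.2.le.trans ((min_le_left _ _).trans (min_le_right _ _))
    have huδ : u * B < δ := (lt_div_iff₀ hBpos).1 (hu.2.trans_le (min_le_right _ _))
    obtain ⟨h1, h2, -⟩ := hbd u hu ϑ l hl
    have h3 : C * u ≤ C := mul_le_of_le_one_right hC hu1
    have h4 : |(W (u, ϑ, l)).1| ≤ B := by
      have h5 := abs_add_le ((W (u, ϑ, l)).1 - 1) 1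
      rw [sub_add_cancel, abs_one] at h5
      have := abs_nonneg C'
      linarith
    have h5 : |(W (u, ϑ, l)).2.1| ≤ B := by
      have h6 := abs_add_le ((W (u, ϑ, l)).2.1 - -2 * α l / cubeAverage c l)
        (-2 * α l / cubeAverage c l)
      rw [sub_add_cancel] at h6
      have h7 : |-2 * α l / cubeAverage c l| ≤ C' := hC' l (hΛK₀ hl)
      have h8 := le_abs_self C'
      linarith
    have h6 : ∀ i : ℕ, ∀ x : ℝ, |x| ≤ B → |u ^ (i + 1) * x| < δ := by
      intro i x hx
      rw [abs_mul, abs_pow, abs_of_nonneg hu.1]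
      have h7 : u ^ (i + 1) ≤ u := pow_le_of_le_one hu.1 hu1 (Nat.succ_ne_zero i)
      exact (mul_le_mul h7 hx (abs_nonneg x) hu.1).trans_lt huδ
    refine hδU (mem_ball_zero_iff.2 ?_)
    rw [Prod.norm_def]
    exact max_lt (h6 1 _ h4) (h6 (κ + 1) _ h5)
  have hsub : ∀ (ϑ : ι → ℝ) (u : ℝ) (l : P),
      (blowDown κ e π W (u, ϑ, l)).2.2 - π ϑ = u ^ e • (W (u, ϑ, l)).2.2 := fun ϑ u l =>
    add_sub_cancel_left _ _
  have hopen : IsOpen (Iio ρ ×ˢ (univ : Set (ι → ℝ)) ×ˢ Λ') :=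
    isOpen_Iio.prod (isOpen_univ.prod hΛ')
  refine ⟨Λ', ρ', C, β, blowDown κ e π W, hΛ', hLΛ', hΛ, hρ'pos, hB.analytic_α.mono hΛ, hβ.mono hΛ,
    fun l hl => hB.pos_α l (hΛ hl), ?_, ?_, ?_, ?_, hmem, ?_⟩
  · exact fun q hq => (hWa q ⟨⟨hq.1.1, hlt hq.1.2⟩, hq.2⟩).blowDown
  · exact ContDiffOn.blowDown (hW1.mono fun q hq => ⟨hlt (mem_Iio.1 hq.1), hq.2⟩)
  · intro u hu ϑ l hl
    obtain ⟨h1, h2, h3⟩ := hbd u hu ϑ l hl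
    have hu0 := hu.1
    refine ⟨?_, ?_, ?_⟩
    · have h4 : (blowDown κ e π W (u, ϑ, l)).1 - u ^ 2 = u ^ 2 * ((W (u, ϑ, l)).1 - 1) := by
        simp only [blowDown]
        ring
      rw [h4, abs_mul, abs_of_nonneg (pow_nonneg hu0 2)]
      exact (mul_le_mul_of_nonneg_left h1 (pow_nonneg hu0 2)).trans_eq (by ring)
    · have h4 : (blowDown κ e π W (u, ϑ, l)).2.1 - -2 * α l / cubeAverage c l * u ^ (κ + 2) =
          u ^ (κ + 2) * ((W (u, ϑ, l)).2.1 - -2 * α l / cubeAverage c l) := by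
        simp only [blowDown]
        ring
      rw [h4, abs_mul, abs_of_nonneg (pow_nonneg hu0 _)]
      exact (mul_le_mul_of_nonneg_left h2 (pow_nonneg hu0 _)).trans_eq (by ring)
    · rw [← sub_sub, hsub, ← smul_sub, norm_smul, norm_pow, Real.norm_of_nonneg hu0]
      exact (mul_le_mul_of_nonneg_left h3 (pow_nonneg hu0 _)).trans_eq (by ring)
  · intro u hu ϑ l hl v hv
    simp only [blowDown, hWp u (hIco hu).2 ϑ l hl v hv, map_add, Prod.mk_add_mk, add_zero,
      add_right_comm]
  · intro u hu ϑ l hl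
    have hd : DifferentiableAt ℝ W (u, ϑ, l) :=
      (hW1.contDiffAt (hopen.mem_nhds ⟨mem_Iio.2 (hIco hu).2, trivial, hl⟩)).differentiableAt (by simp)
    rw [fderiv_blowDown hd, hπ, hsub, map_smul]
    simp only
    have hmem' := hmem u hu ϑ l hl
    -- The blow-up says nothing at u = 0; there both sides equal (0, 0, ω), as the field vanishes in
    -- x and y at the origin.
    rcases hu.1.eq_or_lt with rfl | hu0
    · have h1 := h.form 0 0 ϑ l (hΛ hl) (mem_of_mem_nhds h.mem_nhds)
      have h2 := (h.order_a ϑ l (hΛ hl)).apply_zero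
      have h3 := (h.order_b ϑ l (hΛ hl)).apply_zero
      have hp : p ≠ 0 := by have := h.one_le_p; omega
      simp only [Prod.fst_zero, Prod.snd_zero, zero_pow hp, zero_pow (Nat.succ_ne_zero κ), zero_mul,
        sub_zero, zero_smul, mul_zero] at h1 h2 h3
      have h4 : X (0, 0, ϑ, l) = (0, 0, ω) := by
        rw [Prod.ext_iff, Prod.ext_iff]
        exact ⟨h1, h2, sub_eq_zero.1 h3⟩
      simp [blowDown, h4, he.ne']
    · have h1 := hW u ⟨hu0, (hIco hu).2⟩ ϑ l hl
      rw [blowUpResidual, sub_eq_zero] at h1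
      simp only at h1
      rw [h1, blowDown]
      simp only
      rw [h.eq_blowUpField hu0.ne' _ _ (hΛ hl) hmem']
      obtain ⟨j, rfl⟩ : ∃ j, e = j + 1 := ⟨e - 1, by omega⟩
      simp only [Prod.ext_iff, Prod.smul_fst, Prod.smul_snd, Prod.fst_sub, Prod.snd_sub,
        weightMap_apply, smul_eq_mul]
      refine ⟨by ring, by ring, ?_⟩
      rw [← hep]
      simp only [Nat.add_sub_cancel, smul_sub, smul_smul]
      rw [add_right_inj]
      module

end InvariantManifold

end

section

/-! ### Joining the space and time angles -/

section Torus

variable {d n m : ℕ}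

/-- Splitting of the angles into space and time angles. -/
noncomputable abbrev splitAngles (d n : ℕ) :
    (Fin d ⊕ Fin n → ℝ) ≃L[ℝ] (Fin d → ℝ) × (Fin n → ℝ) :=
  ContinuousLinearEquiv.sumPiEquivProdPi ℝ (Fin d) (Fin n) fun _ => ℝ

theorem torusAverage_eq_cubeAverage {F : Type*} [NormedAddCommGroup F] [NormedSpace ℝ F]
    (h : (Fin d → ℝ) × (Fin n → ℝ) × (Fin m → ℝ) → F) (l : Fin m → ℝ) :
    torusAverage h l = cubeAverage (fun z : (Fin d ⊕ Fin n → ℝ) × (Fin m → ℝ) =>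
      h ((splitAngles d n z.1).1, (splitAngles d n z.1).2, z.2)) l := by
  have h1 := (volume_measurePreserving_sumPiEquivProdPi fun _ : Fin d ⊕ Fin n => ℝ).setIntegral_preimage_emb
    (MeasurableEquiv.measurableEmbedding _)
    (fun z : (Fin d → ℝ) × (Fin n → ℝ) => h (z.1, z.2, l))
    ((Icc (0 : Fin d → ℝ) 1) ×ˢ (Icc (0 : Fin n → ℝ) 1))
  have h2 : (MeasurableEquiv.sumPiEquivProdPi fun _ : Fin d ⊕ Fin n => ℝ) ⁻¹'
      ((Icc (0 : Fin d → ℝ) 1) ×ˢ (Icc (0 : Fin n → ℝ) 1)) = Icc 0 1 := by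
    ext f
    simp only [mem_preimage, mem_prod, mem_Icc, Pi.le_def, Sum.forall]
    exact and_and_and_comm
  rw [h2] at h1
  exact h1.symm

open scoped Classical in
/-- The field as a function of all angles, extended by zero. -/
noncomputable def jointField (U : Set (ℝ × ℝ))
    (Xh : ℝ × ℝ × (Fin d → ℝ) × (Fin n → ℝ) × (Fin m → ℝ) → ℝ × ℝ × (Fin d → ℝ))
    (z : ℝ × ℝ × (Fin d ⊕ Fin n → ℝ) × (Fin m → ℝ)) : ℝ × ℝ × (Fin d → ℝ) :=
  if (z.1, z.2.1) ∈ U then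
    Xh (z.1, z.2.1, (splitAngles d n z.2.2.1).1, (splitAngles d n z.2.2.1).2, z.2.2.2) else 0

/-- Extending the field by zero outside U makes periodicity hold for all (x, y); the other
conditions concern only points of U or a neighbourhood of the origin. -/
theorem IsReducedHull.isReducedField {U : Set (ℝ × ℝ)} {Λ : Set (Fin m → ℝ)} {κ p : ℕ}
    {ω : Fin d → ℝ} {c a : (Fin d → ℝ) × (Fin n → ℝ) × (Fin m → ℝ) → ℝ}
    {b : (Fin d → ℝ) × (Fin n → ℝ) × (Fin m → ℝ) → (Fin d → ℝ)}
    {A : ℝ × ℝ × (Fin d → ℝ) × (Fin n → ℝ) × (Fin m → ℝ) → ℝ}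
    {B : ℝ × ℝ × (Fin d → ℝ) × (Fin n → ℝ) × (Fin m → ℝ) → (Fin d → ℝ)}
    {Xh : ℝ × ℝ × (Fin d → ℝ) × (Fin n → ℝ) × (Fin m → ℝ) → ℝ × ℝ × (Fin d → ℝ)}
    (hX : IsReducedHull U Λ (κ + 1) p ω c a b A B Xh) (hκ : 1 ≤ κ) (hp : 1 ≤ p) (hU : IsOpen U)
    (hU0 : (0, 0) ∈ U) (hΛ : IsOpen Λ) :
    IsReducedField U Λ κ p ω
      (fun z => c ((splitAngles d n z.1).1, (splitAngles d n z.1).2, z.2))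
      (fun z => a ((splitAngles d n z.1).1, (splitAngles d n z.1).2, z.2))
      (fun z => b ((splitAngles d n z.1).1, (splitAngles d n z.1).2, z.2)) (jointField U Xh) where
  one_le_κ := hκ
  one_le_p := hp
  isOpen := hΛ
  mem_nhds := hU.mem_nhds hU0
  analytic := fun ϑ l hl => by
    have hT : ContDiff ℝ ⊤ (fun z : ℝ × ℝ × (Fin d ⊕ Fin n → ℝ) × (Fin m → ℝ) =>
        (z.1, z.2.1, (splitAngles d n z.2.2.1).1, (splitAngles d n z.2.2.1).2, z.2.2.2)) := by
      fun_prop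
    have h1 := AnalyticAt.fun_comp (g := Xh)
      (f := fun z : ℝ × ℝ × (Fin d ⊕ Fin n → ℝ) × (Fin m → ℝ) =>
        (z.1, z.2.1, (splitAngles d n z.2.2.1).1, (splitAngles d n z.2.2.1).2, z.2.2.2))
      (x := (0, 0, ϑ, l))
      (hX.analytic (0, 0, (splitAngles d n ϑ).1, (splitAngles d n ϑ).2, l) ⟨hU0, hl⟩)
      (hT.contDiffAt (x := (0, 0, ϑ, l))).analyticAt
    refine h1.congr ?_
    have h2 : ContinuousAt (fun z : ℝ × ℝ × (Fin d ⊕ Fin n → ℝ) × (Fin m → ℝ) => (z.1, z.2.1))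
      (0, 0, ϑ, l) := by fun_prop
    filter_upwards [h2.eventually (hU.mem_nhds hU0)] with z hz
    rw [jointField, if_pos (show (z.1, z.2.1) ∈ U from hz)]
  periodic := fun x y ϑ l hl v hv => by
    obtain ⟨q, rfl⟩ := hv
    unfold jointField
    split_ifs with h
    · exact hX.periodic x y _ _ l h hl (fun i => q (Sum.inl i)) (fun i => q (Sum.inr i))
    · rfl
  form := fun x y ϑ l hl h => by
    rw [jointField, if_pos h, hX.form x y _ _ l h hl]
  order_a := fun ϑ l hl => by
    refine (hX.order_A (splitAngles d n ϑ).1 (splitAngles d n ϑ).2 l hl).congr ?_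
    filter_upwards [hU.mem_nhds hU0] with z hz
    rw [jointField, if_pos hz, hX.form _ _ _ _ l hz hl]
    simp only
    ring
  order_b := fun ϑ l hl => by
    refine (hX.order_B (splitAngles d n ϑ).1 (splitAngles d n ϑ).2 l hl).congr ?_
    filter_upwards [hU.mem_nhds hU0] with z hz
    rw [jointField, if_pos hz, hX.form _ _ _ _ l hz hl]
    simp only
    abel

end Torus

end

/-! ### The theorem for quasiperiodic fields -/

theorem mainTheorem2 {d n m : ℕ} (k p : ℕ) (hk : 2 ≤ k) (hp : 1 ≤ p) (hkp : k - 1 < 2 * p)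
    (U : Set (ℝ × ℝ)) (hU : IsOpen U) (hU0 : (0, 0) ∈ U)
    (Λ : Set (Fin m → ℝ)) (hΛ : IsOpen Λ)
    (ω : Fin d → ℝ) (ν : Fin n → ℝ)
    (c a : (Fin d → ℝ) × (Fin n → ℝ) × (Fin m → ℝ) → ℝ)
    (b : (Fin d → ℝ) × (Fin n → ℝ) × (Fin m → ℝ) → (Fin d → ℝ))
    (A : ℝ × ℝ × (Fin d → ℝ) × (Fin n → ℝ) × (Fin m → ℝ) → ℝ)
    (B : ℝ × ℝ × (Fin d → ℝ) × (Fin n → ℝ) × (Fin m → ℝ) → (Fin d → ℝ))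
    (Xh : ℝ × ℝ × (Fin d → ℝ) × (Fin n → ℝ) × (Fin m → ℝ) → ℝ × ℝ × (Fin d → ℝ))
    (hX : IsReducedHull U Λ k p ω c a b A B Xh)
    (hc : ∀ l ∈ Λ, 0 < torusAverage c l)
    (ha : ∀ l ∈ Λ, 0 < torusAverage a l)
    (hdioph : IsDiophantine (Sum.elim ω ν))
    (L : Set (Fin m → ℝ)) (hL : IsCompact L) (hLΛ : L ⊆ Λ) :
    ∃ ρ : ℝ, 0 < ρ ∧
    ∃ Λ' : Set (Fin m → ℝ), IsOpen Λ' ∧ L ⊆ Λ' ∧ Λ' ⊆ Λ ∧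
    ∃ (Kh : ℝ × (Fin d → ℝ) × (Fin n → ℝ) × (Fin m → ℝ) → ℝ × ℝ × (Fin d → ℝ))
      (K : ℝ × (Fin d → ℝ) × ℝ × (Fin m → ℝ) → ℝ × ℝ × (Fin d → ℝ))
      (Ky Yk Y2k1 : (Fin m → ℝ) → ℝ) (Kθ : (Fin m → ℝ) → (Fin d → ℝ))
      (Y : ℝ → (Fin m → ℝ) → ℝ × (Fin d → ℝ)),
      -- `K` is quasiperiodic in time with frequencies `ν` and hull function `Kh`
      K = mapOfHull ν Kh ∧
      IsTorusLift ρ Λ' Kh ∧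
      -- regularity, of the hull function and of `K`
      ContDiffOn ℝ 1 Kh (Ico 0 ρ ×ˢ univ ×ˢ univ ×ˢ Λ') ∧
      AnalyticOnNhd ℝ Kh (Ioo 0 ρ ×ˢ univ ×ˢ univ ×ˢ Λ') ∧
      ContDiffOn ℝ 1 K (Ico 0 ρ ×ˢ univ ×ˢ univ ×ˢ Λ') ∧
      AnalyticOnNhd ℝ K (Ioo 0 ρ ×ˢ univ ×ˢ univ ×ˢ Λ') ∧
      -- the form of `K`
      (∃ C : ℝ, ∀ u ∈ Ico (0 : ℝ) ρ, ∀ θ t, ∀ l ∈ Λ',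
        |(K (u, θ, t, l)).1 - u ^ 2| ≤ C * u ^ 3 ∧
        |(K (u, θ, t, l)).2.1 - Ky l * u ^ (k + 1)| ≤ C * u ^ (k + 2) ∧
        ‖(K (u, θ, t, l)).2.2 - (θ + u ^ (2 * p + 1 - k) • Kθ l)‖ ≤ C * u ^ (2 * p + 2 - k)) ∧
      -- the polynomial vector field `Y`
      (∀ u, ∀ l ∈ Λ', Y u l = (Yk l * u ^ k + Y2k1 l * u ^ (2 * k - 1), ω)) ∧
      AnalyticOnNhd ℝ Yk Λ' ∧ AnalyticOnNhd ℝ Y2k1 Λ' ∧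
      (∀ l ∈ Λ', Yk l < 0) ∧
      -- the image of `K` lies in the domain of `X`, and the invariance equation holds
      (∀ u ∈ Ico (0 : ℝ) ρ, ∀ θ t, ∀ l ∈ Λ', ((K (u, θ, t, l)).1, (K (u, θ, t, l)).2.1) ∈ U) ∧
      InvarianceEquation ρ Λ' (fieldOfHull ν Xh) K Y ∧
      -- the leading coefficients
      (∀ l ∈ Λ',
        Ky l = -√(2 * torusAverage a l / (torusAverage c l * (k + 1))) ∧
        Kθ l = (-(1 / (2 * (p : ℝ) - k + 1)) *
            √(2 * (k + 1) / (torusAverage c l * torusAverage a l))) • torusAverage b l ∧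
        Yk l = -√(torusAverage c l * torusAverage a l / (2 * (k + 1)))) := by
  obtain ⟨κ, rfl⟩ : ∃ κ, k = κ + 1 := ⟨k - 1, by omega⟩
  -- This e is 2p - k + 1, positive because k - 1 < 2p.
  obtain ⟨e, he⟩ : ∃ e, e + κ = 2 * p := ⟨2 * p - κ, by omega⟩
  have he0 : 0 < e := by omega
  have hR := hX.isReducedField (by omega) hp hU hU0 hΛ
  obtain ⟨α, hα⟩ : ∃ α : (Fin m → ℝ) → ℝ, ∀ l, α l =
    √(torusAverage c l * torusAverage a l / (2 * (κ + 2))) := ⟨_, fun l => rfl⟩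
  obtain ⟨π, hπ⟩ : ∃ π : (Fin d ⊕ Fin n → ℝ) →L[ℝ] (Fin d → ℝ), ∀ ϑ, π ϑ = ((splitAngles d n) ϑ).1 :=
    ⟨ContinuousLinearMap.fst ℝ (Fin d → ℝ) (Fin n → ℝ) ∘L (splitAngles d n).toContinuousLinearMap, fun _ => rfl⟩
  obtain ⟨I, hI⟩ : ∃ I : (Fin d → ℝ) →L[ℝ] (Fin d ⊕ Fin n → ℝ), ∀ z, I z = (splitAngles d n).symm (z, 0) :=
    ⟨(splitAngles d n).symm.toContinuousLinearMap ∘L ContinuousLinearMap.inl ℝ (Fin d → ℝ) (Fin n → ℝ),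
      fun _ => rfl⟩
  obtain ⟨Λ', ρ, C, β, K, hΛ', hLΛ', hΛΛ', hρ, hαa, hβa, hα0, hKa, hK1, hKb, hKp, hKU, hK⟩ :=
    hR.exists_invariantManifold he0 he (fun l hl => by
      rw [← torusAverage_eq_cubeAverage]; exact hc l hl) (fun l hl => by
      rw [← torusAverage_eq_cubeAverage]; exact ha l hl) (α := α) (fun l => by
      rw [hα, torusAverage_eq_cubeAverage, torusAverage_eq_cubeAverage]) hdioph
      ((hπ _).trans rfl : π (Sum.elim ω ν) = ω) I hL hLΛ
  simp only [← torusAverage_eq_cubeAverage c, ← torusAverage_eq_cubeAverage b] at hKb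
  obtain ⟨T, hT⟩ : ∃ T : ℝ × (Fin d → ℝ) × (Fin n → ℝ) × (Fin m → ℝ) →
    ℝ × (Fin d ⊕ Fin n → ℝ) × (Fin m → ℝ), ∀ z, T z =
      (z.1, (splitAngles d n).symm (z.2.1, z.2.2.1), z.2.2.2) := ⟨_, fun z => rfl⟩
  have hTc : ContDiff ℝ ⊤ T := by
    rw [funext hT]
    fun_prop
  obtain ⟨T', hT'⟩ : ∃ T' : ℝ × (Fin d → ℝ) × ℝ × (Fin m → ℝ) →
    ℝ × (Fin d ⊕ Fin n → ℝ) × (Fin m → ℝ), ∀ z, T' z =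
      (z.1, (splitAngles d n).symm (z.2.1, z.2.2.1 • ν), z.2.2.2) := ⟨_, fun z => rfl⟩
  have hTc' : ContDiff ℝ ⊤ T' := by
    rw [funext hT']
    fun_prop
  have hKT : mapOfHull ν (fun z => K (T z)) = fun z => K (T' z) := by
    funext z
    simp only [mapOfHull, hT, hT']
  have hlt : ∀ {s : Set ℝ} {z : ℝ × (Fin d → ℝ) × (Fin n → ℝ) × (Fin m → ℝ)},
      z ∈ s ×ˢ univ ×ˢ univ ×ˢ Λ' → T z ∈ s ×ˢ univ ×ˢ Λ' := fun hz => by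
    rw [hT]
    exact ⟨hz.1, trivial, hz.2.2.2⟩
  have hlt' : ∀ {s : Set ℝ} {z : ℝ × (Fin d → ℝ) × ℝ × (Fin m → ℝ)},
      z ∈ s ×ˢ univ ×ˢ univ ×ˢ Λ' → T' z ∈ s ×ˢ univ ×ˢ Λ' := fun hz => by
    rw [hT']
    exact ⟨hz.1, trivial, hz.2.2.2⟩
  have hK1' : ContDiffOn ℝ 1 K (Ico 0 ρ ×ˢ univ ×ˢ Λ') := hK1.mono fun z hz => ⟨hz.1.2, hz.2⟩
  refine ⟨ρ, hρ, Λ', hΛ', hLΛ', hΛΛ', fun z => K (T z), fun z => K (T' z),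
    fun l => -2 * α l / torusAverage c l, fun l => -α l, β,
    fun l => -((e * α l)⁻¹ • torusAverage b l),
    fun u l => (-α l * u ^ (κ + 1) + β l * u ^ (2 * (κ + 1) - 1), ω), hKT.symm, ?_, ?_, ?_, ?_, ?_,
    ⟨C, ?_⟩, fun u l hl => rfl, fun l hl => (hαa l hl).fun_neg, hβa,
    fun l hl => neg_neg_of_pos (hα0 l hl), ?_, ?_, ?_⟩
  · intro u hu θ τ l hl q r
    have h1 := hKp u hu ((splitAngles d n).symm (θ, τ)) l hl ((splitAngles d n).symm (intVec q, intVec r))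
      ⟨Sum.elim q r, by ext (i | i) <;> rfl⟩
    simp only [hT]
    rw [← Prod.mk_add_mk, map_add, h1, hπ, ContinuousLinearEquiv.apply_symm_apply]
  · exact hK1'.comp (hTc.of_le le_top).contDiffOn fun z hz => hlt hz
  · exact fun z hz => AnalyticAt.fun_comp (hKa _ (hlt hz)) hTc.contDiffAt.analyticAt
  · exact hK1'.comp (hTc'.of_le le_top).contDiffOn fun z hz => hlt' hz
  · exact fun z hz => AnalyticAt.fun_comp (hKa _ (hlt' hz)) hTc'.contDiffAt.analyticAt
  · intro u hu θ t l hl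
    simp only [hT']
    rw [show 2 * p + 1 - (κ + 1) = e by omega, show 2 * p + 2 - (κ + 1) = e + 1 by omega]
    have h1 := hKb u hu ((splitAngles d n).symm (θ, t • ν)) l hl
    rw [hπ, ContinuousLinearEquiv.apply_symm_apply] at h1
    exact h1
  · intro u hu θ t l hl
    simp only [hT']
    exact hKU u hu _ l hl
  · intro u hu θ t l hl
    have hd : HasFDerivAt K (fderiv ℝ K (u, (splitAngles d n).symm (θ, t • ν), l)) (u, (splitAngles d n).symm (θ, t • ν), l) :=
      ((hK1.contDiffAt ((isOpen_Iio.prod (isOpen_univ.prod hΛ')).mem_nhds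
        ⟨mem_Iio.2 hu.2, trivial, hl⟩)).differentiableAt (by simp)).hasFDerivAt
    have h1 : HasFDerivAt (fun v : ℝ × (Fin d → ℝ) => (v.1, (splitAngles d n).symm (v.2, t • ν), l))
        ((ContinuousLinearMap.fst ℝ ℝ (Fin d → ℝ)).prod
          (((splitAngles d n).symm.toContinuousLinearMap ∘L ContinuousLinearMap.inl ℝ (Fin d → ℝ) (Fin n → ℝ) ∘L
            ContinuousLinearMap.snd ℝ ℝ (Fin d → ℝ)).prod 0)) (u, θ) := by
      refine hasFDerivAt_fst.prodMk (HasFDerivAt.prodMk ?_ (hasFDerivAt_const _ _))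
      exact (splitAngles d n).symm.toContinuousLinearMap.hasFDerivAt.comp (u, θ)
        (HasFDerivAt.comp (g := fun θ : Fin d → ℝ => (θ, t • ν)) (u, θ)
          (hasFDerivAt_prodMk_left θ (t • ν)) hasFDerivAt_snd)
    have h2 : HasDerivAt (fun s : ℝ => (u, (splitAngles d n).symm (θ, s • ν), l))
        ((0 : ℝ), (splitAngles d n).symm (0, ν), (0 : Fin m → ℝ)) t := by
      refine (hasDerivAt_const t u).prodMk (HasDerivAt.prodMk ?_ (hasDerivAt_const t l))
      have h3 : HasDerivAt (fun s : ℝ => (θ, s • ν)) ((0 : Fin d → ℝ), ν) t := by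
        have h4 := (hasDerivAt_id t).smul_const ν
        rw [one_smul] at h4
        exact (hasDerivAt_const t θ).prodMk h4
      exact (splitAngles d n).symm.toContinuousLinearMap.hasFDerivAt.comp_hasDerivAt t h3
    have h3 := HasFDerivAt.comp (u, θ) (g := K)
      (f := fun v : ℝ × (Fin d → ℝ) => (v.1, (splitAngles d n).symm (v.2, t • ν), l)) hd h1
    have h4 := HasFDerivAt.comp_hasDerivAt t (l := K)
      (f := fun s : ℝ => (u, (splitAngles d n).symm (θ, s • ν), l)) hd h2
    simp only [Function.comp_def] at h3 h4
    -- K is C¹ across u = 0, so the one-sided derivative is the full one, also at the end point.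
    have h5 := h3.hasFDerivWithinAt.fderivWithin
      (((uniqueDiffOn_Ico 0 ρ).prod uniqueDiffOn_univ) (u, θ) ⟨hu, trivial⟩)
    have h6 := h4.deriv
    simp only [hT', fieldOfHull]
    -- The derivatives along Y and in t combine into one derivative in the direction with angular
    -- part (ω, ν), as in the equation over all angles.
    rw [h5, h6, sub_sub, sub_eq_zero, ContinuousLinearMap.comp_apply, ← map_add]
    have h7 := hK u hu ((splitAngles d n).symm (θ, t • ν)) l hl
    have h8 : u ^ (κ + 1) * (-α l + β l * u ^ κ) =
        -α l * u ^ (κ + 1) + β l * u ^ (2 * (κ + 1) - 1) := by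
      rw [show 2 * (κ + 1) - 1 = κ + 1 + κ by omega]
      ring
    rw [h8] at h7
    have h9 : (splitAngles d n).symm (ω, 0) + (splitAngles d n).symm (0, ν) = Sum.elim ω ν := by
      rw [← map_add, Prod.mk_add_mk, add_zero, zero_add]
      rfl
    -- Only the space angles are displaced; the phases t ν are those at which the time-dependent
    -- field is evaluated.
    have h10 : (splitAngles d n).symm (θ, t • ν) + I ((K (u, (splitAngles d n).symm (θ, t • ν), l)).2.2 -
        π ((splitAngles d n).symm (θ, t • ν))) = (splitAngles d n).symm
          ((K (u, (splitAngles d n).symm (θ, t • ν), l)).2.2, t • ν) := by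
      rw [hπ, hI, ContinuousLinearEquiv.apply_symm_apply, ← map_add, Prod.mk_add_mk, add_zero,
        add_sub_cancel]
    rw [h10, jointField, if_pos (hKU u hu _ l hl), ContinuousLinearEquiv.apply_symm_apply] at h7
    refine h7.symm.trans (congrArg _ ?_)
    rw [← h9]
    simp
  · intro l hl
    have hcl := hc l (hΛΛ' hl)
    have hal := ha l (hΛΛ' hl)
    have hκ2 : ((κ + 1 : ℕ) : ℝ) + 1 = κ + 2 := by
      push_cast
      ring
    -- By this relation the three square roots are 2α divided by the average of c, 1/α and α.
    have hsq : 2 * (κ + 2) * α l ^ 2 = torusAverage c l * torusAverage a l := by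
      rw [hα, Real.sq_sqrt (by positivity)]
      field_simp
    have hαl := hα0 l hl
    rw [hκ2]
    refine ⟨?_, ?_, ?_⟩
    · have h1 : 2 * torusAverage a l / (torusAverage c l * (κ + 2)) =
          (2 * α l / torusAverage c l) ^ 2 := by
        field_simp
        linear_combination -hsq
      rw [h1, Real.sqrt_sq (by positivity)]
      ring
    · have h1 : 2 * (κ + 2) / (torusAverage c l * torusAverage a l) = (α l)⁻¹ ^ 2 := by
        rw [← hsq]
        field_simp
      have h2 : (2 * (p : ℝ) - ((κ + 1 : ℕ) : ℝ) + 1) = e := by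
        have h3 : (e : ℝ) + κ = 2 * p := by exact_mod_cast he
        push_cast
        linarith
      simp only
      rw [h1, Real.sqrt_sq (by positivity), h2, ← neg_smul, one_div, mul_inv, neg_mul]
    · simp only [hα]
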